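/- **Setting.** Let $d\ge 1$, $\delta>0$, $\lambda>0$. For an integer $N\ge1$ let $\Lambda=\Lambda_N=(\mathbb{Z}/2N)^d$ be the torus with nearest-neighbour relation $\sim$, and let $0<b<\infty$. Let $E$ govern independent Poisson processes $D_x$ ($x\in\Lambda$) of intensity $\delta$ on $[0,b)$, each conditioned to have an even number of points, and independent $\xi_x\in\{0,1\}$ taking each value with probability $1/2$, independent of $(D_x)$. Put $\sigma(x,t)=(-1)^{\xi_x+|D_x\cap[0,t]|}$ for $t\in[0,b)$, extended $b$-periodically to $t\in\mathbb{R}$. The finite-volume space–time Ising measure (which represents the transverse-field Ising model with coupling $\lambda$ and transverse field $\delta$ at inverse temperature $b$) is $$\mu^b_\Lambda(f)=\frac{E\big[f(\sigma)\exp\big(\lambda\sum_{x\sim y}\int_0^b\sigma(x,t)\sigma(y,t)\,dt\big)\big]}{E\big[\exp\big(\lambda\sum_{x\sim y}\int_0^b\sigma(x,t)\sigma(y,t)\,dt\big)\big]},$$ the sums being over unordered pairs of neighbours, and $\chi_\Lambda(\lambda,\delta,b)=\sum_{x\in\Lambda}\int_0^b\mu^b_\Lambda(\sigma(0,0)\sigma(x,t))\,dt$.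 Let $0<\beta\le\infty$. If $\beta<\infty$, the thermodynamic limit means $N\to\infty$ with $b=\beta$; if $\beta=\infty$, it means $N,b\to\infty$ with $b$ and $N$ of the same order (the ratios $b/N$ and $N/b$ stay bounded). Let $\lambda_c=\lambda_c(\delta,\beta)$ be the supremum of those $\lambda>0$ for which $\limsup\chi_\Lambda(\lambda,\delta,b)<\infty$ in the thermodynamic limit. Let $\mu$ be an infinite-volume limit, that is, a probability measure on $\{-1,1\}^{\mathbb{Z}^d\times\mathbb{R}}$ which is the limit, in the sense of finite-dimensional distributions, of the measures $\mu^b_\Lambda$ along some sequence realizing the thermodynamic limit (for $\lambda<\lambda_c$ it is known to be unique), and define the susceptibility and the bubble diagram by $$\chi=\sum_{x\in\mathbb{Z}^d}\int_{-\beta/2}^{\beta/2}\mu(\sigma(0,0)\sigma(x,t))\,dt,\qquad B=\sum_{x\in\mathbb{Z}^d}\int_{-\beta/2}^{\beta/2}\mu(\sigma(0,0)\sigma(x,t))^2\,dt .$$ **Lemma.** Fix $d$, $0<\beta\le\infty$ and $\varepsilon_0>0$. 1. Suppose that either $\beta<\infty$ and $d>4$, or $\beta=\infty$ and $d>3$.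 Then there is a finite constant $C_1$ (depending only on $d$, $\varepsilon_0$, $\beta$) such that $B\le C_1$ for all $\delta\ge\varepsilon_0$, all $\varepsilon_0\le\lambda<\lambda_c(\delta,\beta)$ and every infinite-volume limit $\mu$. 2. Suppose that either $\beta<\infty$ and $d=4$, or $\beta=\infty$ and $d=3$. Then there is a finite constant $C_2$ (depending only on $d$, $\varepsilon_0$, $\beta$) such that $\chi<\infty$ and $B\le C_2\,(1+\log_+\chi)$ for all $\delta\ge\varepsilon_0$, all $\varepsilon_0\le\lambda<\lambda_c(\delta,\beta)$ and every infinite-volume limit $\mu$, where $\log_+\chi=\max(\log\chi,0)$. -/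

import Mathlib

open MeasureTheory ProbabilityTheory Filter Topology
open scoped ENNReal

namespace SpaceTimeIsing

noncomputable section

/-- The torus `(ℤ / 2N)^d`. -/
abbrev Torus (d : ℕ) (N : ℕ+) : Type := Fin d → ZMod (2 * (N : ℕ))

instance neZero_side (N : ℕ+) : NeZero (2 * (N : ℕ)) :=
  ⟨Nat.mul_ne_zero two_ne_zero N.ne_zero⟩

/-- A finite (labelled) collection of points of the line. -/
abbrev PointConfig : Type := Σ n : ℕ, (Fin n → ℝ)

/-- The law of a Poisson process of intensity `δ` on `[0, β)`: on configurations with `n` labelled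
points it has density `e^{-δβ} δ^n / n!` with respect to Lebesgue measure on `[0, β)^n`. -/
def poissonProcess (δ β : ℝ) : Measure PointConfig :=
  Measure.sum fun n : ℕ =>
    ENNReal.ofReal (Real.exp (-(δ * β)) * δ ^ n / (n.factorial : ℝ)) •
      (Measure.pi fun _ : Fin n => (volume : Measure ℝ).restrict (Set.Ico 0 β)).map (Sigma.mk n)

/-- The Poisson process conditioned on having an even number of points. -/
def evenPoissonProcess (δ β : ℝ) : Measure PointConfig :=
  ProbabilityTheory.cond (poissonProcess δ β) {D | Even D.1}

/-- The sample space: for each site the points `D_x` and the initial sign `ξ_x ∈ {0, 1}`. -/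
abbrev Sample (d : ℕ) (N : ℕ+) : Type := (Torus d N → PointConfig) × (Torus d N → Fin 2)

/-- The a priori measure `E`: independent conditioned Poisson processes `D_x`, and independent
uniform `ξ_x ∈ {0, 1}`, independent of the former. -/
def aPriori (d : ℕ) (N : ℕ+) (δ β : ℝ) : Measure (Sample d N) :=
  (Measure.pi fun _ => evenPoissonProcess δ β).prod
    (Measure.pi fun _ => (PMF.uniformOfFintype (Fin 2)).toMeasure)

/-- `σ(x, t) = (-1)^(ξ_x + |D_x ∩ [0, t]|)` for `t ∈ [0, β)`, extended to all real `t` with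
period `β` (`β * Int.fract (t / β)` is the representative of `t` in `[0, β)`). -/
def spin {d : ℕ} {N : ℕ+} (β : ℝ) (ω : Sample d N) (p : Torus d N × ℝ) : ℤˣ :=
  (-1) ^ ((ω.2 p.1 : ℕ) +
    Nat.card {i : Fin (ω.1 p.1).1 // (ω.1 p.1).2 i ≤ β * Int.fract (p.2 / β)})

/-- `∑_{x ∼ y} ∫_0^β σ(x, t) σ(y, t) dt`, the sum being over unordered pairs of neighbours
(for `N ≥ 2` every such pair is `{x, x + e_j}` for exactly one `(x, j)`). -/
def interaction {d : ℕ} {N : ℕ+} (β : ℝ) (ω : Sample d N) : ℝ :=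
  ∑ x : Torus d N, ∑ j : Fin d, ∫ t in (0 : ℝ)..β,
    (((spin β ω (x, t) * spin β ω (x + Pi.single j 1, t) : ℤˣ) : ℤ) : ℝ)

/-- The space–time Ising measure in finite volume and at positive temperature: the law of `σ` under
`E` reweighted by `exp(lam ∑_{x ∼ y} ∫_0^β σ(x, t) σ(y, t) dt)` and normalized. -/
def isingMeasure (d : ℕ) (N : ℕ+) (δ lam β : ℝ) : Measure (Torus d N × ℝ → ℤˣ) :=
  ((aPriori d N δ β).tilted fun ω => lam * interaction β ω).map (spin β)

/-- The two-point function `μ(σ(0, 0) σ(x, t))` of a law `μ` of spin configurations. -/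
def twoPoint {V : Type*} [Zero V] (μ : Measure (V × ℝ → ℤˣ)) (x : V) (t : ℝ) : ℝ :=
  ∫ σ, (((σ (0, 0) * σ (x, t) : ℤˣ) : ℤ) : ℝ) ∂μ

/-- The finite-volume susceptibility `∑_{x ∈ Λ} ∫_0^β μ_Λ(σ(0, 0) σ(x, t)) dt`
(two-point functions are nonnegative by Griffiths' inequality). -/
def torusSusceptibility (d : ℕ) (N : ℕ+) (δ lam β : ℝ) : ℝ≥0∞ :=
  ∑ x : Torus d N, ∫⁻ t in Set.Ico 0 β,
    ENNReal.ofReal (twoPoint (isingMeasure d N δ lam β) x t)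

/-- The limit in which the infinite-volume system at inverse temperature `β ∈ (0, ∞]` is
approached, on pairs (half side length `N`, finite inverse temperature `b`). If `β < ∞` then
`N → ∞` and `b = β`; if `β = ∞` then `N, b → ∞` being of the same order, with ratios at
most `K`. -/
def thermoLimit (β : ℝ≥0∞) (K : ℝ) : Filter (ℕ+ × ℝ) :=
  if β = ⊤ then
    (atTop ×ˢ atTop) ⊓ 𝓟 {p | ((p.1 : ℕ) : ℝ) ≤ K * p.2 ∧ p.2 ≤ K * ((p.1 : ℕ) : ℝ)}
  else atTop ×ˢ pure β.toReal

/-- The critical value: the supremum of those `lam > 0` for which the finite-volume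
susceptibilities have finite upper limit. -/
def criticalValue (d : ℕ) (δ : ℝ) (β : ℝ≥0∞) : ℝ≥0∞ :=
  sSup {l | ∃ lam : ℝ, 0 < lam ∧ l = ENNReal.ofReal lam ∧
    ∀ K : ℝ, limsup (fun p : ℕ+ × ℝ => torusSusceptibility d p.1 δ lam p.2) (thermoLimit β K) < ⊤}

/-- Spin configurations on `ℤ^d × ℝ`, with the σ-algebra generated by the projections. -/
abbrev Config (d : ℕ) : Type := (Fin d → ℤ) × ℝ → ℤˣ

/-- Read a configuration over the torus as a periodic configuration over `ℤ^d`. -/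
def unwrap {d : ℕ} {N : ℕ+} (σ : Torus d N × ℝ → ℤˣ) : Config d :=
  fun p => σ (fun i => ((p.1 i : ℤ) : ZMod (2 * (N : ℕ))), p.2)

/-- `μ` is an infinite-volume limit, at inverse temperature `β ∈ (0, ∞]`, of the finite-volume
measures: along some sequence of volumes (and, for `β = ∞`, of inverse temperatures) growing as
prescribed, all finite-dimensional distributions converge to those of `μ`. -/
def IsInfiniteVolumeLimit (d : ℕ) (δ lam : ℝ) (β : ℝ≥0∞) (μ : Measure (Config d)) : Prop :=
  IsProbabilityMeasure μ ∧
  ∃ (K : ℝ) (u : ℕ → ℕ+ × ℝ), Tendsto u atTop (thermoLimit β K) ∧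
    ∀ (A : Finset ((Fin d → ℤ) × ℝ)) (f : (A → ℤˣ) → ℝ),
      Tendsto
        (fun n => ∫ σ, f (fun a => unwrap σ a) ∂(isingMeasure d (u n).1 δ lam (u n).2))
        atTop (𝓝 (∫ σ, f (fun a => σ a) ∂μ))

/-- `[-β/2, β/2]`, which is the whole line if `β = ∞`. -/
def timeWindow (β : ℝ≥0∞) : Set ℝ :=
  if β = ⊤ then Set.univ else Set.Icc (-(β.toReal / 2)) (β.toReal / 2)

/-- The susceptibility `χ = ∑_{x ∈ ℤ^d} ∫_{-β/2}^{β/2} μ(σ(0, 0) σ(x, t)) dt`. -/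
def susceptibility {d : ℕ} (β : ℝ≥0∞) (μ : Measure (Config d)) : ℝ≥0∞ :=
  ∑' x : Fin d → ℤ, ∫⁻ t in timeWindow β, ENNReal.ofReal (twoPoint μ x t)

/-- The bubble diagram `B = ∑_{x ∈ ℤ^d} ∫_{-β/2}^{β/2} μ(σ(0, 0) σ(x, t))^2 dt`. -/
def bubble {d : ℕ} (β : ℝ≥0∞) (μ : Measure (Config d)) : ℝ≥0∞ :=
  ∑' x : Fin d → ℤ, ∫⁻ t in timeWindow β, ENNReal.ofReal (twoPoint μ x t ^ 2)

end

end SpaceTimeIsing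

/-! Discretizing time turns the space–time model into a nearest-neighbour Ising model on a
space–time torus. With mesh Δ, the parities of the Poisson points in the cells produce a time
coupling J with tanh J = exp(-2δΔ), and the interaction becomes a spatial coupling λΔ
(`gridAvg_eq_integral_div`, `tendsto_meshCorr`). Griffiths' inequalities, reflection positivity in
space and in time, and a high-temperature bound are proved for the discrete model and passed to the
limit Δ → 0.

No infrared bound at nonzero time frequencies is needed. Let m(t) be the spatial Fourier
coefficient, at a momentum of size q, of the two-point function at time t. Gaussian domination with
bond fields that do not depend on time gives ∫ m ≤ 1/A with A of order λq²
(`latticeSymbol_mul_integral_torusMode_le`). Transfer matrices show that m is nonnegative and, on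
the even grid times of half a period, convex; an estimate of the first increment then yields m(0) -
m(t) ≤ 2δt (`torusMode_zero_sub_le`). So m stays above m(0)/2 during a time m(0)/(4δ), or during the
whole period. Hence m(0) is at most of order 1/(bA) + √(δ/A), and ∫ m² ≤ m(0) ∫ m is of order
1/(bλ²q⁴) + √(δ/λ)/(λq³) (`integral_torusMode_sq_le`). The powers q⁻⁴ and q⁻³ are responsible for
the dimensions 4 and 3, since the first term disappears as b → ∞.

Nothing is known at momentum zero. This mode is removed by comparing the two-point function with its
translates by vectors of size at most R: Parseval's identity then inserts a factor of order min(1,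
Rq)², and the momentum sum is bounded above the critical dimension and of order log R at it
(`sum_integral_sub_sq_le`, `latticeSum_self_le`). Fatou's lemma carries the estimate to infinite
volume. There the average of the two-point function over a box of side R has squared norm at most 1
once R exceeds a multiple of χ²: its supremum at time t is at most R⁻ᵈ times the spatial sum at time
t, which a Harnack inequality in time bounds by a multiple of χ. This gives B ≤ 2 + 2D
(`bubble_le_of_translationDefect`) with D bounded, respectively of order 1 + log₊ χ. Finiteness of χ
below the critical value follows from monotonicity in λ.

For uniformity in δ and λ: if δ ≥ 4dλ, then B ≤ χ ≤ 2/δ. Otherwise δ/λ ≤ 4d bounds the coefficient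
√(δ/λ)/λ and absorbs the dependence of log R on δ. -/

namespace SpaceTimeIsing

noncomputable section

set_option linter.unusedSectionVars false

/-! ### Griffiths inequalities on finite elementary abelian `2`-groups -/

section Griffiths

variable {Γ E : Type*} [CommGroup Γ] [Fintype Γ] [Fintype E]

/-- Unnormalized expectation of `f` with respect to the weight `exp (∑ e, J e * χ e)`. -/
def gibbsSum (χ : E → Γ →* ℝ) (J : E → ℝ) (f : Γ → ℝ) : ℝ :=
  ∑ s, f s * Real.exp (∑ e, J e * χ e s)

/-- Normalized expectation of `f` with respect to the weight `exp (∑ e, J e * χ e)`. -/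
def gibbsAvg (χ : E → Γ →* ℝ) (J : E → ℝ) (f : Γ → ℝ) : ℝ :=
  gibbsSum χ J f / gibbsSum χ J 1

lemma gibbsSum_one_pos (χ : E → Γ →* ℝ) (J : E → ℝ) : 0 < gibbsSum χ J 1 := by
  unfold gibbsSum
  refine Finset.sum_pos (fun s _ => ?_) ⟨1, Finset.mem_univ _⟩
  simpa using Real.exp_pos _

lemma gibbsAvg_one (χ : E → Γ →* ℝ) (J : E → ℝ) : gibbsAvg χ J 1 = 1 :=
  div_self (gibbsSum_one_pos χ J).ne'

lemma gibbsSum_smul (χ : E → Γ →* ℝ) (J : E → ℝ) (c : ℝ) (f : Γ → ℝ) :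
    gibbsSum χ J (c • f) = c * gibbsSum χ J f := by
  simp [gibbsSum, mul_assoc, Finset.mul_sum]

lemma gibbsSum_sum {ι : Type*} (χ : E → Γ →* ℝ) (J : E → ℝ) (t : Finset ι) (f : ι → Γ → ℝ) :
    gibbsSum χ J (fun s => ∑ i ∈ t, f i s) = ∑ i ∈ t, gibbsSum χ J (f i) := by
  simp only [gibbsSum, Finset.sum_mul]
  exact Finset.sum_comm

lemma gibbsAvg_sum {ι : Type*} (χ : E → Γ →* ℝ) (J : E → ℝ) (t : Finset ι) (f : ι → Γ → ℝ) :
    gibbsAvg χ J (fun s => ∑ i ∈ t, f i s) = ∑ i ∈ t, gibbsAvg χ J (f i) := by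
  simp only [gibbsAvg, gibbsSum_sum, Finset.sum_div]

lemma gibbsAvg_const_mul (χ : E → Γ →* ℝ) (J : E → ℝ) (c : ℝ) (f : Γ → ℝ) :
    gibbsAvg χ J (fun s => c * f s) = c * gibbsAvg χ J f := by
  have := gibbsSum_smul χ J c f
  simp only [gibbsAvg]
  rw [← mul_div_assoc, ← this]
  rfl

lemma gibbsAvg_mono (χ : E → Γ →* ℝ) (J : E → ℝ) {f g : Γ → ℝ} (h : ∀ s, f s ≤ g s) :
    gibbsAvg χ J f ≤ gibbsAvg χ J g := by
  unfold gibbsAvg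
  refine div_le_div_of_nonneg_right ?_ (gibbsSum_one_pos χ J).le
  exact Finset.sum_le_sum fun s _ => mul_le_mul_of_nonneg_right (h s) (Real.exp_pos _).le

lemma char_eq_one_or (hΓ : ∀ s : Γ, s * s = 1) (m : Γ →* ℝ) (s : Γ) : m s = 1 ∨ m s = -1 := by
  have h : m s * m s = 1 := by rw [← map_mul, hΓ, map_one]
  exact mul_self_eq_one_iff.mp h

/-- A variable with values ±1 makes the exponential affine: this is one factor of the
high-temperature expansion. -/
lemma exp_mul_char (hΓ : ∀ s : Γ, s * s = 1) (m : Γ →* ℝ) (s : Γ) (t : ℝ) :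
    Real.exp (t * m s) = Real.cosh t * (1 + Real.tanh t * m s) := by
  have hc : Real.cosh t ≠ 0 := (Real.cosh_pos t).ne'
  rw [Real.tanh_eq_sinh_div_cosh]
  rcases char_eq_one_or hΓ m s with h | h <;> rw [h] <;> field_simp
  · rw [← Real.cosh_add_sinh]
  · rw [← Real.cosh_sub_sinh]; ring

/-- Orthogonality: translating by an element where the character is not 1 shows that a nontrivial
character sums to 0. -/
lemma sum_char_nonneg (m : Γ →* ℝ) : 0 ≤ ∑ s, m s := by
  by_cases h : ∀ s, m s = 1
  · simp [h]
  · push Not at h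
    obtain ⟨t, ht⟩ := h
    have h1 : ∑ s, m s = m t * ∑ s, m s := by
      rw [Finset.mul_sum, ← Equiv.sum_comp (Equiv.mulLeft t)]
      simp
    have h2 : (1 - m t) * ∑ s, m s = 0 := by linarith
    rcases mul_eq_zero.mp h2 with h3 | h3
    · exact absurd (by linarith) ht
    · exact h3.ge

/-- Expanding every exponential by `exp_mul_char` leaves nonnegative multiples of sums of single
characters. The expansion multiplies `m` by characters, so the induction must let `m` vary. -/
lemma sum_char_mul_exp_nonneg (hΓ : ∀ s : Γ, s * s = 1) (χ : E → Γ →* ℝ) (J : E → ℝ)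
    (hJ : ∀ e, 0 ≤ J e) (F : Finset E) (m : Γ →* ℝ) :
    0 ≤ ∑ s, m s * Real.exp (∑ e ∈ F, J e * χ e s) := by
  classical
  induction F using Finset.induction_on generalizing m with
  | empty => simpa using sum_char_nonneg m
  | insert a F ha ih =>
    have key : ∀ s, m s * Real.exp (∑ e ∈ insert a F, J e * χ e s) =
        Real.cosh (J a) * (m s * Real.exp (∑ e ∈ F, J e * χ e s)) +
        Real.cosh (J a) * Real.tanh (J a) *
          ((m * χ a) s * Real.exp (∑ e ∈ F, J e * χ e s)) := by
      intro s
      rw [Finset.sum_insert ha, Real.exp_add, exp_mul_char hΓ, MonoidHom.mul_apply]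
      ring
    rw [Finset.sum_congr rfl fun s _ => key s, Finset.sum_add_distrib, ← Finset.mul_sum,
      ← Finset.mul_sum]
    have h1 := (Real.cosh_pos (J a)).le
    have h2 : 0 ≤ Real.tanh (J a) := by
      rw [Real.tanh_eq_sinh_div_cosh]
      exact div_nonneg (Real.sinh_nonneg_iff.mpr (hJ a)) h1
    exact add_nonneg (mul_nonneg h1 (ih m)) (mul_nonneg (mul_nonneg h1 h2) (ih _))

/-- Griffiths' first inequality. -/
lemma gibbsAvg_char_nonneg (hΓ : ∀ s : Γ, s * s = 1) (χ : E → Γ →* ℝ) {J : E → ℝ}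
    (hJ : ∀ e, 0 ≤ J e) (m : Γ →* ℝ) : 0 ≤ gibbsAvg χ J m :=
  div_nonneg (sum_char_mul_exp_nonneg hΓ χ J hJ Finset.univ m) (gibbsSum_one_pos χ J).le

lemma gibbsAvg_char_le_one (hΓ : ∀ s : Γ, s * s = 1) (χ : E → Γ →* ℝ) (J : E → ℝ)
    (m : Γ →* ℝ) : gibbsAvg χ J m ≤ 1 := by
  rw [← gibbsAvg_one χ J]
  refine gibbsAvg_mono χ J fun s => ?_
  rcases char_eq_one_or hΓ m s with h | h <;> simp [h]

/-- Griffiths' second inequality. -/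
lemma gibbsAvg_mul_le (hΓ : ∀ s : Γ, s * s = 1) (χ : E → Γ →* ℝ) {J : E → ℝ}
    (hJ : ∀ e, 0 ≤ J e) (m n : Γ →* ℝ) :
    gibbsAvg χ J m * gibbsAvg χ J n ≤ gibbsAvg χ J (m * n : Γ →* ℝ) := by
  have hZ := gibbsSum_one_pos χ J
  have key : 0 ≤ gibbsSum χ J (m * n : Γ →* ℝ) * gibbsSum χ J 1 -
      gibbsSum χ J m * gibbsSum χ J n := by
    -- Ginibre's doubling: the second copy of the system is written as `s * t`. For fixed `t` the
    -- pair is again a system of the same kind in `s`, with couplings `J e * (1 + χ e t) ≥ 0`, to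
    -- which the first inequality applies.
    have h1 : gibbsSum χ J (m * n : Γ →* ℝ) * gibbsSum χ J 1 - gibbsSum χ J m * gibbsSum χ J n =
        ∑ t, (1 - n t) * ∑ s, (m * n) s * Real.exp (∑ e, J e * (1 + χ e t) * χ e s) := by
      have h2 : ∀ s, ∀ f : Γ → ℝ, ∑ t, f t = ∑ t, f (s * t) := fun s f =>
        (Equiv.sum_comp (Equiv.mulLeft s) f).symm
      simp only [gibbsSum]
      rw [Finset.sum_mul_sum, Finset.sum_mul_sum, ← Finset.sum_sub_distrib]
      simp_rw [Finset.mul_sum]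
      rw [Finset.sum_comm (s := Finset.univ (α := Γ)) (t := Finset.univ (α := Γ))
        (f := fun t s => (1 - n t) * ((m * n) s * Real.exp (∑ e, J e * (1 + χ e t) * χ e s)))]
      refine Finset.sum_congr rfl fun s _ => ?_
      rw [← Finset.sum_sub_distrib, h2 s]
      refine Finset.sum_congr rfl fun t _ => ?_
      have h3 : (∑ e, J e * (1 + χ e t) * χ e s) =
          (∑ e, J e * χ e s) + ∑ e, J e * χ e (s * t) := by
        rw [← Finset.sum_add_distrib]
        refine Finset.sum_congr rfl fun e _ => ?_
        rw [map_mul]; ring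
      rw [h3, Real.exp_add]
      simp only [MonoidHom.mul_apply, map_mul, Pi.one_apply]
      ring
    rw [h1]
    refine Finset.sum_nonneg fun t _ => mul_nonneg ?_ ?_
    · rcases char_eq_one_or hΓ n t with h | h <;> simp [h]
    · refine sum_char_mul_exp_nonneg hΓ χ (fun e => J e * (1 + χ e t)) (fun e => ?_) Finset.univ _
      refine mul_nonneg (hJ e) ?_
      rcases char_eq_one_or hΓ (χ e) t with h | h <;> simp [h]
  unfold gibbsAvg
  rw [div_mul_div_comm, div_le_div_iff₀ (by positivity) hZ]
  nlinarith

lemma gibbsSum_add_single [DecidableEq E] (hΓ : ∀ s : Γ, s * s = 1) (χ : E → Γ →* ℝ) (J : E → ℝ)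
    (e : E) (t : ℝ) (m : Γ →* ℝ) :
    gibbsSum χ (J + Pi.single e t) m =
      Real.cosh t * (gibbsSum χ J m + Real.tanh t * gibbsSum χ J (m * χ e : Γ →* ℝ)) := by
  simp only [gibbsSum]
  rw [Finset.mul_sum, ← Finset.sum_add_distrib, Finset.mul_sum]
  refine Finset.sum_congr rfl fun s _ => ?_
  have : ∑ e', (J + Pi.single e t : E → ℝ) e' * χ e' s = (∑ e', J e' * χ e' s) + t * χ e s := by
    simp only [Pi.add_apply, add_mul, Finset.sum_add_distrib]
    congr 1
    rw [Finset.sum_eq_single e] <;> simp +contextual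
  rw [this, Real.exp_add, exp_mul_char hΓ, MonoidHom.mul_apply]
  ring

/-- Effect of changing one coupling. -/
lemma gibbsAvg_add_single [DecidableEq E] (hΓ : ∀ s : Γ, s * s = 1) (χ : E → Γ →* ℝ) (J : E → ℝ)
    (e : E) (t : ℝ) (m : Γ →* ℝ) :
    gibbsAvg χ (J + Pi.single e t) m =
      (gibbsAvg χ J m + Real.tanh t * gibbsAvg χ J (m * χ e : Γ →* ℝ)) /
        (1 + Real.tanh t * gibbsAvg χ J (χ e)) := by
  have h1 := gibbsSum_add_single hΓ χ J e t m
  have h2 := gibbsSum_add_single hΓ χ J e t 1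
  rw [one_mul] at h2
  have h3 : gibbsSum χ J ((1 : Γ →* ℝ) : Γ → ℝ) = gibbsSum χ J 1 := rfl
  have h4 : gibbsSum χ (J + Pi.single e t) ((1 : Γ →* ℝ) : Γ → ℝ) =
    gibbsSum χ (J + Pi.single e t) 1 := rfl
  rw [h3, h4] at h2
  have hZ := (gibbsSum_one_pos χ J).ne'
  have hc : Real.cosh t ≠ 0 := (Real.cosh_pos t).ne'
  unfold gibbsAvg
  rw [h1, h2, mul_div_mul_left _ _ hc]
  rw [← mul_div_assoc, ← mul_div_assoc, ← add_div, one_add_div hZ, div_div_div_cancel_right₀ hZ]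

lemma tanh_nonneg_of_nonneg {t : ℝ} (ht : 0 ≤ t) : 0 ≤ Real.tanh t := by
  rw [Real.tanh_eq_sinh_div_cosh]
  exact div_nonneg (Real.sinh_nonneg_iff.mpr ht) (Real.cosh_pos t).le

/-- In `gibbsAvg_add_single` the quotient is at least its value at zero coupling exactly because of
Griffiths' second inequality. -/
lemma gibbsAvg_le_add_single [DecidableEq E] (hΓ : ∀ s : Γ, s * s = 1) (χ : E → Γ →* ℝ) {J : E → ℝ}
    (hJ : ∀ e, 0 ≤ J e) (e : E) {t : ℝ} (ht : 0 ≤ t) (m : Γ →* ℝ) :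
    gibbsAvg χ J m ≤ gibbsAvg χ (J + Pi.single e t) m := by
  rw [gibbsAvg_add_single hΓ]
  have h0 := tanh_nonneg_of_nonneg ht
  have h1 := gibbsAvg_char_nonneg hΓ χ hJ (χ e)
  rw [le_div_iff₀ (by positivity)]
  nlinarith [gibbsAvg_mul_le hΓ χ hJ m (χ e)]

/-- The denominator in `gibbsAvg_add_single` is at least 1 and is dropped. This is the one-bond step
of the high-temperature bound. -/
lemma gibbsAvg_add_single_le [DecidableEq E] (hΓ : ∀ s : Γ, s * s = 1) (χ : E → Γ →* ℝ) {J : E → ℝ}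
    (hJ : ∀ e, 0 ≤ J e) (e : E) {t : ℝ} (ht : 0 ≤ t) (m : Γ →* ℝ) :
    gibbsAvg χ (J + Pi.single e t) m ≤
      gibbsAvg χ J m + Real.tanh t * gibbsAvg χ J (m * χ e : Γ →* ℝ) := by
  rw [gibbsAvg_add_single hΓ]
  have h0 := tanh_nonneg_of_nonneg ht
  have h1 := gibbsAvg_char_nonneg hΓ χ hJ (χ e)
  have h2 := gibbsAvg_char_nonneg hΓ χ hJ m
  have h3 := gibbsAvg_char_nonneg hΓ χ hJ (m * χ e)
  exact div_le_self (by positivity) (by nlinarith)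

/-- Correlations increase with the couplings. -/
lemma gibbsAvg_le_of_le (hΓ : ∀ s : Γ, s * s = 1) (χ : E → Γ →* ℝ) {J J' : E → ℝ}
    (hJ : ∀ e, 0 ≤ J e) (h : ∀ e, J e ≤ J' e) (m : Γ →* ℝ) :
    gibbsAvg χ J m ≤ gibbsAvg χ J' m := by
  classical
  -- The couplings are raised one at a time; `F` is the set of those already raised.
  have key : ∀ F : Finset E, gibbsAvg χ J m ≤
      gibbsAvg χ (fun e => if e ∈ F then J' e else J e) m := by
    intro F
    induction F using Finset.induction_on with
    | empty => simp
    | insert a F ha ih =>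
      refine ih.trans ?_
      have : (fun e => if e ∈ insert a F then J' e else J e) =
          (fun e => if e ∈ F then J' e else J e) + Pi.single a (J' a - J a) := by
        funext e
        by_cases he : e = a
        · subst he; simp [ha]
        · simp [he]
      rw [this]
      refine gibbsAvg_le_add_single hΓ χ (fun e => ?_) a (sub_nonneg.mpr (h a)) m
      split_ifs
      · exact (hJ e).trans (h e)
      · exact hJ e
  simpa using key Finset.univ

/-- With the coupling of `e` switched off the average is some a ≥ 0. Switching it on, with τ = tanh
(J e), gives (a + τ)/(1 + τa), because the square of `χ e` is 1; this is at least τ since τ ≤ 1. -/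
lemma tanh_le_gibbsAvg (hΓ : ∀ s : Γ, s * s = 1) (χ : E → Γ →* ℝ) {J : E → ℝ}
    (hJ : ∀ e, 0 ≤ J e) (e : E) : Real.tanh (J e) ≤ gibbsAvg χ J (χ e) := by
  classical
  have hJ' : J = Function.update J e 0 + Pi.single e (J e) := by
    funext e'
    by_cases he : e' = e
    · subst he; simp
    · simp [he]
  have h0 : ∀ e', 0 ≤ Function.update J e 0 e' := by
    intro e'
    by_cases he : e' = e
    · subst he; simp
    · simp [he, hJ]
  have hsq : (χ e * χ e : Γ →* ℝ) = 1 := by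
    ext s
    rw [MonoidHom.mul_apply, ← map_mul, hΓ]; simp
  have hτ := tanh_nonneg_of_nonneg (hJ e)
  have h1 := gibbsAvg_char_nonneg hΓ χ h0 (χ e)
  have h2 : gibbsAvg χ (Function.update J e 0) ((1 : Γ →* ℝ) : Γ → ℝ) = 1 := gibbsAvg_one _ _
  have h3 : Real.tanh (J e) < 1 := Real.tanh_lt_one _
  conv_rhs => rw [hJ']
  rw [gibbsAvg_add_single hΓ, hsq, h2, le_div_iff₀ (by positivity)]
  nlinarith [mul_nonneg h1 (sub_nonneg.mpr h3.le), mul_nonneg (mul_nonneg h1 (sub_nonneg.mpr h3.le)) hτ]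

/-- Invariance of correlations under an automorphism which preserves the energy. -/
lemma gibbsAvg_comp_equiv (χ : E → Γ →* ℝ) (J : E → ℝ) (θ : Γ ≃ Γ)
    (h : ∀ s, ∑ e, J e * χ e (θ s) = ∑ e, J e * χ e s) (f : Γ → ℝ) :
    gibbsAvg χ J (fun s => f (θ s)) = gibbsAvg χ J f := by
  unfold gibbsAvg gibbsSum
  congr 1
  rw [← Equiv.sum_comp θ (fun s => f s * _)]
  exact Finset.sum_congr rfl fun s _ => by rw [h]

end Griffiths

/-! ### The Gaussian kernel is positive semidefinite -/

section GaussianKernel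

variable {ι κ : Type*} [Fintype ι] [Fintype κ]

/-- Schur's argument: in the exponential series, the n-th power of the inner product is a sum over
words of length n of products of a function of `i` and the same function of `j`, so each term is a
sum of squares. -/
lemma sum_mul_exp_inner_nonneg (c : ι → ℝ) (P : ι → κ → ℝ) :
    0 ≤ ∑ i, ∑ j, c i * c j * Real.exp (∑ k, P i k * P j k) := by
  have h1 : ∀ i j, HasSum (fun n : ℕ => c i * c j * ((∑ k, P i k * P j k) ^ n / n.factorial))
      (c i * c j * Real.exp (∑ k, P i k * P j k)) := by
    intro i j
    refine HasSum.mul_left _ ?_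
    rw [Real.exp_eq_exp_ℝ]
    exact NormedSpace.expSeries_div_hasSum_exp _
  have h2 := hasSum_sum (s := Finset.univ) fun i _ =>
    hasSum_sum (s := Finset.univ) fun j _ => h1 i j
  refine h2.nonneg fun n => ?_
  have h3 : ∑ i, ∑ j, c i * c j * ((∑ k, P i k * P j k) ^ n / n.factorial) =
      (∑ f : Fin n → κ, (∑ i, c i * ∏ m, P i (f m)) ^ 2) / n.factorial := by
    have h4 : ∀ i j, (∑ k, P i k * P j k) ^ n =
        ∑ f : Fin n → κ, (∏ m, P i (f m)) * ∏ m, P j (f m) := by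
      intro i j
      rw [Fintype.sum_pow]
      exact Finset.sum_congr rfl fun f _ => Finset.prod_mul_distrib
    simp_rw [h4, sq, Finset.sum_mul_sum, Finset.sum_div, Finset.mul_sum]
    rw [Finset.sum_comm' (t' := Finset.univ) (s' := fun _ => Finset.univ) (by simp)]
    rw [Finset.sum_comm]
    conv_rhs => rw [Finset.sum_comm]
    refine Finset.sum_congr rfl fun i _ => ?_
    conv_rhs => rw [Finset.sum_comm]
    refine Finset.sum_congr rfl fun j _ => Finset.sum_congr rfl fun f _ => ?_
    ring
  rw [h3]
  exact div_nonneg (Finset.sum_nonneg fun f _ => sq_nonneg _) (Nat.cast_nonneg _)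

/-- The factors exp(-|P i|²/2) are absorbed into the coefficients, which leaves the kernel exp⟨P i,
P j⟩. -/
lemma sum_mul_gaussian_nonneg (c : ι → ℝ) (P : ι → κ → ℝ) :
    0 ≤ ∑ i, ∑ j, c i * c j * Real.exp (-(1 / 2) * ∑ k, (P i k - P j k) ^ 2) := by
  have h := sum_mul_exp_inner_nonneg
    (fun i => c i * Real.exp (-(1 / 2) * ∑ k, P i k ^ 2)) P
  refine h.trans_eq (Finset.sum_congr rfl fun i _ => Finset.sum_congr rfl fun j _ => ?_)
  have h1 : -(1 / 2) * ∑ k, (P i k - P j k) ^ 2 =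
      -(1 / 2) * ∑ k, P i k ^ 2 + -(1 / 2) * ∑ k, P j k ^ 2 + ∑ k, P i k * P j k := by
    simp only [Finset.mul_sum]
    rw [← Finset.sum_add_distrib, ← Finset.sum_add_distrib]
    exact Finset.sum_congr rfl fun k _ => by ring
  rw [h1, Real.exp_add, Real.exp_add]
  ring

/-- Cauchy–Schwarz inequality for the Gaussian kernel, with a shift. -/
lemma sq_sum_gaussian_le (a b : ι → ℝ) (P : ι → κ → ℝ) (γ : κ → ℝ) :
    (∑ i, ∑ j, a i * b j * Real.exp (-(1 / 2) * ∑ k, (P i k - P j k - γ k) ^ 2)) ^ 2 ≤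
      (∑ i, ∑ j, a i * a j * Real.exp (-(1 / 2) * ∑ k, (P i k - P j k) ^ 2)) *
      ∑ i, ∑ j, b i * b j * Real.exp (-(1 / 2) * ∑ k, (P i k - P j k) ^ 2) := by
  set A := ∑ i, ∑ j, a i * a j * Real.exp (-(1 / 2) * ∑ k, (P i k - P j k) ^ 2)
  set B := ∑ i, ∑ j, b i * b j * Real.exp (-(1 / 2) * ∑ k, (P i k - P j k) ^ 2)
  set X := ∑ i, ∑ j, a i * b j * Real.exp (-(1 / 2) * ∑ k, (P i k - P j k - γ k) ^ 2)
  have h : ∀ t : ℝ, 0 ≤ B * (t * t) + (2 * X) * t + A := by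
    intro t
    -- Positivity is applied to the points `P` with weights `a` together with the points `P + γ`
    -- with weights `t * b`. The shift shows only in the mixed terms, and the discriminant in `t`
    -- gives the inequality.
    have h0 := sum_mul_gaussian_nonneg (Sum.elim a (fun i => t * b i))
      (Sum.elim P (fun i k => P i k + γ k))
    simp only [Fintype.sum_sum_type, Sum.elim_inl, Sum.elim_inr, Finset.sum_add_distrib] at h0
    have e1 : ∑ i, ∑ j, a i * (t * b j) *
        Real.exp (-(1 / 2) * ∑ k, (P i k - (P j k + γ k)) ^ 2) = t * X := by
      simp only [X, Finset.mul_sum]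
      refine Finset.sum_congr rfl fun i _ => Finset.sum_congr rfl fun j _ => ?_
      simp only [sub_add_eq_sub_sub]
      ring_nf
    have e2 : ∑ i, ∑ j, t * b i * a j *
        Real.exp (-(1 / 2) * ∑ k, (P i k + γ k - P j k) ^ 2) = t * X := by
      simp only [X, Finset.mul_sum]
      rw [Finset.sum_comm]
      refine Finset.sum_congr rfl fun i _ => Finset.sum_congr rfl fun j _ => ?_
      have : ∀ k, (P j k + γ k - P i k) ^ 2 = (P i k - P j k - γ k) ^ 2 := fun k => by ring
      simp only [this]
      ring_nf
    have e3 : ∑ i, ∑ j, t * b i * (t * b j) *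
        Real.exp (-(1 / 2) * ∑ k, (P i k + γ k - (P j k + γ k)) ^ 2) = t * t * B := by
      simp only [B, Finset.mul_sum]
      refine Finset.sum_congr rfl fun i _ => Finset.sum_congr rfl fun j _ => ?_
      simp only [add_sub_add_right_eq_sub]
      ring_nf
    rw [e1, e2, e3] at h0
    linarith
  have := discrim_le_zero h
  unfold discrim at this
  nlinarith

end GaussianKernel

/-! ### Gaussian domination -/

section GaussianDomination

/-- This extracts a second moment from a symmetric pair of exponential moments. -/
lemma one_add_sq_div_two_le_cosh (x : ℝ) : 1 + x ^ 2 / 2 ≤ Real.cosh x := by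
  have h1 : Real.cosh x = 1 + 2 * Real.sinh (|x| / 2) ^ 2 := by
    have h2 := Real.cosh_two_mul (|x| / 2)
    have h3 := Real.cosh_sq (|x| / 2)
    rw [mul_div_cancel₀ _ two_ne_zero, Real.cosh_abs] at h2
    rw [h2, h3]; ring
  have h4 : |x| / 2 ≤ Real.sinh (|x| / 2) := Real.self_le_sinh_iff.mpr (by positivity)
  have h5 : (|x| / 2) ^ 2 ≤ Real.sinh (|x| / 2) ^ 2 := by gcongr
  rw [div_pow, sq_abs] at h5
  rw [h1]; linarith

variable {Λ S κ : Type*} [Fintype Λ] [DecidableEq Λ] [Fintype S] [Fintype κ]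

/-- The energy of a configuration in the presence of a bond field `g`. -/
def bondEnergy (φ : S → κ → ℝ) (J g : Λ → Λ → ℝ) (s : Λ → S) : ℝ :=
  ∑ x, ∑ y, J x y * ∑ k, (φ (s x) k - φ (s y) k - g x y) ^ 2

/-- The partition function in the presence of a bond field `g`. -/
def bondPartition (ρ : S → ℝ) (φ : S → κ → ℝ) (J g : Λ → Λ → ℝ) : ℝ :=
  ∑ s : Λ → S, (∏ x, ρ (s x)) * Real.exp (-(1 / 4) * bondEnergy φ J g s)

/-- A reflection of `Λ` which preserves `J`, where `J` couples the two halves only through pairs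
of mirror images. -/
structure BondReflection (J : Λ → Λ → ℝ) where
  /-- the reflection -/
  θ : Λ → Λ
  /-- one of the two halves -/
  L : Finset Λ
  invol : ∀ x, θ (θ x) = x
  mem_iff : ∀ x, θ x ∈ L ↔ x ∉ L
  map_J : ∀ x y, J (θ x) (θ y) = J x y
  cross : ∀ x ∈ L, ∀ y ∈ L, J x (θ y) ≠ 0 → y = x

namespace BondReflection

variable {J : Λ → Λ → ℝ} (R : BondReflection J)

lemma sum_eq (f : Λ → ℝ) : ∑ x, f x = ∑ x ∈ R.L, (f x + f (R.θ x)) := by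
  rw [Finset.sum_add_distrib, ← Finset.sum_add_sum_compl R.L]
  congr 1
  refine Finset.sum_bij' (fun x _ => R.θ x) (fun x _ => R.θ x) ?_ ?_ ?_ ?_ ?_
  · intro x hx; rw [R.mem_iff]; simpa using hx
  · intro x hx; rw [Finset.mem_compl, R.mem_iff]; simpa using hx
  · intro x _; exact R.invol x
  · intro x _; exact R.invol x
  · intro x _; rw [R.invol]

lemma sum_sum_eq (f : Λ → Λ → ℝ) : ∑ x, ∑ y, f x y =
    ∑ x ∈ R.L, ∑ y ∈ R.L, (f x y + f (R.θ x) (R.θ y)) +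
    ∑ x ∈ R.L, ∑ y ∈ R.L, (f x (R.θ y) + f (R.θ x) y) := by
  rw [R.sum_eq, ← Finset.sum_add_distrib]
  refine Finset.sum_congr rfl fun x _ => ?_
  rw [R.sum_eq, R.sum_eq, ← Finset.sum_add_distrib, ← Finset.sum_add_distrib]
  exact Finset.sum_congr rfl fun y _ => by ring

lemma theta_notMem {x : Λ} (hx : x ∈ R.L) : R.θ x ∉ R.L := by
  rw [R.mem_iff]; simpa using hx

lemma prod_eq (f : Λ → ℝ) : ∏ x, f x = (∏ x ∈ R.L, f x) * ∏ x ∈ R.L, f (R.θ x) := by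
  rw [← Finset.prod_mul_prod_compl R.L]
  congr 1
  refine Finset.prod_bij' (fun x _ => R.θ x) (fun x _ => R.θ x) ?_ ?_ ?_ ?_ ?_
  · intro x hx; rw [R.mem_iff]; simpa using hx
  · intro x hx; rw [Finset.mem_compl, R.mem_iff]; simpa using hx
  · intro x _; exact R.invol x
  · intro x _; exact R.invol x
  · intro x _; rw [R.invol]

/-- The configuration which is `u` on `L` and the mirror image of `v` off `L`. -/
def glue (u v : Λ → S) : Λ → S := fun x => if x ∈ R.L then u x else v (R.θ x)

lemma glue_of_mem (u v : Λ → S) {x : Λ} (hx : x ∈ R.L) : R.glue u v x = u x := if_pos hx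

lemma glue_theta (u v : Λ → S) {x : Λ} (hx : x ∈ R.L) : R.glue u v (R.θ x) = v x := by
  unfold glue
  rw [if_neg (R.theta_notMem hx), R.invol]

/-- Gluing sees `u` and `v` on `L` only. Summing over full configurations avoids a separate type of
half configurations; since `L` is half of `Λ`, each glued configuration is counted `card (Λ → S)`
times. -/
lemma sum_glue (F : (Λ → S) → ℝ) :
    ∑ u : Λ → S, ∑ v : Λ → S, F (R.glue u v) = Fintype.card (Λ → S) * ∑ s, F s := by
  have h1 : ∀ u : Λ → S, ∑ v : Λ → S, F (R.glue u v) =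
      ∑ w : Λ → S, F (fun x => if x ∈ R.L then u x else w x) := by
    intro u
    let e : (Λ → S) ≃ (Λ → S) :=
      ⟨fun v => v ∘ R.θ, fun v => v ∘ R.θ, fun v => by funext x; simp [R.invol],
        fun v => by funext x; simp [R.invol]⟩
    exact Equiv.sum_comp e (fun w : Λ → S => F (fun x => if x ∈ R.L then u x else w x))
  simp_rw [h1]
  rw [← Fintype.sum_prod_type' (f := fun u w : Λ → S => F (fun x => if x ∈ R.L then u x else w x))]
  let e : (Λ → S) × (Λ → S) ≃ (Λ → S) × (Λ → S) :=
    Function.Involutive.toPerm (fun p => (fun x => if x ∈ R.L then p.1 x else p.2 x,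
      fun x => if x ∈ R.L then p.2 x else p.1 x)) (by
        intro p
        ext x <;> simp only <;> split_ifs <;> rfl)
  have h2 := Equiv.sum_comp e (fun p : (Λ → S) × (Λ → S) => F p.1)
  refine Eq.trans h2 ?_
  rw [Fintype.sum_prod_type]
  simp [Finset.mul_sum]

/-- The reflected bond field, built from the values of `g` on `L`. -/
def reflectField (g : Λ → Λ → ℝ) : Λ → Λ → ℝ := fun x y =>
  if x ∈ R.L then (if y ∈ R.L then g x y else 0) else (if y ∈ R.L then 0 else g (R.θ x) (R.θ y))

/-- The weight of the half of a configuration. -/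
def halfWeight (ρ : S → ℝ) (φ : S → κ → ℝ) (g : Λ → Λ → ℝ) (u : Λ → S) : ℝ :=
  (∏ x ∈ R.L, ρ (u x)) * Real.exp (-(1 / 4) * ∑ x ∈ R.L, ∑ y ∈ R.L,
    J x y * ∑ k, (φ (u x) k - φ (u y) k - g x y) ^ 2)

/-- The glued energy splits into the two half energies and the mirror bonds. Each mirror bond occurs
in both orders, which turns 1/4 into 1/2; with √J moved into the vectors the coupling of the halves
is a Gaussian kernel shifted by the field. -/
lemma card_mul_bondPartition (ρ : S → ℝ) (φ : S → κ → ℝ) (hJ0 : ∀ x y, 0 ≤ J x y)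
    (hJ : ∀ x y, J x y = J y x) {g : Λ → Λ → ℝ} (hg : ∀ x y, g x y = -g y x) :
    Fintype.card (Λ → S) * bondPartition ρ φ J g =
      ∑ u : Λ → S, ∑ v : Λ → S, R.halfWeight ρ φ g u *
        R.halfWeight ρ φ (fun x y => g (R.θ x) (R.θ y)) v *
        Real.exp (-(1 / 2) * ∑ p : R.L × κ, (Real.sqrt (J p.1 (R.θ p.1)) * φ (u p.1) p.2 -
          Real.sqrt (J p.1 (R.θ p.1)) * φ (v p.1) p.2 -
          Real.sqrt (J p.1 (R.θ p.1)) * g p.1 (R.θ p.1)) ^ 2) := by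
  unfold bondPartition
  rw [← R.sum_glue]
  refine Finset.sum_congr rfl fun u _ => Finset.sum_congr rfl fun v _ => ?_
  have e1 : ∏ x, ρ (R.glue u v x) = (∏ x ∈ R.L, ρ (u x)) * ∏ x ∈ R.L, ρ (v x) := by
    rw [R.prod_eq]
    congr 1
    · exact Finset.prod_congr rfl fun x hx => by rw [R.glue_of_mem u v hx]
    · exact Finset.prod_congr rfl fun x hx => by rw [R.glue_theta u v hx]
  have e2 : bondEnergy φ J g (R.glue u v) =
      (∑ x ∈ R.L, ∑ y ∈ R.L, J x y * ∑ k, (φ (u x) k - φ (u y) k - g x y) ^ 2) +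
      (∑ x ∈ R.L, ∑ y ∈ R.L,
        J x y * ∑ k, (φ (v x) k - φ (v y) k - g (R.θ x) (R.θ y)) ^ 2) +
      2 * ∑ x ∈ R.L, J x (R.θ x) * ∑ k, (φ (u x) k - φ (v x) k - g x (R.θ x)) ^ 2 := by
    unfold bondEnergy
    rw [R.sum_sum_eq]
    congr 1
    · rw [← Finset.sum_add_distrib]
      refine Finset.sum_congr rfl fun x hx => ?_
      rw [← Finset.sum_add_distrib]
      refine Finset.sum_congr rfl fun y hy => ?_
      rw [R.glue_of_mem u v hx, R.glue_of_mem u v hy, R.glue_theta u v hx, R.glue_theta u v hy,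
        R.map_J]
    · rw [Finset.mul_sum]
      refine Finset.sum_congr rfl fun x hx => ?_
      rw [Finset.sum_eq_single x]
      · rw [R.glue_of_mem u v hx, R.glue_theta u v hx, hJ (R.θ x) x, hg (R.θ x) x, two_mul]
        congr 2
        exact Finset.sum_congr rfl fun k _ => by ring
      · intro y hy hyx
        have h0 : J x (R.θ y) = 0 := by
          by_contra h
          exact hyx (R.cross x hx y hy h)
        have h1 : J (R.θ x) y = 0 := by
          rw [← R.map_J, R.invol]; exact h0
        rw [h0, h1]; ring
      · exact fun h => absurd hx h
  have e3 : ∑ p : R.L × κ, (Real.sqrt (J p.1 (R.θ p.1)) * φ (u p.1) p.2 -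
          Real.sqrt (J p.1 (R.θ p.1)) * φ (v p.1) p.2 -
          Real.sqrt (J p.1 (R.θ p.1)) * g p.1 (R.θ p.1)) ^ 2 =
      ∑ x ∈ R.L, J x (R.θ x) * ∑ k, (φ (u x) k - φ (v x) k - g x (R.θ x)) ^ 2 := by
    rw [Fintype.sum_prod_type, ← Finset.sum_coe_sort R.L]
    refine Finset.sum_congr rfl fun x _ => ?_
    rw [Finset.mul_sum]
    refine Finset.sum_congr rfl fun k _ => ?_
    rw [← mul_sub, ← mul_sub, mul_pow, Real.sq_sqrt (hJ0 _ _)]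
  rw [e1, e2, e3]
  unfold halfWeight
  rw [mul_add, mul_add, Real.exp_add, Real.exp_add]
  have : -(1 / 4) * (2 * ∑ x ∈ R.L, J x (R.θ x) * ∑ k, (φ (u x) k - φ (v x) k - g x (R.θ x)) ^ 2) =
    -(1 / 2) * ∑ x ∈ R.L, J x (R.θ x) * ∑ k, (φ (u x) k - φ (v x) k - g x (R.θ x)) ^ 2 := by ring
  rw [this]
  ring

lemma halfWeight_congr (ρ : S → ℝ) (φ : S → κ → ℝ) {g g' : Λ → Λ → ℝ}
    (h : ∀ x ∈ R.L, ∀ y ∈ R.L, g x y = g' x y) :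
    R.halfWeight ρ φ g = R.halfWeight ρ φ g' := by
  funext u
  unfold halfWeight
  congr 3
  exact Finset.sum_congr rfl fun x hx => Finset.sum_congr rfl fun y hy => by rw [h x hx y hy]

lemma reflectField_antisymm {g : Λ → Λ → ℝ} (hg : ∀ x y, g x y = -g y x) (x y : Λ) :
    R.reflectField g x y = -R.reflectField g y x := by
  unfold reflectField
  split_ifs <;> simp [hg x y, hg (R.θ x) (R.θ y)]

/-- Cauchy–Schwarz for the Gaussian kernel, applied to the weights of the two halves. The diagonal
terms are partition functions whose field is symmetric under the reflection and vanishes on the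
bonds between the halves. -/
lemma sq_bondPartition_le (ρ : S → ℝ) (φ : S → κ → ℝ) (hJ0 : ∀ x y, 0 ≤ J x y)
    (hJ : ∀ x y, J x y = J y x) {g : Λ → Λ → ℝ} (hg : ∀ x y, g x y = -g y x) :
    bondPartition ρ φ J g ^ 2 ≤ bondPartition ρ φ J (R.reflectField g) *
      bondPartition ρ φ J (R.reflectField fun x y => g (R.θ x) (R.θ y)) := by
  rcases isEmpty_or_nonempty (Λ → S) with hS | hS
  · simp [bondPartition]
  have hc : (0 : ℝ) < Fintype.card (Λ → S) := by exact_mod_cast Fintype.card_pos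
  have hrefl : ∀ g : Λ → Λ → ℝ, (∀ x y, g x y = -g y x) →
      Fintype.card (Λ → S) * bondPartition ρ φ J (R.reflectField g) =
      ∑ u : Λ → S, ∑ v : Λ → S, R.halfWeight ρ φ g u * R.halfWeight ρ φ g v *
        Real.exp (-(1 / 2) * ∑ p : R.L × κ, (Real.sqrt (J p.1 (R.θ p.1)) * φ (u p.1) p.2 -
          Real.sqrt (J p.1 (R.θ p.1)) * φ (v p.1) p.2) ^ 2) := by
    intro g hg
    rw [R.card_mul_bondPartition ρ φ hJ0 hJ (R.reflectField_antisymm hg)]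
    have h1 : R.halfWeight ρ φ (R.reflectField g) = R.halfWeight ρ φ g :=
      R.halfWeight_congr ρ φ fun x hx y hy => by simp [reflectField, hx, hy]
    have h2 : R.halfWeight ρ φ (fun x y => R.reflectField g (R.θ x) (R.θ y)) =
        R.halfWeight ρ φ g :=
      R.halfWeight_congr ρ φ fun x hx y hy => by
        simp [reflectField, R.theta_notMem hx, R.theta_notMem hy, R.invol]
    rw [h1, h2]
    refine Finset.sum_congr rfl fun u _ => Finset.sum_congr rfl fun v _ => ?_
    congr 3
    refine Finset.sum_congr rfl fun p _ => ?_
    have : R.reflectField g p.1 (R.θ p.1) = 0 := by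
      simp [reflectField, p.1.2, R.theta_notMem p.1.2]
    rw [this]; simp
  have hg' : ∀ x y, g (R.θ x) (R.θ y) = -g (R.θ y) (R.θ x) := fun x y => hg _ _
  have key := sq_sum_gaussian_le (R.halfWeight ρ φ g)
    (R.halfWeight ρ φ (fun x y => g (R.θ x) (R.θ y)))
    (fun (u : Λ → S) (p : R.L × κ) => Real.sqrt (J p.1 (R.θ p.1)) * φ (u p.1) p.2)
    (fun p => Real.sqrt (J p.1 (R.θ p.1)) * g p.1 (R.θ p.1))
  rw [← R.card_mul_bondPartition ρ φ hJ0 hJ hg, ← hrefl g hg, ← hrefl _ hg'] at key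
  have : (Fintype.card (Λ → S) : ℝ) ^ 2 * bondPartition ρ φ J g ^ 2 ≤
      (Fintype.card (Λ → S) : ℝ) ^ 2 * (bondPartition ρ φ J (R.reflectField g) *
      bondPartition ρ φ J (R.reflectField fun x y => g (R.θ x) (R.θ y))) := by
    nlinarith
  exact le_of_mul_le_mul_left this (by positivity)

/-- The number of coupled pairs on which a bond field does not vanish. -/
def defectCount (J g : Λ → Λ → ℝ) : ℝ := ∑ x, ∑ y, if J x y ≠ 0 ∧ g x y ≠ 0 then 1 else 0

lemma defectCount_reflect (g : Λ → Λ → ℝ) : defectCount J (R.reflectField g) =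
    2 * ∑ x ∈ R.L, ∑ y ∈ R.L, if J x y ≠ 0 ∧ g x y ≠ 0 then (1 : ℝ) else 0 := by
  unfold defectCount
  rw [R.sum_sum_eq, Finset.mul_sum]
  have h2 : ∑ x ∈ R.L, ∑ y ∈ R.L,
      ((if J x (R.θ y) ≠ 0 ∧ R.reflectField g x (R.θ y) ≠ 0 then (1 : ℝ) else 0) +
        if J (R.θ x) y ≠ 0 ∧ R.reflectField g (R.θ x) y ≠ 0 then (1 : ℝ) else 0) = 0 := by
    refine Finset.sum_eq_zero fun x hx => Finset.sum_eq_zero fun y hy => ?_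
    simp [reflectField, hx, hy, R.theta_notMem hx, R.theta_notMem hy]
  rw [h2, add_zero]
  refine Finset.sum_congr rfl fun x hx => ?_
  rw [Finset.mul_sum]
  refine Finset.sum_congr rfl fun y hy => ?_
  simp only [reflectField, hx, hy, R.theta_notMem hx, R.theta_notMem hy, R.invol, R.map_J,
    if_true, if_false]
  ring

/-- Together the two reflected fields have twice the defects of `g` inside the halves and none
across; the pair `(x, y)` is a defect across that is lost. -/
lemma defectCount_reflect_add_lt {g : Λ → Λ → ℝ} {x y : Λ} (hx : x ∈ R.L) (hy : y ∉ R.L)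
    (hJ : J x y ≠ 0) (hg : g x y ≠ 0) :
    defectCount J (R.reflectField g) +
      defectCount J (R.reflectField fun x y => g (R.θ x) (R.θ y)) < 2 * defectCount J g := by
  rw [R.defectCount_reflect, R.defectCount_reflect]
  unfold defectCount
  rw [R.sum_sum_eq]
  have h1 : (0 : ℝ) < ∑ x ∈ R.L, ∑ y ∈ R.L,
      ((if J x (R.θ y) ≠ 0 ∧ g x (R.θ y) ≠ 0 then (1 : ℝ) else 0) +
        if J (R.θ x) y ≠ 0 ∧ g (R.θ x) y ≠ 0 then (1 : ℝ) else 0) := by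
    have hn : ∀ x y : Λ, (0 : ℝ) ≤ (if J x (R.θ y) ≠ 0 ∧ g x (R.θ y) ≠ 0 then (1 : ℝ) else 0) +
        if J (R.θ x) y ≠ 0 ∧ g (R.θ x) y ≠ 0 then (1 : ℝ) else 0 := by
      intro x y; positivity
    refine Finset.sum_pos' (fun x _ => Finset.sum_nonneg fun y _ => hn x y) ⟨x, hx, ?_⟩
    refine Finset.sum_pos' (fun y _ => hn x y) ⟨R.θ y, (R.mem_iff y).mpr hy, ?_⟩
    rw [R.invol, if_pos ⟨hJ, hg⟩]
    positivity
  have h2 : ∑ x ∈ R.L, ∑ y ∈ R.L, ((if J x y ≠ 0 ∧ g x y ≠ 0 then (1 : ℝ) else 0) +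
      if J (R.θ x) (R.θ y) ≠ 0 ∧ g (R.θ x) (R.θ y) ≠ 0 then (1 : ℝ) else 0) =
      (∑ x ∈ R.L, ∑ y ∈ R.L, if J x y ≠ 0 ∧ g x y ≠ 0 then (1 : ℝ) else 0) +
      ∑ x ∈ R.L, ∑ y ∈ R.L, if J x y ≠ 0 ∧ g (R.θ x) (R.θ y) ≠ 0 then (1 : ℝ) else 0 := by
    simp only [R.map_J, Finset.sum_add_distrib]
  rw [h2]
  linarith

end BondReflection

/-- Gaussian domination: a bond field decreases the partition function. -/
theorem bondPartition_le_zero (ρ : S → ℝ) (hρ : ∀ a, 0 ≤ ρ a) (φ : S → κ → ℝ) {J : Λ → Λ → ℝ}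
    (hJ0 : ∀ x y, 0 ≤ J x y) (hJ : ∀ x y, J x y = J y x)
    (hR : ∀ x y, J x y ≠ 0 → ∃ R : BondReflection J, x ∈ R.L ∧ y ∉ R.L)
    {g : Λ → Λ → ℝ} (hg : ∀ x y, g x y = -g y x) :
    bondPartition ρ φ J g ≤ bondPartition ρ φ J 0 := by
  classical
  -- Reflecting a field only moves its values or replaces them by 0. The maximum can therefore be
  -- sought among the finitely many antisymmetric fields with values in `V`.
  let V : Finset ℝ := insert 0 (Finset.univ.image fun p : Λ × Λ => g p.1 p.2)
  let G : Finset (Λ → Λ → ℝ) :=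
    (Fintype.piFinset fun _ => Fintype.piFinset fun _ => V).filter fun g => ∀ x y, g x y = -g y x
  have hGmem : ∀ g', g' ∈ G ↔ (∀ x y, g' x y ∈ V) ∧ ∀ x y, g' x y = -g' y x := by
    intro g'; simp [G, Fintype.mem_piFinset]
  have hgG : g ∈ G := by
    rw [hGmem]
    exact ⟨fun x y => Finset.mem_insert_of_mem (Finset.mem_image.mpr ⟨(x, y), by simp⟩), hg⟩
  have hrG : ∀ (R : BondReflection J), ∀ g' ∈ G, R.reflectField g' ∈ G := by
    intro R g' hg'
    rw [hGmem] at hg' ⊢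
    refine ⟨fun x y => ?_, R.reflectField_antisymm hg'.2⟩
    unfold BondReflection.reflectField
    split_ifs
    · exact hg'.1 _ _
    · exact Finset.mem_insert_self _ _
    · exact Finset.mem_insert_self _ _
    · exact hg'.1 _ _
  have hθG : ∀ (R : BondReflection J), ∀ g' ∈ G, (fun x y => g' (R.θ x) (R.θ y)) ∈ G := by
    intro R g' hg'
    rw [hGmem] at hg' ⊢
    exact ⟨fun x y => hg'.1 _ _, fun x y => hg'.2 _ _⟩
  obtain ⟨g₁, hg₁, hmax⟩ := G.exists_max_image (bondPartition ρ φ J) ⟨g, hgG⟩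
  -- Among the maximizers, one with the fewest defects is chosen.
  obtain ⟨g₂, hg₂, hmin⟩ := (G.filter fun g' => bondPartition ρ φ J g' =
    bondPartition ρ φ J g₁).exists_min_image (BondReflection.defectCount J)
      ⟨g₁, by simp [hg₁]⟩
  rw [Finset.mem_filter] at hg₂
  have hZ0 : ∀ g', 0 ≤ bondPartition ρ φ J g' := fun g' =>
    Finset.sum_nonneg fun s _ => mul_nonneg (Finset.prod_nonneg fun x _ => hρ _) (Real.exp_pos _).le
  rcases (hZ0 g₁).eq_or_lt with hz | hz
  · refine (hmax g hgG).trans ?_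
    rw [← hz]
    exact hZ0 _
  -- If a defect were left, the reflection across it would produce two fields which Cauchy–Schwarz
  -- forces to be maximizers too, and one of them would have fewer defects.
  have hzero : ∀ x y, J x y ≠ 0 → g₂ x y = 0 := by
    intro x y hxy
    by_contra hne
    obtain ⟨R, hx, hy⟩ := hR x y hxy
    have h1 := R.defectCount_reflect_add_lt hx hy hxy hne
    have h2 := R.sq_bondPartition_le ρ φ hJ0 hJ ((hGmem g₂).mp hg₂.1).2
    have hA := hrG R g₂ hg₂.1
    have hB := hrG R _ (hθG R g₂ hg₂.1)
    have hA' := hmax _ hA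
    have hB' := hmax _ hB
    rw [hg₂.2] at h2
    have hA0 : bondPartition ρ φ J (R.reflectField g₂) = bondPartition ρ φ J g₁ := by
      refine le_antisymm hA' ?_
      have := h2.trans (mul_le_mul_of_nonneg_left hB' (hZ0 _))
      rw [sq] at this
      exact le_of_mul_le_mul_right this hz
    have hB0 : bondPartition ρ φ J (R.reflectField fun x y => g₂ (R.θ x) (R.θ y)) =
        bondPartition ρ φ J g₁ := by
      refine le_antisymm hB' ?_
      have := h2.trans (mul_le_mul_of_nonneg_right hA' (hZ0 _))
      rw [sq] at this
      exact le_of_mul_le_mul_left this hz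
    have h3 := hmin _ (Finset.mem_filter.mpr ⟨hA, hA0⟩)
    have h4 := hmin _ (Finset.mem_filter.mpr ⟨hB, hB0⟩)
    linarith
  have hfin : bondPartition ρ φ J g₂ = bondPartition ρ φ J 0 := by
    unfold bondPartition bondEnergy
    refine Finset.sum_congr rfl fun s _ => ?_
    congr 3
    refine Finset.sum_congr rfl fun x _ => Finset.sum_congr rfl fun y _ => ?_
    by_cases h : J x y = 0
    · simp [h]
    · simp [hzero x y h]
  calc bondPartition ρ φ J g ≤ bondPartition ρ φ J g₁ := hmax g hgG
    _ = bondPartition ρ φ J g₂ := hg₂.2.symm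
    _ = _ := hfin

/-- The infrared bound as a bound on a quadratic form. -/
theorem sum_sq_mul_le (ρ : S → ℝ) (hρ : ∀ a, 0 ≤ ρ a) (φ : S → κ → ℝ) {J : Λ → Λ → ℝ}
    (hJ0 : ∀ x y, 0 ≤ J x y) (hJ : ∀ x y, J x y = J y x)
    (hR : ∀ x y, J x y ≠ 0 → ∃ R : BondReflection J, x ∈ R.L ∧ y ∉ R.L) (h : Λ → ℝ) :
    ∑ s : Λ → S, (∑ x, (∑ y, J x y * (h x - h y)) * ∑ k, φ (s x) k) ^ 2 *
        ((∏ x, ρ (s x)) * Real.exp (-(1 / 4) * bondEnergy φ J 0 s)) ≤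
      (Fintype.card κ / 2 * ∑ x, ∑ y, J x y * (h x - h y) ^ 2) * bondPartition ρ φ J 0 := by
  set Y : (Λ → S) → ℝ := fun s => ∑ x, (∑ y, J x y * (h x - h y)) * ∑ k, φ (s x) k
  set w : (Λ → S) → ℝ := fun s => (∏ x, ρ (s x)) * Real.exp (-(1 / 4) * bondEnergy φ J 0 s)
  set Q : ℝ := Fintype.card κ / 4 * ∑ x, ∑ y, J x y * (h x - h y) ^ 2
  have hw : ∀ s, 0 ≤ w s := fun s =>
    mul_nonneg (Finset.prod_nonneg fun x _ => hρ _) (Real.exp_pos _).le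
  have hZ : bondPartition ρ φ J 0 = ∑ s, w s := rfl
  -- For the gradient field ε(h x - h y), expanding the square and summing by parts leaves the
  -- linear term `ε * Y` and the configuration-independent term `ε² Q`.
  have henergy : ∀ (ε : ℝ) (s : Λ → S),
      -(1 / 4) * bondEnergy φ J (fun x y => ε * (h x - h y)) s =
        -(1 / 4) * bondEnergy φ J 0 s + (ε * Y s - ε ^ 2 * Q) := by
    intro ε s
    have e1 : Y s = 1 / 2 * ∑ x, ∑ y, J x y * ((h x - h y) * ∑ k, (φ (s x) k - φ (s y) k)) := by
      have e2 : ∑ x, ∑ y, J x y * ((h x - h y) * ∑ k, (φ (s x) k - φ (s y) k)) =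
          ∑ x, ∑ y, J x y * (h x - h y) * (∑ k, φ (s x) k) -
          ∑ x, ∑ y, J x y * (h x - h y) * (∑ k, φ (s y) k) := by
        rw [← Finset.sum_sub_distrib]
        refine Finset.sum_congr rfl fun x _ => ?_
        rw [← Finset.sum_sub_distrib]
        refine Finset.sum_congr rfl fun y _ => ?_
        rw [Finset.sum_sub_distrib]; ring
      have e3 : ∑ x, ∑ y, J x y * (h x - h y) * (∑ k, φ (s y) k) =
          -∑ x, ∑ y, J x y * (h x - h y) * (∑ k, φ (s x) k) := by
        rw [Finset.sum_comm, ← Finset.sum_neg_distrib]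
        refine Finset.sum_congr rfl fun x _ => ?_
        rw [← Finset.sum_neg_distrib]
        refine Finset.sum_congr rfl fun y _ => ?_
        rw [hJ y x]; ring
      have e4 : Y s = ∑ x, ∑ y, J x y * (h x - h y) * (∑ k, φ (s x) k) := by
        simp only [Y, Finset.sum_mul]
      rw [e2, e3, ← e4]; ring
    have e5 : bondEnergy φ J (fun x y => ε * (h x - h y)) s = bondEnergy φ J 0 s -
        2 * ε * (∑ x, ∑ y, J x y * ((h x - h y) * ∑ k, (φ (s x) k - φ (s y) k))) +
        ε ^ 2 * Fintype.card κ * ∑ x, ∑ y, J x y * (h x - h y) ^ 2 := by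
      unfold bondEnergy
      simp only [Finset.mul_sum, Pi.zero_apply, sub_zero]
      rw [← Finset.sum_sub_distrib, ← Finset.sum_add_distrib]
      refine Finset.sum_congr rfl fun x _ => ?_
      rw [← Finset.sum_sub_distrib, ← Finset.sum_add_distrib]
      refine Finset.sum_congr rfl fun y _ => ?_
      have e6 : ε ^ 2 * (Fintype.card κ : ℝ) * (J x y * (h x - h y) ^ 2) =
          ∑ _k : κ, ε ^ 2 * (J x y * (h x - h y) ^ 2) := by
        rw [Finset.sum_const, Finset.card_univ, nsmul_eq_mul]; ring
      rw [e6, ← Finset.sum_sub_distrib, ← Finset.sum_add_distrib]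
      exact Finset.sum_congr rfl fun k _ => by ring
    rw [e5, e1]
    simp only [Q]
    ring
  have hdom : ∀ ε : ℝ, ∑ s, w s * Real.exp (ε * Y s) ≤ Real.exp (ε ^ 2 * Q) * ∑ s, w s := by
    intro ε
    have h1 := bondPartition_le_zero ρ hρ φ hJ0 hJ hR (g := fun x y => ε * (h x - h y))
      (fun x y => by ring)
    rw [hZ] at h1
    have h2 : bondPartition ρ φ J (fun x y => ε * (h x - h y)) =
        Real.exp (-(ε ^ 2 * Q)) * ∑ s, w s * Real.exp (ε * Y s) := by
      unfold bondPartition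
      rw [Finset.mul_sum]
      refine Finset.sum_congr rfl fun s _ => ?_
      rw [henergy, Real.exp_add, sub_eq_add_neg, Real.exp_add]
      simp only [w]; ring
    rw [h2] at h1
    have h3 := mul_le_mul_of_nonneg_left h1 (Real.exp_pos (ε ^ 2 * Q)).le
    rwa [← mul_assoc, ← Real.exp_add, add_neg_cancel, Real.exp_zero, one_mul] at h3
  -- The bounds for ε and -ε are added, so that only cosh remains; then ε → 0 turns the exponential
  -- bound into one for the second moment.
  have hcosh : ∀ ε : ℝ, 0 < ε → ∑ s, Y s ^ 2 * w s ≤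
      2 * ((Real.exp (ε ^ 2 * Q) - 1) / ε ^ 2) * ∑ s, w s := by
    intro ε hε
    have h1 := hdom ε
    have h2 := hdom (-ε)
    rw [neg_sq] at h2
    have h3 : ∑ s, w s * (2 + ε ^ 2 * Y s ^ 2) ≤
        ∑ s, w s * Real.exp (ε * Y s) + ∑ s, w s * Real.exp (-ε * Y s) := by
      rw [← Finset.sum_add_distrib]
      refine Finset.sum_le_sum fun s _ => ?_
      rw [← mul_add]
      refine mul_le_mul_of_nonneg_left ?_ (hw s)
      have h4 := one_add_sq_div_two_le_cosh (ε * Y s)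
      rw [Real.cosh_eq] at h4
      rw [neg_mul]
      nlinarith
    have h5 : ∑ s, w s * (2 + ε ^ 2 * Y s ^ 2) = 2 * ∑ s, w s + ε ^ 2 * ∑ s, Y s ^ 2 * w s := by
      rw [Finset.mul_sum, Finset.mul_sum, ← Finset.sum_add_distrib]
      exact Finset.sum_congr rfl fun s _ => by ring
    rw [h5] at h3
    rw [mul_div_assoc', div_mul_eq_mul_div, le_div_iff₀ (by positivity)]
    nlinarith
  have hlim : Tendsto (fun ε : ℝ => 2 * ((Real.exp (ε ^ 2 * Q) - 1) / ε ^ 2) * ∑ s, w s)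
      (𝓝[>] 0) (𝓝 (2 * Q * ∑ s, w s)) := by
    refine Tendsto.mul_const _ (Tendsto.const_mul _ ?_)
    have hd : HasDerivAt (fun u : ℝ => Real.exp (u * Q)) Q 0 := by
      have := ((hasDerivAt_id (0 : ℝ)).mul_const Q).exp
      simpa using this
    have h1 := hd.tendsto_slope_zero
    have h2 : Tendsto (fun ε : ℝ => ε ^ 2) (𝓝[>] 0) (𝓝[≠] 0) := by
      refine tendsto_nhdsWithin_iff.mpr ⟨?_, ?_⟩
      · have : Tendsto (fun ε : ℝ => ε ^ 2) (𝓝 0) (𝓝 (0 ^ 2)) := (continuous_pow 2).tendsto 0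
        rw [zero_pow two_ne_zero] at this
        exact this.mono_left nhdsWithin_le_nhds
      · filter_upwards [self_mem_nhdsWithin] with ε hε
        exact pow_ne_zero 2 (ne_of_gt hε)
    refine (h1.comp h2).congr fun ε => ?_
    simp [div_eq_inv_mul]
  have hfin : ∑ s, Y s ^ 2 * w s ≤ 2 * Q * ∑ s, w s := by
    refine ge_of_tendsto hlim ?_
    filter_upwards [self_mem_nhdsWithin] with ε hε using hcosh ε hε
  calc _ ≤ 2 * Q * ∑ s, w s := hfin
    _ = _ := by rw [hZ]; simp only [Q]; ring

end GaussianDomination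

/-! ### Transfer matrices and reflection positivity in time -/

section Transfer

variable {S : Type*} [Fintype S] [DecidableEq S]

lemma prod_ofFn_apply {n : ℕ} (A : Fin (n + 1) → Matrix S S ℝ) (a b : S) :
    (List.ofFn A).prod a b = ∑ s : Fin n → S, ∏ i : Fin (n + 1),
      A i ((Fin.cons a s : Fin (n + 1) → S) i) ((Fin.snoc s b : Fin (n + 1) → S) i) := by
  induction n generalizing a with
  | zero => simp [List.ofFn_succ, Fin.snoc]
  | succ n ih =>
    rw [List.ofFn_succ, List.prod_cons, Matrix.mul_apply]
    rw [← Equiv.sum_comp (Fin.consEquiv fun _ => S)]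
    rw [Fintype.sum_prod_type]
    refine Finset.sum_congr rfl fun c _ => ?_
    rw [ih (fun i => A i.succ), Finset.mul_sum]
    refine Finset.sum_congr rfl fun s _ => ?_
    rw [Fin.prod_univ_succ (n := n + 1)]
    have h : (Fin.snoc ((Fin.consEquiv fun _ => S) (c, s)) b : Fin (n + 2) → S) =
        Fin.cons c (Fin.snoc s b : Fin (n + 1) → S) :=
      (Fin.cons_snoc_eq_snoc_cons c s b).symm
    simp only [h, Fin.consEquiv_apply, Fin.cons_zero, Fin.cons_succ]

lemma trace_prod_ofFn {n : ℕ} (A : Fin (n + 1) → Matrix S S ℝ) :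
    (List.ofFn A).prod.trace = ∑ s : Fin (n + 1) → S, ∏ i, A i (s i) (s (i + 1)) := by
  rw [← Equiv.sum_comp (Fin.consEquiv fun _ => S), Fintype.sum_prod_type, Matrix.trace]
  refine Finset.sum_congr rfl fun a _ => ?_
  rw [Matrix.diag_apply, prod_ofFn_apply]
  refine Finset.sum_congr rfl fun s _ => Finset.prod_congr rfl fun i _ => ?_
  simp only [Fin.consEquiv_apply]
  congr 1
  induction i using Fin.lastCases with
  | last => simp
  | cast j => simp [Fin.coeSucc_eq_succ]

/-- Unnormalized two-time correlation of a periodic chain with transfer matrix `T`. -/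
def chainCorr (T : Matrix S S ℝ) (M : ℕ) [NeZero M] (f : S → ℝ) (k : ℕ) : ℝ :=
  ∑ s : ZMod M → S, f (s 0) * f (s k) * ∏ i, T (s i) (s (i + 1))

lemma chainCorr_eq_trace (T : Matrix S S ℝ) (M : ℕ) [NeZero M] (f : S → ℝ) {k : ℕ} (hk : k < M) :
    chainCorr T M f k =
      (Matrix.diagonal f * T ^ k * Matrix.diagonal f * T ^ (M - k)).trace := by
  obtain ⟨n, rfl⟩ : ∃ n, M = n + 1 := ⟨M - 1, by omega⟩
  have hdiag : ∀ a b, (Matrix.diagonal f * T) a b = f a * T a b := fun a b => by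
    rw [Matrix.diagonal_mul]
  let kf : Fin (n + 1) := ⟨k, hk⟩
  -- The observable is inserted in front of the transfer matrix at times 0 and `k`. The two
  -- insertions are separate factors because they coincide when `k = 0`.
  let A : Fin (n + 1) → Matrix S S ℝ := fun i =>
    (if i = 0 then Matrix.diagonal f else 1) * ((if i = kf then Matrix.diagonal f else 1) * T)
  have hk' : ((k : ℕ) : ZMod (n + 1)) = (kf : Fin (n + 1)) :=
    Fin.ext ((ZMod.val_natCast (n + 1) k).trans (Nat.mod_eq_of_lt hk))
  have h0 : chainCorr T (n + 1) f k = ∑ s : Fin (n + 1) → S,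
      f (s 0) * f (s kf) * ∏ i, T (s i) (s (i + 1)) := by
    unfold chainCorr
    rw [hk']
    rfl
  have h1 : chainCorr T (n + 1) f k = (List.ofFn A).prod.trace := by
    rw [trace_prod_ofFn, h0]
    refine Finset.sum_congr rfl fun s _ => ?_
    have h2 : ∀ i : Fin (n + 1), A i (s i) (s (i + 1)) =
        (if i = 0 then f (s i) else 1) * ((if i = kf then f (s i) else 1) * T (s i) (s (i + 1))) := by
      intro i
      simp only [A]
      split_ifs <;> simp [Matrix.diagonal_mul]
    have h3 : ∏ i : Fin (n + 1), A i (s i) (s (i + 1)) =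
        f (s (0 : Fin (n + 1))) * (f (s kf) * ∏ i : Fin (n + 1), T (s i) (s (i + 1))) := by
      rw [Finset.prod_congr rfl fun i _ => h2 i, Finset.prod_mul_distrib, Finset.prod_mul_distrib]
      simp
    exact (mul_assoc _ _ _).trans h3.symm
  rw [h1]
  congr 1
  rcases Nat.eq_zero_or_pos k with hk0 | hk0
  · subst hk0
    have : List.ofFn A = (Matrix.diagonal f * (Matrix.diagonal f * T)) :: List.replicate n T := by
      rw [List.ofFn_succ, ← List.ofFn_const]
      congr 1
      congr 1
      funext i
      have : i.succ ≠ kf := Fin.succ_ne_zero i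
      simp [A, this, Fin.succ_ne_zero]
    rw [this, List.prod_cons, List.prod_replicate, pow_zero, Nat.sub_zero, mul_one, pow_succ']
    simp only [Matrix.mul_assoc]
  · have : List.ofFn A = (Matrix.diagonal f * T) :: (List.replicate (k - 1) T ++
        (Matrix.diagonal f * T) :: List.replicate (n - k) T) := by
      refine List.ext_getElem (by simp; omega) fun i h1 h2 => ?_
      simp only [List.getElem_ofFn, List.getElem_cons, List.getElem_append, List.getElem_replicate,
        List.length_replicate, A, kf, ← Fin.val_eq_val, Fin.val_zero]
      by_cases hi0 : i = 0
      · have : ¬ (i = k) := by omega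
        simp [hi0, hk0.ne]
      · by_cases hik : i = k
        · have h3 : ¬ (i - 1 < k - 1) := by omega
          have h4 : i - 1 - (k - 1) = 0 := by omega
          simp [hik, hk0.ne']
        · rcases lt_or_gt_of_ne hik with h5 | h5
          · have h3 : (i - 1 < k - 1) := by omega
            simp [hi0, hik, h3]
          · have h3 : ¬ (i - 1 < k - 1) := by omega
            have h4 : ¬ (i - 1 - (k - 1) = 0) := by omega
            simp [hi0, hik, h3, h4]
    rw [this, List.prod_cons, List.prod_append, List.prod_cons, List.prod_replicate,
      List.prod_replicate]
    have e1 : T ^ k = T * T ^ (k - 1) := by rw [← pow_succ']; congr 1; omega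
    have e2 : T ^ (n + 1 - k) = T * T ^ (n - k) := by rw [← pow_succ']; congr 1; omega
    rw [e1, e2]
    simp only [Matrix.mul_assoc]

/-- The range is extended to `k = M`, which is time 0 again; the trace formula persists because the
trace is cyclic. This endpoint is the distance `2 * j` with `j = m` below. -/
lemma chainCorr_eq_trace' (T : Matrix S S ℝ) (M : ℕ) [NeZero M] (f : S → ℝ) {k : ℕ} (hk : k ≤ M) :
    chainCorr T M f k =
      (Matrix.diagonal f * T ^ k * Matrix.diagonal f * T ^ (M - k)).trace := by
  rcases hk.lt_or_eq with h | h
  · exact chainCorr_eq_trace T M f h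
  · have h0 : chainCorr T M f k = chainCorr T M f 0 := by
      simp [chainCorr, h]
    rw [h0, chainCorr_eq_trace T M f (Nat.pos_of_ne_zero (NeZero.ne M)), h]
    simp only [pow_zero, mul_one, Nat.sub_zero, Nat.sub_self]
    rw [Matrix.mul_assoc, Matrix.trace_mul_comm]

lemma trace_mul_transpose_self_nonneg (X : Matrix S S ℝ) : 0 ≤ (X * X.transpose).trace := by
  rw [Matrix.trace]
  refine Finset.sum_nonneg fun i _ => ?_
  rw [Matrix.diag_apply, Matrix.mul_apply]
  exact Finset.sum_nonneg fun j _ => mul_self_nonneg _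

/-- The trace is tr(X Xᵀ) with X = T^(m-j) D T^j. Only the symmetry of `T` enters, so both the
distance and the period are even. -/
lemma chainCorr_nonneg {T : Matrix S S ℝ} (hT : T.transpose = T) (m : ℕ) [NeZero (2 * m)]
    (f : S → ℝ) {j : ℕ} (hj : j ≤ m) : 0 ≤ chainCorr T (2 * m) f (2 * j) := by
  rw [chainCorr_eq_trace' T _ f (by omega)]
  have h := trace_mul_transpose_self_nonneg (T ^ (m - j) * Matrix.diagonal f * T ^ j)
  have hp : ∀ k, (T ^ k).transpose = T ^ k := fun k => by rw [Matrix.transpose_pow, hT]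
  rw [Matrix.transpose_mul, Matrix.transpose_mul, hp, hp, Matrix.diagonal_transpose] at h
  have e1 : 2 * m - 2 * j = (m - j) + (m - j) := by omega
  have e2 : 2 * j = j + j := by omega
  rw [e1, e2, pow_add, pow_add]
  rw [show T ^ (m - j) * Matrix.diagonal f * T ^ j * (T ^ j * (Matrix.diagonal f * T ^ (m - j))) =
    T ^ (m - j) * (Matrix.diagonal f * (T ^ j * T ^ j) * Matrix.diagonal f * T ^ (m - j)) by
      simp only [Matrix.mul_assoc], Matrix.trace_mul_comm] at h
  simpa only [Matrix.mul_assoc] using h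

/-- Convexity in the even distances, from tr((A - B)(A - B)ᵀ) ≥ 0: the two squares give the outer
distances and the mixed terms the middle one. -/
lemma two_mul_chainCorr_le {T : Matrix S S ℝ} (hT : T.transpose = T) (m : ℕ) [NeZero (2 * m)]
    (f : S → ℝ) {j : ℕ} (hj : j + 2 ≤ m) :
    2 * chainCorr T (2 * m) f (2 * (j + 1)) ≤
      chainCorr T (2 * m) f (2 * j) + chainCorr T (2 * m) f (2 * (j + 2)) := by
  rw [chainCorr_eq_trace' T _ f (by omega), chainCorr_eq_trace' T _ f (by omega),
    chainCorr_eq_trace' T _ f (by omega)]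
  obtain ⟨i, rfl⟩ : ∃ i, m = j + 2 + i := ⟨m - (j + 2), by omega⟩
  set D := Matrix.diagonal f
  have hD : D.transpose = D := Matrix.diagonal_transpose f
  have hp : ∀ k, (T ^ k).transpose = T ^ k := fun k => by rw [Matrix.transpose_pow, hT]
  set A := T ^ (i + 2) * D * T ^ j
  set B := T ^ i * D * T ^ (j + 2)
  have h := trace_mul_transpose_self_nonneg (A - B)
  have hA : A.transpose = T ^ j * (D * T ^ (i + 2)) := by
    simp only [A, Matrix.transpose_mul, hp, hD]
  have hB : B.transpose = T ^ (j + 2) * (D * T ^ i) := by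
    simp only [B, Matrix.transpose_mul, hp, hD]
  rw [Matrix.transpose_sub, Matrix.sub_mul, Matrix.mul_sub, Matrix.mul_sub, Matrix.trace_sub,
    Matrix.trace_sub, Matrix.trace_sub] at h
  have key : ∀ a b c e k l : ℕ, b + c = k → e + a = l →
      (T ^ a * D * T ^ b * (T ^ c * (D * T ^ e))).trace = (D * T ^ k * D * T ^ l).trace := by
    intro a b c e k l h1 h2
    rw [show T ^ a * D * T ^ b * (T ^ c * (D * T ^ e)) =
      T ^ a * (D * (T ^ b * T ^ c) * D * T ^ e) by simp only [Matrix.mul_assoc],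
      Matrix.trace_mul_comm, ← pow_add, h1, Matrix.mul_assoc _ (T ^ e), ← pow_add, h2]
  rw [hA, hB] at h
  rw [key (i + 2) j j (i + 2) (2 * j) (2 * (j + 2 + i) - 2 * j) (by omega) (by omega),
    key (i + 2) j (j + 2) i (2 * (j + 1)) (2 * (j + 2 + i) - 2 * (j + 1)) (by omega) (by omega),
    key i (j + 2) j (i + 2) (2 * (j + 1)) (2 * (j + 2 + i) - 2 * (j + 1)) (by omega) (by omega),
    key i (j + 2) (j + 2) i (2 * (j + 2)) (2 * (j + 2 + i) - 2 * (j + 2)) (by omega) (by omega)]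
    at h
  linarith

end Transfer

/-! ### Ising models with couplings along fixed directions of a finite abelian group -/

section GroupIsing

variable {V ι : Type*} [AddCommGroup V] [Fintype V] [DecidableEq V] [Fintype ι] [DecidableEq ι]

/-- The spin at `v`, as a real character of the group of configurations. -/
def spinHom (v : V) : (V → ℤˣ) →* ℝ where
  toFun s := ((s v : ℤ) : ℝ)
  map_one' := by simp
  map_mul' s t := by simp

@[simp] lemma spinHom_apply (v : V) (s : V → ℤˣ) : spinHom v s = ((s v : ℤ) : ℝ) := rfl

lemma config_mul_self (s : V → ℤˣ) : s * s = 1 := by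
  funext v; exact Int.units_mul_self (s v)

lemma spinHom_mul_self (v : V) : spinHom v * spinHom v = 1 := by
  refine MonoidHom.ext fun s => ?_
  rw [MonoidHom.mul_apply, ← map_mul, config_mul_self, map_one]; rfl

/-- The product of the spins at the ends of the bond from `e.1` to `e.1 + D e.2`. -/
def bondHom (D : ι → V) (e : V × ι) : (V → ℤˣ) →* ℝ := spinHom e.1 * spinHom (e.1 + D e.2)

/-- Two-point function of the Ising model with general bond couplings. -/
def bondCorr (D : ι → V) (J : V × ι → ℝ) (u v : V) : ℝ :=
  gibbsAvg (bondHom D) J (spinHom u * spinHom v : (V → ℤˣ) →* ℝ)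

/-- Two-point function of the Ising model with translation invariant couplings. -/
def pairCorr (D : ι → V) (K : ι → ℝ) (u v : V) : ℝ := bondCorr D (fun e => K e.2) u v

lemma bondCorr_comm (D : ι → V) (J : V × ι → ℝ) (u v : V) :
    bondCorr D J u v = bondCorr D J v u := by
  unfold bondCorr; rw [mul_comm]

lemma bondCorr_self (D : ι → V) (J : V × ι → ℝ) (u : V) : bondCorr D J u u = 1 := by
  unfold bondCorr; rw [spinHom_mul_self]; exact gibbsAvg_one _ _

lemma bondCorr_nonneg (D : ι → V) {J : V × ι → ℝ} (hJ : ∀ e, 0 ≤ J e) (u v : V) :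
    0 ≤ bondCorr D J u v := gibbsAvg_char_nonneg config_mul_self _ hJ _

lemma bondCorr_le_one (D : ι → V) (J : V × ι → ℝ) (u v : V) :
    bondCorr D J u v ≤ 1 := gibbsAvg_char_le_one config_mul_self _ _ _

lemma bondCorr_mono (D : ι → V) {J J' : V × ι → ℝ} (hJ : ∀ e, 0 ≤ J e) (h : ∀ e, J e ≤ J' e)
    (u v : V) : bondCorr D J u v ≤ bondCorr D J' u v :=
  gibbsAvg_le_of_le config_mul_self _ hJ h _

lemma bondCorr_mul_le (D : ι → V) {J : V × ι → ℝ} (hJ : ∀ e, 0 ≤ J e) (u v w : V) :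
    bondCorr D J u v * bondCorr D J v w ≤ bondCorr D J u w := by
  have h := gibbsAvg_mul_le config_mul_self (bondHom D) hJ (spinHom u * spinHom v)
    (spinHom v * spinHom w)
  have e : spinHom u * spinHom v * (spinHom v * spinHom w) = spinHom u * spinHom w := by
    rw [mul_assoc, ← mul_assoc (spinHom v), spinHom_mul_self, one_mul]
  rwa [e] at h

/-- The couplings `J`, with the bonds in `F` removed. -/
def cutBonds (J : V × ι → ℝ) (F : Finset (V × ι)) (e : V × ι) : ℝ := if e ∈ F then 0 else J e

lemma cutBonds_nonneg {J : V × ι → ℝ} (hJ : ∀ e, 0 ≤ J e) (F : Finset (V × ι)) (e : V × ι) :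
    0 ≤ cutBonds J F e := by
  unfold cutBonds; split_ifs
  · exact le_rfl
  · exact hJ e

lemma cutBonds_anti {J : V × ι → ℝ} (hJ : ∀ e, 0 ≤ J e) {F F' : Finset (V × ι)} (h : F ⊆ F')
    (e : V × ι) : cutBonds J F' e ≤ cutBonds J F e := by
  unfold cutBonds
  by_cases h1 : e ∈ F
  · simp [h1, h h1]
  · by_cases h2 : e ∈ F'
    · simp [h1, h2, hJ]
    · simp [h1, h2]

lemma bondCorr_cut_anti (D : ι → V) {J : V × ι → ℝ} (hJ : ∀ e, 0 ≤ J e)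
    {F F' : Finset (V × ι)} (h : F ⊆ F') (u v : V) :
    bondCorr D (cutBonds J F') u v ≤ bondCorr D (cutBonds J F) u v :=
  bondCorr_mono D (cutBonds_nonneg hJ F') (cutBonds_anti hJ h) u v

lemma bondCorr_cut_le (D : ι → V) {J : V × ι → ℝ} (hJ : ∀ e, 0 ≤ J e)
    (F : Finset (V × ι)) (u v : V) :
    bondCorr D (cutBonds J F) u v ≤ bondCorr D J u v := by
  refine bondCorr_mono D (cutBonds_nonneg hJ F) (fun e => ?_) u v
  unfold cutBonds; split_ifs
  · exact hJ e
  · exact le_rfl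

/-- Restoring the bond between `p` and `q` multiplies the spins at `p` and `x` by those at `p` and
`q`, which leaves the pair `q`, `x`: a walk from `p` makes one step. -/
lemma bondCorr_cut_insert (D : ι → V) {J : V × ι → ℝ} (hJ : ∀ e, 0 ≤ J e)
    (F : Finset (V × ι)) {e : V × ι} {p q : V} (he : bondHom D e = spinHom p * spinHom q) (x : V) :
    bondCorr D (cutBonds J F) p x ≤ bondCorr D (cutBonds J (insert e F)) p x +
      Real.tanh (J e) * bondCorr D (cutBonds J (insert e F)) q x := by
  by_cases h : e ∈ F
  · rw [Finset.insert_eq_of_mem h]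
    have := mul_nonneg (tanh_nonneg_of_nonneg (hJ e))
      (bondCorr_nonneg D (cutBonds_nonneg hJ F) q x)
    linarith
  · have h1 : cutBonds J F = cutBonds J (insert e F) + Pi.single e (J e) := by
      funext e'
      by_cases h2 : e' = e
      · subst h2; simp [cutBonds, h]
      · simp [cutBonds, h2]
    have h2 := gibbsAvg_add_single_le config_mul_self (bondHom D)
      (cutBonds_nonneg hJ (insert e F)) e (hJ e) (spinHom p * spinHom x)
    have e1 : spinHom p * spinHom x * bondHom D e = spinHom q * spinHom x := by
      rw [he, mul_comm (spinHom p) (spinHom x), mul_assoc, ← mul_assoc (spinHom p),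
        spinHom_mul_self, one_mul, mul_comm]
    rw [e1, ← h1] at h2
    exact h2

/-- The correlation after each step is bounded by the one with all bonds present, so the order in
which the bonds are cut does not matter. -/
lemma bondCorr_cut_union (D : ι → V) {J : V × ι → ℝ} (hJ : ∀ e, 0 ≤ J e)
    {A : Type*} (T : Finset A) (ε : A → V × ι) (q : A → V) {p : V}
    (hε : ∀ a ∈ T, bondHom D (ε a) = spinHom p * spinHom (q a)) (F : Finset (V × ι)) (x : V) :
    bondCorr D (cutBonds J F) p x ≤ bondCorr D (cutBonds J (T.image ε ∪ F)) p x +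
      ∑ a ∈ T, Real.tanh (J (ε a)) * bondCorr D J (q a) x := by
  classical
  induction T using Finset.induction_on with
  | empty => simp
  | insert a T ha ih =>
    have h1 := ih fun b hb => hε b (Finset.mem_insert_of_mem hb)
    have h2 := bondCorr_cut_insert D hJ (T.image ε ∪ F) (hε a (Finset.mem_insert_self a T)) x
    have h3 := mul_le_mul_of_nonneg_left
      (bondCorr_cut_le D hJ (insert (ε a) (T.image ε ∪ F)) (q a) x)
      (tanh_nonneg_of_nonneg (hJ (ε a)))
    rw [Finset.sum_insert ha, Finset.image_insert, Finset.insert_union]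
    linarith

/-- Flipping the spin at `p` alone preserves the energy and changes the sign of the correlation. -/
lemma bondCorr_isolated (D : ι → V) {J : V × ι → ℝ} {p : V}
    (hJ : ∀ e, (e.1 = p ∨ e.1 + D e.2 = p) → J e = 0) (x : V) :
    bondCorr D J p x ≤ if x = p then 1 else 0 := by
  by_cases hx : x = p
  · rw [if_pos hx]; exact bondCorr_le_one D J p x
  · rw [if_neg hx]
    let f : V → ℤˣ := Function.update 1 p (-1)
    have h1 := gibbsAvg_comp_equiv (bondHom D) J (Equiv.mulLeft f) (by
      intro s
      refine Finset.sum_congr rfl fun e _ => ?_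
      by_cases h : e.1 = p ∨ e.1 + D e.2 = p
      · rw [hJ e h]; ring
      · push Not at h
        simp [bondHom, f, h.1, h.2]) (spinHom p * spinHom x : (V → ℤˣ) →* ℝ)
    have h2 : (fun s => (spinHom p * spinHom x : (V → ℤˣ) →* ℝ) ((Equiv.mulLeft f) s)) =
        fun s => (-1) * (spinHom p * spinHom x : (V → ℤˣ) →* ℝ) s := by
      funext s
      simp [f, hx]
    rw [h2, gibbsAvg_const_mul] at h1
    have : bondCorr D J p x = gibbsAvg (bondHom D) J (spinHom p * spinHom x : (V → ℤˣ) →* ℝ) := rfl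
    linarith

/-- High-temperature bound: one direction `i₀` has an arbitrary coupling. -/
lemma sum_bondCorr_high_temperature (D : ι → V) {K : ι → ℝ} (hK : ∀ i, 0 ≤ K i) (i₀ : ι)
    {X : ℝ} (hX : ∀ p, ∑ x, pairCorr D K p x = X) :
    (1 - Real.tanh (K i₀)) * X ≤ (1 + Real.tanh (K i₀)) *
      (1 + 2 * (∑ i ∈ Finset.univ.erase i₀, Real.tanh (K i)) * X) := by
  classical
  set J : V × ι → ℝ := fun e => K e.2
  have hJ : ∀ e, 0 ≤ J e := fun e => hK _
  set r := Real.tanh (K i₀)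
  have hr0 : 0 ≤ r := tanh_nonneg_of_nonneg (hK i₀)
  have hr1 : r < 1 := Real.tanh_lt_one _
  set τ := ∑ i ∈ Finset.univ.erase i₀, Real.tanh (K i)
  set a : ℝ := 1 + 2 * τ * X
  have hup : ∀ p, bondHom D (p, i₀) = spinHom p * spinHom (p + D i₀) := fun p => rfl
  have hdown : ∀ p, bondHom D (p - D i₀, i₀) = spinHom p * spinHom (p - D i₀) := fun p => by
    simp only [bondHom, sub_add_cancel]; rw [mul_comm]
  -- The coupling in direction `i₀` need not be small, so repeated steps along it are summed as a
  -- geometric series. With both of its bonds at `p` cut, only the two bonds at `p` in each other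
  -- direction are left; this gives `a = 1 + 2 τ X`.
  let both : V → Finset (V × ι) := fun p => {(p, i₀), (p - D i₀, i₀)}
  have hiso : ∀ p, ∑ x, bondCorr D (cutBonds J (both p)) p x ≤ a := by
    intro p
    let T : Finset (ι × Bool) := (Finset.univ.erase i₀) ×ˢ Finset.univ
    let ε : ι × Bool → V × ι := fun b => if b.2 then (p, b.1) else (p - D b.1, b.1)
    let q : ι × Bool → V := fun b => if b.2 then p + D b.1 else p - D b.1
    have hε : ∀ b ∈ T, bondHom D (ε b) = spinHom p * spinHom (q b) := by
      rintro ⟨i, b⟩ _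
      cases b
      · simp only [ε, q, bondHom, Bool.false_eq_true, if_false, sub_add_cancel]; rw [mul_comm]
      · simp only [ε, q, bondHom, if_true]
    have h1 : ∀ x, bondCorr D (cutBonds J (both p)) p x ≤ (if x = p then 1 else 0) +
        ∑ b ∈ T, Real.tanh (J (ε b)) * bondCorr D J (q b) x := by
      intro x
      refine (bondCorr_cut_union D hJ T ε q hε (both p) x).trans ?_
      gcongr
      refine bondCorr_isolated D (fun e he => ?_) x
      unfold cutBonds
      rw [if_pos]
      obtain ⟨v, i⟩ := e
      rw [Finset.mem_union]
      by_cases hi : i = i₀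
      · subst hi
        right
        rcases he with he | he
        · simp only at he; simp [both, he]
        · simp only at he; simp [both, ← he]
      · left
        rw [Finset.mem_image]
        rcases he with he | he
        · simp only at he
          exact ⟨(i, true), by simp [T, hi], by simp [ε, he]⟩
        · simp only at he
          exact ⟨(i, false), by simp [T, hi], by simp [ε, ← he]⟩
    refine (Finset.sum_le_sum fun x _ => h1 x).trans (le_of_eq ?_)
    rw [Finset.sum_add_distrib, Finset.sum_comm]
    have h2 : ∀ b ∈ T, ∑ x, Real.tanh (J (ε b)) * bondCorr D J (q b) x = Real.tanh (K b.1) * X := by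
      rintro ⟨i, b⟩ _
      rw [← Finset.mul_sum, ← hX (q (i, b))]
      cases b <;> rfl
    rw [Finset.sum_congr rfl h2]
    simp only [T, Finset.sum_product, Finset.sum_ite_eq', Finset.mem_univ, if_true, Finset.sum_const,
      Finset.card_univ, Fintype.card_bool, nsmul_eq_mul, a, τ, ← Finset.mul_sum, ← Finset.sum_mul]
    push_cast; ring
  -- A walk that has just moved along `i₀` does not return over the same bond, which stays cut: `P`
  -- continues forward and `Q` backward. Each satisfies a recursion with ratio `r < 1`, whence a
  -- bound by a/(1 - r) at its maximum.
  let P : V → ℝ := fun p => ∑ x, bondCorr D (cutBonds J {(p - D i₀, i₀)}) p x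
  let Q : V → ℝ := fun p => ∑ x, bondCorr D (cutBonds J {(p, i₀)}) p x
  have hP : ∀ p, P p ≤ a + r * P (p + D i₀) := by
    intro p
    refine le_trans ?_ (add_le_add_left (hiso p) _)
    simp only [P, Finset.mul_sum]
    rw [← Finset.sum_add_distrib]
    refine Finset.sum_le_sum fun x _ => ?_
    refine (bondCorr_cut_insert D hJ {(p - D i₀, i₀)} (hup p) x).trans ?_
    gcongr
    refine bondCorr_cut_anti D hJ ?_ _ _
    simp
  have hQ : ∀ p, Q p ≤ a + r * Q (p - D i₀) := by
    intro p
    refine le_trans ?_ (add_le_add_left (hiso p) _)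
    simp only [Q, Finset.mul_sum]
    rw [← Finset.sum_add_distrib]
    refine Finset.sum_le_sum fun x _ => ?_
    refine (bondCorr_cut_insert D hJ {(p, i₀)} (hdown p) x).trans ?_
    gcongr
    · refine bondCorr_cut_anti D hJ ?_ _ _
      simp [both, Finset.subset_iff, or_comm]
    · refine bondCorr_cut_anti D hJ ?_ _ _
      simp
  obtain ⟨p₁, -, hp₁⟩ := Finset.exists_max_image Finset.univ P ⟨0, Finset.mem_univ _⟩
  obtain ⟨p₂, -, hp₂⟩ := Finset.exists_max_image Finset.univ Q ⟨0, Finset.mem_univ _⟩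
  have hPmax : ∀ p, P p * (1 - r) ≤ a := by
    intro p
    have h1 := hP p₁
    have h2 := hp₁ (p₁ + D i₀) (Finset.mem_univ _)
    have h3 := hp₁ p (Finset.mem_univ _)
    nlinarith
  have hQmax : ∀ p, Q p * (1 - r) ≤ a := by
    intro p
    have h1 := hQ p₂
    have h2 := hp₂ (p₂ - D i₀) (Finset.mem_univ _)
    have h3 := hp₂ p (Finset.mem_univ _)
    nlinarith
  -- From the origin the walk turns aside, goes forward or goes backward. With P and Q at most a/(1
  -- - r) this gives (1 - r) X ≤ (1 + r) a.
  have hmain : X ≤ a + r * P (0 + D i₀) + r * Q (0 - D i₀) := by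
    rw [← hX 0]
    have h1 : ∀ x, pairCorr D K 0 x ≤ bondCorr D (cutBonds J (both 0)) 0 x +
        r * bondCorr D (cutBonds J {(0 + D i₀ - D i₀, i₀)}) (0 + D i₀) x +
        r * bondCorr D (cutBonds J {(0 - D i₀, i₀)}) (0 - D i₀) x := by
      intro x
      have e0 : pairCorr D K 0 x = bondCorr D (cutBonds J ∅) 0 x := by
        unfold pairCorr; congr 1
      have e1 := bondCorr_cut_insert D hJ ∅ (hup 0) x
      have e2 := bondCorr_cut_insert D hJ (insert (0, i₀) ∅) (hdown 0) x
      have e3 : bondCorr D (cutBonds J (insert (0 - D i₀, i₀) (insert (0, i₀) ∅))) (0 - D i₀) x ≤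
          bondCorr D (cutBonds J {(0 - D i₀, i₀)}) (0 - D i₀) x :=
        bondCorr_cut_anti D hJ (by simp) _ _
      have e4 : bondCorr D (cutBonds J (insert (0 - D i₀, i₀) (insert (0, i₀) ∅))) 0 x ≤
          bondCorr D (cutBonds J (both 0)) 0 x :=
        bondCorr_cut_anti D hJ (by simp [both, Finset.subset_iff, or_comm]) _ _
      have e5 : bondCorr D (cutBonds J (insert (0, i₀) ∅)) (0 + D i₀) x ≤
          bondCorr D (cutBonds J {(0 + D i₀ - D i₀, i₀)}) (0 + D i₀) x :=
        bondCorr_cut_anti D hJ (by simp) _ _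
      have e6 := mul_le_mul_of_nonneg_left e3 hr0
      have e7 := mul_le_mul_of_nonneg_left e5 hr0
      simp only [J] at e1 e2 e6 e7 ⊢
      linarith
    refine (Finset.sum_le_sum fun x _ => h1 x).trans ?_
    rw [Finset.sum_add_distrib, Finset.sum_add_distrib, ← Finset.mul_sum, ← Finset.mul_sum]
    have := hiso 0
    gcongr
  have h1 := hPmax (0 + D i₀)
  have h2 := hQmax (0 - D i₀)
  have h3 : 0 ≤ 1 - r := by linarith
  have h4 := mul_le_mul_of_nonneg_right hmain h3
  nlinarith

lemma pairCorr_comp_equiv (D : ι → V) (K : ι → ℝ) (θ : V ≃ V)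
    (h : ∀ (s : V → ℤˣ), ∑ e : V × ι, K e.2 * bondHom D e (s ∘ θ) =
      ∑ e : V × ι, K e.2 * bondHom D e s) (u v : V) :
    pairCorr D K (θ u) (θ v) = pairCorr D K u v :=
  gibbsAvg_comp_equiv (bondHom D) (fun e => K e.2) (Equiv.arrowCongr θ.symm (Equiv.refl _)) h
    (spinHom u * spinHom v : (V → ℤˣ) →* ℝ)

lemma pairCorr_add_right (D : ι → V) (K : ι → ℝ) (a u v : V) :
    pairCorr D K (u + a) (v + a) = pairCorr D K u v := by
  refine pairCorr_comp_equiv D K (Equiv.addRight a) (fun s => ?_) u v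
  rw [← Equiv.sum_comp ((Equiv.addRight a).prodCongr (Equiv.refl ι))
    (fun e : V × ι => K e.2 * bondHom D e s)]
  refine Finset.sum_congr rfl fun e _ => ?_
  simp only [bondHom, MonoidHom.mul_apply, spinHom_apply, Function.comp_apply, Equiv.coe_addRight,
    Equiv.prodCongr_apply, Prod.map, Equiv.coe_refl, id]
  rw [add_right_comm]

lemma pairCorr_eq_zero_sub (D : ι → V) (K : ι → ℝ) (u v : V) :
    pairCorr D K u v = pairCorr D K 0 (v - u) := by
  rw [← pairCorr_add_right D K u 0 (v - u), zero_add, sub_add_cancel]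

lemma sum_pairCorr (D : ι → V) (K : ι → ℝ) (p : V) :
    ∑ x, pairCorr D K p x = ∑ x, pairCorr D K 0 x := by
  rw [← Equiv.sum_comp (Equiv.addRight p) (fun x => pairCorr D K p x)]
  refine Finset.sum_congr rfl fun x _ => ?_
  rw [Equiv.coe_addRight, pairCorr_eq_zero_sub, add_sub_cancel_right]

lemma pairCorr_comm (D : ι → V) (K : ι → ℝ) (u v : V) : pairCorr D K u v = pairCorr D K v u :=
  bondCorr_comm D _ u v

lemma tanh_le_pairCorr (D : ι → V) {K : ι → ℝ} (hK : ∀ i, 0 ≤ K i) (i : ι) (v : V) :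
    Real.tanh (K i) ≤ pairCorr D K v (v + D i) :=
  tanh_le_gibbsAvg config_mul_self (bondHom D) (J := fun e : V × ι => K e.2) (fun _ => hK _) (v, i)

end GroupIsing

/-! ### The Ising model on the discretized space–time torus -/

section Grid

variable {d : ℕ} {N : ℕ+} {M : ℕ} [NeZero M]

/-- The discretized space–time torus. -/
abbrev Grid (d : ℕ) (N : ℕ+) (M : ℕ) : Type := Torus d N × ZMod M

/-- The bond directions: the time direction and the `d` directions of space. -/
def gridDir : Option (Fin d) → Grid d N M
  | none => (0, 1)
  | some i => (Pi.single i 1, 0)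

/-- The couplings: `jt` in the time direction and `js` in the directions of space. -/
def gridCoupling (jt js : ℝ) : Option (Fin d) → ℝ
  | none => jt
  | some _ => js

/-- The two-point function of the Ising model on the discretized space–time torus. -/
def gridCorr (jt js : ℝ) (x : Torus d N) (j : ZMod M) : ℝ :=
  pairCorr (gridDir (d := d) (N := N) (M := M)) (gridCoupling jt js) 0 (x, j)

/-- Expectation in the Ising model on the discretized space–time torus. -/
def gridAvg (jt js : ℝ) (f : (Grid d N M → ℤˣ) → ℝ) : ℝ :=
  gibbsAvg (bondHom (gridDir (d := d) (N := N) (M := M))) (fun e => gridCoupling jt js e.2) f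

/-- The energy of a configuration. -/
def gridEnergy (jt js : ℝ) (s : Grid d N M → ℤˣ) : ℝ :=
  jt * ∑ x, ∑ j, ((s (x, j) : ℤ) : ℝ) * ((s (x, j + 1) : ℤ) : ℝ) +
    js * ∑ x, ∑ i, ∑ j, ((s (x, j) : ℤ) : ℝ) * ((s (x + Pi.single i 1, j) : ℤ) : ℝ)

lemma sum_gridCoupling_mul (jt js : ℝ) (s : Grid d N M → ℤˣ) :
    ∑ e : Grid d N M × Option (Fin d), gridCoupling jt js e.2 * bondHom gridDir e s =
      gridEnergy jt js s := by
  rw [Fintype.sum_prod_type, Fintype.sum_prod_type]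
  simp only [Fintype.sum_option, gridCoupling, bondHom, gridDir, MonoidHom.mul_apply, spinHom_apply,
    Prod.mk_add_mk, add_zero, Finset.sum_add_distrib, Finset.mul_sum, gridEnergy]
  congr 1
  exact Finset.sum_congr rfl fun x _ => Finset.sum_comm

lemma gridCoupling_nonneg {jt js : ℝ} (ht : 0 ≤ jt) (hs : 0 ≤ js) (i : Option (Fin d)) :
    0 ≤ gridCoupling jt js i := by
  cases i <;> assumption

lemma gridCorr_nonneg {jt js : ℝ} (ht : 0 ≤ jt) (hs : 0 ≤ js) (x : Torus d N) (j : ZMod M) :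
    0 ≤ gridCorr jt js x j :=
  bondCorr_nonneg _ (fun _ => gridCoupling_nonneg ht hs _) _ _

lemma gridCorr_le_one (jt js : ℝ) (x : Torus d N) (j : ZMod M) : gridCorr jt js x j ≤ 1 :=
  bondCorr_le_one _ _ _ _

lemma gridCorr_zero (jt js : ℝ) : gridCorr jt js (0 : Torus d N) (0 : ZMod M) = 1 :=
  bondCorr_self _ _ _

lemma gridCorr_mono {jt js js' : ℝ} (ht : 0 ≤ jt) (hs : 0 ≤ js) (h : js ≤ js') (x : Torus d N)
    (j : ZMod M) : gridCorr jt js x j ≤ gridCorr jt js' x j := by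
  refine bondCorr_mono _ (fun _ => gridCoupling_nonneg ht hs _) (fun e => ?_) _ _
  cases e.2
  · exact le_rfl
  · exact h

/-- Griffiths' second inequality, with the lower bound tanh for neighbours in time. It is the source
of the Harnack inequality. -/
lemma tanh_mul_gridCorr_le {jt js : ℝ} (ht : 0 ≤ jt) (hs : 0 ≤ js) (x : Torus d N) (j : ZMod M) :
    Real.tanh jt * gridCorr jt js x j ≤ gridCorr jt js x (j + 1) := by
  have hK := gridCoupling_nonneg (d := d) ht hs
  have h1 := bondCorr_mul_le (gridDir (d := d) (N := N) (M := M))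
    (J := fun e => gridCoupling jt js e.2) (fun _ => hK _) 0 (x, j) (x, j + 1)
  have h2 := tanh_le_pairCorr (gridDir (d := d) (N := N) (M := M)) hK none (x, j)
  simp only [gridDir, Prod.mk_add_mk, add_zero, gridCoupling] at h2
  have h3 := mul_le_mul_of_nonneg_right h2 (gridCorr_nonneg ht hs x j)
  refine h3.trans ?_
  rw [mul_comm]
  exact h1

lemma tanh_pow_mul_gridCorr_le {jt js : ℝ} (ht : 0 ≤ jt) (hs : 0 ≤ js) (x : Torus d N) (j : ZMod M)
    (k : ℕ) : Real.tanh jt ^ k * gridCorr jt js x j ≤ gridCorr jt js x (j + (k : ZMod M)) := by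
  induction k with
  | zero => simp
  | succ k ih =>
    have h1 := mul_le_mul_of_nonneg_left ih (tanh_nonneg_of_nonneg ht)
    have h2 := tanh_mul_gridCorr_le ht hs x (j + (k : ZMod M))
    rw [pow_succ', mul_assoc]
    refine (h1.trans h2).trans (le_of_eq ?_)
    push_cast
    rw [add_assoc]

lemma gridCorr_neg_neg (jt js : ℝ) (x : Torus d N) (j : ZMod M) :
    gridCorr jt js (-x) (-j) = gridCorr jt js x j := by
  unfold gridCorr
  rw [pairCorr_comm, pairCorr_eq_zero_sub]
  simp

lemma gridCorr_neg_left (jt js : ℝ) (x : Torus d N) (j : ZMod M) :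
    gridCorr jt js (-x) j = gridCorr jt js x j := by
  let θ : Grid d N M ≃ Grid d N M := (Equiv.neg (Torus d N)).prodCongr (Equiv.refl _)
  have h := pairCorr_comp_equiv (gridDir (d := d) (N := N) (M := M)) (gridCoupling jt js) θ
    (fun s => ?_) 0 (x, j)
  · have h0 : θ 0 = 0 := by simp [θ, Prod.ext_iff]
    rw [h0] at h
    exact h
  · rw [sum_gridCoupling_mul, sum_gridCoupling_mul]
    unfold gridEnergy
    congr 2
    · exact Equiv.sum_comp (Equiv.neg (Torus d N))
        (fun x => ∑ j, ((s (x, j) : ℤ) : ℝ) * ((s (x, j + 1) : ℤ) : ℝ))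
    · rw [Finset.sum_comm]
      conv_rhs => rw [Finset.sum_comm]
      refine Finset.sum_congr rfl fun i _ => ?_
      -- Reflection sends the bond from `x` to `x + e_i` to the one starting at `-x - e_i`, hence
      -- the extra shift.
      refine Eq.trans ?_ (Equiv.sum_comp
        ((Equiv.neg (Torus d N)).trans (Equiv.subRight (Pi.single i 1)))
        (fun x => ∑ j, ((s (x, j) : ℤ) : ℝ) * ((s (x + Pi.single i 1, j) : ℤ) : ℝ)))
      refine Finset.sum_congr rfl fun x _ => Finset.sum_congr rfl fun j _ => ?_
      simp only [θ, Function.comp_apply, Equiv.prodCongr_apply, Prod.map, Equiv.neg_apply,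
        Equiv.coe_refl, id, Equiv.trans_apply, Equiv.subRight_apply, sub_add_cancel, neg_add]
      rw [mul_comm, sub_eq_add_neg]

lemma gridCorr_neg_right (jt js : ℝ) (x : Torus d N) (j : ZMod M) :
    gridCorr jt js x (-j) = gridCorr jt js x j := by
  rw [← gridCorr_neg_left, gridCorr_neg_neg]

lemma gridAvg_mul_spin (jt js : ℝ) (u v : Grid d N M) :
    gridAvg jt js (fun s => ((s u : ℤ) : ℝ) * ((s v : ℤ) : ℝ)) =
      gridCorr jt js (v.1 - u.1) (v.2 - u.2) :=
  pairCorr_eq_zero_sub _ _ u v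

lemma sum_gridCorr_high_temperature {jt js : ℝ} (ht : 0 ≤ jt) (hs : 0 ≤ js) :
    (1 - Real.tanh jt) * ∑ x : Torus d N, ∑ j : ZMod M, gridCorr jt js x j ≤
      (1 + Real.tanh jt) * (1 + 2 * (d * Real.tanh js) *
        ∑ x : Torus d N, ∑ j : ZMod M, gridCorr jt js x j) := by
  have h := sum_bondCorr_high_temperature (gridDir (d := d) (N := N) (M := M))
    (gridCoupling_nonneg (d := d) ht hs) none (fun p => sum_pairCorr _ _ p)
  have e1 : ∑ i ∈ Finset.univ.erase none, Real.tanh (gridCoupling (d := d) jt js i) =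
      d * Real.tanh js := by
    have h2 := Finset.add_sum_erase Finset.univ
      (fun i => Real.tanh (gridCoupling (d := d) jt js i)) (Finset.mem_univ none)
    rw [Fintype.sum_option] at h2
    have h3 := add_left_cancel h2
    rw [h3]
    simp [gridCoupling]
  have e2 : ∑ v : Grid d N M, pairCorr gridDir (gridCoupling jt js) 0 v =
      ∑ x : Torus d N, ∑ j : ZMod M, gridCorr jt js x j := Fintype.sum_prod_type _
  rw [e1, e2] at h
  exact h

/-! #### Quadratic forms and characters -/

/-- Fourier coefficient, over space, of a function on the torus. -/
def cosTransform (ψ : AddChar (Torus d N) ℂ) (γ : Torus d N → ℝ) : ℝ := ∑ x, (ψ x).re * γ x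

lemma char_re_sub (ψ : AddChar (Torus d N) ℂ) (x y : Torus d N) :
    (ψ x).re * (ψ y).re + (ψ x).im * (ψ y).im = (ψ (y - x)).re := by
  rw [sub_eq_add_neg, AddChar.map_add_eq_mul, AddChar.map_neg_eq_conj, Complex.mul_re,
    Complex.conj_re, Complex.conj_im]
  ring

lemma char_re_sq_add (ψ : AddChar (Torus d N) ℂ) (x : Torus d N) :
    (ψ x).re ^ 2 + (ψ x).im ^ 2 = 1 := by
  have := char_re_sub ψ x x
  rw [sub_self, AddChar.map_zero_eq_one, Complex.one_re] at this
  nlinarith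

/-- The real and imaginary parts of a character together diagonalize a translation invariant form,
so all test functions can be kept real. -/
lemma sum_char_mul_eq (ψ : AddChar (Torus d N) ℂ) (γ : Torus d N → ℝ) :
    ∑ x, ∑ y, (ψ x).re * (ψ y).re * γ (y - x) + ∑ x, ∑ y, (ψ x).im * (ψ y).im * γ (y - x) =
      Fintype.card (Torus d N) * cosTransform ψ γ := by
  rw [← Finset.sum_add_distrib]
  have : ∀ x, ∑ y, (ψ x).re * (ψ y).re * γ (y - x) + ∑ y, (ψ x).im * (ψ y).im * γ (y - x) =
      cosTransform ψ γ := by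
    intro x
    rw [← Finset.sum_add_distrib, cosTransform]
    refine Eq.trans ?_ (Equiv.sum_comp (Equiv.subRight x) fun y => (ψ y).re * γ y)
    refine Finset.sum_congr rfl fun y _ => ?_
    rw [Equiv.subRight_apply, ← char_re_sub]
    ring
  rw [Finset.sum_congr rfl fun x _ => this x]
  simp

/-- Real linear combination of the spins at a given time. -/
def sliceSum (h : Torus d N → ℝ) (j : ZMod M) (s : Grid d N M → ℤˣ) : ℝ :=
  ∑ x, h x * ((s (x, j) : ℤ) : ℝ)

lemma gridAvg_sum {ι : Type*} (jt js : ℝ) (t : Finset ι) (f : ι → (Grid d N M → ℤˣ) → ℝ) :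
    gridAvg jt js (fun s => ∑ i ∈ t, f i s) = ∑ i ∈ t, gridAvg jt js (f i) :=
  gibbsAvg_sum _ _ _ _

lemma gridAvg_const_mul (jt js c : ℝ) (f : (Grid d N M → ℤˣ) → ℝ) :
    gridAvg jt js (fun s => c * f s) = c * gridAvg jt js f := gibbsAvg_const_mul _ _ _ _

lemma gridAvg_mono (jt js : ℝ) {f g : (Grid d N M → ℤˣ) → ℝ} (h : ∀ s, f s ≤ g s) :
    gridAvg jt js f ≤ gridAvg jt js g := gibbsAvg_mono _ _ h

lemma gridAvg_sliceSum_mul (jt js : ℝ) (h : Torus d N → ℝ) (i j : ZMod M) :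
    gridAvg jt js (fun s => sliceSum h i s * sliceSum h j s) =
      ∑ x, ∑ y, h x * h y * gridCorr jt js (y - x) (j - i) := by
  have : (fun s : Grid d N M → ℤˣ => sliceSum h i s * sliceSum h j s) =
      fun s => ∑ x, ∑ y, (h x * h y) * (((s (x, i) : ℤ) : ℝ) * ((s (y, j) : ℤ) : ℝ)) := by
    funext s
    unfold sliceSum
    rw [Finset.sum_mul_sum]
    exact Finset.sum_congr rfl fun x _ => Finset.sum_congr rfl fun y _ => by ring
  rw [this, gridAvg_sum]
  refine Finset.sum_congr rfl fun x _ => ?_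
  rw [gridAvg_sum]
  refine Finset.sum_congr rfl fun y _ => ?_
  rw [gridAvg_const_mul, gridAvg_mul_spin]

/-- Fourier coefficient of the two-point function at a given time. -/
def gridMode (jt js : ℝ) (ψ : AddChar (Torus d N) ℂ) (j : ZMod M) : ℝ :=
  cosTransform ψ fun x => gridCorr jt js x j

/-- Through this identity, positivity and convexity of correlations of slice sums pass to the
Fourier coefficients. -/
lemma card_mul_gridMode (jt js : ℝ) (ψ : AddChar (Torus d N) ℂ) (i j : ZMod M) :
    Fintype.card (Torus d N) * gridMode jt js ψ (j - i) =
      gridAvg jt js (fun s => sliceSum (fun x => (ψ x).re) i s * sliceSum (fun x => (ψ x).re) j s) +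
      gridAvg jt js
        (fun s => sliceSum (fun x => (ψ x).im) i s * sliceSum (fun x => (ψ x).im) j s) := by
  rw [gridAvg_sliceSum_mul, gridAvg_sliceSum_mul]
  exact (sum_char_mul_eq ψ fun x => gridCorr jt js x (j - i)).symm

lemma card_torus_pos : (0 : ℝ) < Fintype.card (Torus d N) := by
  exact_mod_cast Fintype.card_pos

/-- By 2ab ≤ a² + b² and stationarity in time. -/
lemma gridMode_le (jt js : ℝ) (ψ : AddChar (Torus d N) ℂ) (j : ZMod M) :
    gridMode jt js ψ j ≤ gridMode jt js ψ (0 : ZMod M) := by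
  have hc := card_torus_pos (d := d) (N := N)
  refine le_of_mul_le_mul_left ?_ hc
  have key : ∀ h : Torus d N → ℝ, gridAvg jt js (fun s : Grid d N M → ℤˣ =>
      sliceSum h 0 s * sliceSum h j s) ≤
      gridAvg jt js (fun s : Grid d N M → ℤˣ => sliceSum h 0 s * sliceSum h 0 s) := by
    intro h
    have h1 : gridAvg jt js (fun s : Grid d N M → ℤˣ => sliceSum h j s * sliceSum h j s) =
        gridAvg jt js (fun s : Grid d N M → ℤˣ => sliceSum h 0 s * sliceSum h 0 s) := by
      rw [gridAvg_sliceSum_mul, gridAvg_sliceSum_mul, sub_self, sub_self]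
    have h2 : gridAvg jt js (fun s : Grid d N M → ℤˣ => sliceSum h 0 s * sliceSum h j s) ≤
        gridAvg jt js (fun s : Grid d N M → ℤˣ => ∑ k : Bool, (1 / 2) *
          (sliceSum h (if k then 0 else j) s * sliceSum h (if k then 0 else j) s)) := by
      refine gridAvg_mono _ _ fun s => ?_
      simp only [Fintype.sum_bool, if_true, Bool.false_eq_true, if_false]
      nlinarith [sq_nonneg (sliceSum h 0 s - sliceSum h j s)]
    refine h2.trans (le_of_eq ?_)
    rw [gridAvg_sum]
    simp only [gridAvg_const_mul, Fintype.sum_bool, if_true, Bool.false_eq_true, if_false]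
    rw [h1]; ring
  have h1 := card_mul_gridMode jt js ψ (0 : ZMod M) j
  have h2 := card_mul_gridMode jt js ψ (0 : ZMod M) 0
  rw [sub_zero] at h1 h2
  rw [h1, h2]
  exact add_le_add (key _) (key _)

/-! #### Reflection positivity in time -/

/-- Interaction within a time slice. -/
def sliceEnergy (a : Torus d N → ℤˣ) : ℝ :=
  ∑ x, ∑ i, ((a x : ℤ) : ℝ) * ((a (x + Pi.single i 1) : ℤ) : ℝ)

/-- The transfer matrix in the time direction. -/
def transferMatrix (d : ℕ) (N : ℕ+) (jt js : ℝ) : Matrix (Torus d N → ℤˣ) (Torus d N → ℤˣ) ℝ :=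
  Matrix.of fun a b => Real.exp (js / 2 * sliceEnergy a + js / 2 * sliceEnergy b +
    jt * ∑ x, ((a x : ℤ) : ℝ) * ((b x : ℤ) : ℝ))

lemma transferMatrix_transpose (jt js : ℝ) :
    (transferMatrix d N jt js).transpose = transferMatrix d N jt js := by
  ext a b
  simp only [transferMatrix, Matrix.transpose_apply, Matrix.of_apply]
  congr 2
  · ring
  · congr 1
    exact Finset.sum_congr rfl fun x _ => mul_comm _ _

/-- Configurations as functions of time. -/
def timeCurry : (ZMod M → Torus d N → ℤˣ) ≃ (Grid d N M → ℤˣ) where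
  toFun s := fun p => s p.2 p.1
  invFun s := fun j x => s (x, j)
  left_inv _ := rfl
  right_inv _ := rfl

/-- Each slice shares its spatial energy equally between the two adjacent transfer matrices, which
keeps the matrix symmetric. -/
lemma exp_gridEnergy_eq_prod (jt js : ℝ) (s : ZMod M → Torus d N → ℤˣ) :
    Real.exp (gridEnergy jt js (timeCurry s)) = ∏ j, transferMatrix d N jt js (s j) (s (j + 1)) := by
  simp only [transferMatrix, Matrix.of_apply]
  rw [← Real.exp_sum]
  congr 1
  rw [Finset.sum_add_distrib, Finset.sum_add_distrib, ← Finset.mul_sum, ← Finset.mul_sum,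
    ← Finset.mul_sum]
  have h1 : ∑ j, sliceEnergy (s (j + 1)) = ∑ j, sliceEnergy (s j) :=
    Equiv.sum_comp (Equiv.addRight (1 : ZMod M)) fun j => sliceEnergy (s j)
  rw [h1, ← add_mul, add_halves, add_comm]
  unfold gridEnergy sliceEnergy
  congr 2
  · exact Finset.sum_comm
  · rw [Finset.sum_comm (s := (Finset.univ : Finset (ZMod M)))]
    refine Finset.sum_congr rfl fun x _ => ?_
    rw [Finset.sum_comm]
    rfl

lemma gridAvg_mul_partition (jt js : ℝ) (h : Torus d N → ℝ) (k : ℕ) :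
    gridAvg jt js (fun s : Grid d N M → ℤˣ => sliceSum h 0 s * sliceSum h k s) *
      gibbsSum (bondHom (gridDir (d := d) (N := N) (M := M)))
        (fun e => gridCoupling jt js e.2) 1 =
      chainCorr (transferMatrix d N jt js) M (fun a => ∑ x, h x * ((a x : ℤ) : ℝ)) k := by
  unfold gridAvg gibbsAvg
  rw [div_mul_cancel₀ _ (gibbsSum_one_pos _ _).ne']
  unfold gibbsSum chainCorr
  rw [← Equiv.sum_comp timeCurry]
  refine Finset.sum_congr rfl fun s _ => ?_
  rw [sum_gridCoupling_mul, exp_gridEnergy_eq_prod]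
  rfl

lemma gridMode_nonneg (jt js : ℝ) {m : ℕ} [NeZero (2 * m)] (ψ : AddChar (Torus d N) ℂ) {j : ℕ}
    (hj : j ≤ m) : 0 ≤ gridMode jt js ψ ((2 * j : ℕ) : ZMod (2 * m)) := by
  have hc := card_torus_pos (d := d) (N := N)
  refine nonneg_of_mul_nonneg_right ?_ hc
  have h1 := card_mul_gridMode jt js ψ 0 ((2 * j : ℕ) : ZMod (2 * m))
  rw [sub_zero] at h1
  rw [h1]
  have key : ∀ h : Torus d N → ℝ, 0 ≤ gridAvg jt js (fun s : Grid d N (2 * m) → ℤˣ =>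
      sliceSum h 0 s * sliceSum h ((2 * j : ℕ) : ZMod (2 * m)) s) := by
    intro h
    refine nonneg_of_mul_nonneg_left ?_ (gibbsSum_one_pos
      (bondHom (gridDir (d := d) (N := N) (M := 2 * m))) (fun e => gridCoupling jt js e.2))
    rw [gridAvg_mul_partition]
    exact chainCorr_nonneg (transferMatrix_transpose jt js) m _ hj
  exact add_nonneg (key _) (key _)

lemma two_mul_gridMode_le (jt js : ℝ) {m : ℕ} [NeZero (2 * m)] (ψ : AddChar (Torus d N) ℂ) {j : ℕ}
    (hj : j + 2 ≤ m) : 2 * gridMode jt js ψ ((2 * (j + 1) : ℕ) : ZMod (2 * m)) ≤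
      gridMode jt js ψ ((2 * j : ℕ) : ZMod (2 * m)) +
      gridMode jt js ψ ((2 * (j + 2) : ℕ) : ZMod (2 * m)) := by
  have hc := card_torus_pos (d := d) (N := N)
  refine le_of_mul_le_mul_left ?_ hc
  have h1 : ∀ k : ℕ, _ := fun k => card_mul_gridMode jt js ψ 0 (k : ZMod (2 * m))
  simp only [sub_zero] at h1
  rw [mul_left_comm, mul_add (Fintype.card (Torus d N) : ℝ), h1 (2 * (j + 1)), h1 (2 * j),
    h1 (2 * (j + 2))]
  have key : ∀ h : Torus d N → ℝ, 2 * gridAvg jt js (fun s : Grid d N (2 * m) → ℤˣ =>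
      sliceSum h 0 s * sliceSum h ((2 * (j + 1) : ℕ) : ZMod (2 * m)) s) ≤
      gridAvg jt js (fun s : Grid d N (2 * m) → ℤˣ =>
        sliceSum h 0 s * sliceSum h ((2 * j : ℕ) : ZMod (2 * m)) s) +
      gridAvg jt js (fun s : Grid d N (2 * m) → ℤˣ =>
        sliceSum h 0 s * sliceSum h ((2 * (j + 2) : ℕ) : ZMod (2 * m)) s) := by
    intro h
    refine le_of_mul_le_mul_right ?_ (gibbsSum_one_pos
      (bondHom (gridDir (d := d) (N := N) (M := 2 * m))) (fun e => gridCoupling jt js e.2))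
    rw [add_mul, mul_assoc, gridAvg_mul_partition, gridAvg_mul_partition, gridAvg_mul_partition]
    exact two_mul_chainCorr_le (transferMatrix_transpose jt js) m _ hj
  have k1 := key fun x => (ψ x).re
  have k2 := key fun x => (ψ x).im
  linarith

end Grid

/-! ### Reflection positivity in space and the infrared bound for the discrete model -/

section Infrared

variable {d : ℕ} {N : ℕ+} {M : ℕ} [NeZero M]

/-! #### Reflections of the torus -/

/-- Nearest-neighbour couplings of the torus. -/
def torusCoupling (js : ℝ) (x y : Torus d N) : ℝ :=
  js * ∑ i, ((if y = x + Pi.single i 1 then 1 else 0) + if x = y + Pi.single i 1 then 1 else 0)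

lemma torusCoupling_comm (js : ℝ) (x y : Torus d N) :
    torusCoupling js x y = torusCoupling js y x := by
  unfold torusCoupling
  congr 1
  exact Finset.sum_congr rfl fun i _ => add_comm _ _

lemma torusCoupling_nonneg {js : ℝ} (hs : 0 ≤ js) (x y : Torus d N) :
    0 ≤ torusCoupling js x y := by
  unfold torusCoupling
  refine mul_nonneg hs (Finset.sum_nonneg fun i _ => ?_)
  positivity

lemma exists_of_torusCoupling_ne_zero {js : ℝ} {x y : Torus d N} (h : torusCoupling js x y ≠ 0) :
    ∃ i : Fin d, y = x + Pi.single i 1 ∨ x = y + Pi.single i 1 := by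
  by_contra hcon
  push Not at hcon
  apply h
  unfold torusCoupling
  rw [Finset.sum_eq_zero, mul_zero]
  intro i _
  simp [(hcon i).1, (hcon i).2]

lemma sum_torusCoupling_mul (js : ℝ) (x : Torus d N) (F : Torus d N → ℝ) :
    ∑ y, torusCoupling js x y * F y =
      js * ∑ i, (F (x + Pi.single i 1) + F (x - Pi.single i 1)) := by
  unfold torusCoupling
  simp only [mul_assoc, Finset.sum_mul, ← Finset.mul_sum]
  congr 1
  rw [Finset.sum_comm]
  refine Finset.sum_congr rfl fun i _ => ?_
  simp only [add_mul, Finset.sum_add_distrib, ite_mul, one_mul, zero_mul]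
  congr 1
  · simp
  · have : ∀ y : Torus d N, (x = y + Pi.single i 1) ↔ (y = x - Pi.single i 1) := fun y =>
      ⟨fun h => by rw [h]; simp, fun h => by rw [h]; simp⟩
    simp only [this]
    simp

/-- The reflection of the torus in direction `i` which exchanges `a` and `a - 1`. -/
def torusFlip (i : Fin d) (a : ZMod (2 * (N : ℕ))) (x : Torus d N) : Torus d N :=
  Function.update x i (2 * a - 1 - x i)

lemma torusFlip_flip (i : Fin d) (a : ZMod (2 * (N : ℕ))) (x : Torus d N) :
    torusFlip i a (torusFlip i a x) = x := by
  simp [torusFlip]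

lemma torusFlip_add_self (i : Fin d) (a : ZMod (2 * (N : ℕ))) (x : Torus d N) :
    torusFlip i a (x + Pi.single i 1) = torusFlip i a x - Pi.single i 1 := by
  funext k
  by_cases h : k = i
  · subst h; simp [torusFlip]; ring
  · simp [torusFlip, h]

lemma torusFlip_add_of_ne (i : Fin d) (a : ZMod (2 * (N : ℕ))) (x : Torus d N) {j : Fin d}
    (hj : j ≠ i) : torusFlip i a (x + Pi.single j 1) = torusFlip i a x + Pi.single j 1 := by
  funext k
  by_cases h : k = i
  · subst h; simp [torusFlip, hj.symm]
  · simp [torusFlip, h]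

/-- Measured from `a`, the reflection maps the offset v to 2N - 1 - v, so exactly one of two mirror
images has offset less than N. -/
lemma val_flip (a b : ZMod (2 * (N : ℕ))) :
    (2 * a - 1 - b - a).val + (b - a).val + 1 = 2 * N := by
  have h1 : (2 * a - 1 - b - a) = -((b - a) + 1) := by ring
  rw [h1]
  set c := b - a
  have hN : 0 < 2 * (N : ℕ) := by have := N.pos; omega
  have hlt : c.val < 2 * N := ZMod.val_lt c
  have h2 : (c + 1) = ((c.val + 1 : ℕ) : ZMod (2 * (N : ℕ))) := by
    push_cast; rw [ZMod.natCast_zmod_val]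
  have h3 : -(c + 1) = ((2 * N - (c.val + 1) : ℕ) : ZMod (2 * (N : ℕ))) := by
    rw [Nat.cast_sub (by omega), ← h2, ZMod.natCast_self, zero_sub]
  rw [h3, ZMod.val_natCast, Nat.mod_eq_of_lt (by omega)]
  omega

lemma val_sum_of_add_eq_zero {n : ℕ} [NeZero n] {u v : ZMod n} {k : ℕ} (h : u + v + k = 0) :
    n ∣ u.val + v.val + k := by
  rw [← ZMod.natCast_eq_zero_iff]
  push_cast
  rw [ZMod.natCast_zmod_val, ZMod.natCast_zmod_val, h]

/-- The reflections of the torus satisfy the conditions for reflection positivity. -/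
def torusReflection (js : ℝ) (i : Fin d) (a : ZMod (2 * (N : ℕ))) :
    BondReflection (torusCoupling (d := d) (N := N) js) where
  θ := torusFlip i a
  L := Finset.univ.filter fun x => (x i - a).val < N
  invol := torusFlip_flip i a
  mem_iff x := by
    have := val_flip a (x i)
    simp only [Finset.mem_filter, Finset.mem_univ, true_and, torusFlip, Function.update_self]
    omega
  map_J x y := by
    unfold torusCoupling
    congr 1
    refine Finset.sum_congr rfl fun j _ => ?_
    have hinj : ∀ u v : Torus d N, torusFlip i a u = torusFlip i a v ↔ u = v := fun u v =>
      ⟨fun h => by rw [← torusFlip_flip i a u, h, torusFlip_flip], fun h => by rw [h]⟩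
    by_cases hj : j = i
    · subst hj
      have h1 : ∀ u v : Torus d N, torusFlip j a v = torusFlip j a u + Pi.single j 1 ↔
          u = v + Pi.single j 1 := by
        intro u v
        rw [← hinj u, torusFlip_add_self, eq_sub_iff_add_eq, eq_comm]
      simp only [h1]
      exact add_comm _ _
    · simp only [← torusFlip_add_of_ne i a _ hj, hinj]
  cross x hx y hy h := by
    simp only [Finset.mem_filter, Finset.mem_univ, true_and] at hx hy
    obtain ⟨j, hj⟩ := exists_of_torusCoupling_ne_zero h
    have hfl := val_flip a (y i)
    have hNpos := N.pos
    by_cases hji : j = i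
    · subst hji
      have hother : ∀ k, k ≠ j → y k = x k := by
        intro k hk
        rcases hj with hj | hj
        · have := congrFun hj k
          simpa [torusFlip, hk] using this
        · have := congrFun hj k
          simpa [torusFlip, hk] using this.symm
      -- The two halves meet at two seams. In the first case the offsets u, v < N satisfy u + v + 2
      -- ≡ 0 modulo 2N, so both are N - 1; in the second u + v ≡ 0, so both are 0.
      have hself : y j = x j := by
        rcases hj with hj | hj
        · have h1 := congrFun hj j
          simp only [torusFlip, Function.update_self, Pi.add_apply, Pi.single_eq_same] at h1
          have h2 : (x j - a) + (y j - a) + ((2 : ℕ) : ZMod (2 * (N : ℕ))) = 0 := by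
            push_cast
            linear_combination -h1
          have h3 := val_sum_of_add_eq_zero h2
          obtain ⟨c, hc⟩ := h3
          have h5 : c = 1 := by
            have h6 : c ≠ 0 := by rintro rfl; omega
            have h7 : c < 2 := by
              by_contra h8
              push Not at h8
              have : 2 * (N : ℕ) * 2 ≤ 2 * N * c := Nat.mul_le_mul_left _ h8
              omega
            omega
          subst h5
          have h4 : (x j - a).val = (y j - a).val := by omega
          have := ZMod.val_injective _ h4
          linear_combination -this
        · have h1 := congrFun hj j
          simp only [torusFlip, Function.update_self, Pi.add_apply, Pi.single_eq_same] at h1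
          have h2 : (x j - a) + (y j - a) + ((0 : ℕ) : ZMod (2 * (N : ℕ))) = 0 := by
            push_cast
            linear_combination h1
          have h3 := val_sum_of_add_eq_zero h2
          have h5 := Nat.eq_zero_of_dvd_of_lt h3 (by omega)
          have h4 : (x j - a).val = (y j - a).val := by omega
          have := ZMod.val_injective _ h4
          linear_combination -this
      funext k
      by_cases hk : k = j
      · rw [hk, hself]
      · exact hother k hk
    · exfalso
      have h1 : 2 * a - 1 - y i = x i := by
        rcases hj with hj | hj
        · have := congrFun hj i
          simpa [torusFlip, Ne.symm hji] using this
        · have := congrFun hj i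
          simpa [torusFlip, Ne.symm hji] using this.symm
      rw [h1] at hfl
      omega

/-- The reflection is placed so that the given bond crosses a seam: in one case the offsets of `x`
and `y` are N - 1 and N, in the other 0 and 2N - 1. -/
lemma exists_torusReflection {js : ℝ} {x y : Torus d N} (h : torusCoupling js x y ≠ 0) :
    ∃ R : BondReflection (torusCoupling (d := d) (N := N) js), x ∈ R.L ∧ y ∉ R.L := by
  have hN := N.pos
  obtain ⟨i, hi⟩ := exists_of_torusCoupling_ne_zero h
  rcases hi with hi | hi
  · refine ⟨torusReflection js i (y i - (N : ℕ)), ?_, ?_⟩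
    · simp only [torusReflection, Finset.mem_filter, Finset.mem_univ, true_and]
      have h1 : x i - (y i - (N : ℕ)) = ((N - 1 : ℕ) : ZMod (2 * (N : ℕ))) := by
        rw [hi]
        have hN1 : 1 ≤ (N : ℕ) := hN
        push_cast [hN1]
        simp only [Pi.add_apply, Pi.single_eq_same]
        ring
      rw [h1, ZMod.val_natCast, Nat.mod_eq_of_lt (by omega)]
      omega
    · simp only [torusReflection, Finset.mem_filter, Finset.mem_univ, true_and]
      rw [sub_sub_cancel, ZMod.val_natCast, Nat.mod_eq_of_lt (by omega)]
      omega
  · refine ⟨torusReflection js i (x i), ?_, ?_⟩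
    · simp only [torusReflection, Finset.mem_filter, Finset.mem_univ, true_and]
      simp
    · simp only [torusReflection, Finset.mem_filter, Finset.mem_univ, true_and]
      have h1 : y i - x i = ((2 * N - 1 : ℕ) : ZMod (2 * (N : ℕ))) := by
        rw [hi, Nat.cast_sub (by omega), ZMod.natCast_self]
        simp
      rw [h1, ZMod.val_natCast, Nat.mod_eq_of_lt (by omega)]
      omega

/-! #### The infrared bound at zero time frequency -/

/-- Configurations as functions of space. -/
def spaceCurry : (Torus d N → ZMod M → ℤˣ) ≃ (Grid d N M → ℤˣ) where
  toFun s := fun p => s p.1 p.2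
  invFun s := fun x j => s (x, j)
  left_inv _ := rfl
  right_inv _ := rfl

/-- The weight of a column. -/
def columnWeight (jt : ℝ) (a : ZMod M → ℤˣ) : ℝ :=
  Real.exp (jt * ∑ j, ((a j : ℤ) : ℝ) * ((a (j + 1) : ℤ) : ℝ))

lemma sign_sq (u : ℤˣ) : ((u : ℤ) : ℝ) ^ 2 = 1 := by
  rcases Int.units_eq_one_or u with h | h <;> simp [h]

/-- A whole column is treated as one vector spin with a priori weight `columnWeight`. Since σ² = 1,
the squared differences give the ferromagnetic energy up to a constant, and 1/4 compensates for
ordered pairs and the factor 2 of the mixed term. -/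
lemma columnWeight_mul_exp (jt js : ℝ) (s : Torus d N → ZMod M → ℤˣ) :
    (∏ x, columnWeight jt (s x)) *
      Real.exp (-(1 / 4) * bondEnergy (fun a j => ((a j : ℤ) : ℝ)) (torusCoupling js) 0 s) =
    Real.exp (-(js * (Fintype.card (Torus d N) * d * M))) *
      Real.exp (gridEnergy jt js (spaceCurry s)) := by
  unfold columnWeight
  rw [← Real.exp_sum, ← Real.exp_add, ← Real.exp_add]
  congr 1
  have h1 : bondEnergy (fun (a : ZMod M → ℤˣ) j => ((a j : ℤ) : ℝ)) (torusCoupling js) 0 s =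
      4 * (js * (Fintype.card (Torus d N) * d * M)) - 4 * (js * ∑ x, ∑ i, ∑ j,
        ((s x j : ℤ) : ℝ) * ((s (x + Pi.single i 1) j : ℤ) : ℝ)) := by
    unfold bondEnergy
    have h2 : ∀ x y : Torus d N, ∑ j, (((s x j : ℤ) : ℝ) - ((s y j : ℤ) : ℝ) -
        (0 : Torus d N → Torus d N → ℝ) x y) ^ 2 =
        2 * M - 2 * ∑ j, ((s x j : ℤ) : ℝ) * ((s y j : ℤ) : ℝ) := by
      intro x y
      have h3 : ∀ j, (((s x j : ℤ) : ℝ) - ((s y j : ℤ) : ℝ) -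
          (0 : Torus d N → Torus d N → ℝ) x y) ^ 2 =
          2 - 2 * (((s x j : ℤ) : ℝ) * ((s y j : ℤ) : ℝ)) := by
        intro j
        simp only [Pi.zero_apply, sub_zero]
        linear_combination sign_sq (s x j) + sign_sq (s y j)
      rw [Finset.sum_congr rfl fun j _ => h3 j, Finset.sum_sub_distrib, ← Finset.mul_sum]
      simp [ZMod.card, mul_comm]
    simp only [h2, sum_torusCoupling_mul, ← Finset.mul_sum]
    have h4 : ∑ x : Torus d N, ∑ i : Fin d,
        (2 * (M : ℝ) - 2 * ∑ j, ((s x j : ℤ) : ℝ) * ((s (x + Pi.single i 1) j : ℤ) : ℝ) +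
        (2 * (M : ℝ) - 2 * ∑ j, ((s x j : ℤ) : ℝ) * ((s (x - Pi.single i 1) j : ℤ) : ℝ))) =
        4 * (Fintype.card (Torus d N) * d * M) -
        2 * (∑ x, ∑ i, ∑ j, ((s x j : ℤ) : ℝ) * ((s (x + Pi.single i 1) j : ℤ) : ℝ)) -
        2 * (∑ x, ∑ i, ∑ j, ((s x j : ℤ) : ℝ) * ((s (x - Pi.single i 1) j : ℤ) : ℝ)) := by
      simp only [Finset.sum_add_distrib, Finset.sum_sub_distrib, ← Finset.mul_sum, Finset.sum_const,
        Finset.card_univ, Fintype.card_fin, nsmul_eq_mul]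
      ring
    have h5 : ∑ x, ∑ i, ∑ j, ((s x j : ℤ) : ℝ) * ((s (x - Pi.single i 1) j : ℤ) : ℝ) =
        ∑ x, ∑ i, ∑ j, ((s x j : ℤ) : ℝ) * ((s (x + Pi.single i 1) j : ℤ) : ℝ) := by
      rw [Finset.sum_comm]
      conv_rhs => rw [Finset.sum_comm]
      refine Finset.sum_congr rfl fun i _ => ?_
      refine Eq.trans ?_ (Equiv.sum_comp (Equiv.subRight (Pi.single i 1 : Torus d N)) fun x =>
        ∑ j, ((s x j : ℤ) : ℝ) * ((s (x + Pi.single i 1) j : ℤ) : ℝ))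
      refine Finset.sum_congr rfl fun x _ => Finset.sum_congr rfl fun j _ => ?_
      rw [Equiv.subRight_apply, sub_add_cancel, mul_comm]
    rw [h4, h5]
    ring
  rw [h1]
  simp only [gridEnergy, spaceCurry, Equiv.coe_fn_mk, ← Finset.mul_sum]
  ring

/-- The symbol of the lattice Laplacian. -/
def latticeSymbol (ψ : AddChar (Torus d N) ℂ) : ℝ := ∑ i, (1 - (ψ (Pi.single i 1)).re)

lemma char_re_le_one (ψ : AddChar (Torus d N) ℂ) (x : Torus d N) : (ψ x).re ≤ 1 := by
  nlinarith [char_re_sq_add ψ x, sq_nonneg (ψ x).im, sq_nonneg ((ψ x).re - 1)]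

lemma latticeSymbol_nonneg (ψ : AddChar (Torus d N) ℂ) : 0 ≤ latticeSymbol ψ :=
  Finset.sum_nonneg fun _ _ => sub_nonneg.mpr (char_re_le_one ψ _)

/-- Real and imaginary parts of characters are eigenfunctions of the lattice Laplacian. -/
lemma sum_torusCoupling_char (js : ℝ) (ψ : AddChar (Torus d N) ℂ) (h : Torus d N → ℝ)
    (hh : h = (fun x => (ψ x).re) ∨ h = fun x => (ψ x).im) (x : Torus d N) :
    ∑ y, torusCoupling js x y * (h x - h y) = 2 * js * latticeSymbol ψ * h x := by
  rw [sum_torusCoupling_mul js x fun y => h x - h y]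
  have key : ∀ i : Fin d, h x - h (x + Pi.single i 1) + (h x - h (x - Pi.single i 1)) =
      2 * (1 - (ψ (Pi.single i 1)).re) * h x := by
    intro i
    rcases hh with rfl | rfl
    · simp only [sub_eq_add_neg, AddChar.map_add_eq_mul, AddChar.map_neg_eq_conj, Complex.mul_re,
        Complex.conj_re, Complex.conj_im]
      ring
    · simp only [sub_eq_add_neg, AddChar.map_add_eq_mul, AddChar.map_neg_eq_conj, Complex.mul_im,
        Complex.conj_re, Complex.conj_im]
      ring
  rw [Finset.sum_congr rfl fun i _ => key i]
  unfold latticeSymbol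
  rw [← Finset.sum_mul, ← Finset.mul_sum]
  ring

/-- This is `sum_sq_mul_le` for columns, with an eigenfunction of the Laplacian as test function.
Its bond field is the same at all times, so it controls the sum over time of the slice sums. -/
lemma gridAvg_sq_le {jt js : ℝ} (hs : 0 ≤ js) (ψ : AddChar (Torus d N) ℂ) (h : Torus d N → ℝ)
    (hh : h = (fun x => (ψ x).re) ∨ h = fun x => (ψ x).im) :
    (2 * js * latticeSymbol ψ) ^ 2 *
        gridAvg jt js (fun s : Grid d N M → ℤˣ => (∑ j, sliceSum h j s) ^ 2) ≤
      M * (2 * js * latticeSymbol ψ) * ∑ x, h x ^ 2 := by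
  have key := sum_sq_mul_le (κ := ZMod M) (columnWeight (M := M) jt)
    (fun a => (Real.exp_pos _).le) (fun a j => ((a j : ℤ) : ℝ))
    (torusCoupling_nonneg (d := d) (N := N) hs) (torusCoupling_comm js)
    (fun x y hxy => exists_torusReflection hxy) h
  have hpart : bondPartition (columnWeight (M := M) jt) (fun a (j : ZMod M) => ((a j : ℤ) : ℝ))
      (torusCoupling (d := d) (N := N) js) 0 =
      Real.exp (-(js * (Fintype.card (Torus d N) * d * M))) *
        gibbsSum (bondHom (gridDir (d := d) (N := N) (M := M)))
          (fun e => gridCoupling jt js e.2) 1 := by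
    unfold bondPartition gibbsSum
    rw [Finset.mul_sum, ← Equiv.sum_comp spaceCurry]
    refine Finset.sum_congr rfl fun s _ => ?_
    rw [columnWeight_mul_exp, sum_gridCoupling_mul, Pi.one_apply, one_mul]
  have hleft : ∑ s : Torus d N → ZMod M → ℤˣ,
      (∑ x, (∑ y, torusCoupling js x y * (h x - h y)) * ∑ j, ((s x j : ℤ) : ℝ)) ^ 2 *
        ((∏ x, columnWeight jt (s x)) * Real.exp (-(1 / 4) *
          bondEnergy (fun a j => ((a j : ℤ) : ℝ)) (torusCoupling js) 0 s)) =
      Real.exp (-(js * (Fintype.card (Torus d N) * d * M))) * ((2 * js * latticeSymbol ψ) ^ 2 *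
        gibbsSum (bondHom (gridDir (d := d) (N := N) (M := M)))
          (fun e => gridCoupling jt js e.2) (fun s => (∑ j, sliceSum h j s) ^ 2)) := by
    unfold gibbsSum
    rw [Finset.mul_sum, Finset.mul_sum, ← Equiv.sum_comp spaceCurry]
    refine Finset.sum_congr rfl fun s _ => ?_
    rw [columnWeight_mul_exp, sum_gridCoupling_mul]
    have h1 : ∑ x, (∑ y, torusCoupling js x y * (h x - h y)) * ∑ j, ((s x j : ℤ) : ℝ) =
        2 * js * latticeSymbol ψ * ∑ j, sliceSum h j (spaceCurry s) := by
      unfold sliceSum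
      rw [Finset.sum_comm, Finset.mul_sum]
      refine Finset.sum_congr rfl fun x _ => ?_
      rw [sum_torusCoupling_char js ψ h hh, ← Finset.mul_sum]
      simp only [spaceCurry, Equiv.coe_fn_mk]
      ring
    rw [h1]
    ring
  have hright : ∑ x, ∑ y, torusCoupling js x y * (h x - h y) ^ 2 =
      2 * ((2 * js * latticeSymbol ψ) * ∑ x, h x ^ 2) := by
    have h1 : ∑ x, ∑ y, torusCoupling js x y * (h x - h y) ^ 2 =
        ∑ x, ∑ y, torusCoupling js x y * (h x - h y) * h x -
        ∑ x, ∑ y, torusCoupling js x y * (h x - h y) * h y := by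
      rw [← Finset.sum_sub_distrib]
      refine Finset.sum_congr rfl fun x _ => ?_
      rw [← Finset.sum_sub_distrib]
      exact Finset.sum_congr rfl fun y _ => by ring
    have h2 : ∑ x, ∑ y, torusCoupling js x y * (h x - h y) * h y =
        -∑ x, ∑ y, torusCoupling js x y * (h x - h y) * h x := by
      rw [Finset.sum_comm, ← Finset.sum_neg_distrib]
      refine Finset.sum_congr rfl fun x _ => ?_
      rw [← Finset.sum_neg_distrib]
      refine Finset.sum_congr rfl fun y _ => ?_
      rw [torusCoupling_comm js y x]; ring
    have h3 : ∑ x, ∑ y, torusCoupling js x y * (h x - h y) * h x =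
        (2 * js * latticeSymbol ψ) * ∑ x, h x ^ 2 := by
      rw [Finset.mul_sum]
      refine Finset.sum_congr rfl fun x _ => ?_
      rw [← Finset.sum_mul, sum_torusCoupling_char js ψ h hh]
      ring
    rw [h1, h2, h3]; ring
  rw [hleft, hpart, hright, ZMod.card] at key
  have hZ := gibbsSum_one_pos (bondHom (gridDir (d := d) (N := N) (M := M)))
    (fun e => gridCoupling jt js e.2)
  have hE := Real.exp_pos (-(js * (Fintype.card (Torus d N) * d * M)))
  unfold gridAvg gibbsAvg
  rw [← mul_div_assoc, div_le_iff₀ hZ]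
  refine le_of_mul_le_mul_left ?_ hE
  refine key.trans (le_of_eq ?_)
  ring

/-- The infrared bound at zero time frequency. -/
lemma two_mul_latticeSymbol_mul_sum_gridMode_le {jt js : ℝ} (hs : 0 ≤ js)
    (ψ : AddChar (Torus d N) ℂ) :
    2 * js * latticeSymbol ψ * ∑ j : ZMod M, gridMode jt js ψ j ≤ 1 := by
  have hM : (0 : ℝ) < M := by exact_mod_cast Nat.pos_of_ne_zero (NeZero.ne M)
  have hc := card_torus_pos (d := d) (N := N)
  set A := 2 * js * latticeSymbol ψ
  have hA : 0 ≤ A := mul_nonneg (by linarith) (latticeSymbol_nonneg ψ)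
  have h1 := gridAvg_sq_le (M := M) (jt := jt) hs ψ (fun x => (ψ x).re) (Or.inl rfl)
  have h2 := gridAvg_sq_le (M := M) (jt := jt) hs ψ (fun x => (ψ x).im) (Or.inr rfl)
  have h3 : ∀ h : Torus d N → ℝ, gridAvg jt js (fun s : Grid d N M → ℤˣ =>
      (∑ j, sliceSum h j s) ^ 2) =
      ∑ i, ∑ j, gridAvg jt js (fun s : Grid d N M → ℤˣ => sliceSum h i s * sliceSum h j s) := by
    intro h
    have : (fun s : Grid d N M → ℤˣ => (∑ j, sliceSum h j s) ^ 2) =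
        fun s => ∑ i, ∑ j, sliceSum h i s * sliceSum h j s := by
      funext s; rw [sq, Finset.sum_mul_sum]
    rw [this, gridAvg_sum]
    exact Finset.sum_congr rfl fun i _ => gridAvg_sum _ _ _ _
  have h4 : gridAvg jt js (fun s : Grid d N M → ℤˣ =>
      (∑ j, sliceSum (fun x => (ψ x).re) j s) ^ 2) +
      gridAvg jt js (fun s : Grid d N M → ℤˣ =>
      (∑ j, sliceSum (fun x => (ψ x).im) j s) ^ 2) =
      M * (Fintype.card (Torus d N) * ∑ j : ZMod M, gridMode jt js ψ j) := by
    rw [h3, h3, ← Finset.sum_add_distrib]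
    have h5 : ∀ i : ZMod M, ∑ j, gridAvg jt js (fun s : Grid d N M → ℤˣ =>
        sliceSum (fun x => (ψ x).re) i s * sliceSum (fun x => (ψ x).re) j s) +
        ∑ j, gridAvg jt js (fun s : Grid d N M → ℤˣ =>
        sliceSum (fun x => (ψ x).im) i s * sliceSum (fun x => (ψ x).im) j s) =
        Fintype.card (Torus d N) * ∑ j : ZMod M, gridMode jt js ψ j := by
      intro i
      rw [← Finset.sum_add_distrib, Finset.mul_sum]
      refine Eq.trans ?_ (Equiv.sum_comp (Equiv.subRight i) fun j =>
        (Fintype.card (Torus d N) : ℝ) * gridMode jt js ψ j)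
      refine Finset.sum_congr rfl fun j _ => ?_
      rw [Equiv.subRight_apply, card_mul_gridMode]
    rw [Finset.sum_congr rfl fun i _ => h5 i]
    simp [ZMod.card]
  have h6 : ∑ x, (ψ x).re ^ 2 + ∑ x, (ψ x).im ^ 2 = Fintype.card (Torus d N) := by
    rw [← Finset.sum_add_distrib, Finset.sum_congr rfl fun x _ => char_re_sq_add ψ x]
    simp
  rcases hA.eq_or_lt with hA0 | hA0
  · rw [← hA0]; simp
  have h7 : A ^ 2 * (M * (Fintype.card (Torus d N) * ∑ j : ZMod M, gridMode jt js ψ j)) ≤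
      M * A * Fintype.card (Torus d N) := by
    rw [← h4, ← h6]
    linarith
  have h8 : (A * M * Fintype.card (Torus d N)) * (A * ∑ j : ZMod M, gridMode jt js ψ j) ≤
      (A * M * Fintype.card (Torus d N)) * 1 := by linarith
  exact le_of_mul_le_mul_left h8 (by positivity)

end Infrared

section TimeRegularity

variable {d : ℕ} {N : ℕ+} {M : ℕ} [NeZero M]

/-! #### Regularity in time of the Fourier coefficients -/

lemma abs_sign (u : ℤˣ) : |((u : ℤ) : ℝ)| = 1 := by
  rcases Int.units_eq_one_or u with h | h <;> simp [h]

lemma abs_spatial_energy_le (s : Grid d N M → ℤˣ) :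
    |∑ x, ∑ i, ∑ j, ((s (x, j) : ℤ) : ℝ) * ((s (x + Pi.single i 1, j) : ℤ) : ℝ)| ≤
      Fintype.card (Torus d N) * d * M := by
  have h1 : ∀ x : Torus d N, ∀ i : Fin d,
      |∑ j, ((s (x, j) : ℤ) : ℝ) * ((s (x + Pi.single i 1, j) : ℤ) : ℝ)| ≤ M := by
    intro x i
    refine (Finset.abs_sum_le_sum_abs _ _).trans (le_of_eq ?_)
    simp [abs_mul, abs_sign, ZMod.card]
  have h2 : ∀ x : Torus d N,
      |∑ i, ∑ j, ((s (x, j) : ℤ) : ℝ) * ((s (x + Pi.single i 1, j) : ℤ) : ℝ)| ≤ d * M := by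
    intro x
    refine (Finset.abs_sum_le_sum_abs _ _).trans ((Finset.sum_le_sum fun i _ => h1 x i).trans ?_)
    simp
  refine (Finset.abs_sum_le_sum_abs _ _).trans ((Finset.sum_le_sum fun x _ => h2 x).trans ?_)
  rw [Finset.sum_const, nsmul_eq_mul, Finset.card_univ, mul_assoc]

/-- Removing the spatial coupling changes each weight by a bounded factor. The bound is crude but
harmless: `js * M` is λb for every mesh. -/
lemma gridAvg_le_exp_mul {jt js : ℝ} (hs : 0 ≤ js) {f : (Grid d N M → ℤˣ) → ℝ}
    (hf : ∀ s, 0 ≤ f s) :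
    gridAvg jt js f ≤ Real.exp (2 * (js * (Fintype.card (Torus d N) * d * M))) *
      gridAvg jt 0 f := by
  set C := js * (Fintype.card (Torus d N) * d * M)
  have hen : ∀ s : Grid d N M → ℤˣ, gridEnergy jt js s ≤ C + gridEnergy jt 0 s ∧
      -C + gridEnergy jt 0 s ≤ gridEnergy jt js s := by
    intro s
    have h := abs_le.mp (abs_spatial_energy_le s)
    have h1 := mul_le_mul_of_nonneg_left h.1 hs
    have h2 := mul_le_mul_of_nonneg_left h.2 hs
    simp only [gridEnergy, zero_mul, add_zero]
    constructor <;> linarith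
  unfold gridAvg gibbsAvg
  set Z1 := gibbsSum (bondHom (gridDir (d := d) (N := N) (M := M)))
    (fun e => gridCoupling jt js e.2) 1
  set Z0 := gibbsSum (bondHom (gridDir (d := d) (N := N) (M := M)))
    (fun e => gridCoupling jt 0 e.2) 1
  have hZ1 : 0 < Z1 := gibbsSum_one_pos _ _
  have hZ0 : 0 < Z0 := gibbsSum_one_pos _ _
  have hnum : gibbsSum (bondHom gridDir) (fun e => gridCoupling jt js e.2) f ≤
      Real.exp C * gibbsSum (bondHom gridDir) (fun e => gridCoupling jt 0 e.2) f := by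
    unfold gibbsSum
    rw [Finset.mul_sum]
    refine Finset.sum_le_sum fun s _ => ?_
    rw [sum_gridCoupling_mul, sum_gridCoupling_mul, mul_left_comm, ← Real.exp_add]
    exact mul_le_mul_of_nonneg_left (Real.exp_le_exp.mpr (hen s).1) (hf s)
  have hden : Real.exp (-C) * Z0 ≤ Z1 := by
    simp only [Z0, Z1]
    unfold gibbsSum
    rw [Finset.mul_sum]
    refine Finset.sum_le_sum fun s _ => ?_
    rw [sum_gridCoupling_mul, sum_gridCoupling_mul, mul_left_comm, ← Real.exp_add]
    simpa using (hen s).2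
  have hf0 : 0 ≤ gibbsSum (bondHom gridDir) (fun e => gridCoupling jt 0 e.2) f :=
    Finset.sum_nonneg fun s _ => mul_nonneg (hf s) (Real.exp_pos _).le
  rw [div_le_iff₀ hZ1]
  calc gibbsSum (bondHom gridDir) (fun e => gridCoupling jt js e.2) f
      ≤ Real.exp C * gibbsSum (bondHom gridDir) (fun e => gridCoupling jt 0 e.2) f := hnum
    _ = Real.exp (2 * C) * (gibbsSum (bondHom gridDir) (fun e => gridCoupling jt 0 e.2) f / Z0) *
        (Real.exp (-C) * Z0) := by
        have : Real.exp C = Real.exp (2 * C) * Real.exp (-C) := by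
          rw [← Real.exp_add]; ring_nf
        rw [this]
        field_simp
    _ ≤ _ := by
        refine mul_le_mul_of_nonneg_left hden ?_
        positivity

lemma gibbsSum_prod_columns (jt : ℝ) (F : Torus d N → (ZMod M → ℤˣ) → ℝ) :
    gibbsSum (bondHom (gridDir (d := d) (N := N) (M := M))) (fun e => gridCoupling jt 0 e.2)
      (fun s => ∏ x, F x fun j => s (x, j)) = ∏ x, ∑ a, F x a * columnWeight jt a := by
  rw [Finset.prod_univ_sum, Fintype.piFinset_univ]
  unfold gibbsSum
  rw [← Equiv.sum_comp spaceCurry]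
  refine Finset.sum_congr rfl fun s _ => ?_
  rw [Finset.prod_mul_distrib, sum_gridCoupling_mul]
  congr 1
  unfold columnWeight
  rw [← Real.exp_sum]
  congr 1
  simp [gridEnergy, spaceCurry, Finset.mul_sum]

/-- Without spatial coupling the columns are independent and identically distributed. -/
lemma gridAvg_prod_columns (jt : ℝ) (k : ZMod M) (A : Finset (Torus d N)) :
    gridAvg jt 0 (fun s : Grid d N M → ℤˣ =>
      ∏ x ∈ A, (((s (x, 0) : ℤ) : ℝ) * ((s (x, k) : ℤ) : ℝ))) =
      gridCorr jt 0 (0 : Torus d N) k ^ A.card := by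
  set z := ∑ a : ZMod M → ℤˣ, columnWeight jt a
  set w := ∑ a : ZMod M → ℤˣ, (((a 0 : ℤ) : ℝ) * ((a k : ℤ) : ℝ)) * columnWeight jt a
  have hz : 0 < z := Finset.sum_pos (fun a _ => Real.exp_pos _) ⟨1, Finset.mem_univ _⟩
  have key : ∀ A : Finset (Torus d N), gridAvg jt 0 (fun s : Grid d N M → ℤˣ =>
      ∏ x ∈ A, (((s (x, 0) : ℤ) : ℝ) * ((s (x, k) : ℤ) : ℝ))) = (w / z) ^ A.card := by
    intro A
    have h1 := gibbsSum_prod_columns (d := d) (N := N) (M := M) jt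
      (fun x a => if x ∈ A then ((a 0 : ℤ) : ℝ) * ((a k : ℤ) : ℝ) else 1)
    have h2 := gibbsSum_prod_columns (d := d) (N := N) (M := M) jt (fun _ _ => 1)
    have e1 : (fun s : Grid d N M → ℤˣ => ∏ x : Torus d N,
        if x ∈ A then ((s (x, 0) : ℤ) : ℝ) * ((s (x, k) : ℤ) : ℝ) else 1) =
        fun s => ∏ x ∈ A, (((s (x, 0) : ℤ) : ℝ) * ((s (x, k) : ℤ) : ℝ)) := by
      funext s
      rw [Finset.prod_ite_mem, Finset.univ_inter]
    have e2 : (fun s : Grid d N M → ℤˣ => ∏ x : Torus d N, (1 : ℝ)) = 1 := by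
      funext s; simp
    have e3 : ∀ x : Torus d N, ∑ a : ZMod M → ℤˣ,
        (if x ∈ A then ((a 0 : ℤ) : ℝ) * ((a k : ℤ) : ℝ) else 1) * columnWeight jt a =
        z * if x ∈ A then w / z else 1 := by
      intro x
      split_ifs
      · rw [mul_div_cancel₀ _ hz.ne']
      · simp [z]
    rw [e1] at h1
    rw [e2] at h2
    unfold gridAvg gibbsAvg
    rw [h1, h2, Finset.prod_congr rfl fun x _ => e3 x, Finset.prod_mul_distrib,
      Finset.prod_ite_mem, Finset.univ_inter, Finset.prod_const, Finset.prod_const]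
    simp only [one_mul]
    rw [Finset.prod_const, mul_div_cancel_left₀ _ (pow_pos hz _).ne']
  have h0 := key {0}
  simp only [Finset.prod_singleton, Finset.card_singleton, pow_one] at h0
  rw [gridAvg_mul_spin, sub_self, sub_zero] at h0
  rw [key A, h0]

lemma sq_tanh_le_gridCorr {jt js : ℝ} (ht : 0 ≤ jt) (hs : 0 ≤ js) :
    Real.tanh jt ^ 2 ≤ gridCorr jt js (0 : Torus d N) (2 : ZMod M) := by
  have h := tanh_pow_mul_gridCorr_le ht hs (0 : Torus d N) (0 : ZMod M) 2
  rw [gridCorr_zero, mul_one, zero_add] at h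
  exact_mod_cast h

/-- Twice the difference is the mean of the product of the increments of two distinct columns, which
vanishes unless both spins change. After decoupling the columns this is the square of a one-column
quantity of the order of the mesh, hence negligible in the continuum limit. -/
lemma abs_gridCorr_sub_le {jt js : ℝ} (ht : 0 ≤ jt) (hs : 0 ≤ js) {x : Torus d N} (hx : x ≠ 0) :
    |gridCorr jt js x (0 : ZMod M) - gridCorr jt js x (2 : ZMod M)| ≤
      Real.exp (2 * (js * (Fintype.card (Torus d N) * d * M))) * (1 - Real.tanh jt ^ 2) ^ 2 := by
  let a : (Grid d N M → ℤˣ) → ℝ := fun s => ((s (0, 0) : ℤ) : ℝ)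
  let a' : (Grid d N M → ℤˣ) → ℝ := fun s => ((s (0, 2) : ℤ) : ℝ)
  let b : (Grid d N M → ℤˣ) → ℝ := fun s => ((s (x, 0) : ℤ) : ℝ)
  let b' : (Grid d N M → ℤˣ) → ℝ := fun s => ((s (x, 2) : ℤ) : ℝ)
  have lin4 : ∀ (js : ℝ) (c₁ c₂ c₃ c₄ : ℝ) (f₁ f₂ f₃ f₄ : (Grid d N M → ℤˣ) → ℝ),
      gridAvg jt js (fun s => c₁ * f₁ s + c₂ * f₂ s + c₃ * f₃ s + c₄ * f₄ s) =
      c₁ * gridAvg jt js f₁ + c₂ * gridAvg jt js f₂ + c₃ * gridAvg jt js f₃ +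
        c₄ * gridAvg jt js f₄ := by
    intro js c₁ c₂ c₃ c₄ f₁ f₂ f₃ f₄
    have := gridAvg_sum (d := d) (N := N) (M := M) jt js (Finset.univ : Finset (Fin 4))
      ![fun s => c₁ * f₁ s, fun s => c₂ * f₂ s, fun s => c₃ * f₃ s, fun s => c₄ * f₄ s]
    simpa [Fin.sum_univ_four, gridAvg_const_mul] using this
  have h1 : gridAvg jt js (fun s => (a s - a' s) * (b s - b' s)) =
      2 * (gridCorr jt js x (0 : ZMod M) - gridCorr jt js x (2 : ZMod M)) := by
    have e1 : (fun s => (a s - a' s) * (b s - b' s)) = fun s =>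
        1 * (a s * b s) + (-1) * (a s * b' s) + (-1) * (a' s * b s) + 1 * (a' s * b' s) := by
      funext s; ring
    rw [e1, lin4]
    simp only [a, a', b, b', gridAvg_mul_spin, sub_zero, sub_self, zero_sub, gridCorr_neg_right]
    ring
  set f : (Grid d N M → ℤˣ) → ℝ := fun s => (1 - a s * a' s) * (1 - b s * b' s)
  have hsgn : ∀ u v : ℤˣ, |((u : ℤ) : ℝ) - ((v : ℤ) : ℝ)| = 1 - ((u : ℤ) : ℝ) * ((v : ℤ) : ℝ) := by
    intro u v
    rcases Int.units_eq_one_or u with h | h <;> rcases Int.units_eq_one_or v with h' | h' <;>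
      simp [h, h'] <;> norm_num
  have hf : ∀ s, |(a s - a' s) * (b s - b' s)| = f s := by
    intro s
    rw [abs_mul, hsgn, hsgn]
  have hf0 : ∀ s, 0 ≤ f s := fun s => by rw [← hf s]; exact abs_nonneg _
  have h2 : |2 * (gridCorr jt js x (0 : ZMod M) - gridCorr jt js x (2 : ZMod M))| ≤ gridAvg jt js f := by
    rw [← h1, abs_le]
    constructor
    · have : gridAvg jt js (fun s => -1 * f s) ≤
          gridAvg jt js (fun s => (a s - a' s) * (b s - b' s)) :=
        gridAvg_mono _ _ fun s => by
          have := neg_abs_le ((a s - a' s) * (b s - b' s))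
          rw [hf] at this; linarith
      rw [gridAvg_const_mul] at this
      linarith
    · exact gridAvg_mono _ _ fun s => (le_abs_self _).trans (hf s).le
  have h3 := gridAvg_le_exp_mul (jt := jt) hs hf0
  have h4 : gridAvg jt 0 f = (1 - gridCorr jt 0 (0 : Torus d N) (2 : ZMod M)) ^ 2 := by
    have e1 : f = fun s => 1 * (∏ y ∈ (∅ : Finset (Torus d N)),
        (((s (y, 0) : ℤ) : ℝ) * ((s (y, 2) : ℤ) : ℝ))) +
        (-1) * (∏ y ∈ ({0} : Finset (Torus d N)),
        (((s (y, 0) : ℤ) : ℝ) * ((s (y, 2) : ℤ) : ℝ))) +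
        (-1) * (∏ y ∈ ({x} : Finset (Torus d N)),
        (((s (y, 0) : ℤ) : ℝ) * ((s (y, 2) : ℤ) : ℝ))) +
        1 * (∏ y ∈ ({0, x} : Finset (Torus d N)),
        (((s (y, 0) : ℤ) : ℝ) * ((s (y, 2) : ℤ) : ℝ))) := by
      funext s
      rw [Finset.prod_pair hx.symm]
      simp only [Finset.prod_singleton, Finset.prod_empty, f, a, a', b, b']
      ring
    rw [e1, lin4]
    simp only [gridAvg_prod_columns, Finset.card_empty, Finset.card_singleton,
      Finset.card_pair hx.symm]
    ring
  have h5 := sq_tanh_le_gridCorr (d := d) (N := N) (M := M) ht le_rfl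
  have h6 := gridCorr_le_one jt 0 (0 : Torus d N) (2 : ZMod M)
  have h7 : (1 - gridCorr jt 0 (0 : Torus d N) (2 : ZMod M)) ^ 2 ≤ (1 - Real.tanh jt ^ 2) ^ 2 := by
    refine pow_le_pow_left₀ (by linarith) (by linarith) 2
  rw [h4] at h3
  have h8 := mul_le_mul_of_nonneg_left h7
    (Real.exp_pos (2 * (js * (Fintype.card (Torus d N) * d * M)))).le
  rw [abs_mul, abs_two] at h2
  have h9 := abs_nonneg (gridCorr jt js x (0 : ZMod M) - gridCorr jt js x (2 : ZMod M))
  linarith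

lemma abs_char_re_le_one (ψ : AddChar (Torus d N) ℂ) (x : Torus d N) : |(ψ x).re| ≤ 1 := by
  rw [abs_le_one_iff_mul_self_le_one]
  nlinarith [char_re_sq_add ψ x, sq_nonneg (ψ x).im]

/-- Only the site 0 contributes to first order in the mesh; by `abs_gridCorr_sub_le` all others are
of second order. -/
lemma gridMode_zero_sub_le {jt js : ℝ} (ht : 0 ≤ jt) (hs : 0 ≤ js) (ψ : AddChar (Torus d N) ℂ) :
    gridMode jt js ψ (0 : ZMod M) - gridMode jt js ψ (2 : ZMod M) ≤ (1 - Real.tanh jt ^ 2) +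
      Fintype.card (Torus d N) *
        (Real.exp (2 * (js * (Fintype.card (Torus d N) * d * M))) * (1 - Real.tanh jt ^ 2) ^ 2) := by
  set B := Real.exp (2 * (js * (Fintype.card (Torus d N) * d * M))) * (1 - Real.tanh jt ^ 2) ^ 2
  have hB : 0 ≤ B := by positivity
  unfold gridMode cosTransform
  rw [← Finset.sum_sub_distrib]
  have h1 : ∀ x : Torus d N, (ψ x).re * gridCorr jt js x (0 : ZMod M) -
      (ψ x).re * gridCorr jt js x (2 : ZMod M) ≤ (if x = 0 then 1 - Real.tanh jt ^ 2 else 0) + B := by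
    intro x
    rw [← mul_sub]
    by_cases hx : x = 0
    · subst hx
      rw [if_pos rfl, AddChar.map_zero_eq_one, Complex.one_re, one_mul, gridCorr_zero]
      have := sq_tanh_le_gridCorr (d := d) (N := N) (M := M) ht hs
      linarith
    · rw [if_neg hx, zero_add]
      refine (le_abs_self _).trans ?_
      rw [abs_mul]
      exact (mul_le_of_le_one_left (abs_nonneg _) (abs_char_re_le_one ψ x)).trans
        (abs_gridCorr_sub_le ht hs hx)
  refine (Finset.sum_le_sum fun x _ => h1 x).trans (le_of_eq ?_)
  rw [Finset.sum_add_distrib]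
  simp

/-- The increments of a convex sequence, starting from its first term. -/
lemma sub_le_mul_of_convex {a : ℕ → ℝ} {m : ℕ} (h : ∀ j, j + 2 ≤ m → 2 * a (j + 1) ≤ a j + a (j + 2))
    {j : ℕ} (hj : j ≤ m) : a 0 - a j ≤ j * (a 0 - a 1) := by
  have hd : ∀ i, i + 1 ≤ m → a i - a (i + 1) ≤ a 0 - a 1 := by
    intro i
    induction i with
    | zero => intro _; exact le_rfl
    | succ i ih =>
      intro hi
      have h1 := ih (by omega)
      have h2 := h i (by omega)
      have : a (i + 1 + 1) = a (i + 2) := rfl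
      linarith
  induction j with
  | zero => simp
  | succ j ih =>
    have h1 := ih (by omega)
    have h2 := hd j hj
    push_cast
    linarith

/-- By convexity the first decrement is the largest, so the decrease is at most linear in time. -/
lemma gridMode_zero_sub_le_mul {jt js : ℝ} (ht : 0 ≤ jt) (hs : 0 ≤ js) {m : ℕ} [NeZero (2 * m)]
    (ψ : AddChar (Torus d N) ℂ) {j : ℕ} (hj : j ≤ m) :
    gridMode jt js ψ (0 : ZMod (2 * m)) - gridMode jt js ψ ((2 * j : ℕ) : ZMod (2 * m)) ≤
      j * ((1 - Real.tanh jt ^ 2) + Fintype.card (Torus d N) *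
        (Real.exp (2 * (js * (Fintype.card (Torus d N) * d * (2 * m : ℕ)))) *
          (1 - Real.tanh jt ^ 2) ^ 2)) := by
  have h1 := sub_le_mul_of_convex (a := fun j => gridMode jt js ψ ((2 * j : ℕ) : ZMod (2 * m)))
    (fun j hj => two_mul_gridMode_le jt js ψ hj) hj
  have h2 := gridMode_zero_sub_le (M := 2 * m) ht hs ψ
  simp only [mul_zero, Nat.cast_zero, mul_one] at h1
  refine h1.trans (mul_le_mul_of_nonneg_left ?_ (Nat.cast_nonneg j))
  exact_mod_cast h2

end TimeRegularity

/-! ### The Poisson process -/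

section Poisson

lemma measurable_from_sigma {β : Type*} [MeasurableSpace β] {f : PointConfig → β}
    (h : ∀ n, Measurable fun x : Fin n → ℝ => f ⟨n, x⟩) : Measurable f := by
  intro s hs
  rw [MeasurableSpace.measurableSet_iInf]
  intro n
  exact h n hs

lemma measurable_sigma_mk (n : ℕ) : Measurable (fun x : Fin n → ℝ => (⟨n, x⟩ : PointConfig)) := by
  intro s hs
  rw [MeasurableSpace.measurableSet_iInf] at hs
  exact hs n

lemma volume_restrict_Ico_univ (β : ℝ) :
    ((volume : Measure ℝ).restrict (Set.Ico 0 β)) Set.univ = ENNReal.ofReal β := by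
  simp

lemma poissonProcess_isProbabilityMeasure {δ β : ℝ} (hδ : 0 ≤ δ) (hβ : 0 ≤ β) :
    IsProbabilityMeasure (poissonProcess δ β) := by
  constructor
  unfold poissonProcess
  rw [Measure.sum_apply _ MeasurableSet.univ]
  have h1 : ∀ n : ℕ, (ENNReal.ofReal (Real.exp (-(δ * β)) * δ ^ n / (n.factorial : ℝ)) •
      (Measure.pi fun _ : Fin n => (volume : Measure ℝ).restrict (Set.Ico 0 β)).map (fun x => (⟨n, x⟩ : PointConfig)) :
        Measure PointConfig) Set.univ =
      ENNReal.ofReal (Real.exp (-(δ * β)) * ((δ * β) ^ n / (n.factorial : ℝ))) := by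
    intro n
    rw [Measure.smul_apply, Measure.map_apply (measurable_sigma_mk n) MeasurableSet.univ,
      Set.preimage_univ, Measure.pi_univ]
    simp only [volume_restrict_Ico_univ, Finset.prod_const, Finset.card_univ, Fintype.card_fin,
      smul_eq_mul]
    rw [← ENNReal.ofReal_pow hβ, ← ENNReal.ofReal_mul (by positivity)]
    congr 1
    rw [mul_pow]; ring
  rw [tsum_congr h1]
  have h2 : HasSum (fun n : ℕ => Real.exp (-(δ * β)) * ((δ * β) ^ n / (n.factorial : ℝ))) 1 := by
    have := (NormedSpace.expSeries_div_hasSum_exp (δ * β)).mul_left (Real.exp (-(δ * β)))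
    rwa [← Real.exp_eq_exp_ℝ, ← Real.exp_add, neg_add_cancel, Real.exp_zero] at this
  rw [← ENNReal.ofReal_tsum_of_nonneg (fun n => by positivity) h2.summable, h2.tsum_eq,
    ENNReal.ofReal_one]

/-- The product of the values of a function over the points of a configuration. -/
def pointProd (a : ℝ → ℝ) (D : PointConfig) : ℝ := ∏ i, a (D.2 i)

lemma measurable_pointProd {a : ℝ → ℝ} (ha : Measurable a) : Measurable (pointProd a) := by
  refine measurable_from_sigma fun n => ?_
  change Measurable fun x : Fin n → ℝ => ∏ i, a (x i)
  exact Finset.measurable_prod Finset.univ fun i _ => ha.comp (measurable_pi_apply i)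

lemma abs_pointProd_le {a : ℝ → ℝ} (ha : ∀ t, |a t| ≤ 1) (D : PointConfig) :
    |pointProd a D| ≤ 1 := by
  unfold pointProd
  rw [Finset.abs_prod]
  exact Finset.prod_le_one (fun _ _ => abs_nonneg _) fun _ _ => ha _

lemma integrable_pointProd {δ β : ℝ} (hδ : 0 ≤ δ) (hβ : 0 ≤ β) {a : ℝ → ℝ} (ha : Measurable a)
    (ha1 : ∀ t, |a t| ≤ 1) : Integrable (pointProd a) (poissonProcess δ β) := by
  have := poissonProcess_isProbabilityMeasure hδ hβ
  exact Integrable.of_bound (measurable_pointProd ha).aestronglyMeasurable 1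
    (Eventually.of_forall fun D => by rw [Real.norm_eq_abs]; exact abs_pointProd_le ha1 D)

/-- The generating functional of the Poisson process. -/
lemma integral_pointProd {δ β : ℝ} (hδ : 0 ≤ δ) (hβ : 0 ≤ β) {a : ℝ → ℝ} (ha : Measurable a)
    (ha1 : ∀ t, |a t| ≤ 1) :
    ∫ D, pointProd a D ∂(poissonProcess δ β) =
      Real.exp (-(δ * β) + δ * ∫ t in Set.Ico 0 β, a t) := by
  have hint := integrable_pointProd hδ hβ ha ha1
  unfold poissonProcess at hint ⊢
  have h1 := hasSum_integral_measure hint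
  have h2 : ∀ n : ℕ, ∫ D, pointProd a D ∂(ENNReal.ofReal
      (Real.exp (-(δ * β)) * δ ^ n / (n.factorial : ℝ)) •
      (Measure.pi fun _ : Fin n => (volume : Measure ℝ).restrict (Set.Ico 0 β)).map (fun x => (⟨n, x⟩ : PointConfig))) =
      Real.exp (-(δ * β)) * ((δ * ∫ t in Set.Ico 0 β, a t) ^ n / (n.factorial : ℝ)) := by
    intro n
    rw [integral_smul_measure, integral_map (measurable_sigma_mk n).aemeasurable
      (measurable_pointProd ha).aestronglyMeasurable, ENNReal.toReal_ofReal (by positivity)]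
    have h3 := integral_fintype_prod_eq_pow (ι := Fin n) (𝕜 := ℝ) a
      (μ := (volume : Measure ℝ).restrict (Set.Ico 0 β))
    simp only [pointProd]
    rw [h3, Fintype.card_fin, smul_eq_mul, mul_pow]
    ring
  simp only [h2] at h1
  have h4 := (NormedSpace.expSeries_div_hasSum_exp (δ * ∫ t in Set.Ico 0 β, a t)).mul_left
    (Real.exp (-(δ * β)))
  rw [← Real.exp_eq_exp_ℝ, ← Real.exp_add] at h4
  exact h1.unique h4

lemma ae_poissonProcess {δ β : ℝ} {p : ℝ → Prop}
    (hp : ∀ᵐ t ∂((volume : Measure ℝ).restrict (Set.Ico 0 β)), p t) :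
    ∀ᵐ D ∂(poissonProcess δ β), ∀ i, p (D.2 i) := by
  unfold poissonProcess
  rw [Measure.ae_sum_iff]
  intro n
  refine Measure.ae_smul_measure ?_ _
  obtain ⟨s, hsub, hs, hs0⟩ := exists_measurable_superset_of_null hp
  have hmeas : MeasurableSet {D : PointConfig | ∀ i, D.2 i ∉ s} := by
    rw [MeasurableSpace.measurableSet_iInf]
    intro m
    change MeasurableSet {x : Fin m → ℝ | ∀ i, x i ∉ s}
    rw [Set.ofPred_forall]
    exact MeasurableSet.iInter fun i => (hs.compl).preimage (measurable_pi_apply i)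
  have key : ∀ᵐ D ∂((Measure.pi fun _ : Fin n =>
      (volume : Measure ℝ).restrict (Set.Ico 0 β)).map (fun x => (⟨n, x⟩ : PointConfig))), ∀ i : Fin D.1, D.2 i ∉ s := by
    rw [ae_map_iff (measurable_sigma_mk n).aemeasurable hmeas]
    change ∀ᵐ x ∂(Measure.pi fun _ : Fin n => (volume : Measure ℝ).restrict (Set.Ico 0 β)),
      ∀ i : Fin n, x i ∉ s
    refine ae_all_iff.mpr fun i => ?_
    exact (Measure.quasiMeasurePreserving_eval
      (fun _ : Fin n => (volume : Measure ℝ).restrict (Set.Ico 0 β)) i).ae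
      (p := fun t => t ∉ s) (measure_eq_zero_iff_ae_notMem.mp hs0)
  filter_upwards [key] with D hD i
  by_contra hcon
  exact hD i (hsub hcon)

/-- Almost surely all points lie in `[0, β)`, outside of a given countable set. -/
lemma ae_points {δ β : ℝ} {G : Set ℝ} (hG : G.Countable) :
    ∀ᵐ D ∂(poissonProcess δ β), ∀ i, D.2 i ∈ Set.Ico 0 β ∧ D.2 i ∉ G := by
  refine ae_poissonProcess (p := fun t => t ∈ Set.Ico 0 β ∧ t ∉ G) ?_
  filter_upwards [ae_restrict_mem measurableSet_Ico,
    ae_restrict_of_ae (hG.ae_notMem volume)] with t h1 h2 using ⟨h1, h2⟩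

end Poisson

/-! ### Step functions -/

section Steps

lemma floor_div_eq {Δ : ℝ} (hΔ : 0 < Δ) {j : ℤ} {t : ℝ} (ht : t ∈ Set.Ico (j * Δ) ((j + 1) * Δ)) :
    ⌊t / Δ⌋ = j := by
  rw [Int.floor_eq_iff]
  exact ⟨by rw [le_div_iff₀ hΔ]; exact ht.1, by rw [div_lt_iff₀ hΔ]; exact ht.2⟩

/-- The integral of a step function. -/
lemma integral_step {Δ : ℝ} (hΔ : 0 < Δ) (M : ℕ) (G : ℤ → ℝ) :
    ∫ t in (0 : ℝ)..(M * Δ), G ⌊t / Δ⌋ = Δ * ∑ j ∈ Finset.range M, G j := by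
  have hcell : ∀ j : ℕ, IntegrableOn (fun t : ℝ => G ⌊t / Δ⌋) (Set.Ico (j * Δ) ((j + 1 : ℕ) * Δ)) ∧
      ∫ t in Set.Ico ((j : ℝ) * Δ) ((j + 1 : ℕ) * Δ), G ⌊t / Δ⌋ = Δ * G j := by
    intro j
    have h1 : Set.EqOn (fun t : ℝ => G ⌊t / Δ⌋) (fun _ => G j)
        (Set.Ico (j * Δ) ((j + 1 : ℕ) * Δ)) := by
      intro t ht
      have : ⌊t / Δ⌋ = (j : ℤ) := floor_div_eq hΔ (by push_cast at ht ⊢; exact ht)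
      simp only [this]
    refine ⟨(integrableOn_congr_fun h1 measurableSet_Ico).mpr (by simp), ?_⟩
    rw [setIntegral_congr_fun measurableSet_Ico h1]
    simp only [integral_const, MeasurableSet.univ, measureReal_restrict_apply, Set.univ_inter,
      Real.volume_real_Ico, smul_eq_mul]
    push_cast
    rw [max_eq_left (by nlinarith)]
    ring
  have hle : ∀ j : ℕ, (j : ℝ) * Δ ≤ (j + 1 : ℕ) * Δ := fun j => by
    push_cast; nlinarith
  have h2 := intervalIntegral.sum_integral_adjacent_intervals (f := fun t : ℝ => G ⌊t / Δ⌋)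
    (μ := volume) (a := fun j : ℕ => (j : ℝ) * Δ) (n := M) (fun j _ => by
      rw [intervalIntegrable_iff_integrableOn_Ico_of_le (hle j)]
      exact (hcell j).1)
  rw [Nat.cast_zero, zero_mul] at h2
  rw [← h2, Finset.mul_sum]
  refine Finset.sum_congr rfl fun j _ => ?_
  rw [intervalIntegral.integral_of_le (hle j), ← integral_Ico_eq_integral_Ioc, (hcell j).2]

lemma sum_range_eq_sum_zmod (M : ℕ) [NeZero M] (g : ZMod M → ℝ) :
    ∑ j ∈ Finset.range M, g (j : ZMod M) = ∑ j, g j := by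
  refine Finset.sum_bij' (fun j _ => (j : ZMod M)) (fun j _ => j.val) (by simp) ?_ ?_ ?_ (by simp)
  · intro j _; rw [Finset.mem_range]; exact ZMod.val_lt j
  · intro j hj; rw [ZMod.val_natCast, Nat.mod_eq_of_lt (Finset.mem_range.mp hj)]
  · intro j _; exact ZMod.natCast_zmod_val j

/-- The cell of the grid of mesh `Δ` which contains a point. -/
def cellIndex (M : ℕ) (Δ t : ℝ) : ZMod M := (⌊t / Δ⌋ : ℤ)

lemma measurable_comp_cellIndex (M : ℕ) [NeZero M] (Δ : ℝ) (g : ZMod M → ℝ) :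
    Measurable fun t => g (cellIndex M Δ t) := by
  have h : Measurable fun k : ℤ => g (k : ZMod M) := measurable_from_top
  exact h.comp (Int.measurable_floor.comp (measurable_id.div_const Δ))

lemma integral_cellIndex {Δ : ℝ} (hΔ : 0 < Δ) (M : ℕ) [NeZero M] (g : ZMod M → ℝ) :
    ∫ t in Set.Ico 0 (M * Δ), g (cellIndex M Δ t) = Δ * ∑ j, g j := by
  rw [integral_Ico_eq_integral_Ioc, ← intervalIntegral.integral_of_le (by positivity)]
  have := integral_step hΔ M fun k => g (k : ZMod M)
  unfold cellIndex
  rw [this]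
  congr 1
  simpa using sum_range_eq_sum_zmod M g

end Steps

/-! ### The law of the spins on a grid, for one site -/

section Column

variable {M : ℕ} [NeZero M]

lemma measurableSet_even : MeasurableSet {D : PointConfig | Even D.1} := by
  rw [MeasurableSpace.measurableSet_iInf]
  intro n
  change MeasurableSet {_x : Fin n → ℝ | Even n}
  exact MeasurableSet.const (Even n)

/-- The parity of the number of points in a union of cells, as a sign. -/
def cellParity (M : ℕ) (Δ : ℝ) (A : Finset (ZMod M)) (D : PointConfig) : ℝ :=
  pointProd (fun u => if cellIndex M Δ u ∈ A then -1 else 1) D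

lemma measurable_cellSign (Δ : ℝ) (A : Finset (ZMod M)) :
    Measurable fun u => if cellIndex M Δ u ∈ A then (-1 : ℝ) else 1 :=
  measurable_comp_cellIndex M Δ fun j => if j ∈ A then (-1 : ℝ) else 1

lemma abs_cellSign_le (Δ : ℝ) (A : Finset (ZMod M)) (u : ℝ) :
    |if cellIndex M Δ u ∈ A then (-1 : ℝ) else 1| ≤ 1 := by
  split_ifs <;> simp

lemma cellParity_eq_prod (Δ : ℝ) (A : Finset (ZMod M)) (D : PointConfig) :
    cellParity M Δ A D = ∏ j ∈ A, cellParity M Δ {j} D := by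
  unfold cellParity pointProd
  rw [Finset.prod_comm]
  refine Finset.prod_congr rfl fun i _ => ?_
  simp only [Finset.mem_singleton]
  rw [Finset.prod_ite_eq]

lemma cellParity_univ (Δ : ℝ) (D : PointConfig) :
    cellParity M Δ Finset.univ D = (-1) ^ D.1 := by
  simp [cellParity, pointProd]

lemma cellParity_eq_or (Δ : ℝ) (A : Finset (ZMod M)) (D : PointConfig) :
    cellParity M Δ A D = 1 ∨ cellParity M Δ A D = -1 := by
  rw [← sq_eq_one_iff]
  unfold cellParity pointProd
  rw [← Finset.prod_pow]
  refine Finset.prod_eq_one fun i _ => ?_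
  beta_reduce
  split_ifs <;> norm_num

lemma integral_cellParity {δ Δ : ℝ} (hδ : 0 ≤ δ) (hΔ : 0 < Δ) (A : Finset (ZMod M)) :
    ∫ D, cellParity M Δ A D ∂(poissonProcess δ (M * Δ)) = Real.exp (-(2 * δ * Δ)) ^ A.card := by
  unfold cellParity
  rw [integral_pointProd hδ (by positivity) (measurable_cellSign Δ A) (abs_cellSign_le Δ A),
    integral_cellIndex hΔ M fun j => if j ∈ A then (-1 : ℝ) else 1, ← Real.exp_nat_mul]
  congr 1
  have h : ∑ j : ZMod M, (if j ∈ A then (-1 : ℝ) else 1) = M - 2 * A.card := by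
    have : ∀ j : ZMod M, (if j ∈ A then (-1 : ℝ) else 1) = 1 - 2 * if j ∈ A then 1 else 0 := by
      intro j; split_ifs <;> norm_num
    simp only [this, Finset.sum_sub_distrib, ← Finset.mul_sum]
    simp [ZMod.card]
  rw [h]; ring

lemma integrable_cellParity {δ Δ : ℝ} (hδ : 0 ≤ δ) (hΔ : 0 < Δ) (A : Finset (ZMod M)) :
    Integrable (cellParity M Δ A) (poissonProcess δ (M * Δ)) :=
  integrable_pointProd hδ (by positivity) (measurable_cellSign Δ A) (abs_cellSign_le Δ A)

/-- The indicator that the parities of the cells are those of the increments of `s`. -/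
def parityIndicator (Δ : ℝ) (s : ZMod M → ℤˣ) (D : PointConfig) : ℝ :=
  ∏ j, (1 / 2) * (1 + cellParity M Δ {j} D * (((s j : ℤ) : ℝ) * ((s (j + 1) : ℤ) : ℝ)))

lemma parityIndicator_eq_sum (Δ : ℝ) (s : ZMod M → ℤˣ) (D : PointConfig) :
    parityIndicator Δ s D = (1 / 2) ^ M * ∑ A : Finset (ZMod M),
      (∏ j ∈ A, ((s j : ℤ) : ℝ) * ((s (j + 1) : ℤ) : ℝ)) * cellParity M Δ A D := by
  unfold parityIndicator
  rw [Finset.prod_mul_distrib, Finset.prod_const, Finset.card_univ, ZMod.card, Finset.prod_one_add,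
    Finset.powerset_univ]
  congr 1
  refine Finset.sum_congr rfl fun A _ => ?_
  rw [Finset.prod_mul_distrib, ← cellParity_eq_prod]
  ring

lemma integrable_parityIndicator {δ Δ : ℝ} (hδ : 0 ≤ δ) (hΔ : 0 < Δ) (s : ZMod M → ℤˣ) :
    Integrable (parityIndicator Δ s) (poissonProcess δ (M * Δ)) := by
  have h : parityIndicator Δ s = fun D => (1 / 2) ^ M * ∑ A : Finset (ZMod M),
      (∏ j ∈ A, ((s j : ℤ) : ℝ) * ((s (j + 1) : ℤ) : ℝ)) * cellParity M Δ A D :=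
    funext (parityIndicator_eq_sum Δ s)
  rw [h]
  exact (integrable_finsetSum _ fun A _ => (integrable_cellParity hδ hΔ A).const_mul _).const_mul _

lemma one_add_mul_tanh (jt : ℝ) (u v : ℤˣ) :
    1 + ((u : ℤ) : ℝ) * ((v : ℤ) : ℝ) * Real.tanh jt =
      Real.exp (jt * (((u : ℤ) : ℝ) * ((v : ℤ) : ℝ))) / Real.cosh jt := by
  have h : ((u : ℤ) : ℝ) * ((v : ℤ) : ℝ) = 1 ∨ ((u : ℤ) : ℝ) * ((v : ℤ) : ℝ) = -1 := by
    rcases Int.units_eq_one_or u with h | h <;> rcases Int.units_eq_one_or v with h' | h' <;>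
      simp [h, h']
  have hc := (Real.cosh_pos jt).ne'
  rw [eq_div_iff hc, add_mul, Real.tanh_eq_sinh_div_cosh]
  rcases h with h | h <;> rw [h]
  · rw [mul_one, ← Real.cosh_add_sinh]; field_simp
  · rw [mul_neg_one, ← Real.cosh_sub_sinh]; field_simp; ring

/-- Expanding the product over the cells, a set A of cells contributes exp(-2δΔ|A|). With `hjt` this
is tanh(jt)^|A|, and the sum over A is the product expansion of the one-dimensional Ising weight;
this is what fixes the time coupling. -/
lemma integral_parityIndicator {δ Δ jt : ℝ} (hδ : 0 ≤ δ) (hΔ : 0 < Δ)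
    (hjt : Real.tanh jt = Real.exp (-(2 * δ * Δ))) (s : ZMod M → ℤˣ) :
    ∫ D, parityIndicator Δ s D ∂(poissonProcess δ (M * Δ)) =
      (2 * Real.cosh jt)⁻¹ ^ M * columnWeight jt s := by
  simp only [parityIndicator_eq_sum]
  rw [integral_const_mul, integral_finsetSum _ fun A _ =>
    (integrable_cellParity hδ hΔ A).const_mul _]
  simp only [integral_const_mul, integral_cellParity hδ hΔ, ← hjt]
  have h1 : ∀ A : Finset (ZMod M), (∏ j ∈ A, ((s j : ℤ) : ℝ) * ((s (j + 1) : ℤ) : ℝ)) *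
      Real.tanh jt ^ A.card =
      ∏ j ∈ A, (((s j : ℤ) : ℝ) * ((s (j + 1) : ℤ) : ℝ) * Real.tanh jt) := by
    intro A
    rw [← Finset.prod_const, ← Finset.prod_mul_distrib]
  have h2 := Finset.prod_one_add (f := fun j : ZMod M =>
    (((s j : ℤ) : ℝ) * ((s (j + 1) : ℤ) : ℝ) * Real.tanh jt)) Finset.univ
  rw [Finset.powerset_univ] at h2
  simp only [h1]
  rw [← h2]
  simp only [one_add_mul_tanh]
  rw [Finset.prod_div_distrib, Finset.prod_const, Finset.card_univ, ZMod.card, ← Real.exp_sum,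
    ← Finset.mul_sum]
  unfold columnWeight
  rw [mul_inv, mul_pow, inv_pow (Real.cosh jt)]
  simp only [one_div]
  ring

lemma prod_succ_eq (s : ZMod M → ℝ) : ∏ j, s (j + 1) = ∏ j, s j :=
  Equiv.prod_comp (Equiv.addRight (1 : ZMod M)) s

/-- The increments of a periodic sequence of signs multiply to 1, whereas the parities of all cells
multiply to (-1)^|D|. The conditioning on an even number of points therefore affects only the
normalization. -/
lemma parityIndicator_eq_zero_of_odd (Δ : ℝ) (s : ZMod M → ℤˣ) {D : PointConfig}
    (hD : ¬ Even D.1) : parityIndicator Δ s D = 0 := by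
  by_contra hcon
  unfold parityIndicator at hcon
  rw [← ne_eq, Finset.prod_ne_zero_iff] at hcon
  have h1 : ∀ j, cellParity M Δ {j} D * (((s j : ℤ) : ℝ) * ((s (j + 1) : ℤ) : ℝ)) = 1 := by
    intro j
    have h := hcon j (Finset.mem_univ _)
    rcases cellParity_eq_or Δ {j} D with h1 | h1 <;>
    rcases Int.units_eq_one_or (s j) with h2 | h2 <;>
    rcases Int.units_eq_one_or (s (j + 1)) with h3 | h3 <;>
    simp [h1, h2, h3] at h ⊢
  have h2 : ∏ j, (cellParity M Δ {j} D * (((s j : ℤ) : ℝ) * ((s (j + 1) : ℤ) : ℝ))) = 1 :=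
    Finset.prod_eq_one fun j _ => h1 j
  rw [Finset.prod_mul_distrib, Finset.prod_mul_distrib, ← cellParity_eq_prod, cellParity_univ,
    prod_succ_eq fun j => ((s j : ℤ) : ℝ), ← sq, ← Finset.prod_pow,
    Finset.prod_eq_one fun j _ => sign_sq (s j), mul_one,
    (Nat.not_even_iff_odd.mp hD).neg_one_pow] at h2
  norm_num at h2

lemma val_succ_cases (j : ZMod M) :
    (j.val + 1 < M ∧ (j + 1).val = j.val + 1) ∨ (j.val + 1 = M ∧ (j + 1).val = 0) := by
  have h0 : j + 1 = ((j.val + 1 : ℕ) : ZMod M) := by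
    push_cast; rw [ZMod.natCast_zmod_val]
  have hj := ZMod.val_lt j
  rw [h0, ZMod.val_natCast]
  rcases Nat.lt_or_ge (j.val + 1) M with h | h
  · exact Or.inl ⟨h, Nat.mod_eq_of_lt h⟩
  · have : j.val + 1 = M := le_antisymm hj h
    exact Or.inr ⟨this, by rw [this, Nat.mod_self]⟩

lemma eq_of_zero_of_increments {c s : ZMod M → ℤˣ} (h0 : c 0 = s 0)
    (h : ∀ j, c j * c (j + 1) = s j * s (j + 1)) : c = s := by
  have key : ∀ n : ℕ, c (n : ZMod M) = s (n : ZMod M) := by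
    intro n
    induction n with
    | zero => simpa using h0
    | succ k ih =>
      have := h (k : ZMod M)
      rw [ih] at this
      push_cast
      exact mul_left_cancel this
  funext j
  rw [← ZMod.natCast_zmod_val j]
  exact key _

/-- A sequence of signs is determined by its value at 0 and its increments, and (1 + uv)/2 is the
indicator that two signs u, v agree. -/
lemma indicator_eq_prod (c s : ZMod M → ℤˣ) :
    (if c = s then (1 : ℝ) else 0) = (1 / 2) * (1 + ((c 0 : ℤ) : ℝ) * ((s 0 : ℤ) : ℝ)) *
      ∏ j, (1 / 2) * (1 + (((c j : ℤ) : ℝ) * ((c (j + 1) : ℤ) : ℝ)) *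
        (((s j : ℤ) : ℝ) * ((s (j + 1) : ℤ) : ℝ))) := by
  split_ifs with h
  · subst h
    have h1 : ∀ j, (1 / 2) * (1 + (((c j : ℤ) : ℝ) * ((c (j + 1) : ℤ) : ℝ)) *
        (((c j : ℤ) : ℝ) * ((c (j + 1) : ℤ) : ℝ))) = 1 := by
      intro j
      have := sign_sq (c j); have := sign_sq (c (j + 1))
      rw [show (1 / 2) * (1 + (((c j : ℤ) : ℝ) * ((c (j + 1) : ℤ) : ℝ)) *
        (((c j : ℤ) : ℝ) * ((c (j + 1) : ℤ) : ℝ))) =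
        (1 / 2) * (1 + ((c j : ℤ) : ℝ) ^ 2 * ((c (j + 1) : ℤ) : ℝ) ^ 2) by ring,
        sign_sq, sign_sq]
      norm_num
    rw [Finset.prod_congr rfl fun j _ => h1 j, Finset.prod_const_one, ← sq, sign_sq]
    norm_num
  · by_contra hcon
    have hcon := Ne.symm hcon
    rw [mul_ne_zero_iff, Finset.prod_ne_zero_iff] at hcon
    refine h (eq_of_zero_of_increments ?_ fun j => ?_)
    · have := hcon.1
      rcases Int.units_eq_one_or (c 0) with h1 | h1 <;>
      rcases Int.units_eq_one_or (s 0) with h2 | h2 <;>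
      simp [h1, h2] at this ⊢
    · have := hcon.2 j (Finset.mem_univ _)
      rcases Int.units_eq_one_or (c j) with h1 | h1 <;>
      rcases Int.units_eq_one_or (s j) with h2 | h2 <;>
      rcases Int.units_eq_one_or (c (j + 1)) with h3 | h3 <;>
      rcases Int.units_eq_one_or (s (j + 1)) with h4 | h4 <;>
      simp [h1, h2, h3, h4] at this ⊢

/-- The path of the spin of one site, given its points and its initial sign. -/
def columnSpin (b : ℝ) (y : PointConfig × Fin 2) (t : ℝ) : ℤˣ :=
  (-1) ^ ((y.2 : ℕ) + Nat.card {i : Fin y.1.1 // y.1.2 i ≤ b * Int.fract (t / b)})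

lemma spin_eq_columnSpin {d : ℕ} {N : ℕ+} (b : ℝ) (ω : Sample d N) (x : Torus d N) (t : ℝ) :
    spin b ω (x, t) = columnSpin b (ω.1 x, ω.2 x) t := rfl

/-- The sign of the parity of the number of points up to a given time. -/
def pathSign (u : ℝ) (D : PointConfig) : ℝ := pointProd (fun v => if v ≤ u then -1 else 1) D

lemma coe_columnSpin (b : ℝ) (y : PointConfig × Fin 2) (t : ℝ) :
    ((columnSpin b y t : ℤ) : ℝ) = (-1) ^ (y.2 : ℕ) * pathSign (b * Int.fract (t / b)) y.1 := by
  unfold columnSpin pathSign pointProd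
  rw [pow_add]
  push_cast
  congr 1
  rw [Finset.prod_ite, Finset.prod_const, Finset.prod_const_one, mul_one, Nat.card_eq_fintype_card,
    Fintype.card_subtype]

lemma fract_grid {Δ : ℝ} (hΔ : 0 < Δ) {k : ℕ} (hk : k < M) :
    (M * Δ) * Int.fract (k * Δ / (M * Δ)) = k * Δ := by
  have hM : (0 : ℝ) < M := by exact_mod_cast (Nat.pos_of_ne_zero (NeZero.ne M))
  rw [Int.fract_eq_self.mpr]
  · field_simp
  · refine ⟨by positivity, ?_⟩
    rw [div_lt_one (by positivity)]
    exact mul_lt_mul_of_pos_right (by exact_mod_cast hk) hΔ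

/-- Points in general position with respect to the grid. -/
def GridGeneric (M : ℕ) (Δ : ℝ) (D : PointConfig) : Prop :=
  ∀ i, D.2 i ∈ Set.Ico 0 (M * Δ) ∧ D.2 i ∉ Set.range fun k : ℤ => (k : ℝ) * Δ

lemma ae_gridGeneric (δ Δ : ℝ) : ∀ᵐ D ∂(poissonProcess δ (M * Δ)), GridGeneric M Δ D :=
  ae_points (Set.countable_range _)

lemma cellIndex_eq_natCast_iff {Δ : ℝ} (hΔ : 0 < Δ) {u : ℝ} (hu : u ∈ Set.Ico 0 (M * Δ)) {k : ℕ}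
    (hk : k < M) : cellIndex M Δ u = (k : ZMod M) ↔ ⌊u / Δ⌋ = k := by
  have h0 : 0 ≤ ⌊u / Δ⌋ := Int.floor_nonneg.mpr (div_nonneg hu.1 hΔ.le)
  have h1 : ⌊u / Δ⌋ < M := by
    rw [Int.floor_lt, div_lt_iff₀ hΔ]; exact_mod_cast hu.2
  unfold cellIndex
  rw [show ((k : ℕ) : ZMod M) = (((k : ℕ) : ℤ) : ZMod M) by push_cast; rfl,
    ZMod.intCast_eq_intCast_iff']
  rw [Int.emod_eq_of_lt h0 h1, Int.emod_eq_of_lt (by positivity) (by exact_mod_cast hk)]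

lemma pathSign_zero {Δ : ℝ} {D : PointConfig} (hD : GridGeneric M Δ D) : pathSign 0 D = 1 := by
  unfold pathSign pointProd
  refine Finset.prod_eq_one fun i _ => ?_
  beta_reduce
  rw [if_neg]
  intro h
  exact (hD i).2 ⟨0, by simpa using le_antisymm (hD i).1.1 h⟩

lemma pathSign_top {Δ : ℝ} {D : PointConfig} (hD : GridGeneric M Δ D) (he : Even D.1) :
    pathSign (M * Δ) D = 1 := by
  unfold pathSign pointProd
  rw [Finset.prod_congr rfl fun i _ => if_pos (hD i).1.2.le]
  simpa using he.neg_one_pow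

lemma pathSign_succ {Δ : ℝ} (hΔ : 0 < Δ) {D : PointConfig} (hD : GridGeneric M Δ D) {k : ℕ}
    (hk : k < M) : pathSign ((k + 1 : ℕ) * Δ) D =
      pathSign (k * Δ) D * cellParity M Δ {(k : ZMod M)} D := by
  unfold pathSign cellParity pointProd
  rw [← Finset.prod_mul_distrib]
  refine Finset.prod_congr rfl fun i _ => ?_
  have hu := hD i
  generalize D.2 i = u at hu
  -- `pathSign` counts points up to and including a grid time, while cells contain their left ends;
  -- the two conventions agree only away from the grid.
  have hne : ∀ m : ℤ, u ≠ m * Δ := fun m h => hu.2 ⟨m, h.symm⟩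
  have hk0 := hne k
  have hk1 := hne (k + 1)
  push_cast at hk0 hk1
  simp only [Finset.mem_singleton, cellIndex_eq_natCast_iff hΔ hu.1 hk, Int.floor_eq_iff,
    le_div_iff₀ hΔ, div_lt_iff₀ hΔ]
  push_cast
  rcases lt_or_gt_of_ne hk0 with h0 | h0
  · rw [if_pos (by nlinarith), if_pos h0.le, if_neg (by rintro ⟨h, -⟩; linarith)]
    ring
  · rcases lt_or_gt_of_ne hk1 with h1 | h1
    · rw [if_pos h1.le, if_neg (by linarith), if_pos ⟨h0.le, h1⟩]; ring
    · rw [if_neg (by linarith), if_neg (by linarith), if_neg (by rintro ⟨-, h⟩; linarith)]; ring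

/-- The spins of a site on the grid. -/
def gridColumn (M : ℕ) (Δ : ℝ) (y : PointConfig × Fin 2) (j : ZMod M) : ℤˣ :=
  columnSpin (M * Δ) y (j.val * Δ)

lemma coe_gridColumn {Δ : ℝ} (hΔ : 0 < Δ) (y : PointConfig × Fin 2) (j : ZMod M) :
    ((gridColumn M Δ y j : ℤ) : ℝ) = (-1) ^ (y.2 : ℕ) * pathSign (j.val * Δ) y.1 := by
  unfold gridColumn
  rw [coe_columnSpin, fract_grid hΔ (ZMod.val_lt j)]

/-- For the last cell the path must close up, which is where the even number of points enters. -/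
lemma pathSign_mul_succ {Δ : ℝ} (hΔ : 0 < Δ) {D : PointConfig} (hD : GridGeneric M Δ D)
    (he : Even D.1) (j : ZMod M) :
    pathSign ((j + 1).val * Δ) D = pathSign (j.val * Δ) D * cellParity M Δ {j} D := by
  have h1 := pathSign_succ hΔ hD (ZMod.val_lt j)
  rw [ZMod.natCast_zmod_val] at h1
  rw [← h1]
  rcases val_succ_cases j with ⟨-, h2⟩ | ⟨h2, h3⟩
  · rw [h2]
  · rw [h2, h3, pathSign_top hD he, Nat.cast_zero, zero_mul, pathSign_zero hD]

lemma pathSign_sq (u : ℝ) (D : PointConfig) : pathSign u D ^ 2 = 1 := by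
  unfold pathSign pointProd
  rw [← Finset.prod_pow]
  refine Finset.prod_eq_one fun i _ => ?_
  beta_reduce
  split_ifs <;> norm_num

lemma indicator_gridColumn {Δ : ℝ} (hΔ : 0 < Δ) {y : PointConfig × Fin 2}
    (hD : GridGeneric M Δ y.1) (he : Even y.1.1) (s : ZMod M → ℤˣ) :
    (if gridColumn M Δ y = s then (1 : ℝ) else 0) =
      parityIndicator Δ s y.1 * ((1 / 2) * (1 + (-1) ^ (y.2 : ℕ) * ((s 0 : ℤ) : ℝ))) := by
  rw [indicator_eq_prod, mul_comm]
  simp only [coe_gridColumn hΔ]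
  congr 1
  · unfold parityIndicator
    refine Finset.prod_congr rfl fun j _ => ?_
    rw [pathSign_mul_succ hΔ hD he]
    congr 3
    have h1 : ((-1 : ℝ) ^ (y.2 : ℕ)) ^ 2 = 1 := by rw [← pow_mul, mul_comm, pow_mul]; simp
    have h2 := pathSign_sq (j.val * Δ) y.1
    linear_combination (cellParity M Δ {j} y.1) * (h2 + pathSign (j.val * Δ) y.1 ^ 2 * h1)
  · rw [ZMod.val_zero, Nat.cast_zero, zero_mul, pathSign_zero hD, mul_one]

/-- The probability that the Poisson process has an even number of points. -/
def evenMass (δ b : ℝ) : ℝ := (poissonProcess δ b {D | Even D.1}).toReal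

/-- Were the number of points almost surely odd, the mean of (-1)^|D| would be -1; by the generating
functional it is a positive exponential. -/
lemma evenMass_pos {δ b : ℝ} (hδ : 0 ≤ δ) (hb : 0 ≤ b) : 0 < evenMass δ b := by
  have := poissonProcess_isProbabilityMeasure hδ hb
  have h1 := integral_pointProd (β := b) hδ hb (measurable_const (a := (-1 : ℝ)))
    (fun _ => by simp)
  by_contra hcon
  have h0 : poissonProcess δ b {D | Even D.1} = 0 := by
    have h2 : evenMass δ b = 0 := le_antisymm (not_lt.mp hcon) ENNReal.toReal_nonneg
    rcases (ENNReal.toReal_eq_zero_iff _).mp h2 with h | h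
    · exact h
    · exact absurd h (measure_ne_top _ _)
  have h3 : ∀ᵐ D ∂(poissonProcess δ b), pointProd (fun _ => (-1 : ℝ)) D = -1 := by
    filter_upwards [measure_eq_zero_iff_ae_notMem.mp h0] with D hD
    simp only [pointProd, Finset.prod_const, Finset.card_univ, Fintype.card_fin]
    exact (Nat.not_even_iff_odd.mp hD).neg_one_pow
  rw [integral_congr_ae h3] at h1
  simp only [integral_const, probReal_univ, smul_eq_mul, one_mul] at h1
  linarith [Real.exp_pos (-(δ * b) + δ * ((volume : Measure ℝ).restrict (Set.Ico 0 b)).real Set.univ * (-1)),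
    Real.exp_pos (-(δ * b) + δ * (((volume : Measure ℝ).restrict (Set.Ico 0 b)).real Set.univ * (-1)))]

lemma evenPoissonProcess_isProbabilityMeasure {δ b : ℝ} (hδ : 0 ≤ δ) (hb : 0 ≤ b) :
    IsProbabilityMeasure (evenPoissonProcess δ b) := by
  have := poissonProcess_isProbabilityMeasure hδ hb
  refine cond_isProbabilityMeasure fun h => ?_
  have := evenMass_pos hδ hb
  unfold evenMass at this
  simp [h] at this

/-- The law of the points and the initial sign of one site. -/
def columnLaw (δ b : ℝ) : Measure (PointConfig × Fin 2) :=
  (evenPoissonProcess δ b).prod (PMF.uniformOfFintype (Fin 2)).toMeasure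

lemma columnLaw_isProbabilityMeasure {δ b : ℝ} (hδ : 0 ≤ δ) (hb : 0 ≤ b) :
    IsProbabilityMeasure (columnLaw δ b) := by
  have := evenPoissonProcess_isProbabilityMeasure hδ hb
  unfold columnLaw
  infer_instance

lemma indicator_gridColumn_ae {δ Δ : ℝ} (hδ : 0 ≤ δ) (hΔ : 0 < Δ) (s : ZMod M → ℤˣ) :
    (fun y => if gridColumn M Δ y = s then (1 : ℝ) else 0) =ᵐ[columnLaw δ (M * Δ)]
      fun y => parityIndicator Δ s y.1 * ((1 / 2) * (1 + (-1) ^ (y.2 : ℕ) * ((s 0 : ℤ) : ℝ))) := by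
  have := evenPoissonProcess_isProbabilityMeasure (b := M * Δ) hδ (by positivity)
  have h1 : ∀ᵐ D ∂(evenPoissonProcess δ (M * Δ)), GridGeneric M Δ D ∧ Even D.1 := by
    filter_upwards [cond_absolutelyContinuous.ae_le (ae_gridGeneric (M := M) δ Δ),
      ae_cond_mem (μ := poissonProcess δ (M * Δ)) measurableSet_even] with D h2 h3 using ⟨h2, h3⟩
  filter_upwards [Measure.quasiMeasurePreserving_fst.ae h1] with y hy
  exact indicator_gridColumn hΔ hy.1 hy.2 s

lemma integrable_indicator_gridColumn {δ Δ : ℝ} (hδ : 0 ≤ δ) (hΔ : 0 < Δ) (s : ZMod M → ℤˣ) :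
    Integrable (fun y => if gridColumn M Δ y = s then (1 : ℝ) else 0) (columnLaw δ (M * Δ)) := by
  have h0 := evenPoissonProcess_isProbabilityMeasure (b := M * Δ) hδ (by positivity)
  refine Integrable.congr ?_ (indicator_gridColumn_ae hδ hΔ s).symm
  have h1 : Integrable (parityIndicator Δ s) (evenPoissonProcess δ (M * Δ)) := by
    unfold evenPoissonProcess ProbabilityTheory.cond
    refine (integrable_parityIndicator hδ hΔ s).restrict.smul_measure ?_
    have h2 := evenMass_pos (b := M * Δ) hδ (by positivity)
    intro h
    rw [ENNReal.inv_eq_top] at h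
    unfold evenMass at h2
    simp [h] at h2
  exact h1.mul_prod (Integrable.of_finite (f := fun k : Fin 2 =>
    (1 / 2) * (1 + (-1 : ℝ) ^ (k : ℕ) * ((s 0 : ℤ) : ℝ))))

lemma integral_indicator_gridColumn {δ Δ jt : ℝ} (hδ : 0 ≤ δ) (hΔ : 0 < Δ)
    (hjt : Real.tanh jt = Real.exp (-(2 * δ * Δ))) (s : ZMod M → ℤˣ) :
    ∫ y, (if gridColumn M Δ y = s then (1 : ℝ) else 0) ∂(columnLaw δ (M * Δ)) =
      (evenMass δ (M * Δ))⁻¹ * (2 * Real.cosh jt)⁻¹ ^ M * (1 / 2) * columnWeight jt s := by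
  have h0 := evenPoissonProcess_isProbabilityMeasure (b := M * Δ) hδ (by positivity)
  rw [integral_congr_ae (indicator_gridColumn_ae hδ hΔ s)]
  unfold columnLaw
  rw [integral_prod_mul (parityIndicator Δ s)
    (fun k : Fin 2 => (1 / 2) * (1 + (-1 : ℝ) ^ (k : ℕ) * ((s 0 : ℤ) : ℝ)))]
  have h1 : ∫ D, parityIndicator Δ s D ∂(evenPoissonProcess δ (M * Δ)) =
      (evenMass δ (M * Δ))⁻¹ * ((2 * Real.cosh jt)⁻¹ ^ M * columnWeight jt s) := by
    unfold evenPoissonProcess ProbabilityTheory.cond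
    rw [integral_smul_measure, setIntegral_eq_integral_of_ae_compl_eq_zero,
      integral_parityIndicator hδ hΔ hjt, ENNReal.toReal_inv, smul_eq_mul]
    · rfl
    · exact Eventually.of_forall fun D hD => parityIndicator_eq_zero_of_odd Δ s hD
  have h2 : ∫ k : Fin 2, (1 / 2) * (1 + (-1 : ℝ) ^ (k : ℕ) * ((s 0 : ℤ) : ℝ))
      ∂(PMF.uniformOfFintype (Fin 2)).toMeasure = 1 / 2 := by
    rw [PMF.integral_eq_sum]
    simp
    ring
  rw [h1, h2]
  ring

end Column

/-! ### The law of the spins on a grid -/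

section GridLaw

variable {d : ℕ} {N : ℕ+} {M : ℕ} [NeZero M]

/-- The spins at the points of a grid. -/
def gridSpins (M : ℕ) (Δ : ℝ) (ω : Sample d N) : Grid d N M → ℤˣ :=
  fun p => spin (M * Δ) ω (p.1, p.2.val * Δ)

lemma aPriori_isProbabilityMeasure {δ b : ℝ} (hδ : 0 ≤ δ) (hb : 0 ≤ b) :
    IsProbabilityMeasure (aPriori d N δ b) := by
  have := evenPoissonProcess_isProbabilityMeasure hδ hb
  unfold aPriori
  infer_instance

lemma measurePreserving_columns {δ b : ℝ} (hδ : 0 ≤ δ) (hb : 0 ≤ b) :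
    MeasurePreserving (MeasurableEquiv.arrowProdEquivProdArrow PointConfig (Fin 2) (Torus d N))
      (Measure.pi fun _ => columnLaw δ b) (aPriori d N δ b) := by
  have := evenPoissonProcess_isProbabilityMeasure hδ hb
  exact measurePreserving_arrowProdEquivProdArrow PointConfig (Fin 2) (Torus d N)
    (fun _ => evenPoissonProcess δ b) (fun _ => (PMF.uniformOfFintype (Fin 2)).toMeasure)

/-- The expectation is decomposed according to the values of all columns, which are independent,
each with law proportional to `columnWeight`. -/
lemma integral_gridSpins {δ Δ jt : ℝ} (hδ : 0 ≤ δ) (hΔ : 0 < Δ)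
    (hjt : Real.tanh jt = Real.exp (-(2 * δ * Δ))) (F : (Grid d N M → ℤˣ) → ℝ) :
    ∫ ω, F (gridSpins M Δ ω) ∂(aPriori d N δ (M * Δ)) =
      ((evenMass δ (M * Δ))⁻¹ * (2 * Real.cosh jt)⁻¹ ^ M * (1 / 2)) ^ Fintype.card (Torus d N) *
        ∑ s : Torus d N → ZMod M → ℤˣ, F (spaceCurry s) * ∏ x, columnWeight jt (s x) := by
  have hb : 0 ≤ M * Δ := by positivity
  have := columnLaw_isProbabilityMeasure hδ hb
  rw [← (measurePreserving_columns hδ hb).integral_comp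
    (MeasurableEquiv.measurableEmbedding _)]
  have h1 : ∀ y : Torus d N → PointConfig × Fin 2,
      F (gridSpins M Δ (MeasurableEquiv.arrowProdEquivProdArrow PointConfig (Fin 2) (Torus d N) y)) =
      ∑ s : Torus d N → ZMod M → ℤˣ, F (spaceCurry s) *
        ∏ x, if gridColumn M Δ (y x) = s x then (1 : ℝ) else 0 := by
    intro y
    rw [Finset.sum_eq_single (fun x => gridColumn M Δ (y x))]
    · simp only [if_true, Finset.prod_const_one, mul_one]
      rfl
    · intro s _ hs
      have : ∃ x, gridColumn M Δ (y x) ≠ s x := by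
        by_contra hcon
        push Not at hcon
        exact hs (funext fun x => (hcon x).symm)
      obtain ⟨x, hx⟩ := this
      rw [Finset.prod_eq_zero (Finset.mem_univ x) (if_neg hx), mul_zero]
    · intro h; exact absurd (Finset.mem_univ _) h
  simp only [h1]
  rw [integral_finsetSum]
  · rw [Finset.mul_sum]
    refine Finset.sum_congr rfl fun s _ => ?_
    rw [integral_const_mul, integral_fintype_prod_eq_prod (fun x (z : PointConfig × Fin 2) =>
      if gridColumn M Δ z = s x then (1 : ℝ) else 0)]
    simp only [integral_indicator_gridColumn hδ hΔ hjt]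
    rw [Finset.prod_mul_distrib, Finset.prod_const, Finset.card_univ]
    ring
  · intro s _
    exact (Integrable.fintype_prod (f := fun x (z : PointConfig × Fin 2) =>
      if gridColumn M Δ z = s x then (1 : ℝ) else 0)
      fun x => integrable_indicator_gridColumn hδ hΔ (s x)).const_mul _

/-- The sum of the products of neighbouring spins at equal times. -/
def spatialEnergy (s : Grid d N M → ℤˣ) : ℝ :=
  ∑ x, ∑ i, ∑ j, ((s (x, j) : ℤ) : ℝ) * ((s (x + Pi.single i 1, j) : ℤ) : ℝ)

/-- The discrete Ising model is exactly the law on the grid of the Poisson spins, reweighted by a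
Riemann sum of the interaction; the constants of `integral_gridSpins` cancel in the quotient. -/
lemma gridAvg_eq_integral_div {δ Δ jt : ℝ} (hδ : 0 ≤ δ) (hΔ : 0 < Δ)
    (hjt : Real.tanh jt = Real.exp (-(2 * δ * Δ))) (js : ℝ) (F : (Grid d N M → ℤˣ) → ℝ) :
    gridAvg jt js F =
      (∫ ω, F (gridSpins M Δ ω) * Real.exp (js * spatialEnergy (gridSpins M Δ ω))
        ∂(aPriori d N δ (M * Δ))) /
      ∫ ω, Real.exp (js * spatialEnergy (gridSpins M Δ ω)) ∂(aPriori d N δ (M * Δ)) := by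
  have key : ∀ G : (Grid d N M → ℤˣ) → ℝ,
      ∫ ω, G (gridSpins M Δ ω) * Real.exp (js * spatialEnergy (gridSpins M Δ ω))
        ∂(aPriori d N δ (M * Δ)) =
      ((evenMass δ (M * Δ))⁻¹ * (2 * Real.cosh jt)⁻¹ ^ M * (1 / 2)) ^ Fintype.card (Torus d N) *
        gibbsSum (bondHom (gridDir (d := d) (N := N) (M := M)))
          (fun e => gridCoupling jt js e.2) G := by
    intro G
    rw [integral_gridSpins hδ hΔ hjt
      (fun s => G s * Real.exp (js * spatialEnergy s))]
    congr 1
    unfold gibbsSum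
    rw [← Equiv.sum_comp spaceCurry]
    refine Finset.sum_congr rfl fun s _ => ?_
    rw [sum_gridCoupling_mul, mul_assoc]
    congr 1
    unfold columnWeight gridEnergy spatialEnergy
    rw [← Real.exp_sum, ← Real.exp_add]
    congr 1
    rw [← Finset.mul_sum, add_comm]
    rfl
  have h2 := key 1
  simp only [Pi.one_apply, one_mul] at h2
  have h3 := key F
  rw [h2, h3]
  unfold gridAvg gibbsAvg
  rw [mul_div_mul_left]
  have := evenMass_pos (b := M * Δ) hδ (by positivity)
  have := Real.cosh_pos jt
  positivity

end GridLaw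

/-! ### The continuum limit -/

section Continuum

variable {d : ℕ} {N : ℕ+}

lemma measurable_pathSign (u : ℝ) : Measurable (pathSign u) :=
  measurable_pointProd (Measurable.ite measurableSet_Iic measurable_const measurable_const)

lemma measurable_spin_real (b : ℝ) (p : Torus d N × ℝ) :
    Measurable fun ω : Sample d N => ((spin b ω p : ℤ) : ℝ) := by
  obtain ⟨x, t⟩ := p
  simp only [spin_eq_columnSpin, coe_columnSpin]
  have h1 : Measurable fun k : Fin 2 => (-1 : ℝ) ^ (k : ℕ) := measurable_from_top
  exact (h1.comp ((measurable_pi_apply x).comp measurable_snd)).mul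
    ((measurable_pathSign _).comp ((measurable_pi_apply x).comp measurable_fst))

lemma measurable_spin_apply (b : ℝ) (p : Torus d N × ℝ) :
    Measurable fun ω : Sample d N => spin b ω p := by
  have h1 : (fun ω : Sample d N => spin b ω p) =
      (fun r : ℝ => if r = 1 then (1 : ℤˣ) else -1) ∘ fun ω => ((spin b ω p : ℤ) : ℝ) := by
    funext ω
    simp only [Function.comp]
    rcases Int.units_eq_one_or (spin b ω p) with h | h <;> simp [h]; norm_num
  rw [h1]
  exact (Measurable.ite (measurableSet_singleton 1) measurable_const measurable_const).comp
    (measurable_spin_real b p)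

lemma measurable_spin (b : ℝ) : Measurable (spin (d := d) (N := N) b) :=
  measurable_pi_iff.mpr fun p => measurable_spin_apply b p

lemma fract_of_mem {b t : ℝ} (ht : t ∈ Set.Ico 0 b) : b * Int.fract (t / b) = t := by
  have hb : 0 < b := ht.1.trans_lt ht.2
  rw [Int.fract_eq_self.mpr ⟨div_nonneg ht.1 hb.le, (div_lt_one hb).mpr ht.2⟩]
  field_simp

/-- A path is continuous away from its jumps. -/
lemma tendsto_spin {b t : ℝ} {u : ℕ → ℝ} (hu : Tendsto u atTop (𝓝 t)) (ht : t ∈ Set.Ico 0 b)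
    (hub : ∀ n, u n ∈ Set.Ico 0 b) (ω : Sample d N) (x : Torus d N)
    (hD : ∀ i, (ω.1 x).2 i ≠ t) :
    Tendsto (fun n => ((spin b ω (x, u n) : ℤ) : ℝ)) atTop (𝓝 ((spin b ω (x, t) : ℤ) : ℝ)) := by
  simp only [spin_eq_columnSpin, coe_columnSpin, fract_of_mem ht, fract_of_mem (hub _)]
  refine tendsto_const_nhds.mul ?_
  unfold pathSign pointProd
  refine tendsto_finsetProd _ fun i _ => ?_
  refine tendsto_const_nhds.congr' ?_
  rcases lt_or_gt_of_ne (hD i) with h | h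
  · filter_upwards [hu.eventually (lt_mem_nhds h)] with n hn
    rw [if_pos h.le, if_pos hn.le]
  · filter_upwards [hu.eventually (gt_mem_nhds h)] with n hn
    rw [if_neg (not_le.mpr h), if_neg (not_le.mpr hn)]

/-- The mesh of the grid with `2 (n + 1)` points. -/
def mesh (b : ℝ) (n : ℕ) : ℝ := b / (2 * (n + 1) : ℕ)

lemma mesh_pos {b : ℝ} (hb : 0 < b) (n : ℕ) : 0 < mesh b n := by
  unfold mesh; positivity

lemma mul_mesh (b : ℝ) (n : ℕ) : ((2 * (n + 1) : ℕ) : ℝ) * mesh b n = b := by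
  unfold mesh; push_cast; field_simp

lemma tendsto_mesh (b : ℝ) : Tendsto (mesh b) atTop (𝓝 0) := by
  have h1 : Tendsto (fun n : ℕ => (2 * (n + 1) : ℕ)) atTop atTop :=
    tendsto_atTop_mono (fun n => show n ≤ 2 * (n + 1) by omega) tendsto_id
  exact tendsto_const_nhds.div_atTop (tendsto_natCast_atTop_atTop.comp h1)

/-- Rounding down to the grid. -/
lemma tendsto_floor_mesh {b : ℝ} (hb : 0 < b) (t : ℝ) :
    Tendsto (fun n => (⌊t / mesh b n⌋ : ℝ) * mesh b n) atTop (𝓝 t) := by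
  have h1 : Tendsto (fun n => t - mesh b n) atTop (𝓝 t) := by
    simpa using tendsto_const_nhds.sub (tendsto_mesh b) (a := t)
  refine tendsto_of_tendsto_of_tendsto_of_le_of_le h1 tendsto_const_nhds (fun n => ?_) fun n => ?_
  · have h2 := Int.lt_floor_add_one (t / mesh b n)
    rw [div_lt_iff₀ (mesh_pos hb n)] at h2
    beta_reduce
    linarith
  · have h2 := Int.floor_le (t / mesh b n)
    rwa [le_div_iff₀ (mesh_pos hb n)] at h2

lemma floor_mesh_mem {b : ℝ} (hb : 0 < b) {t : ℝ} (ht : t ∈ Set.Ico 0 b) (n : ℕ) :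
    (⌊t / mesh b n⌋ : ℝ) * mesh b n ∈ Set.Ico 0 b := by
  have hm := mesh_pos hb n
  refine ⟨mul_nonneg ?_ hm.le, ?_⟩
  · exact_mod_cast Int.floor_nonneg.mpr (div_nonneg ht.1 hm.le)
  · have h2 := Int.floor_le (t / mesh b n)
    rw [le_div_iff₀ hm] at h2
    exact h2.trans_lt ht.2

/-- The spins on the grid with `2 (n + 1)` points. -/
abbrev meshSpins (b : ℝ) (n : ℕ) (ω : Sample d N) : Grid d N (2 * (n + 1)) → ℤˣ :=
  gridSpins (2 * (n + 1)) (mesh b n) ω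

lemma meshSpins_apply (b : ℝ) (n : ℕ) (ω : Sample d N) (x : Torus d N)
    (j : ZMod (2 * (n + 1))) :
    meshSpins b n ω (x, j) = spin b ω (x, j.val * mesh b n) := by
  change spin _ _ _ = _
  rw [mul_mesh]

lemma tendsto_spatialEnergy {b : ℝ} (hb : 0 < b) (ω : Sample d N) :
    Tendsto (fun n => mesh b n * spatialEnergy (meshSpins b n ω)) atTop
      (𝓝 (interaction b ω)) := by
  unfold spatialEnergy interaction
  simp only [Finset.mul_sum]
  refine tendsto_finsetSum _ fun x _ => tendsto_finsetSum _ fun i _ => ?_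
  set f : ℝ → ℝ := fun t => ((spin b ω (x, t) : ℤ) : ℝ) *
    ((spin b ω (x + Pi.single i 1, t) : ℤ) : ℝ) with hf
  have h1 : ∀ n, ∑ j : ZMod (2 * (n + 1)), mesh b n *
      (((meshSpins b n ω (x, j) : ℤ) : ℝ) *
        ((meshSpins b n ω (x + Pi.single i 1, j) : ℤ) : ℝ)) =
      ∫ t in (0 : ℝ)..b, f (⌊t / mesh b n⌋ * mesh b n) := by
    intro n
    have h2 := integral_step (mesh_pos hb n) (2 * (n + 1)) fun k => f (k * mesh b n)
    rw [mul_mesh] at h2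
    rw [h2, ← Finset.mul_sum]
    congr 1
    rw [← sum_range_eq_sum_zmod (2 * (n + 1))]
    refine Finset.sum_congr rfl fun j hj => ?_
    rw [meshSpins_apply, meshSpins_apply, ZMod.val_natCast,
      Nat.mod_eq_of_lt (Finset.mem_range.mp hj)]
    simp [hf]
  simp only [h1]
  have h4 : ∫ t in (0 : ℝ)..b, (((spin b ω (x, t) * spin b ω (x + Pi.single i 1, t) : ℤˣ) : ℤ) : ℝ) =
      ∫ t in (0 : ℝ)..b, f t := by
    simp [hf]
  rw [h4]
  refine intervalIntegral.tendsto_integral_filter_of_dominated_convergence (fun _ => 1) ?_ ?_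
    intervalIntegrable_const ?_
  · refine Eventually.of_forall fun n => ?_
    have : Measurable fun k : ℤ => f (k * mesh b n) := measurable_from_top
    exact (this.comp (Int.measurable_floor.comp
      (measurable_id.div_const _))).aestronglyMeasurable
  · refine Eventually.of_forall fun n => Eventually.of_forall fun t _ => ?_
    rw [Real.norm_eq_abs, hf, abs_mul, abs_sign, abs_sign, one_mul]
  · have hS : (Set.range (ω.1 x).2 ∪ Set.range (ω.1 (x + Pi.single i 1)).2 ∪ {b}).Countable :=
      ((Set.countable_range _).union (Set.countable_range _)).union (Set.countable_singleton _)
    filter_upwards [hS.ae_notMem volume] with t ht htb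
    rw [Set.uIoc_of_le hb.le] at htb
    simp only [Set.mem_union, not_or] at ht
    have ht' : t ∈ Set.Ico 0 b := ⟨htb.1.le, lt_of_le_of_ne htb.2 fun h => ht.2 h⟩
    exact (tendsto_spin (tendsto_floor_mesh hb t) ht' (floor_mesh_mem hb ht') ω _
      fun j hj => ht.1.1 ⟨j, hj⟩).mul
      (tendsto_spin (tendsto_floor_mesh hb t) ht' (floor_mesh_mem hb ht') ω _
      fun j hj => ht.1.2 ⟨j, hj⟩)

lemma measurable_spatialEnergy (b : ℝ) (n : ℕ) :
    Measurable fun ω : Sample d N => spatialEnergy (meshSpins b n ω) := by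
  unfold spatialEnergy
  refine Finset.measurable_sum _ fun x _ => Finset.measurable_sum _ fun i _ =>
    Finset.measurable_sum _ fun j _ => ?_
  exact (measurable_spin_real _ _).mul (measurable_spin_real _ _)

lemma measurable_interaction {b : ℝ} (hb : 0 < b) :
    Measurable (interaction (d := d) (N := N) b) :=
  measurable_of_tendsto_metrizable
    (fun n => (measurable_spatialEnergy b n).const_mul (mesh b n))
    (tendsto_pi_nhds.mpr fun ω => tendsto_spatialEnergy hb ω)

lemma abs_mesh_mul_spatialEnergy_le {b : ℝ} (hb : 0 < b) (n : ℕ) (ω : Sample d N) :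
    |mesh b n * spatialEnergy (meshSpins b n ω)| ≤ Fintype.card (Torus d N) * d * b := by
  rw [abs_mul, abs_of_pos (mesh_pos hb n)]
  have h1 : |spatialEnergy (meshSpins b n ω)| ≤
      Fintype.card (Torus d N) * d * (2 * (n + 1) : ℕ) := by
    unfold spatialEnergy
    have h2 : ∀ x : Torus d N, ∀ i : Fin d, |∑ j, ((meshSpins b n ω (x, j) : ℤ) : ℝ) *
        ((meshSpins b n ω (x + Pi.single i 1, j) : ℤ) : ℝ)| ≤ (2 * (n + 1) : ℕ) := by
      intro x i
      refine (Finset.abs_sum_le_sum_abs _ _).trans_eq ?_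
      simp only [abs_mul, abs_sign, mul_one, Finset.sum_const, Finset.card_univ, ZMod.card,
        nsmul_eq_mul]
    refine (Finset.abs_sum_le_sum_abs _ _).trans ((Finset.sum_le_sum fun x _ =>
      (Finset.abs_sum_le_sum_abs _ _).trans (Finset.sum_le_sum fun i _ => h2 x i)).trans_eq ?_)
    rw [Finset.sum_const, Finset.sum_const, Finset.card_univ, Finset.card_univ, Fintype.card_fin,
      nsmul_eq_mul, nsmul_eq_mul]
    ring
  calc mesh b n * |spatialEnergy (meshSpins b n ω)|
      ≤ mesh b n * (Fintype.card (Torus d N) * d * (2 * (n + 1) : ℕ)) :=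
        mul_le_mul_of_nonneg_left h1 (mesh_pos hb n).le
    _ = Fintype.card (Torus d N) * d * ((2 * (n + 1) : ℕ) * mesh b n) := by ring
    _ = _ := by rw [mul_mesh]

lemma abs_interaction_le {b : ℝ} (hb : 0 < b) (ω : Sample d N) :
    |interaction b ω| ≤ Fintype.card (Torus d N) * d * b :=
  le_of_tendsto (tendsto_spatialEnergy hb ω).abs
    (Eventually.of_forall fun n => abs_mesh_mul_spatialEnergy_le hb n ω)

lemma exp_mul_le_of_abs_le {a u c : ℝ} (h : |u| ≤ c) : Real.exp (a * u) ≤ Real.exp (|a| * c) := by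
  refine Real.exp_le_exp.mpr ((le_abs_self _).trans ?_)
  rw [abs_mul]
  exact mul_le_mul_of_nonneg_left h (abs_nonneg a)

lemma integrable_exp_interaction {δ b : ℝ} (hδ : 0 ≤ δ) (hb : 0 < b) (lam : ℝ) :
    Integrable (fun ω => Real.exp (lam * interaction b ω)) (aPriori d N δ b) := by
  have := aPriori_isProbabilityMeasure (d := d) (N := N) hδ hb.le
  refine Integrable.of_bound
    ((measurable_interaction hb).const_mul lam).exp.aestronglyMeasurable
    (Real.exp (|lam| * (Fintype.card (Torus d N) * d * b))) (Eventually.of_forall fun ω => ?_)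
  rw [Real.norm_eq_abs, Real.abs_exp]
  exact exp_mul_le_of_abs_le (abs_interaction_le hb ω)

lemma measurable_coe_sign {V : Type*} (p : V) :
    Measurable fun σ : V → ℤˣ => ((σ p : ℤ) : ℝ) := by
  have h : Measurable fun u : ℤˣ => ((u : ℤ) : ℝ) := by
    have h1 : Measurable fun u : ℤˣ => (u : ℤ) := comap_measurable _
    exact (measurable_from_top (f := fun k : ℤ => (k : ℝ))).comp h1
  exact h.comp (measurable_pi_apply p)

lemma twoPoint_isingMeasure {δ b : ℝ} (lam : ℝ) (x : Torus d N) (t : ℝ) :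
    twoPoint (isingMeasure d N δ lam b) x t =
      (∫ ω, ((spin b ω (0, 0) : ℤ) : ℝ) * ((spin b ω (x, t) : ℤ) : ℝ) *
        Real.exp (lam * interaction b ω) ∂(aPriori d N δ b)) /
      ∫ ω, Real.exp (lam * interaction b ω) ∂(aPriori d N δ b) := by
  unfold twoPoint isingMeasure
  simp only [Units.val_mul, Int.cast_mul]
  rw [integral_map (f := fun σ : Torus d N × ℝ → ℤˣ =>
      ((σ (0, 0) : ℤ) : ℝ) * ((σ (x, t) : ℤ) : ℝ)) (measurable_spin b).aemeasurable
    ((measurable_coe_sign (0, 0)).mul (measurable_coe_sign (x, t))).aestronglyMeasurable,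
    integral_tilted, ← integral_div]
  refine integral_congr_ae (Eventually.of_forall fun ω => ?_)
  simp only [smul_eq_mul]
  ring

/-- The coupling in the direction of time. -/
def timeCoupling (δ b : ℝ) (n : ℕ) : ℝ := Real.artanh (Real.exp (-(2 * δ * mesh b n)))

lemma exp_mesh_mem {δ b : ℝ} (hδ : 0 < δ) (hb : 0 < b) (n : ℕ) :
    Real.exp (-(2 * δ * mesh b n)) ∈ Set.Ioo (0 : ℝ) 1 := by
  refine ⟨Real.exp_pos _, ?_⟩
  have := mesh_pos hb n
  rw [Real.exp_lt_one_iff, neg_lt_zero]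
  positivity

lemma tanh_timeCoupling {δ b : ℝ} (hδ : 0 < δ) (hb : 0 < b) (n : ℕ) :
    Real.tanh (timeCoupling δ b n) = Real.exp (-(2 * δ * mesh b n)) := by
  have := exp_mesh_mem hδ hb n
  exact Real.tanh_artanh ⟨by linarith [this.1], this.2⟩

lemma timeCoupling_nonneg {δ b : ℝ} (n : ℕ) : 0 ≤ timeCoupling δ b n :=
  Real.artanh_nonneg (Real.exp_pos _).le

/-- The two-point function of the discrete model on the grid with `2 (n + 1)` times. -/
def meshCorr (δ lam b : ℝ) (n : ℕ) (x : Torus d N) (j : ZMod (2 * (n + 1))) : ℝ :=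
  gridCorr (timeCoupling δ b n) (lam * mesh b n) x j

lemma ae_points_ne {δ b : ℝ} (hδ : 0 ≤ δ) (hb : 0 < b) (x : Torus d N) (t : ℝ) :
    ∀ᵐ ω ∂(aPriori d N δ b), ∀ i, (ω.1 x).2 i ≠ t := by
  have h0 := evenPoissonProcess_isProbabilityMeasure hδ hb.le
  have h1 : ∀ᵐ D ∂(evenPoissonProcess δ b), ∀ i, D.2 i ≠ t := by
    filter_upwards [cond_absolutelyContinuous.ae_le (ae_points (δ := δ) (β := b)
      (Set.countable_singleton t))] with D hD i using (hD i).2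
  have h2 : ∀ᵐ Ds ∂(Measure.pi fun _ : Torus d N => evenPoissonProcess δ b),
      ∀ i, (Ds x).2 i ≠ t :=
    (Measure.quasiMeasurePreserving_eval (fun _ : Torus d N => evenPoissonProcess δ b) x).ae h1
  exact Measure.quasiMeasurePreserving_fst.ae h2

/-- The two-point function of the discrete model converges to that of the space–time model. -/
theorem tendsto_meshCorr {δ b : ℝ} (hδ : 0 < δ) (hb : 0 < b) (lam : ℝ) (x : Torus d N) {t : ℝ}
    (ht : t ∈ Set.Ico 0 b) {j : ℕ → ℕ} (hj : ∀ n, j n < 2 * (n + 1))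
    (hjt : Tendsto (fun n => j n * mesh b n) atTop (𝓝 t)) :
    Tendsto (fun n => meshCorr (d := d) (N := N) δ lam b n x (j n)) atTop
      (𝓝 (twoPoint (isingMeasure d N δ lam b) x t)) := by
  have hP := aPriori_isProbabilityMeasure (d := d) (N := N) hδ.le hb.le
  have h1 : ∀ n, meshCorr (d := d) (N := N) δ lam b n x (j n) =
      (∫ ω, ((spin b ω (0, 0) : ℤ) : ℝ) * ((spin b ω (x, j n * mesh b n) : ℤ) : ℝ) *
        Real.exp (lam * (mesh b n * spatialEnergy (meshSpins b n ω))) ∂(aPriori d N δ b)) /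
      ∫ ω, Real.exp (lam * (mesh b n * spatialEnergy (meshSpins b n ω))) ∂(aPriori d N δ b) := by
    intro n
    have h2 := gridAvg_mul_spin (d := d) (N := N) (timeCoupling δ b n) (lam * mesh b n)
      (0, (0 : ZMod (2 * (n + 1)))) (x, (j n : ZMod (2 * (n + 1))))
    simp only [sub_zero] at h2
    unfold meshCorr
    rw [← h2, gridAvg_eq_integral_div hδ.le (mesh_pos hb n) (tanh_timeCoupling hδ hb n), mul_mesh]
    simp only [meshSpins_apply, ZMod.val_zero, Nat.cast_zero, zero_mul, ZMod.val_natCast,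
      Nat.mod_eq_of_lt (hj n), mul_assoc]
  simp only [h1]
  rw [twoPoint_isingMeasure]
  have hexp : ∀ ω : Sample d N, Tendsto
      (fun n => Real.exp (lam * (mesh b n * spatialEnergy (meshSpins b n ω)))) atTop
      (𝓝 (Real.exp (lam * interaction b ω))) := fun ω =>
    (Real.continuous_exp.tendsto _).comp ((tendsto_spatialEnergy hb ω).const_mul lam)
  have hexpm : ∀ n, Measurable fun ω : Sample d N =>
      Real.exp (lam * (mesh b n * spatialEnergy (meshSpins b n ω))) := fun n =>
    (((measurable_spatialEnergy b n).const_mul _).const_mul _).exp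
  have hbound : ∀ n (ω : Sample d N),
      Real.exp (lam * (mesh b n * spatialEnergy (meshSpins b n ω))) ≤
        Real.exp (|lam| * (Fintype.card (Torus d N) * d * b)) := fun n ω =>
    exp_mul_le_of_abs_le (abs_mesh_mul_spatialEnergy_le hb n ω)
  refine Tendsto.div ?_ ?_ ?_
  · refine tendsto_integral_of_dominated_convergence
      (fun _ => Real.exp (|lam| * (Fintype.card (Torus d N) * d * b))) (fun n => ?_)
      (integrable_const _) (fun n => Eventually.of_forall fun ω => ?_) ?_
    · exact (((measurable_spin_real _ _).mul (measurable_spin_real _ _)).mul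
        (hexpm n)).aestronglyMeasurable
    · rw [Real.norm_eq_abs, abs_mul, abs_mul, abs_sign, abs_sign, one_mul, one_mul,
        Real.abs_exp]
      exact hbound n ω
    -- Almost surely the path over `x` does not jump at `t`, so its values at the approximating grid
    -- times converge.
    · filter_upwards [ae_points_ne hδ.le hb x t] with ω hω
      refine (tendsto_const_nhds.mul (tendsto_spin hjt ht (fun n => ?_) ω x hω)).mul (hexp ω)
      refine ⟨mul_nonneg (Nat.cast_nonneg _) (mesh_pos hb n).le, ?_⟩
      calc (j n : ℝ) * mesh b n < (2 * (n + 1) : ℕ) * mesh b n :=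
            mul_lt_mul_of_pos_right (by exact_mod_cast hj n) (mesh_pos hb n)
        _ = b := mul_mesh b n
  · refine tendsto_integral_of_dominated_convergence
      (fun _ => Real.exp (|lam| * (Fintype.card (Torus d N) * d * b))) (fun n => ?_)
      (integrable_const _) (fun n => Eventually.of_forall fun ω => ?_)
      (Eventually.of_forall fun ω => hexp ω)
    · exact (hexpm n).aestronglyMeasurable
    · rw [Real.norm_eq_abs, Real.abs_exp]
      exact hbound n ω
  · exact (integral_exp_pos (integrable_exp_interaction hδ.le hb lam)).ne'

end Continuum

/-! ### The two-point function in finite volume -/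

section FiniteVolume

variable {d : ℕ} {N : ℕ+} {δ lam b : ℝ}

/-- The two-point function of the space–time Ising model in finite volume. -/
def torusCorr (δ lam b : ℝ) (x : Torus d N) (t : ℝ) : ℝ :=
  twoPoint (isingMeasure d N δ lam b) x t

lemma tendsto_natFloor_mul {h : ℕ → ℝ} (hpos : ∀ n, 0 < h n) (h0 : Tendsto h atTop (𝓝 0)) {t : ℝ}
    (ht : 0 ≤ t) : Tendsto (fun n => (⌊t / h n⌋₊ : ℝ) * h n) atTop (𝓝 t) := by
  have h1 : Tendsto (fun n => t - h n) atTop (𝓝 t) := by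
    simpa using tendsto_const_nhds.sub h0 (a := t)
  refine tendsto_of_tendsto_of_tendsto_of_le_of_le h1 tendsto_const_nhds (fun n => ?_) fun n => ?_
  · have h2 := Nat.lt_floor_add_one (t / h n)
    rw [div_lt_iff₀ (hpos n)] at h2
    beta_reduce
    linarith
  · have h2 := Nat.floor_le (div_nonneg ht (hpos n).le)
    rwa [le_div_iff₀ (hpos n)] at h2

lemma natFloor_mesh_lt (hb : 0 < b) {t : ℝ} (ht : t ∈ Set.Ico 0 b) (n : ℕ) :
    ⌊t / mesh b n⌋₊ < 2 * (n + 1) := by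
  rw [Nat.floor_lt (div_nonneg ht.1 (mesh_pos hb n).le), div_lt_iff₀ (mesh_pos hb n), mul_mesh]
  exact ht.2

lemma natFloor_two_mesh_lt (hb : 0 < b) {t : ℝ} (ht : t ∈ Set.Ico 0 b) (n : ℕ) :
    ⌊t / (2 * mesh b n)⌋₊ < n + 1 := by
  have hm := mesh_pos hb n
  rw [Nat.floor_lt (div_nonneg ht.1 (by positivity)), div_lt_iff₀ (by positivity)]
  have := mul_mesh b n
  push_cast at this ⊢
  linarith [ht.2]

lemma tendsto_meshCorr_natFloor (hδ : 0 < δ) (hb : 0 < b) (x : Torus d N) {t : ℝ}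
    (ht : t ∈ Set.Ico 0 b) :
    Tendsto (fun n => meshCorr (d := d) (N := N) δ lam b n x (⌊t / mesh b n⌋₊ : ℕ)) atTop
      (𝓝 (torusCorr δ lam b x t)) :=
  tendsto_meshCorr hδ hb lam x ht (natFloor_mesh_lt hb ht)
    (tendsto_natFloor_mul (mesh_pos hb) (tendsto_mesh b) ht.1)

/-- Times are rounded to even multiples of the mesh, where positivity and convexity from the
transfer matrix are available. -/
lemma tendsto_two_natFloor (hb : 0 < b) {t : ℝ} (ht : 0 ≤ t) :
    Tendsto (fun n => ((2 * ⌊t / (2 * mesh b n)⌋₊ : ℕ) : ℝ) * mesh b n) atTop (𝓝 t) := by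
  have h1 := tendsto_natFloor_mul (h := fun n => 2 * mesh b n)
    (fun n => by have := mesh_pos hb n; positivity)
    (by simpa using (tendsto_mesh b).const_mul 2) ht
  refine h1.congr fun n => ?_
  push_cast; ring

lemma tendsto_meshCorr_two_natFloor (hδ : 0 < δ) (hb : 0 < b) (x : Torus d N) {t : ℝ}
    (ht : t ∈ Set.Ico 0 b) :
    Tendsto (fun n => meshCorr (d := d) (N := N) δ lam b n x
      ((2 * ⌊t / (2 * mesh b n)⌋₊ : ℕ) : ZMod (2 * (n + 1)))) atTop
      (𝓝 (torusCorr δ lam b x t)) :=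
  tendsto_meshCorr hδ hb lam x ht
    (fun n => by have := natFloor_two_mesh_lt hb ht n; omega) (tendsto_two_natFloor hb ht.1)

/-- The representative in `[0, b)` of a time. -/
lemma mul_fract_mem (hb : 0 < b) (t : ℝ) : b * Int.fract (t / b) ∈ Set.Ico 0 b :=
  ⟨mul_nonneg hb.le (Int.fract_nonneg _), by
    nlinarith [Int.fract_lt_one (t / b)]⟩

lemma spin_mul_fract (hb : 0 < b) (ω : Sample d N) (x : Torus d N) (t : ℝ) :
    spin b ω (x, b * Int.fract (t / b)) = spin b ω (x, t) := by
  unfold spin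
  simp only [fract_of_mem (mul_fract_mem hb t)]

lemma torusCorr_mul_fract (hb : 0 < b) (x : Torus d N) (t : ℝ) :
    torusCorr δ lam b x (b * Int.fract (t / b)) = torusCorr δ lam b x t := by
  unfold torusCorr
  simp only [twoPoint_isingMeasure, spin_mul_fract hb]

lemma torusCorr_add_period (hb : 0 < b) (x : Torus d N) (t : ℝ) :
    torusCorr δ lam b x (t + b) = torusCorr δ lam b x t := by
  rw [← torusCorr_mul_fract hb, ← torusCorr_mul_fract hb x t, add_div, div_self hb.ne',
    Int.fract_add_one]

lemma meshCorr_nonneg (hlam : 0 ≤ lam) (hb : 0 < b) (n : ℕ) (x : Torus d N)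
    (j : ZMod (2 * (n + 1))) : 0 ≤ meshCorr δ lam b n x j :=
  gridCorr_nonneg (timeCoupling_nonneg n) (mul_nonneg hlam (mesh_pos hb n).le) x j

lemma torusCorr_nonneg (hδ : 0 < δ) (hlam : 0 ≤ lam) (hb : 0 < b) (x : Torus d N) (t : ℝ) :
    0 ≤ torusCorr δ lam b x t := by
  rw [← torusCorr_mul_fract hb]
  exact ge_of_tendsto' (tendsto_meshCorr_natFloor hδ hb x (mul_fract_mem hb t))
    fun n => meshCorr_nonneg hlam hb n x _

lemma torusCorr_le_one (hδ : 0 < δ) (hb : 0 < b) (x : Torus d N) (t : ℝ) :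
    torusCorr δ lam b x t ≤ 1 := by
  rw [← torusCorr_mul_fract hb]
  exact le_of_tendsto' (tendsto_meshCorr_natFloor hδ hb x (mul_fract_mem hb t))
    fun n => gridCorr_le_one _ _ x _

lemma measurable_torusCorr (hδ : 0 < δ) (hb : 0 < b) (x : Torus d N) :
    Measurable (torusCorr δ lam b x) := by
  have h1 : ∀ t, Tendsto (fun n => meshCorr (d := d) (N := N) δ lam b n x
      (⌊(b * Int.fract (t / b)) / mesh b n⌋₊ : ℕ)) atTop (𝓝 (torusCorr δ lam b x t)) := by
    intro t
    rw [← torusCorr_mul_fract hb]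
    exact tendsto_meshCorr_natFloor hδ hb x (mul_fract_mem hb t)
  refine measurable_of_tendsto_metrizable (fun n => ?_) (tendsto_pi_nhds.mpr h1)
  have h2 : Measurable fun k : ℕ => meshCorr (d := d) (N := N) δ lam b n x k := measurable_from_top
  exact h2.comp (Nat.measurable_floor.comp (((measurable_fract.comp
    (measurable_id.div_const b)).const_mul b).div_const _))

lemma torusCorr_mono (hδ : 0 < δ) (hb : 0 < b) {lam' : ℝ} (hlam : 0 ≤ lam) (h : lam ≤ lam')
    (x : Torus d N) (t : ℝ) : torusCorr δ lam b x t ≤ torusCorr δ lam' b x t := by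
  rw [← torusCorr_mul_fract hb, ← torusCorr_mul_fract hb x t]
  have ht := mul_fract_mem hb t
  refine le_of_tendsto_of_tendsto' (tendsto_meshCorr_natFloor hδ hb x ht)
    (tendsto_meshCorr_natFloor hδ hb x ht) fun n => ?_
  have hm := mesh_pos hb n
  exact gridCorr_mono (timeCoupling_nonneg n) (by positivity)
    (mul_le_mul_of_nonneg_right h hm.le) x _

/-- The two-point function cannot decrease too fast. -/
lemma exp_mul_torusCorr_le (hδ : 0 < δ) (hlam : 0 ≤ lam) (hb : 0 < b) (x : Torus d N) {t s : ℝ}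
    (ht : 0 ≤ t) (hs : 0 ≤ s) (hts : t + s < b) :
    Real.exp (-(2 * δ * s)) * torusCorr δ lam b x t ≤ torusCorr δ lam b x (t + s) := by
  have h1 := tendsto_meshCorr_natFloor (d := d) (N := N) (lam := lam) hδ hb x (t := t)
    ⟨ht, by linarith⟩
  have hT := tendsto_natFloor_mul (mesh_pos hb) (tendsto_mesh b) ht
  have hS := tendsto_natFloor_mul (mesh_pos hb) (tendsto_mesh b) hs
  -- The two times are rounded separately, so that the discrete inequality applies exactly to their
  -- sum.
  have h2 : Tendsto (fun n => meshCorr (d := d) (N := N) δ lam b n x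
      ((⌊t / mesh b n⌋₊ + ⌊s / mesh b n⌋₊ : ℕ) : ZMod (2 * (n + 1)))) atTop
      (𝓝 (torusCorr δ lam b x (t + s))) := by
    refine tendsto_meshCorr hδ hb lam x ⟨by positivity, hts⟩ (fun n => ?_) ?_
    · have hm := mesh_pos hb n
      have e1 := Nat.floor_le (div_nonneg ht hm.le)
      have e2 := Nat.floor_le (div_nonneg hs hm.le)
      have e3 : (t + s) / mesh b n < (2 * (n + 1) : ℕ) := by
        rw [div_lt_iff₀ hm, mul_mesh]; exact hts
      rw [add_div] at e3
      have e4 : ((⌊t / mesh b n⌋₊ + ⌊s / mesh b n⌋₊ : ℕ) : ℝ) < (2 * (n + 1) : ℕ) := by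
        push_cast at e3 ⊢; linarith
      exact_mod_cast e4
    · refine (hT.add hS).congr fun n => ?_
      push_cast; ring
  have h3 : Tendsto (fun n => Real.exp (-(2 * δ * (⌊s / mesh b n⌋₊ * mesh b n)))) atTop
      (𝓝 (Real.exp (-(2 * δ * s)))) :=
    (Real.continuous_exp.tendsto _).comp (hS.const_mul (2 * δ)).neg
  refine le_of_tendsto_of_tendsto' (h3.mul h1) h2 fun n => ?_
  have h4 := tanh_pow_mul_gridCorr_le (timeCoupling_nonneg (δ := δ) (b := b) n)
    (mul_nonneg hlam (mesh_pos hb n).le) x ((⌊t / mesh b n⌋₊ : ℕ) : ZMod (2 * (n + 1)))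
    ⌊s / mesh b n⌋₊
  rw [tanh_timeCoupling hδ hb, ← Real.exp_nat_mul, ← Nat.cast_add] at h4
  refine le_trans (le_of_eq ?_) h4
  unfold meshCorr
  congr 2
  ring

lemma torusCorr_reflect (hδ : 0 < δ) (hb : 0 < b) (x : Torus d N) {t : ℝ} (ht : 0 < t)
    (htb : t < b) : torusCorr δ lam b x (b - t) = torusCorr δ lam b x t := by
  have h1 := tendsto_meshCorr_natFloor (d := d) (N := N) (lam := lam) hδ hb x (t := t)
    ⟨ht.le, htb⟩
  have hT := tendsto_natFloor_mul (mesh_pos hb) (tendsto_mesh b) ht.le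
  have h2 : Tendsto (fun n => meshCorr (d := d) (N := N) δ lam b n x
      (((-((⌊t / mesh b n⌋₊ : ℕ) : ZMod (2 * (n + 1)))).val : ℕ) : ZMod (2 * (n + 1)))) atTop
      (𝓝 (torusCorr δ lam b x (b - t))) := by
    refine tendsto_meshCorr hδ hb lam x ⟨by linarith, by linarith⟩ (fun n => ZMod.val_lt _) ?_
    refine (tendsto_const_nhds.sub hT).congr' ?_
    filter_upwards [hT.eventually (lt_mem_nhds ht)] with n hn
    -- For t > 0 the rounded time k is eventually nonzero; then -k is represented by 2(n + 1) - k,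
    -- that is, by a time near b - t.
    have hne : ((⌊t / mesh b n⌋₊ : ℕ) : ZMod (2 * (n + 1))) ≠ 0 := by
      intro h
      rw [ZMod.natCast_eq_zero_iff] at h
      have h5 := Nat.eq_zero_of_dvd_of_lt h (natFloor_mesh_lt hb ⟨ht.le, htb⟩ n)
      rw [h5] at hn
      simp at hn
    have : NeZero ((⌊t / mesh b n⌋₊ : ℕ) : ZMod (2 * (n + 1))) := ⟨hne⟩
    rw [ZMod.val_neg_of_ne_zero, ZMod.val_natCast,
      Nat.mod_eq_of_lt (natFloor_mesh_lt hb ⟨ht.le, htb⟩ n),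
      Nat.cast_sub (natFloor_mesh_lt hb ⟨ht.le, htb⟩ n).le, sub_mul, mul_mesh]
  refine tendsto_nhds_unique (h2.congr fun n => ?_) h1
  rw [ZMod.natCast_zmod_val]
  exact gridCorr_neg_right _ _ _ _

lemma torusCorr_neg_time (hδ : 0 < δ) (hb : 0 < b) (x : Torus d N) {t : ℝ} (ht : 0 ≤ t)
    (htb : t < b) : torusCorr δ lam b x (-t) = torusCorr δ lam b x t := by
  rcases ht.eq_or_lt with h | h
  · rw [← h, neg_zero]
  · rw [← torusCorr_reflect hδ hb x h htb, ← torusCorr_add_period hb x (-t)]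
    congr 1; ring

lemma torusCorr_neg_space (hδ : 0 < δ) (hb : 0 < b) (x : Torus d N) (t : ℝ) :
    torusCorr δ lam b (-x) t = torusCorr δ lam b x t := by
  rw [← torusCorr_mul_fract hb, ← torusCorr_mul_fract hb x t]
  have ht := mul_fract_mem hb t
  refine tendsto_nhds_unique ((tendsto_meshCorr_natFloor hδ hb (-x) ht).congr fun n => ?_)
    (tendsto_meshCorr_natFloor hδ hb x ht)
  exact gridCorr_neg_left _ _ _ _

/-- Harnack's inequality for the two-point function as a function of time. -/
lemma exp_mul_torusCorr_le_of_mem (hδ : 0 < δ) (hlam : 0 ≤ lam) (hb : 0 < b) (x : Torus d N)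
    {t u : ℝ} (ht : t ∈ Set.Ioo 0 b) (hu : u ∈ Set.Ioo 0 b) :
    Real.exp (-(2 * δ * |u - t|)) * torusCorr δ lam b x t ≤ torusCorr δ lam b x u := by
  rcases le_total t u with h | h
  · have := exp_mul_torusCorr_le hδ hlam hb x (t := t) (s := u - t) ht.1.le (by linarith)
      (by linarith [hu.2])
    rwa [add_sub_cancel, ← abs_of_nonneg (sub_nonneg.mpr h)] at this
  · have := exp_mul_torusCorr_le hδ hlam hb x (t := b - t) (s := t - u) (by linarith [ht.2])
      (by linarith) (by linarith [hu.1])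
    rw [torusCorr_reflect hδ hb x ht.1 ht.2, show b - t + (t - u) = b - u by ring,
      torusCorr_reflect hδ hb x hu.1 hu.2] at this
    rwa [abs_sub_comm, abs_of_nonneg (sub_nonneg.mpr h)]

lemma intervalIntegrable_torusCorr (hδ : 0 < δ) (hlam : 0 ≤ lam) (hb : 0 < b) (x : Torus d N)
    (u v : ℝ) : IntervalIntegrable (torusCorr δ lam b x) volume u v := by
  refine (intervalIntegrable_const (c := (1 : ℝ))).mono_fun
    (measurable_torusCorr hδ hb x).aestronglyMeasurable (Eventually.of_forall fun t => ?_)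
  beta_reduce
  rw [Real.norm_eq_abs, abs_of_nonneg (torusCorr_nonneg hδ hlam hb x t)]
  simpa using torusCorr_le_one hδ hb x t

/-- Riemann sums of the discrete two-point function. -/
lemma tendsto_sum_meshCorr (hδ : 0 < δ) (hlam : 0 ≤ lam) (hb : 0 < b) (x : Torus d N) :
    Tendsto (fun n => mesh b n * ∑ j, meshCorr (d := d) (N := N) δ lam b n x j) atTop
      (𝓝 (∫ t in (0 : ℝ)..b, torusCorr δ lam b x t)) := by
  have h1 : ∀ n, mesh b n * ∑ j, meshCorr (d := d) (N := N) δ lam b n x j =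
      ∫ t in (0 : ℝ)..b, meshCorr (d := d) (N := N) δ lam b n x
        ((⌊t / mesh b n⌋ : ℤ) : ZMod (2 * (n + 1))) := by
    intro n
    have h2 := integral_step (mesh_pos hb n) (2 * (n + 1)) fun k =>
      meshCorr (d := d) (N := N) δ lam b n x (k : ZMod (2 * (n + 1)))
    rw [mul_mesh] at h2
    rw [h2, ← sum_range_eq_sum_zmod (2 * (n + 1))]
    simp
  simp only [h1]
  refine intervalIntegral.tendsto_integral_filter_of_dominated_convergence (fun _ => 1) ?_ ?_
    intervalIntegrable_const ?_
  · refine Eventually.of_forall fun n => ?_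
    have : Measurable fun k : ℤ => meshCorr (d := d) (N := N) δ lam b n x
      (k : ZMod (2 * (n + 1))) := measurable_from_top
    exact (this.comp (Int.measurable_floor.comp
      (measurable_id.div_const _))).aestronglyMeasurable
  · refine Eventually.of_forall fun n => Eventually.of_forall fun t _ => ?_
    rw [Real.norm_eq_abs, abs_of_nonneg (meshCorr_nonneg hlam hb n x _)]
    exact gridCorr_le_one _ _ _ _
  · filter_upwards [(Set.countable_singleton b).ae_notMem volume] with t ht htb
    rw [Set.uIoc_of_le hb.le] at htb
    have ht' : t ∈ Set.Ico 0 b := ⟨htb.1.le, lt_of_le_of_ne htb.2 fun h => ht h⟩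
    refine (tendsto_meshCorr_natFloor hδ hb x ht').congr fun n => ?_
    congr 1
    rw [← Int.natCast_floor_eq_floor (div_nonneg ht'.1 (mesh_pos hb n).le)]
    simp

/-! ### Modes -/

/-- The spatial cosine transform of the two-point function. -/
def torusMode (δ lam b : ℝ) (ψ : AddChar (Torus d N) ℂ) (t : ℝ) : ℝ :=
  cosTransform ψ fun x => torusCorr δ lam b x t

lemma tendsto_gridMode (hδ : 0 < δ) (hb : 0 < b) (ψ : AddChar (Torus d N) ℂ) {t : ℝ}
    (ht : t ∈ Set.Ico 0 b) :
    Tendsto (fun n => gridMode (timeCoupling δ b n) (lam * mesh b n) ψ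
      ((2 * ⌊t / (2 * mesh b n)⌋₊ : ℕ) : ZMod (2 * (n + 1)))) atTop
      (𝓝 (torusMode δ lam b ψ t)) :=
  tendsto_finsetSum _ fun x _ =>
    (tendsto_meshCorr_two_natFloor hδ hb x ht).const_mul _

lemma tendsto_gridMode_zero (hδ : 0 < δ) (hb : 0 < b) (ψ : AddChar (Torus d N) ℂ) :
    Tendsto (fun n => gridMode (timeCoupling δ b n) (lam * mesh b n) ψ
      (0 : ZMod (2 * (n + 1)))) atTop (𝓝 (torusMode δ lam b ψ 0)) := by
  simpa using tendsto_gridMode (lam := lam) hδ hb ψ (t := 0) ⟨le_rfl, hb⟩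

lemma torusMode_nonneg (hδ : 0 < δ) (hb : 0 < b) (ψ : AddChar (Torus d N) ℂ) {t : ℝ}
    (ht : t ∈ Set.Ico 0 b) : 0 ≤ torusMode δ lam b ψ t :=
  ge_of_tendsto' (tendsto_gridMode hδ hb ψ ht) fun n =>
    gridMode_nonneg _ _ ψ (natFloor_two_mesh_lt hb ht n).le

lemma torusMode_le (hδ : 0 < δ) (hb : 0 < b) (ψ : AddChar (Torus d N) ℂ) {t : ℝ}
    (ht : t ∈ Set.Ico 0 b) : torusMode δ lam b ψ t ≤ torusMode δ lam b ψ 0 :=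
  le_of_tendsto_of_tendsto' (tendsto_gridMode hδ hb ψ ht) (tendsto_gridMode_zero hδ hb ψ)
    fun _ => gridMode_le _ _ ψ _

lemma one_sub_exp_sq_le (u : ℝ) : 1 - Real.exp (-u) ^ 2 ≤ 2 * u := by
  rw [← Real.exp_nat_mul]
  have := Real.add_one_le_exp (((2 : ℕ) : ℝ) * -u)
  push_cast at this ⊢
  linarith

/-- A double step of length 2Δ costs at most 4δΔ to first order, hence 2δ per unit time. The
second-order term, which carries the volume-dependent constant `K`, vanishes with the mesh. -/
lemma torusMode_zero_sub_le (hδ : 0 < δ) (hlam : 0 ≤ lam) (hb : 0 < b)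
    (ψ : AddChar (Torus d N) ℂ) {t : ℝ} (ht : t ∈ Set.Ico 0 b) :
    torusMode δ lam b ψ 0 - torusMode δ lam b ψ t ≤ 2 * δ * t := by
  set K : ℝ := Fintype.card (Torus d N) *
    Real.exp (2 * (lam * (Fintype.card (Torus d N) * d * b))) with hK
  have hT := tendsto_two_natFloor hb ht.1
  have h1 : Tendsto (fun n => 2 * δ * (((2 * ⌊t / (2 * mesh b n)⌋₊ : ℕ) : ℝ) * mesh b n) *
      (1 + K * (4 * δ * mesh b n))) atTop (𝓝 (2 * δ * t * (1 + K * (4 * δ * 0)))) :=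
    (hT.const_mul (2 * δ)).mul
      (tendsto_const_nhds.add (((tendsto_mesh b).const_mul (4 * δ)).const_mul K))
  rw [mul_zero, mul_zero, add_zero, mul_one] at h1
  refine le_of_tendsto_of_tendsto' ((tendsto_gridMode_zero hδ hb ψ).sub
    (tendsto_gridMode hδ hb ψ ht)) h1 fun n => ?_
  have hm := mesh_pos hb n
  refine (gridMode_zero_sub_le_mul (timeCoupling_nonneg n) (mul_nonneg hlam hm.le) ψ
    (natFloor_two_mesh_lt hb ht n).le).trans ?_
  rw [tanh_timeCoupling hδ hb]
  set v := 1 - Real.exp (-(2 * δ * mesh b n)) ^ 2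
  have hv : v ≤ 4 * δ * mesh b n := (one_sub_exp_sq_le _).trans_eq (by ring)
  have hv0 : 0 ≤ v := by
    have := exp_mesh_mem hδ hb n
    have := pow_le_one₀ (n := 2) this.1.le this.2.le
    simp only [v]; linarith
  have hexp : lam * mesh b n * (Fintype.card (Torus d N) * d * ((2 * (n + 1) : ℕ) : ℝ)) =
      lam * (Fintype.card (Torus d N) * d * b) := by
    calc _ = lam * (Fintype.card (Torus d N) * d * (((2 * (n + 1) : ℕ) : ℝ) * mesh b n)) := by ring
      _ = _ := by rw [mul_mesh]
  rw [hexp, ← mul_assoc (Fintype.card (Torus d N) : ℝ), ← hK]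
  have hK0 : 0 ≤ K := by positivity
  have hv2 : v ^ 2 ≤ (4 * δ * mesh b n) ^ 2 := pow_le_pow_left₀ hv0 hv 2
  calc (⌊t / (2 * mesh b n)⌋₊ : ℝ) * (v + K * v ^ 2)
      ≤ ⌊t / (2 * mesh b n)⌋₊ * (4 * δ * mesh b n + K * (4 * δ * mesh b n) ^ 2) := by gcongr
    _ = _ := by push_cast; ring

lemma integral_torusMode (hδ : 0 < δ) (hlam : 0 ≤ lam) (hb : 0 < b) (ψ : AddChar (Torus d N) ℂ) :
    ∫ t in (0 : ℝ)..b, torusMode δ lam b ψ t =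
      ∑ x, (ψ x).re * ∫ t in (0 : ℝ)..b, torusCorr δ lam b x t := by
  unfold torusMode cosTransform
  rw [intervalIntegral.integral_finsetSum fun x _ =>
    (intervalIntegrable_torusCorr hδ hlam hb x 0 b).const_mul _]
  simp

lemma latticeSymbol_mul_integral_torusMode_le (hδ : 0 < δ) (hlam : 0 ≤ lam) (hb : 0 < b)
    (ψ : AddChar (Torus d N) ℂ) :
    2 * lam * latticeSymbol ψ * ∫ t in (0 : ℝ)..b, torusMode δ lam b ψ t ≤ 1 := by
  rw [integral_torusMode hδ hlam hb]
  have h1 : Tendsto (fun n => 2 * lam * latticeSymbol ψ *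
      ∑ x, (ψ x).re * (mesh b n * ∑ j, meshCorr (d := d) (N := N) δ lam b n x j)) atTop
      (𝓝 (2 * lam * latticeSymbol ψ *
        ∑ x, (ψ x).re * ∫ t in (0 : ℝ)..b, torusCorr δ lam b x t)) :=
    (tendsto_finsetSum _ fun x _ => (tendsto_sum_meshCorr hδ hlam hb x).const_mul _).const_mul _
  refine le_of_tendsto' h1 fun n => ?_
  refine le_trans (le_of_eq ?_) (two_mul_latticeSymbol_mul_sum_gridMode_le (M := 2 * (n + 1))
    (jt := timeCoupling δ b n) (mul_nonneg hlam (mesh_pos hb n).le) ψ)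
  unfold gridMode cosTransform
  rw [Finset.sum_comm]
  simp only [Finset.mul_sum, meshCorr]
  refine Finset.sum_congr rfl fun x _ => Finset.sum_congr rfl fun j _ => ?_
  ring

lemma measurable_torusMode (hδ : 0 < δ) (hb : 0 < b) (ψ : AddChar (Torus d N) ℂ) :
    Measurable (torusMode δ lam b ψ) := by
  unfold torusMode cosTransform
  exact Finset.measurable_sum _ fun x _ => (measurable_torusCorr hδ hb x).const_mul _

lemma intervalIntegrable_torusMode (hδ : 0 < δ) (hlam : 0 ≤ lam) (hb : 0 < b)
    (ψ : AddChar (Torus d N) ℂ) (u v : ℝ) :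
    IntervalIntegrable (torusMode δ lam b ψ) volume u v := by
  have h := IntervalIntegrable.sum (f := fun (x : Torus d N) t =>
    (ψ x).re * torusCorr δ lam b x t) (μ := volume) (a := u) (b := v) Finset.univ fun x _ =>
    (intervalIntegrable_torusCorr hδ hlam hb x u v).const_mul _
  rwa [show ∑ x, (fun t => (ψ x).re * torusCorr δ lam b x t) = torusMode δ lam b ψ from
    funext fun t => by simp [torusMode, cosTransform]] at h

/-- A bound at coinciding times which follows from the infrared bound for the time integral. -/
lemma torusMode_zero_le (hδ : 0 < δ) (hlam : 0 ≤ lam) (hb : 0 < b) (ψ : AddChar (Torus d N) ℂ)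
    {A : ℝ} (hA : 0 < A) (hAψ : A ≤ 2 * lam * latticeSymbol ψ) :
    torusMode δ lam b ψ 0 ≤ 2 / (b * A) + 3 * √(δ / A) := by
  set v := torusMode δ lam b ψ 0 with hv
  have hv0 : 0 ≤ v := torusMode_nonneg hδ hb ψ ⟨le_rfl, hb⟩
  set I := ∫ t in (0 : ℝ)..b, torusMode δ lam b ψ t
  have hI0 : 0 ≤ I := by
    refine intervalIntegral.integral_nonneg_of_ae_restrict hb.le ?_
    rw [EventuallyLE, ae_restrict_iff' measurableSet_Icc]
    filter_upwards [(Set.countable_singleton b).ae_notMem volume] with t ht htb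
    exact torusMode_nonneg hδ hb ψ ⟨htb.1, lt_of_le_of_ne htb.2 fun h => ht h⟩
  have hI : A * I ≤ 1 := (mul_le_mul_of_nonneg_right hAψ hI0).trans
    (latticeSymbol_mul_integral_torusMode_le hδ hlam hb ψ)
  -- While 2δt ≤ v/2 the coefficient stays at least v/2, which bounds its integral from below.
  have hlow : ∀ T, 0 ≤ T → T ≤ b → 4 * δ * T ≤ v → T * (v / 2) ≤ I := by
    intro T hT0 hTb hTv
    have h1 : ∫ t in (0 : ℝ)..T, v / 2 ≤ ∫ t in (0 : ℝ)..T, torusMode δ lam b ψ t := by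
      refine intervalIntegral.integral_mono_on_of_le_Ioo hT0 intervalIntegrable_const
        (intervalIntegrable_torusMode hδ hlam hb ψ _ _) fun t ht => ?_
      have := torusMode_zero_sub_le hδ hlam hb ψ (t := t) ⟨ht.1.le, ht.2.trans_le hTb⟩
      have : δ * t ≤ δ * T := mul_le_mul_of_nonneg_left ht.2.le hδ.le
      rw [← hv] at *
      linarith
    have h2 : ∫ t in (0 : ℝ)..T, torusMode δ lam b ψ t ≤ I := by
      refine intervalIntegral.integral_mono_interval le_rfl hT0 hTb ?_
        (intervalIntegrable_torusMode hδ hlam hb ψ _ _)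
      rw [EventuallyLE, ae_restrict_iff' measurableSet_Ioc]
      filter_upwards [(Set.countable_singleton b).ae_notMem volume] with t ht htb
      exact torusMode_nonneg hδ hb ψ ⟨htb.1.le, lt_of_le_of_ne htb.2 fun h => ht h⟩
    rw [intervalIntegral.integral_const, sub_zero, smul_eq_mul] at h1
    exact h1.trans h2
  -- Either the whole period can be taken for T, which gives the term with 1/b, or T = v/(4δ), which
  -- gives v² ≤ 8δ/A.
  rcases le_total (4 * δ * b) v with h | h
  · have h1 := hlow b hb.le le_rfl h
    have h2 : v ≤ 2 / (b * A) := by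
      rw [le_div_iff₀ (by positivity)]
      nlinarith
    linarith [Real.sqrt_nonneg (δ / A)]
  · have h1 := hlow (v / (4 * δ)) (by positivity) (by rw [div_le_iff₀ (by positivity)]; linarith)
      (by field_simp; rfl)
    have h2 : v ^ 2 ≤ 8 * (δ / A) := by
      have h3 : v / (4 * δ) * (v / 2) = v ^ 2 / (8 * δ) := by field_simp; ring
      rw [h3] at h1
      have h4 : A * (v ^ 2 / (8 * δ)) ≤ 1 := (mul_le_mul_of_nonneg_left h1 hA.le).trans hI
      rw [← mul_div_assoc, div_le_one (by positivity)] at h4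
      rw [← mul_div_assoc, le_div_iff₀ hA]
      linarith
    have h5 : v ≤ 3 * √(δ / A) := by
      refine le_of_sq_le_sq ?_ (by positivity)
      rw [mul_pow, Real.sq_sqrt (by positivity)]
      have : 0 ≤ δ / A := by positivity
      linarith
    have : 0 ≤ 2 / (b * A) := by positivity
    linarith

/-- The coefficient is nonnegative and largest at time 0, so ∫ m² ≤ m(0) ∫ m; the two factors are
bounded by `torusMode_zero_le` and by the infrared bound. -/
lemma integral_torusMode_sq_le (hδ : 0 < δ) (hlam : 0 ≤ lam) (hb : 0 < b)
    (ψ : AddChar (Torus d N) ℂ) {A : ℝ} (hA : 0 < A) (hAψ : A ≤ 2 * lam * latticeSymbol ψ) :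
    ∫ t in (0 : ℝ)..b, torusMode δ lam b ψ t ^ 2 ≤ (2 / (b * A) + 3 * √(δ / A)) / A := by
  have hv0 := torusMode_zero_le hδ hlam hb ψ hA hAψ
  have h0 : 0 ≤ torusMode δ lam b ψ 0 := torusMode_nonneg hδ hb ψ ⟨le_rfl, hb⟩
  have hint := intervalIntegrable_torusMode hδ hlam hb ψ 0 b
  have hI0 : 0 ≤ ∫ t in (0 : ℝ)..b, torusMode δ lam b ψ t := by
    refine intervalIntegral.integral_nonneg_of_ae_restrict hb.le ?_
    rw [EventuallyLE, ae_restrict_iff' measurableSet_Icc]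
    filter_upwards [(Set.countable_singleton b).ae_notMem volume] with t ht htb
    exact torusMode_nonneg hδ hb ψ ⟨htb.1, lt_of_le_of_ne htb.2 fun h => ht h⟩
  have h1 : ∫ t in (0 : ℝ)..b, torusMode δ lam b ψ t ^ 2 ≤
      ∫ t in (0 : ℝ)..b, torusMode δ lam b ψ 0 * torusMode δ lam b ψ t := by
    refine intervalIntegral.integral_mono_on_of_le_Ioo hb.le ?_ (hint.const_mul _) fun t ht => ?_
    · refine (hint.const_mul (∑ x : Torus d N, 1)).mono_fun
        ((measurable_torusMode hδ hb ψ).pow_const 2).aestronglyMeasurable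
        (Eventually.of_forall fun t => ?_)
      beta_reduce
      rw [norm_pow, sq, norm_mul]
      refine mul_le_mul_of_nonneg_right ?_ (norm_nonneg _)
      refine (norm_sum_le _ _).trans ((Finset.sum_le_sum fun x _ => ?_).trans (Real.le_norm_self _))
      rw [norm_mul, Real.norm_eq_abs, Real.norm_eq_abs,
        abs_of_nonneg (torusCorr_nonneg hδ hlam hb x t)]
      exact mul_le_one₀ (abs_char_re_le_one ψ x) (torusCorr_nonneg hδ hlam hb x t)
        (torusCorr_le_one hδ hb x t)
    · have ht' : t ∈ Set.Ico 0 b := ⟨ht.1.le, ht.2⟩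
      rw [sq]
      exact mul_le_mul_of_nonneg_right (torusMode_le hδ hb ψ ht') (torusMode_nonneg hδ hb ψ ht')
  rw [intervalIntegral.integral_const_mul] at h1
  have hI : A * ∫ t in (0 : ℝ)..b, torusMode δ lam b ψ t ≤ 1 :=
    (mul_le_mul_of_nonneg_right hAψ hI0).trans
      (latticeSymbol_mul_integral_torusMode_le hδ hlam hb ψ)
  refine h1.trans ?_
  rw [le_div_iff₀ hA]
  calc torusMode δ lam b ψ 0 * (∫ t in (0 : ℝ)..b, torusMode δ lam b ψ t) * A
      = torusMode δ lam b ψ 0 * (A * ∫ t in (0 : ℝ)..b, torusMode δ lam b ψ t) := by ring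
    _ ≤ torusMode δ lam b ψ 0 * 1 := mul_le_mul_of_nonneg_left hI h0
    _ ≤ _ := by rw [mul_one]; exact hv0

/-! ### The regime of a dominating transverse field -/

lemma tanh_le_self {u : ℝ} (hu : 0 ≤ u) : Real.tanh u ≤ u := by
  have h1 : MonotoneOn (fun x : ℝ => x * Real.cosh x - Real.sinh x) (Set.Ici 0) := by
    refine monotoneOn_of_hasDerivWithinAt_nonneg (f' := fun x => x * Real.sinh x)
      (convex_Ici 0) (by fun_prop) (fun x _ => ?_) fun x hx => ?_
    · have := (((hasDerivAt_id x).mul (Real.hasDerivAt_cosh x)).sub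
        (Real.hasDerivAt_sinh x)).hasDerivWithinAt (s := interior (Set.Ici 0))
      refine this.congr_deriv ?_
      simp
    · rw [interior_Ici] at hx
      exact mul_nonneg (le_of_lt hx) (Real.sinh_nonneg_iff.mpr (le_of_lt hx))
  have h2 := h1 (Set.mem_Ici.mpr le_rfl) (Set.mem_Ici.mpr hu) hu
  simp only [Real.sinh_zero, zero_mul, sub_zero] at h2
  rw [Real.tanh_eq_sinh_div_cosh, div_le_iff₀ (Real.cosh_pos u)]
  linarith

/-- A bound on the susceptibility when the transverse field dominates. -/
lemma sum_integral_torusCorr_le (hδ : 0 < δ) (hlam : 0 ≤ lam) (hb : 0 < b)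
    (h : 4 * d * lam ≤ δ) :
    ∑ x : Torus d N, ∫ t in (0 : ℝ)..b, torusCorr δ lam b x t ≤ 2 / δ := by
  set X := ∑ x : Torus d N, ∫ t in (0 : ℝ)..b, torusCorr δ lam b x t
  set Xn : ℕ → ℝ := fun n => ∑ x : Torus d N, mesh b n * ∑ j, meshCorr (d := d) (N := N) δ lam b n x j
    with hXn
  have hX : Tendsto Xn atTop (𝓝 X) :=
    tendsto_finsetSum _ fun x _ => tendsto_sum_meshCorr hδ hlam hb x
  -- For r = exp(-2δΔ) one has 1 - r ≥ 2δΔr and 1 + r ≤ 2, so the discrete bound can be stated for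
  -- the sum rescaled by the mesh. In the limit 2δX ≤ 2 + 4dλX ≤ 2 + δX.
  have h1 : ∀ n, Xn n * (2 * δ * Real.exp (-(2 * δ * mesh b n))) ≤ 2 * (1 + 2 * (d * lam) * Xn n) := by
    intro n
    have hm := mesh_pos hb n
    have hr := exp_mesh_mem hδ hb n
    have hX0 : 0 ≤ Xn n := Finset.sum_nonneg fun x _ =>
      mul_nonneg hm.le (Finset.sum_nonneg fun j _ => meshCorr_nonneg hlam hb n x j)
    have h2 := sum_gridCorr_high_temperature (d := d) (N := N) (M := 2 * (n + 1))
      (timeCoupling_nonneg (δ := δ) (b := b) n) (mul_nonneg hlam hm.le)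
    rw [tanh_timeCoupling hδ hb] at h2
    set r := Real.exp (-(2 * δ * mesh b n))
    set S := ∑ x : Torus d N, ∑ j : ZMod (2 * (n + 1)),
      gridCorr (timeCoupling δ b n) (lam * mesh b n) x j
    have hS : Xn n = mesh b n * S := by
      simp only [hXn, ← Finset.mul_sum]; rfl
    have hS0 : 0 ≤ S := by
      rw [hS] at hX0
      exact nonneg_of_mul_nonneg_right hX0 hm
    have htanh : Real.tanh (lam * mesh b n) ≤ lam * mesh b n :=
      tanh_le_self (mul_nonneg hlam hm.le)
    have hlow : 2 * δ * mesh b n * r ≤ 1 - r := by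
      have e1 := Real.add_one_le_exp (2 * δ * mesh b n)
      have e2 : Real.exp (2 * δ * mesh b n) * r = 1 := by
        simp only [r]; rw [← Real.exp_add]; simp
      nlinarith [hr.1]
    have h3 : (2 * δ * mesh b n * r) * S ≤ 2 * (1 + 2 * (d * (lam * mesh b n)) * S) := by
      calc (2 * δ * mesh b n * r) * S ≤ (1 - r) * S := mul_le_mul_of_nonneg_right hlow hS0
        _ ≤ (1 + r) * (1 + 2 * (d * Real.tanh (lam * mesh b n)) * S) := h2
        _ ≤ (1 + r) * (1 + 2 * (d * (lam * mesh b n)) * S) := by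
          have : 0 ≤ 1 + r := by linarith [hr.1]
          gcongr
        _ ≤ 2 * (1 + 2 * (d * (lam * mesh b n)) * S) := by
          have : 0 ≤ 1 + 2 * (d * (lam * mesh b n)) * S := by positivity
          have : 1 + r ≤ 2 := by linarith [hr.2]
          gcongr
    rw [hS]
    linarith
  have hlim : Tendsto (fun n => Real.exp (-(2 * δ * mesh b n))) atTop (𝓝 1) := by
    have := (Real.continuous_exp.tendsto _).comp ((tendsto_mesh b).const_mul (2 * δ)).neg
    rw [mul_zero, neg_zero, Real.exp_zero] at this
    exact this
  have h4 := le_of_tendsto_of_tendsto' (hX.mul (hlim.const_mul (2 * δ)))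
    ((tendsto_const_nhds.add (hX.const_mul (2 * (d * lam)))).const_mul 2) h1
  have hX0 : 0 ≤ X := Finset.sum_nonneg fun x _ =>
    intervalIntegral.integral_nonneg hb.le fun t _ => torusCorr_nonneg hδ hlam hb x t
  rw [le_div_iff₀ hδ]
  nlinarith

end FiniteVolume

/-! ### Fourier analysis on the torus -/

section Fourier

variable {d : ℕ} {N : ℕ+}

/-- Parseval's identity. -/
lemma sum_normSq_char (f : Torus d N → ℝ) :
    ∑ ψ : AddChar (Torus d N) ℂ, Complex.normSq (∑ x, ψ x * f x) =
      Fintype.card (Torus d N) * ∑ x, f x ^ 2 := by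
  have h1 : ∀ ψ : AddChar (Torus d N) ℂ, ((Complex.normSq (∑ x, ψ x * f x) : ℝ) : ℂ) =
      ∑ x, ∑ y, (f x * f y : ℂ) * ψ (x - y) := by
    intro ψ
    rw [← Complex.mul_conj, map_sum, Finset.sum_mul_sum]
    refine Finset.sum_congr rfl fun x _ => Finset.sum_congr rfl fun y _ => ?_
    rw [map_mul, Complex.conj_ofReal, sub_eq_add_neg, AddChar.map_add_eq_mul,
      AddChar.map_neg_eq_conj]
    ring
  have h2 : ((∑ ψ : AddChar (Torus d N) ℂ, Complex.normSq (∑ x, ψ x * f x) : ℝ) : ℂ) =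
      ((Fintype.card (Torus d N) * ∑ x, f x ^ 2 : ℝ) : ℂ) := by
    push_cast
    simp only [h1]
    rw [Finset.sum_comm, Finset.mul_sum]
    refine Finset.sum_congr rfl fun x _ => ?_
    rw [Finset.sum_comm]
    simp only [← Finset.mul_sum, AddChar.sum_apply_eq_ite]
    rw [Finset.sum_eq_single x]
    · rw [sub_self, if_pos rfl]; ring
    · intro y _ hy
      rw [if_neg (sub_ne_zero.mpr hy.symm), mul_zero]
    · intro h; exact absurd (Finset.mem_univ _) h
  exact_mod_cast h2

lemma sum_char_mul_eq_cosTransform (ψ : AddChar (Torus d N) ℂ) {γ : Torus d N → ℝ}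
    (hγ : ∀ x, γ (-x) = γ x) : ∑ x, ψ x * (γ x : ℂ) = cosTransform ψ γ := by
  have him : ∑ x, (ψ x).im * γ x = 0 := by
    have h1 : ∑ x, (ψ x).im * γ x = ∑ x, (ψ (-x)).im * γ (-x) :=
      (Equiv.sum_comp (Equiv.neg (Torus d N)) fun x => (ψ x).im * γ x).symm
    have h2 : ∑ x, (ψ (-x)).im * γ (-x) = -∑ x, (ψ x).im * γ x := by
      rw [← Finset.sum_neg_distrib]
      refine Finset.sum_congr rfl fun x _ => ?_
      rw [hγ, AddChar.map_neg_eq_conj, Complex.conj_im]; ring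
    linarith
  apply Complex.ext
  · simp [cosTransform]
  · simpa using him

/-- The `ℓ²` distance of an even function to its translates. -/
lemma card_mul_sum_sub_sq {γ : Torus d N → ℝ} (hγ : ∀ x, γ (-x) = γ x) (y : Torus d N) :
    Fintype.card (Torus d N) * ∑ x, (γ x - γ (x - y)) ^ 2 =
      ∑ ψ : AddChar (Torus d N) ℂ, ‖1 - ψ y‖ ^ 2 * cosTransform ψ γ ^ 2 := by
  rw [← sum_normSq_char]
  refine Finset.sum_congr rfl fun ψ _ => ?_
  have h1 : ∑ x, ψ x * ((γ (x - y) : ℝ) : ℂ) = ψ y * ∑ x, ψ x * (γ x : ℂ) := by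
    rw [← Equiv.sum_comp (Equiv.addRight y), Finset.mul_sum]
    refine Finset.sum_congr rfl fun x _ => ?_
    simp only [Equiv.coe_addRight, add_sub_cancel_right, AddChar.map_add_eq_mul]
    ring
  have h2 : ∑ x, ψ x * ((γ x - γ (x - y) : ℝ) : ℂ) = (1 - ψ y) * (cosTransform ψ γ : ℝ) := by
    rw [← sum_char_mul_eq_cosTransform ψ hγ]
    push_cast
    simp only [mul_sub, Finset.sum_sub_distrib, h1]
    ring
  rw [h2, Complex.normSq_mul, Complex.normSq_ofReal, Complex.normSq_eq_norm_sq]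
  ring

/-! ### Integer frequencies of characters and their size -/

lemma char_single_pow (ψ : AddChar (Torus d N) ℂ) (i : Fin d) :
    ψ (Pi.single i 1) ^ (2 * (N : ℕ)) = 1 := by
  rw [← AddChar.map_nsmul_eq_pow, ← Pi.single_smul]
  simp

lemma exists_int_of_pow_eq_one {n : ℕ} (hn : 0 < n) {z : ℂ} (hz : z ^ (2 * n) = 1) :
    ∃ m : ℤ, z.arg = Real.pi * (m / n) := by
  have hnorm : ‖z‖ = 1 := Complex.norm_eq_one_of_pow_eq_one hz (by omega)
  have h1 : Complex.exp (z.arg * Complex.I) = z := by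
    have := Complex.norm_mul_exp_arg_mul_I z
    rwa [hnorm, Complex.ofReal_one, one_mul] at this
  rw [← h1, ← Complex.exp_nat_mul, Complex.exp_eq_one_iff] at hz
  obtain ⟨m, hm⟩ := hz
  refine ⟨m, ?_⟩
  have h2 : (2 * n : ℕ) * z.arg = m * (2 * Real.pi) := by
    have h3 : (((2 * n : ℕ) * z.arg : ℝ) : ℂ) * Complex.I =
        ((m * (2 * Real.pi) : ℝ) : ℂ) * Complex.I := by
      push_cast at hm ⊢
      rw [mul_assoc, hm]; ring
    exact_mod_cast mul_right_cancel₀ Complex.I_ne_zero h3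
  have hn' : (n : ℝ) ≠ 0 := by exact_mod_cast hn.ne'
  push_cast at h2
  field_simp
  linarith

/-- The frequency of a character. -/
def frequency (ψ : AddChar (Torus d N) ℂ) (i : Fin d) : ℤ :=
  (exists_int_of_pow_eq_one N.pos (char_single_pow ψ i)).choose

lemma arg_char (ψ : AddChar (Torus d N) ℂ) (i : Fin d) :
    (ψ (Pi.single i 1)).arg = Real.pi * (frequency ψ i / (N : ℕ)) :=
  (exists_int_of_pow_eq_one N.pos (char_single_pow ψ i)).choose_spec

lemma char_single_eq (ψ : AddChar (Torus d N) ℂ) (i : Fin d) :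
    ψ (Pi.single i 1) =
      Complex.exp (Complex.I * ((Real.pi * (frequency ψ i / (N : ℕ)) : ℝ) : ℂ)) := by
  have := Complex.norm_mul_exp_arg_mul_I (ψ (Pi.single i 1))
  rw [AddChar.norm_apply, Complex.ofReal_one, one_mul, arg_char] at this
  rw [mul_comm Complex.I]
  exact this.symm

lemma cast_pnat_pos (N : ℕ+) : (0 : ℝ) < (N : ℕ) := by exact_mod_cast N.pos

lemma abs_frequency_le (ψ : AddChar (Torus d N) ℂ) (i : Fin d) : (frequency ψ i).natAbs ≤ N := by
  have h1 := Complex.abs_arg_le_pi (ψ (Pi.single i 1))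
  have hN := cast_pnat_pos N
  rw [arg_char, abs_mul, abs_of_pos Real.pi_pos, abs_div, abs_of_pos hN] at h1
  have h2 : |(frequency ψ i : ℝ)| ≤ (N : ℕ) := by
    have h3 := (mul_le_iff_le_one_right Real.pi_pos).mp h1
    rwa [div_le_one hN] at h3
  have h4 : |frequency ψ i| ≤ ((N : ℕ) : ℤ) := by exact_mod_cast h2
  rw [Int.abs_eq_natAbs] at h4
  exact_mod_cast h4

lemma torus_eq_sum (x : Torus d N) :
    x = ∑ i, (x i).val • (Pi.single i 1 : Torus d N) := by
  conv_lhs => rw [← Finset.univ_sum_single x]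
  refine Finset.sum_congr rfl fun i _ => ?_
  rw [← Pi.single_smul]
  simp

lemma char_sum (ψ : AddChar (Torus d N) ℂ) (s : Finset (Fin d)) (f : Fin d → Torus d N) :
    ψ (∑ i ∈ s, f i) = ∏ i ∈ s, ψ (f i) := by
  induction s using Finset.cons_induction with
  | empty => simp
  | cons a s ha ih => rw [Finset.sum_cons, Finset.prod_cons, AddChar.map_add_eq_mul, ih]

lemma frequency_injective :
    Function.Injective (frequency : AddChar (Torus d N) ℂ → Fin d → ℤ) := by
  intro ψ φ h
  have h1 : ∀ i, ψ (Pi.single i 1) = φ (Pi.single i 1) := by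
    intro i
    rw [char_single_eq, char_single_eq, h]
  ext x
  rw [torus_eq_sum x, char_sum, char_sum]
  refine Finset.prod_congr rfl fun i _ => ?_
  rw [AddChar.map_nsmul_eq_pow, AddChar.map_nsmul_eq_pow, h1]

/-- The size of the frequency of a character. -/
def frequencyNorm (ψ : AddChar (Torus d N) ℂ) : ℕ :=
  Finset.univ.sup fun i => (frequency ψ i).natAbs

lemma frequencyNorm_le (ψ : AddChar (Torus d N) ℂ) : frequencyNorm ψ ≤ N :=
  Finset.sup_le fun i _ => abs_frequency_le ψ i

lemma natAbs_le_frequencyNorm (ψ : AddChar (Torus d N) ℂ) (i : Fin d) :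
    (frequency ψ i).natAbs ≤ frequencyNorm ψ :=
  Finset.le_sup (f := fun i => (frequency ψ i).natAbs) (Finset.mem_univ i)

lemma abs_frequency_real_le (ψ : AddChar (Torus d N) ℂ) (i : Fin d) :
    |(frequency ψ i : ℝ)| ≤ frequencyNorm ψ := by
  rw [← Int.cast_abs, Int.abs_eq_natAbs]
  exact_mod_cast natAbs_le_frequencyNorm ψ i

/-- Only the coordinate of largest frequency is kept, and 1 - cos θ ≥ 2θ²/π² for |θ| ≤ π. -/
lemma latticeSymbol_ge (ψ : AddChar (Torus d N) ℂ) :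
    2 * (frequencyNorm ψ / (N : ℕ) : ℝ) ^ 2 ≤ latticeSymbol ψ := by
  rcases Nat.eq_zero_or_pos (frequencyNorm ψ) with h | h
  · rw [h]; simpa using latticeSymbol_nonneg ψ
  have hne : (Finset.univ : Finset (Fin d)).Nonempty := by
    by_contra hcon
    rw [Finset.not_nonempty_iff_eq_empty] at hcon
    unfold frequencyNorm at h
    rw [hcon] at h
    simp at h
  obtain ⟨i, -, hi⟩ := Finset.exists_mem_eq_sup Finset.univ hne fun i => (frequency ψ i).natAbs
  have h1 : 1 - (ψ (Pi.single i 1)).re ≤ latticeSymbol ψ :=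
    Finset.single_le_sum (f := fun i => 1 - (ψ (Pi.single i 1)).re)
      (fun j _ => sub_nonneg.mpr (char_re_le_one ψ _)) (Finset.mem_univ i)
  refine le_trans ?_ h1
  have h2 : (ψ (Pi.single i 1)).re = Real.cos (Real.pi * (frequency ψ i / (N : ℕ))) := by
    rw [char_single_eq, mul_comm, Complex.exp_ofReal_mul_I_re]
  have h3 := Real.cos_le_one_sub_mul_cos_sq (x := Real.pi * (frequency ψ i / (N : ℕ)))
    (by rw [← arg_char]; exact Complex.abs_arg_le_pi _)
  have h4 : ((frequencyNorm ψ : ℕ) : ℝ) ^ 2 = (frequency ψ i : ℝ) ^ 2 := by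
    unfold frequencyNorm
    rw [hi, ← Int.cast_natCast, Int.natCast_natAbs, Int.cast_abs, sq_abs]
  rw [h2, div_pow, h4]
  have h5 : 2 / Real.pi ^ 2 * (Real.pi * (frequency ψ i / (N : ℕ))) ^ 2 =
      2 * ((frequency ψ i : ℝ) ^ 2 / ((N : ℕ) : ℝ) ^ 2) := by
    have := Real.pi_ne_zero
    field_simp
  rw [h5] at h3
  linarith

lemma norm_one_sub_char_add (ψ : AddChar (Torus d N) ℂ) (x y : Torus d N) :
    ‖1 - ψ (x + y)‖ ≤ ‖1 - ψ x‖ + ‖1 - ψ y‖ := by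
  have h : 1 - ψ (x + y) = (1 - ψ x) + ψ x * (1 - ψ y) := by
    rw [AddChar.map_add_eq_mul]; ring
  rw [h]
  refine (norm_add_le _ _).trans_eq ?_
  rw [norm_mul, AddChar.norm_apply, one_mul]

lemma norm_one_sub_char_nsmul (ψ : AddChar (Torus d N) ℂ) (k : ℕ) (x : Torus d N) :
    ‖1 - ψ (k • x)‖ ≤ k * ‖1 - ψ x‖ := by
  induction k with
  | zero => simp
  | succ k ih =>
    rw [succ_nsmul]
    refine (norm_one_sub_char_add ψ _ _).trans ?_
    push_cast
    linarith

lemma norm_one_sub_char_sum (ψ : AddChar (Torus d N) ℂ) (s : Finset (Fin d))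
    (f : Fin d → Torus d N) : ‖1 - ψ (∑ i ∈ s, f i)‖ ≤ ∑ i ∈ s, ‖1 - ψ (f i)‖ := by
  induction s using Finset.cons_induction with
  | empty => simp
  | cons a s ha ih =>
    rw [Finset.sum_cons, Finset.sum_cons]
    exact (norm_one_sub_char_add ψ _ _).trans (by linarith)

/-- A vector of natural numbers as a point of the torus. -/
def torusPoint (N : ℕ+) (y : Fin d → ℕ) : Torus d N := fun i => (y i : ZMod (2 * (N : ℕ)))

lemma torusPoint_eq_sum (y : Fin d → ℕ) :
    torusPoint N y = ∑ i, y i • (Pi.single i 1 : Torus d N) := by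
  conv_lhs => rw [← Finset.univ_sum_single (torusPoint N y)]
  refine Finset.sum_congr rfl fun i _ => ?_
  rw [← Pi.single_smul]
  simp [torusPoint]

lemma norm_one_sub_char_torusPoint_le (ψ : AddChar (Torus d N) ℂ) {y : Fin d → ℕ} {R : ℕ}
    (hy : ∀ i, y i ≤ R) :
    ‖1 - ψ (torusPoint N y)‖ ≤ 4 * d * (R * (frequencyNorm ψ / (N : ℕ) : ℝ)) := by
  rw [torusPoint_eq_sum]
  refine (norm_one_sub_char_sum ψ _ _).trans ?_
  have hN := cast_pnat_pos N
  have h1 : ∀ i : Fin d, ‖1 - ψ (y i • (Pi.single i 1 : Torus d N))‖ ≤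
      4 * (R * (frequencyNorm ψ / (N : ℕ) : ℝ)) := by
    intro i
    refine (norm_one_sub_char_nsmul ψ _ _).trans ?_
    have h2 : ‖1 - ψ (Pi.single i 1)‖ ≤ 4 * (frequencyNorm ψ / (N : ℕ) : ℝ) := by
      rw [char_single_eq, norm_sub_rev]
      refine Real.norm_exp_I_mul_ofReal_sub_one_le.trans ?_
      rw [Real.norm_eq_abs, abs_mul, abs_of_pos Real.pi_pos, abs_div, abs_of_pos hN]
      have := abs_frequency_real_le ψ i
      have := Real.pi_le_four
      gcongr
    have h3 : (y i : ℝ) ≤ R := by exact_mod_cast hy i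
    calc (y i : ℝ) * ‖1 - ψ (Pi.single i 1)‖ ≤ R * (4 * (frequencyNorm ψ / (N : ℕ) : ℝ)) := by
          gcongr
      _ = _ := by ring
  refine (Finset.sum_le_sum fun i _ => h1 i).trans_eq ?_
  rw [Finset.sum_const, Finset.card_univ, Fintype.card_fin, nsmul_eq_mul]
  ring

/-- This factor vanishes at momentum zero and suppresses momenta below 1/R; beyond that the trivial
bound 2 is better. -/
lemma norm_one_sub_char_sq_le (ψ : AddChar (Torus d N) ℂ) (hd : 1 ≤ d) {y : Fin d → ℕ} {R : ℕ}
    (hy : ∀ i, y i ≤ R) :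
    ‖1 - ψ (torusPoint N y)‖ ^ 2 ≤
      16 * d ^ 2 * min 1 (R * (frequencyNorm ψ / (N : ℕ) : ℝ)) ^ 2 := by
  have h1 := norm_one_sub_char_torusPoint_le ψ hy
  have h2 : ‖1 - ψ (torusPoint N y)‖ ≤ 2 := by
    refine (norm_sub_le _ _).trans ?_
    rw [AddChar.norm_apply, norm_one]; norm_num
  have hd' : (1 : ℝ) ≤ d := by exact_mod_cast hd
  have h3 : ‖1 - ψ (torusPoint N y)‖ ≤ 4 * d * min 1 (R * (frequencyNorm ψ / (N : ℕ) : ℝ)) := by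
    rcases le_total 1 (R * (frequencyNorm ψ / (N : ℕ) : ℝ)) with h | h
    · rw [min_eq_left h]; linarith
    · rw [min_eq_right h]; exact h1
  calc _ ≤ (4 * d * min 1 (R * (frequencyNorm ψ / (N : ℕ) : ℝ))) ^ 2 :=
        pow_le_pow_left₀ (norm_nonneg _) h3 2
    _ = _ := by ring

/-! ### Lattice sums -/

/-- On the sphere of radius μ for the maximum norm some coordinate is ±μ and the others lie in [-μ,
μ]. The summand 1 covers d = 0. -/
lemma card_frequencyNorm_eq_le (μ : ℕ) :
    ((Finset.univ.filter fun ψ : AddChar (Torus d N) ℂ => frequencyNorm ψ = μ).card) ≤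
      1 + d * (2 * (2 * μ + 1) ^ (d - 1)) := by
  rcases Nat.eq_zero_or_pos d with hd | hd
  · subst hd
    have : Subsingleton (AddChar (Torus 0 N) ℂ) := ⟨fun ψ φ => frequency_injective (by
      funext i; exact i.elim0)⟩
    exact (Finset.card_le_one_of_subsingleton _).trans (by omega)
  let box : Fin d → Finset (Fin d → ℤ) := fun i => Fintype.piFinset fun j =>
    if j = i then {(μ : ℤ), -(μ : ℤ)} else Finset.Icc (-(μ : ℤ)) μ
  have hbox : ∀ i, (box i).card ≤ 2 * (2 * μ + 1) ^ (d - 1) := by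
    intro i
    simp only [box]
    rw [Fintype.card_piFinset, ← Finset.mul_prod_erase _ _ (Finset.mem_univ i), if_pos rfl]
    refine Nat.mul_le_mul Finset.card_le_two ?_
    rw [Finset.prod_congr rfl (g := fun _ => 2 * μ + 1)]
    · rw [Finset.prod_const, Finset.card_erase_of_mem (Finset.mem_univ i), Finset.card_univ,
        Fintype.card_fin]
    · intro j hj
      rw [if_neg (Finset.ne_of_mem_erase hj), Int.card_Icc]
      omega
  have h1 : ((Finset.univ.filter fun ψ : AddChar (Torus d N) ℂ => frequencyNorm ψ = μ).card) ≤
      (Finset.univ.biUnion box).card := by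
    refine Finset.card_le_card_of_injOn frequency ?_ (frequency_injective.injOn)
    intro ψ hψ
    have hψ' : frequencyNorm ψ = μ := by simpa using hψ
    obtain ⟨i, -, hi⟩ := Finset.exists_mem_eq_sup Finset.univ
      (⟨⟨0, hd⟩, Finset.mem_univ _⟩ : (Finset.univ : Finset (Fin d)).Nonempty)
      fun i => (frequency ψ i).natAbs
    have hi' : (frequency ψ i).natAbs = μ := by rw [← hψ']; exact hi.symm
    simp only [Finset.coe_biUnion, Set.mem_iUnion, Finset.mem_coe, Finset.mem_univ, exists_prop,
      true_and]
    refine ⟨i, ?_⟩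
    simp only [box, Fintype.mem_piFinset]
    intro j
    have hj := natAbs_le_frequencyNorm ψ j
    rw [hψ'] at hj
    split_ifs with h
    · subst h
      rw [Finset.mem_insert, Finset.mem_singleton]
      omega
    · rw [Finset.mem_Icc]; omega
  refine h1.trans (Finset.card_biUnion_le.trans ((Finset.sum_le_sum fun i _ => hbox i).trans ?_))
  simp

lemma frequencyNorm_eq_zero {ψ : AddChar (Torus d N) ℂ} (h : frequencyNorm ψ = 0)
    (x : Torus d N) : ψ x = 1 := by
  have h1 : ∀ i, ψ (Pi.single i 1) = 1 := by
    intro i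
    have := natAbs_le_frequencyNorm ψ i
    rw [h, Nat.le_zero, Int.natAbs_eq_zero] at this
    rw [char_single_eq, this]
    simp
  rw [torus_eq_sum x, char_sum]
  refine Finset.prod_eq_one fun i _ => ?_
  rw [AddChar.map_nsmul_eq_pow, h1, one_pow]

/-- Characters are grouped by the size of their frequency. The zero frequency, about which the
infrared bound says nothing, must contribute nothing positive. -/
lemma sum_char_le {F : AddChar (Torus d N) ℂ → ℝ} {G : ℕ → ℝ} (hd : 1 ≤ d) (hG : ∀ μ, 0 ≤ G μ)
    (h0 : ∀ ψ, frequencyNorm ψ = 0 → F ψ ≤ 0)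
    (h : ∀ ψ, 0 < frequencyNorm ψ → F ψ ≤ G (frequencyNorm ψ)) :
    ∑ ψ, F ψ ≤ ∑ μ ∈ Finset.Icc 1 (N : ℕ), 3 * d * (3 * μ : ℝ) ^ (d - 1) * G μ := by
  have h1 : ∑ ψ, F ψ ≤ ∑ ψ ∈ Finset.univ.filter fun ψ : AddChar (Torus d N) ℂ =>
      frequencyNorm ψ ∈ Finset.Icc 1 (N : ℕ), F ψ := by
    rw [← Finset.sum_filter_add_sum_filter_not Finset.univ
      (fun ψ : AddChar (Torus d N) ℂ => frequencyNorm ψ ∈ Finset.Icc 1 (N : ℕ))]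
    refine add_le_of_nonpos_right (Finset.sum_nonpos fun ψ hψ => h0 ψ ?_)
    have h2 := (Finset.mem_filter.mp hψ).2
    rw [Finset.mem_Icc] at h2
    have := frequencyNorm_le ψ
    omega
  refine h1.trans ?_
  rw [← Finset.sum_fiberwise_of_maps_to (t := Finset.Icc 1 (N : ℕ)) (g := frequencyNorm)
    (fun ψ hψ => (Finset.mem_filter.mp hψ).2)]
  refine Finset.sum_le_sum fun μ hμ => ?_
  have hμ1 : 1 ≤ μ := (Finset.mem_Icc.mp hμ).1
  have h3 : ∀ ψ ∈ (Finset.univ.filter fun ψ : AddChar (Torus d N) ℂ =>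
      frequencyNorm ψ ∈ Finset.Icc 1 (N : ℕ)).filter fun ψ => frequencyNorm ψ = μ, F ψ ≤ G μ := by
    intro ψ hψ
    have h4 := (Finset.mem_filter.mp hψ).2
    rw [← h4]
    exact h ψ (by omega)
  refine (Finset.sum_le_card_nsmul _ _ _ h3).trans ?_
  rw [nsmul_eq_mul]
  refine mul_le_mul_of_nonneg_right ?_ (hG μ)
  have h5 : (((Finset.univ.filter fun ψ : AddChar (Torus d N) ℂ =>
      frequencyNorm ψ ∈ Finset.Icc 1 (N : ℕ)).filter fun ψ => frequencyNorm ψ = μ).card : ℕ) ≤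
      3 * d * (3 * μ) ^ (d - 1) := by
    refine (Finset.card_le_card (Finset.filter_subset_filter _ (Finset.subset_univ _))).trans
      ((card_frequencyNorm_eq_le μ).trans ?_)
    have h6 : (2 * μ + 1) ^ (d - 1) ≤ (3 * μ) ^ (d - 1) := Nat.pow_le_pow_left (by omega) _
    have h7 : 1 ≤ (3 * μ) ^ (d - 1) := Nat.one_le_pow _ _ (by omega)
    nlinarith [Nat.mul_le_mul_left d h6, Nat.mul_le_mul hd h7]
  exact_mod_cast h5

/-- The lattice sum with exponent `p`, smoothed at distance `R`. -/
def latticeSum (d p R N : ℕ) : ℝ :=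
  1 / N * ∑ μ ∈ Finset.Icc 1 N,
    (μ / N : ℝ) ^ (d - 1) * (min 1 (R * (μ / N : ℝ)) ^ 2 / (μ / N : ℝ) ^ p)

lemma latticeSum_nonneg (d p R N : ℕ) : 0 ≤ latticeSum d p R N := by
  unfold latticeSum; positivity

lemma latticeSum_le_of_forall {d p R N : ℕ} {c : ℝ} (hN : 0 < N)
    (h : ∀ q : ℝ, 0 < q → q ≤ 1 → q ^ (d - 1) * (min 1 (R * q) ^ 2 / q ^ p) ≤ c) :
    latticeSum d p R N ≤ c := by
  unfold latticeSum
  have hN' : (0 : ℝ) < N := by exact_mod_cast hN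
  rw [one_div, inv_mul_le_iff₀ hN']
  refine (Finset.sum_le_card_nsmul _ _ c fun μ hμ => ?_).trans_eq ?_
  · have h1 := Finset.mem_Icc.mp hμ
    refine h _ (div_pos (by exact_mod_cast h1.1) hN') ?_
    rw [div_le_one hN']; exact_mod_cast h1.2
  · simp

lemma latticeSum_le_one {d p : ℕ} (hp : p + 1 ≤ d) (R : ℕ) {N : ℕ} (hN : 0 < N) :
    latticeSum d p R N ≤ 1 := by
  refine latticeSum_le_of_forall hN fun q hq hq1 => ?_
  rw [mul_div_assoc', div_le_one (by positivity)]
  have h1 : min 1 ((R : ℝ) * q) ^ 2 ≤ 1 := by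
    refine pow_le_one₀ (le_min zero_le_one (by positivity)) (min_le_left _ _)
  calc q ^ (d - 1) * min 1 ((R : ℝ) * q) ^ 2 ≤ q ^ (d - 1) * 1 := by gcongr
    _ ≤ q ^ p := by rw [mul_one]; exact pow_le_pow_of_le_one hq.le hq1 (by omega)

/-- The smoothing factor alone makes the sum finite. The growth in `R` is harmless, because for
infinite β the sum is multiplied by 1/b, which tends to 0 while `R` is fixed. -/
lemma latticeSum_four_le {d : ℕ} (hd : 3 ≤ d) (R : ℕ) {N : ℕ} (hN : 0 < N) :
    latticeSum d 4 R N ≤ R ^ 2 := by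
  refine latticeSum_le_of_forall hN fun q hq hq1 => ?_
  rw [mul_div_assoc', div_le_iff₀ (by positivity)]
  have h1 : min 1 ((R : ℝ) * q) ^ 2 ≤ (R * q) ^ 2 :=
    pow_le_pow_left₀ (le_min zero_le_one (by positivity)) (min_le_right _ _) 2
  calc q ^ (d - 1) * min 1 ((R : ℝ) * q) ^ 2 ≤ q ^ 2 * (R * q) ^ 2 := by
        have := pow_le_pow_of_le_one hq.le hq1 (show 2 ≤ d - 1 by omega)
        gcongr
    _ = _ := by ring

/-- At the critical exponent the integrand is min(1, Rq)²/q ≤ 2R/(1 + Rq), the derivative of 2 log(1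
+ Rq). The Riemann sum is compared term by term with increments of this logarithm and telescopes. -/
lemma latticeSum_self_le {d : ℕ} (hd : 1 ≤ d) (R : ℕ) {N : ℕ} (hN : 0 < N) :
    latticeSum d d R N ≤ 2 * Real.log (1 + R) := by
  have hN' : (0 : ℝ) < N := by exact_mod_cast hN
  set g : ℕ → ℝ := fun μ => Real.log (1 + R * (μ / N : ℝ)) with hg
  have h1 : ∀ k ∈ Finset.range N, 1 / (N : ℝ) * (((k + 1 : ℕ) / N : ℝ) ^ (d - 1) *
      (min 1 (R * ((k + 1 : ℕ) / N : ℝ)) ^ 2 / ((k + 1 : ℕ) / N : ℝ) ^ d)) ≤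
      2 * (g (k + 1) - g k) := by
    intro k _
    set q : ℝ := ((k + 1 : ℕ) : ℝ) / N with hq
    have hq0 : 0 < q := by positivity
    have hqk : (k / N : ℝ) = q - 1 / N := by rw [hq]; push_cast; field_simp; ring
    set v : ℝ := R * q with hv
    have hv0 : 0 ≤ v := by positivity
    have hb : 0 ≤ (k / N : ℝ) := by positivity
    have hpos : 0 < 1 + (R : ℝ) * (k / N : ℝ) := by positivity
    have h2 : R * (1 / N) / (1 + v) ≤ g (k + 1) - g k := by
      simp only [hg]
      rw [← hq, ← Real.log_div (by positivity) hpos.ne']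
      refine le_trans (le_of_eq ?_) (Real.one_sub_inv_le_log_of_pos (by positivity))
      rw [inv_div, hqk, ← hv]
      field_simp
      rw [hv]; ring
    have h3 : min 1 v ^ 2 ≤ 2 * (v / (1 + v)) := by
      have e1 : min 1 v ^ 2 ≤ min 1 v := by
        have : 0 ≤ min 1 v := le_min zero_le_one hv0
        nlinarith [min_le_left 1 v]
      refine e1.trans ?_
      rw [← mul_div_assoc, le_div_iff₀ (by positivity)]
      rcases le_total 1 v with h | h
      · rw [min_eq_left h]; linarith
      · rw [min_eq_right h]; nlinarith
    have h4 : q ^ (d - 1) * (min 1 v ^ 2 / q ^ d) = min 1 v ^ 2 / q := by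
      obtain ⟨e, rfl⟩ : ∃ e, d = e + 1 := ⟨d - 1, by omega⟩
      rw [Nat.add_sub_cancel, pow_succ]
      field_simp
      ring
    rw [h4]
    calc 1 / (N : ℝ) * (min 1 v ^ 2 / q) ≤ 1 / (N : ℝ) * (2 * (v / (1 + v)) / q) := by gcongr
      _ = 2 * (R * (1 / N) / (1 + v)) := by rw [hv]; field_simp
      _ ≤ _ := by linarith
  unfold latticeSum
  have h5 : Finset.Icc 1 N = (Finset.range N).map (addRightEmbedding 1) := by
    ext m
    simp only [Finset.mem_Icc, Finset.mem_map, Finset.mem_range, addRightEmbedding_apply]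
    constructor
    · intro h; exact ⟨m - 1, by omega, by omega⟩
    · rintro ⟨k, hk, rfl⟩; omega
  rw [h5, Finset.sum_map, Finset.mul_sum]
  refine (Finset.sum_le_sum h1).trans_eq ?_
  rw [← Finset.mul_sum, Finset.sum_range_sub]
  simp [hg, hN'.ne']

/-! ### The distance of the two-point function to its translates -/

variable {δ lam b : ℝ}

lemma intervalIntegrable_torusCorr_mul (hδ : 0 < δ) (hlam : 0 ≤ lam) (hb : 0 < b)
    (x y : Torus d N) (u v : ℝ) :
    IntervalIntegrable (fun t => (torusCorr δ lam b x t - torusCorr δ lam b y t) ^ 2)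
      volume u v := by
  refine (intervalIntegrable_const (c := (1 : ℝ))).mono_fun
    (((measurable_torusCorr hδ hb x).sub (measurable_torusCorr hδ hb y)).pow_const 2
      ).aestronglyMeasurable (Eventually.of_forall fun t => ?_)
  beta_reduce
  have h1 := torusCorr_nonneg hδ hlam hb x t
  have h2 := torusCorr_nonneg hδ hlam hb y t
  have h3 := torusCorr_le_one (lam := lam) hδ hb x t
  have h4 := torusCorr_le_one (lam := lam) hδ hb y t
  rw [Real.norm_eq_abs, norm_one, abs_of_nonneg (sq_nonneg _), sq_le_one_iff_abs_le_one, abs_le]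
  constructor <;> linarith

lemma intervalIntegrable_torusMode_sq (hδ : 0 < δ) (hlam : 0 ≤ lam) (hb : 0 < b)
    (ψ : AddChar (Torus d N) ℂ) (u v : ℝ) :
    IntervalIntegrable (fun t => torusMode δ lam b ψ t ^ 2) volume u v := by
  refine (intervalIntegrable_const (c := ((∑ x : Torus d N, 1 : ℝ)) ^ 2)).mono_fun
    ((measurable_torusMode hδ hb ψ).pow_const 2).aestronglyMeasurable
    (Eventually.of_forall fun t => ?_)
  beta_reduce
  rw [norm_pow, norm_pow]
  refine pow_le_pow_left₀ (norm_nonneg _) ?_ 2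
  refine (norm_sum_le _ _).trans ((Finset.sum_le_sum fun x _ => ?_).trans (Real.le_norm_self _))
  rw [norm_mul, Real.norm_eq_abs, Real.norm_eq_abs,
    abs_of_nonneg (torusCorr_nonneg hδ hlam hb x t)]
  exact mul_le_one₀ (abs_char_re_le_one ψ x) (torusCorr_nonneg hδ hlam hb x t)
    (torusCorr_le_one hδ hb x t)

lemma card_mul_sum_integral_sub_sq (hδ : 0 < δ) (hlam : 0 ≤ lam) (hb : 0 < b) (y : Torus d N) :
    Fintype.card (Torus d N) * ∑ x : Torus d N, ∫ t in (0 : ℝ)..b,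
        (torusCorr δ lam b x t - torusCorr δ lam b (x - y) t) ^ 2 =
      ∑ ψ : AddChar (Torus d N) ℂ, ‖1 - ψ y‖ ^ 2 *
        ∫ t in (0 : ℝ)..b, torusMode δ lam b ψ t ^ 2 := by
  simp only [← intervalIntegral.integral_const_mul]
  rw [← intervalIntegral.integral_finsetSum fun x _ =>
    intervalIntegrable_torusCorr_mul hδ hlam hb x (x - y) 0 b,
    ← intervalIntegral.integral_const_mul,
    ← intervalIntegral.integral_finsetSum fun ψ _ =>
    (intervalIntegrable_torusMode_sq hδ hlam hb ψ 0 b).const_mul _]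
  refine intervalIntegral.integral_congr fun t _ => ?_
  exact card_mul_sum_sub_sq (fun x => torusCorr_neg_space hδ hb x t) y

/-- The infrared bound for the differences of the two-point function. -/
theorem sum_integral_sub_sq_le (hd : 1 ≤ d) (hδ : 0 < δ) (hlam : 0 < lam) (hb : 0 < b)
    {y : Fin d → ℕ} {R : ℕ} (hy : ∀ i, y i ≤ R) :
    ∑ x : Torus d N, ∫ t in (0 : ℝ)..b,
        (torusCorr δ lam b x t - torusCorr δ lam b (x - torusPoint N y) t) ^ 2 ≤
      48 * d ^ 3 * 3 ^ d * (1 / (b * lam ^ 2) * latticeSum d 4 R N +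
        √(δ / lam) / lam * latticeSum d 3 R N) := by
  have hN := cast_pnat_pos N
  set G : ℕ → ℝ := fun μ => 16 * d ^ 2 * (min 1 (R * (μ / (N : ℕ) : ℝ)) ^ 2 *
    (1 / (b * lam ^ 2) / (μ / (N : ℕ) : ℝ) ^ 4 + √(δ / lam) / lam / (μ / (N : ℕ) : ℝ) ^ 3))
    with hG
  have h1 : ∑ ψ : AddChar (Torus d N) ℂ, ‖1 - ψ (torusPoint N y)‖ ^ 2 *
      ∫ t in (0 : ℝ)..b, torusMode δ lam b ψ t ^ 2 ≤
      ∑ μ ∈ Finset.Icc 1 (N : ℕ), 3 * d * (3 * μ : ℝ) ^ (d - 1) * G μ := by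
    refine sum_char_le hd (fun μ => by simp only [hG]; positivity) (fun ψ hψ => ?_)
      fun ψ hψ => ?_
    · rw [frequencyNorm_eq_zero hψ]; simp
    · set q : ℝ := frequencyNorm ψ / (N : ℕ) with hq
      have hq0 : 0 < q := div_pos (by exact_mod_cast hψ) hN
      -- The infrared bound is used with A = 4λq², since the lattice symbol is at least 2q².
      have hA : 4 * lam * q ^ 2 ≤ 2 * lam * latticeSymbol ψ := by
        have := mul_le_mul_of_nonneg_left (latticeSymbol_ge ψ) (show 0 ≤ 2 * lam by positivity)
        refine le_trans (le_of_eq ?_) this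
        rw [← hq]; ring
      have h2 := integral_torusMode_sq_le hδ hlam.le hb ψ (by positivity) hA
      have h3 : (2 / (b * (4 * lam * q ^ 2)) + 3 * √(δ / (4 * lam * q ^ 2))) / (4 * lam * q ^ 2) ≤
          1 / (b * lam ^ 2) / q ^ 4 + √(δ / lam) / lam / q ^ 3 := by
        have e1 : √(δ / (4 * lam * q ^ 2)) = √(δ / lam) / (2 * q) := by
          rw [show δ / (4 * lam * q ^ 2) = δ / lam / (2 * q) ^ 2 by field_simp; ring,
            Real.sqrt_div (by positivity), Real.sqrt_sq (by positivity)]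
        rw [e1]
        have e2 : (2 / (b * (4 * lam * q ^ 2)) + 3 * (√(δ / lam) / (2 * q))) / (4 * lam * q ^ 2) =
            1 / 8 * (1 / (b * lam ^ 2) / q ^ 4) + 3 / 8 * (√(δ / lam) / lam / q ^ 3) := by
          field_simp
          ring
        rw [e2]
        have e3 : 0 ≤ 1 / (b * lam ^ 2) / q ^ 4 := by positivity
        have e4 : 0 ≤ √(δ / lam) / lam / q ^ 3 := by positivity
        linarith
      have h4 := norm_one_sub_char_sq_le ψ hd hy
      rw [← hq] at h4
      simp only [hG]
      rw [← hq, ← mul_assoc]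
      exact mul_le_mul h4 (h2.trans h3) (intervalIntegral.integral_nonneg hb.le
        fun t _ => sq_nonneg _) (by positivity)
  rw [← card_mul_sum_integral_sub_sq hδ hlam.le hb] at h1
  have hcard : (Fintype.card (Torus d N) : ℝ) = (2 * (N : ℕ) : ℝ) ^ d := by
    rw [Fintype.card_fun, ZMod.card, Fintype.card_fin]; push_cast; rfl
  rw [hcard] at h1
  set D := ∑ x : Torus d N, ∫ t in (0 : ℝ)..b,
        (torusCorr δ lam b x t - torusCorr δ lam b (x - torusPoint N y) t) ^ 2
  rw [← le_div_iff₀' (by positivity)] at h1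
  refine h1.trans ?_
  rw [div_le_iff₀ (by positivity)]
  unfold latticeSum
  have h5 : ∀ μ ∈ Finset.Icc 1 (N : ℕ), 3 * d * (3 * μ : ℝ) ^ (d - 1) * G μ ≤
      48 * d ^ 3 * 3 ^ d * (1 / (b * lam ^ 2) * (1 / (N : ℕ) * ((μ / (N : ℕ) : ℝ) ^ (d - 1) *
        (min 1 (R * (μ / (N : ℕ) : ℝ)) ^ 2 / (μ / (N : ℕ) : ℝ) ^ 4))) +
        √(δ / lam) / lam * (1 / (N : ℕ) * ((μ / (N : ℕ) : ℝ) ^ (d - 1) *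
        (min 1 (R * (μ / (N : ℕ) : ℝ)) ^ 2 / (μ / (N : ℕ) : ℝ) ^ 3)))) * (2 * (N : ℕ) : ℝ) ^ d := by
    intro μ hμ
    have hμ0 : (0 : ℝ) < μ := by exact_mod_cast (Finset.mem_Icc.mp hμ).1
    obtain ⟨e, rfl⟩ : ∃ e, d = e + 1 := ⟨d - 1, by omega⟩
    simp only [hG, Nat.add_sub_cancel]
    set q : ℝ := (μ : ℝ) / (N : ℕ) with hq
    have hμq : (μ : ℝ) = q * (N : ℕ) := by rw [hq]; field_simp
    have hq0 : 0 < q := by positivity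
    set m := min 1 (R * q) ^ 2
    have hm : 0 ≤ m := by positivity
    rw [hμq]
    have e5 : 3 * ((e + 1 : ℕ) : ℝ) * (3 * (q * (N : ℕ))) ^ e * (16 * ((e + 1 : ℕ) : ℝ) ^ 2 *
        (m * (1 / (b * lam ^ 2) / q ^ 4 + √(δ / lam) / lam / q ^ 3))) =
        48 * ((e + 1 : ℕ) : ℝ) ^ 3 * 3 ^ e * (((N : ℕ) : ℝ) ^ e * (q ^ e *
        (m * (1 / (b * lam ^ 2) / q ^ 4 + √(δ / lam) / lam / q ^ 3)))) := by
      rw [mul_pow, mul_pow]; ring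
    have e6 : 48 * ((e + 1 : ℕ) : ℝ) ^ 3 * 3 ^ (e + 1) * (1 / (b * lam ^ 2) * (1 / (N : ℕ) *
        (q ^ e * (m / q ^ 4))) + √(δ / lam) / lam * (1 / (N : ℕ) * (q ^ e *
        (m / q ^ 3)))) * (2 * (N : ℕ) : ℝ) ^ (e + 1) =
        (48 * ((e + 1 : ℕ) : ℝ) ^ 3 * 3 ^ e * (((N : ℕ) : ℝ) ^ e * (q ^ e *
        (m * (1 / (b * lam ^ 2) / q ^ 4 + √(δ / lam) / lam / q ^ 3))))) * (3 * 2 ^ (e + 1)) := by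
      rw [mul_pow, pow_succ ((N : ℕ) : ℝ)]
      field_simp
      ring
    rw [e5, e6]
    -- The two sides differ by the factor 3 · 2ᵈ, which is given away. The constant 48 is 3 from
    -- counting frequencies times 16 from the character bound.
    refine le_mul_of_one_le_right (by positivity) ?_
    have : (1 : ℝ) ≤ 2 ^ (e + 1) := one_le_pow₀ (by norm_num)
    linarith
  refine (Finset.sum_le_sum h5).trans_eq ?_
  rw [← Finset.sum_mul, ← Finset.mul_sum, Finset.sum_add_distrib]
  simp only [Finset.mul_sum]

end Fourier

/-! ### Infinite-volume limits -/

section InfiniteVolume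

variable {d : ℕ} {δ lam : ℝ} {β : ℝ≥0∞} {μ : Measure (Config d)} {u : ℕ → ℕ+ × ℝ}

/-- The projection of the lattice onto a torus. -/
def toTorus (N : ℕ+) (x : Fin d → ℤ) : Torus d N := fun i => ((x i : ℤ) : ZMod (2 * (N : ℕ)))

lemma toTorus_sub (N : ℕ+) (x : Fin d → ℤ) (y : Fin d → ℕ) :
    toTorus N (x - fun i => (y i : ℤ)) = toTorus N x - torusPoint N y := by
  funext i
  simp [toTorus, torusPoint]

/-- A sequence of finite volumes whose two-point functions converge to that of `μ`. -/
structure IsApproximation (δ lam : ℝ) (β : ℝ≥0∞) (μ : Measure (Config d)) (u : ℕ → ℕ+ × ℝ) :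
    Prop where
  side : Tendsto (fun n => ((u n).1 : ℕ)) atTop atTop
  pos : ∀ n, 0 < (u n).2
  period_eq : β ≠ ⊤ → ∀ n, (u n).2 = β.toReal
  period_tendsto : β = ⊤ → Tendsto (fun n => (u n).2) atTop atTop
  corr : ∀ x t, Tendsto (fun n => torusCorr δ lam (u n).2 (toTorus (u n).1 x) t) atTop
    (𝓝 (twoPoint μ x t))

lemma tendsto_corr_of_finiteDimensional
    (h : ∀ (A : Finset ((Fin d → ℤ) × ℝ)) (f : (A → ℤˣ) → ℝ),
      Tendsto (fun n => ∫ σ, f (fun a => unwrap σ a) ∂(isingMeasure d (u n).1 δ lam (u n).2))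
        atTop (𝓝 (∫ σ, f (fun a => σ a) ∂μ))) (x : Fin d → ℤ) (t : ℝ) :
    Tendsto (fun n => torusCorr δ lam (u n).2 (toTorus (u n).1 x) t) atTop
      (𝓝 (twoPoint μ x t)) := by
  classical
  let A : Finset ((Fin d → ℤ) × ℝ) := {(0, 0), (x, t)}
  have h1 : ((0, 0) : (Fin d → ℤ) × ℝ) ∈ A := by simp [A]
  have h2 : ((x, t) : (Fin d → ℤ) × ℝ) ∈ A := by simp [A]
  have h3 := h A fun s => (((s ⟨_, h1⟩ * s ⟨_, h2⟩ : ℤˣ) : ℤ) : ℝ)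
  refine h3.congr fun n => ?_
  unfold torusCorr twoPoint
  refine integral_congr_ae (Eventually.of_forall fun σ => ?_)
  have h4 : unwrap σ ((0 : Fin d → ℤ), (0 : ℝ)) = σ (0, 0) := by
    unfold unwrap
    congr 2
    funext i
    simp
  simp only [h4]
  rfl

/-- The sequence is shifted so that what holds eventually along it, such as positivity of the
period, holds for every index. -/
lemma exists_isApproximation (hβ : 0 < β) (h : IsInfiniteVolumeLimit d δ lam β μ) :
    ∃ (K : ℝ) (u : ℕ → ℕ+ × ℝ), Tendsto u atTop (thermoLimit β K) ∧
      IsApproximation δ lam β μ u := by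
  obtain ⟨-, K, u, hu, hf⟩ := h
  have hside : Tendsto (fun n => (u n).1) atTop atTop := by
    unfold thermoLimit at hu
    split_ifs at hu
    · exact tendsto_fst.comp (hu.mono_right inf_le_left)
    · exact tendsto_fst.comp hu
  have hside' : Tendsto (fun n => ((u n).1 : ℕ)) atTop atTop := by
    have h1 : Tendsto (fun m : ℕ+ => (m : ℕ)) atTop atTop :=
      tendsto_atTop_atTop.mpr fun k => ⟨⟨k + 1, k.succ_pos⟩, fun m hm =>
        (Nat.le_succ k).trans (show (⟨k + 1, k.succ_pos⟩ : ℕ+) ≤ m from hm)⟩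
    exact h1.comp hside
  have heq : β ≠ ⊤ → ∀ᶠ n in atTop, (u n).2 = β.toReal := by
    intro hne
    unfold thermoLimit at hu
    rw [if_neg hne] at hu
    exact tendsto_pure.mp (tendsto_snd.comp hu)
  have htop : β = ⊤ → Tendsto (fun n => (u n).2) atTop atTop := by
    intro he
    unfold thermoLimit at hu
    rw [if_pos he] at hu
    exact tendsto_snd.comp (hu.mono_right inf_le_left)
  have hev : ∀ᶠ n in atTop, 0 < (u n).2 ∧ (β ≠ ⊤ → (u n).2 = β.toReal) := by
    by_cases he : β = ⊤
    · filter_upwards [(htop he).eventually_gt_atTop 0] with n hn using ⟨hn, fun h => absurd he h⟩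
    · filter_upwards [heq he] with n hn
      exact ⟨by rw [hn]; exact ENNReal.toReal_pos hβ.ne' he, fun _ => hn⟩
  obtain ⟨n₀, hn₀⟩ := eventually_atTop.mp hev
  have hshift : Tendsto (fun n : ℕ => n + n₀) atTop atTop := tendsto_add_atTop_nat n₀
  refine ⟨K, fun n => u (n + n₀), hu.comp hshift, ?_⟩
  exact
    { side := hside'.comp hshift
      pos := fun n => (hn₀ _ (Nat.le_add_left _ _)).1
      period_eq := fun hne n => (hn₀ _ (Nat.le_add_left _ _)).2 hne
      period_tendsto := fun he => (htop he).comp hshift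
      corr := fun x t => (tendsto_corr_of_finiteDimensional hf x t).comp hshift }

lemma IsApproximation.time (h : IsApproximation δ lam β μ u) {t : ℝ}
    (ht : ENNReal.ofReal t < β) : ∀ᶠ n in atTop, t < (u n).2 := by
  by_cases he : β = ⊤
  · exact (h.period_tendsto he).eventually_gt_atTop t
  · refine Eventually.of_forall fun n => ?_
    rcases lt_or_ge t 0 with h0 | h0
    · exact h0.trans (h.pos n)
    · rw [h.period_eq he n]
      exact (ENNReal.ofReal_lt_iff_lt_toReal h0 he).mp ht

/-- The symmetric window of length `b`. -/
def symmWindow (b : ℝ) : Set ℝ := Set.Icc (-(b / 2)) (b / 2)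

lemma IsApproximation.window (h : IsApproximation δ lam β μ u) {t : ℝ} (ht : t ∈ timeWindow β) :
    ∀ᶠ n in atTop, t ∈ symmWindow (u n).2 := by
  by_cases he : β = ⊤
  · filter_upwards [(h.period_tendsto he).eventually_ge_atTop (2 * |t|)] with n hn
    have h1 := neg_abs_le t
    have h2 := le_abs_self t
    exact ⟨by linarith, by linarith⟩
  · refine Eventually.of_forall fun n => ?_
    unfold timeWindow at ht
    rw [if_neg he, ← h.period_eq he n] at ht
    exact ht

lemma measurableSet_timeWindow (β : ℝ≥0∞) : MeasurableSet (timeWindow β) := by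
  unfold timeWindow
  split_ifs
  · exact MeasurableSet.univ
  · exact measurableSet_Icc

/-- Fatou's lemma for the passage from tori to the lattice. -/
lemma tsum_lintegral_le_liminf (h : IsApproximation δ lam β μ u)
    {G : ∀ n, Torus d (u n).1 → ℝ → ℝ≥0∞} (hG : ∀ n z, Measurable (G n z))
    {g : (Fin d → ℤ) → ℝ → ℝ≥0∞}
    (hg : ∀ x t, Tendsto (fun n => G n (toTorus (u n).1 x) t) atTop (𝓝 (g x t))) :
    ∑' x, ∫⁻ t in timeWindow β, g x t ≤
      liminf (fun n => ∑ z, ∫⁻ t in symmWindow (u n).2, G n z t) atTop := by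
  -- The cube [-N, N)ᵈ maps injectively to the torus and eventually contains any given site.
  -- Extending by zero outside it and outside the time window puts all the integrals on one space.
  let box : ℕ → Set (Fin d → ℤ) := fun n =>
    {x | ∀ i, -((u n).1 : ℤ) ≤ x i ∧ x i < ((u n).1 : ℤ)}
  have hbox : ∀ x, ∀ᶠ n in atTop, x ∈ box n := by
    intro x
    have h1 : ∀ i, ∀ᶠ n in atTop, (x i).natAbs + 1 ≤ ((u n).1 : ℕ) := fun i =>
      h.side.eventually_ge_atTop _
    filter_upwards [eventually_all.mpr h1] with n hn i
    have := hn i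
    have h2 : (((u n).1 : ℕ) : ℤ) = ((u n).1 : ℤ) := rfl
    omega
  have hinj : ∀ n, Set.InjOn (toTorus (d := d) (u n).1) (box n) := by
    intro n x hx y hy hxy
    funext i
    have h1 := congrFun hxy i
    simp only [toTorus] at h1
    rw [ZMod.intCast_eq_intCast_iff_dvd_sub] at h1
    have h2 := hx i
    have h3 := hy i
    push_cast at h1
    obtain ⟨k, hk⟩ := h1
    have hpos : (0 : ℤ) < ((u n).1 : ℤ) := by exact_mod_cast (u n).1.pos
    have hk0 : k = 0 := by
      by_contra hne
      rcases lt_or_gt_of_ne hne with h4 | h4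
      · have h5 : k ≤ -1 := by omega
        nlinarith
      · have h5 : 1 ≤ k := by omega
        nlinarith
    rw [hk0] at hk
    omega
  let H : ℕ → (Fin d → ℤ) → ℝ → ℝ≥0∞ := fun n x => (symmWindow (u n).2).indicator fun t =>
    (box n).indicator (fun x => G n (toTorus (u n).1 x) t) x
  have hHm : ∀ n x, Measurable (H n x) := by
    intro n x
    refine Measurable.indicator ?_ measurableSet_Icc
    by_cases hx : x ∈ box n
    · simp only [Set.indicator_of_mem hx]; exact hG n _
    · simp only [Set.indicator_of_notMem hx]; exact measurable_const
  have hHlim : ∀ x, ∀ t ∈ timeWindow β, liminf (fun n => H n x t) atTop = g x t := by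
    intro x t ht
    refine Tendsto.liminf_eq ((hg x t).congr' ?_)
    filter_upwards [hbox x, h.window ht] with n h1 h2
    simp only [H]
    rw [Set.indicator_of_mem h2, Set.indicator_of_mem h1]
  have h1 : ∀ x, ∫⁻ t in timeWindow β, g x t ≤
      liminf (fun n => ∫⁻ t, H n x t) atTop := by
    intro x
    calc ∫⁻ t in timeWindow β, g x t
        = ∫⁻ t in timeWindow β, liminf (fun n => H n x t) atTop :=
          setLIntegral_congr_fun (measurableSet_timeWindow β) fun t ht => (hHlim x t ht).symm
      _ ≤ ∫⁻ t, liminf (fun n => H n x t) atTop := setLIntegral_le_lintegral _ _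
      _ ≤ _ := lintegral_liminf_le fun n => hHm n x
  -- Fatou's lemma once more, now for the counting measure on the lattice.
  have h2 : ∑' x, ∫⁻ t in timeWindow β, g x t ≤
      liminf (fun n => ∑' x, ∫⁻ t, H n x t) atTop := by
    calc ∑' x, ∫⁻ t in timeWindow β, g x t
        ≤ ∑' x, liminf (fun n => ∫⁻ t, H n x t) atTop := ENNReal.tsum_le_tsum h1
      _ = ∫⁻ x, liminf (fun n => ∫⁻ t, H n x t) atTop ∂Measure.count :=
          (lintegral_count _).symm
      _ ≤ liminf (fun n => ∫⁻ x, (∫⁻ t, H n x t) ∂Measure.count) atTop :=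
          lintegral_liminf_le fun n => Measurable.of_discrete
      _ = _ := by simp only [lintegral_count]
  refine h2.trans (liminf_le_liminf (Eventually.of_forall fun n => ?_))
  have h3 : ∀ x, ∫⁻ t, H n x t = (box n).indicator (fun x =>
      ∫⁻ t in symmWindow (u n).2, G n (toTorus (u n).1 x) t) x := by
    intro x
    simp only [H]
    rw [lintegral_indicator (show MeasurableSet (symmWindow (u n).2) from measurableSet_Icc)]
    by_cases hx : x ∈ box n
    · simp only [Set.indicator_of_mem hx]
    · simp only [Set.indicator_of_notMem hx, lintegral_zero]
  calc ∑' x, ∫⁻ t, H n x t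
      = ∑' x : box n, ∫⁻ t in symmWindow (u n).2, G n (toTorus (u n).1 x) t := by
        rw [tsum_congr h3, tsum_subtype (box n) fun x =>
          ∫⁻ t in symmWindow (u n).2, G n (toTorus (u n).1 x) t]
    _ ≤ ∑' z : Torus d (u n).1, ∫⁻ t in symmWindow (u n).2, G n z t :=
        ENNReal.tsum_comp_le_tsum_of_injective (f := fun x : box n => toTorus (u n).1 x.1)
          (hinj n).injective fun z => ∫⁻ t in symmWindow (u n).2, G n z t
    _ = _ := tsum_fintype _

/-! ### Integrals over a period and the susceptibility -/

lemma lintegral_Ico_ofReal {b : ℝ} (hb : 0 < b) {F : ℝ → ℝ} (h0 : ∀ t, 0 ≤ F t)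
    (hF : IntervalIntegrable F volume 0 b) :
    ∫⁻ t in Set.Ico 0 b, ENNReal.ofReal (F t) = ENNReal.ofReal (∫ t in (0 : ℝ)..b, F t) := by
  rw [intervalIntegral.integral_of_le hb.le, ← integral_Ico_eq_integral_Ioc,
    ofReal_integral_eq_lintegral_ofReal]
  · exact (intervalIntegrable_iff_integrableOn_Ico_of_le hb.le).mp hF
  · exact Eventually.of_forall h0

lemma lintegral_symmWindow {b : ℝ} (hb : 0 < b) {F : ℝ → ℝ} (h0 : ∀ t, 0 ≤ F t)
    (hF : ∀ u v, IntervalIntegrable F volume u v) (hper : Function.Periodic F b) :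
    ∫⁻ t in symmWindow b, ENNReal.ofReal (F t) = ENNReal.ofReal (∫ t in (0 : ℝ)..b, F t) := by
  have h1 := hper.intervalIntegral_add_eq 0 (-(b / 2))
  rw [zero_add, show -(b / 2) + b = b / 2 by ring] at h1
  have hle : -(b / 2) ≤ b / 2 := by linarith
  rw [h1, intervalIntegral.integral_of_le hle, ← integral_Icc_eq_integral_Ioc,
    ofReal_integral_eq_lintegral_ofReal]
  · rfl
  · exact (intervalIntegrable_iff_integrableOn_Icc_of_le hle).mp (hF _ _)
  · exact Eventually.of_forall h0

lemma torusSusceptibility_eq {N : ℕ+} {b : ℝ} (hδ : 0 < δ) (hlam : 0 ≤ lam) (hb : 0 < b) :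
    torusSusceptibility d N δ lam b =
      ENNReal.ofReal (∑ x : Torus d N, ∫ t in (0 : ℝ)..b, torusCorr δ lam b x t) := by
  unfold torusSusceptibility
  rw [ENNReal.ofReal_sum_of_nonneg fun x _ =>
    intervalIntegral.integral_nonneg hb.le fun t _ => torusCorr_nonneg hδ hlam hb x t]
  refine Finset.sum_congr rfl fun x _ => ?_
  exact lintegral_Ico_ofReal hb (fun t => torusCorr_nonneg hδ hlam hb x t)
    (intervalIntegrable_torusCorr hδ hlam hb x 0 b)

lemma sum_lintegral_symmWindow {N : ℕ+} {b : ℝ} (hδ : 0 < δ) (hlam : 0 ≤ lam) (hb : 0 < b) :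
    ∑ x : Torus d N, ∫⁻ t in symmWindow b, ENNReal.ofReal (torusCorr δ lam b x t) =
      torusSusceptibility d N δ lam b := by
  rw [torusSusceptibility_eq hδ hlam hb, ENNReal.ofReal_sum_of_nonneg fun x _ =>
    intervalIntegral.integral_nonneg hb.le fun t _ => torusCorr_nonneg hδ hlam hb x t]
  refine Finset.sum_congr rfl fun x _ => ?_
  exact lintegral_symmWindow hb (fun t => torusCorr_nonneg hδ hlam hb x t)
    (intervalIntegrable_torusCorr hδ hlam hb x) fun t => torusCorr_add_period hb x t

lemma torusSusceptibility_mono {N : ℕ+} {b lam' : ℝ} (hδ : 0 < δ) (hlam : 0 ≤ lam)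
    (h : lam ≤ lam') (hb : 0 < b) :
    torusSusceptibility d N δ lam b ≤ torusSusceptibility d N δ lam' b := by
  refine Finset.sum_le_sum fun x _ => lintegral_mono fun t => ENNReal.ofReal_le_ofReal ?_
  exact torusCorr_mono hδ hb hlam h x t

lemma susceptibility_le_liminf (hδ : 0 < δ) (hlam : 0 ≤ lam) (h : IsApproximation δ lam β μ u) :
    susceptibility β μ ≤
      liminf (fun n => torusSusceptibility d (u n).1 δ lam (u n).2) atTop := by
  have h1 := tsum_lintegral_le_liminf h
    (G := fun n z t => ENNReal.ofReal (torusCorr δ lam (u n).2 z t))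
    (g := fun x t => ENNReal.ofReal (twoPoint μ x t))
    (fun n z => (measurable_torusCorr hδ (h.pos n) z).ennreal_ofReal)
    (fun x t => ENNReal.tendsto_ofReal (h.corr x t))
  simp only [sum_lintegral_symmWindow hδ hlam (h.pos _)] at h1
  exact h1

/-- Below the critical value the susceptibility is finite. -/
lemma susceptibility_lt_top (hδ : 0 < δ) (hlam : 0 ≤ lam) {K : ℝ}
    (hu : Tendsto u atTop (thermoLimit β K)) (h : IsApproximation δ lam β μ u)
    (hc : ENNReal.ofReal lam < criticalValue d δ β) : susceptibility β μ < ⊤ := by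
  -- Some larger `lam'` has bounded finite-volume susceptibilities along the limit, and the
  -- susceptibility increases with the coupling.
  obtain ⟨l, ⟨lam', hlam', rfl, hlim⟩, hl⟩ := lt_sSup_iff.mp hc
  have hle : lam ≤ lam' := ((ENNReal.ofReal_lt_ofReal_iff hlam').mp hl).le
  obtain ⟨C, hC1, hC2⟩ := exists_between (hlim K)
  have h1 := hu.eventually (eventually_lt_of_limsup_lt hC1)
  refine lt_of_le_of_lt ((susceptibility_le_liminf hδ hlam h).trans ?_) hC2
  refine liminf_le_of_frequently_le' (Eventually.frequently ?_)
  filter_upwards [h1] with n hn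
  exact (torusSusceptibility_mono hδ hlam hle (h.pos n)).trans hn.le

lemma susceptibility_le_of_field (hδ : 0 < δ) (hlam : 0 ≤ lam) (h : IsApproximation δ lam β μ u)
    (hd : 4 * d * lam ≤ δ) : susceptibility β μ ≤ ENNReal.ofReal (2 / δ) := by
  refine (susceptibility_le_liminf hδ hlam h).trans
    (liminf_le_of_frequently_le' (Frequently.of_forall fun n => ?_))
  rw [torusSusceptibility_eq hδ hlam (h.pos n)]
  exact ENNReal.ofReal_le_ofReal (sum_integral_torusCorr_le hδ hlam (h.pos n) hd)

lemma IsApproximation.nonneg (h : IsApproximation δ lam β μ u) (hδ : 0 < δ) (hlam : 0 ≤ lam)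
    (x : Fin d → ℤ) (t : ℝ) : 0 ≤ twoPoint μ x t :=
  ge_of_tendsto' (h.corr x t) fun n => torusCorr_nonneg hδ hlam (h.pos n) _ t

lemma IsApproximation.le_one (h : IsApproximation δ lam β μ u) (hδ : 0 < δ)
    (x : Fin d → ℤ) (t : ℝ) : twoPoint μ x t ≤ 1 :=
  le_of_tendsto' (h.corr x t) fun n => torusCorr_le_one hδ (h.pos n) _ t

lemma IsApproximation.measurable (h : IsApproximation δ lam β μ u) (hδ : 0 < δ)
    (x : Fin d → ℤ) : Measurable (twoPoint μ x) :=
  measurable_of_tendsto_metrizable (fun n => measurable_torusCorr hδ (h.pos n) _)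
    (tendsto_pi_nhds.mpr fun t => h.corr x t)

/-- The finite-volume inequality concerns the open interval (0, b), so `t` enters through its
absolute value and must be nonzero. -/
lemma IsApproximation.harnack (h : IsApproximation δ lam β μ u) (hδ : 0 < δ) (hlam : 0 ≤ lam)
    (x : Fin d → ℤ) {t v : ℝ} (ht0 : t ≠ 0) (ht : ENNReal.ofReal |t| < β) (hv : 0 < v)
    (hvβ : ENNReal.ofReal v < β) :
    Real.exp (-(2 * δ * |v - (|t|)|)) * twoPoint μ x t ≤ twoPoint μ x v := by
  refine le_of_tendsto_of_tendsto ((h.corr x t).const_mul _) (h.corr x v) ?_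
  filter_upwards [h.time ht, h.time hvβ] with n h1 h2
  have h3 := exp_mul_torusCorr_le_of_mem hδ hlam (h.pos n) (toTorus (u n).1 x)
    (t := |t|) (u := v) ⟨abs_pos.mpr ht0, h1⟩ ⟨hv, h2⟩
  have h4 : torusCorr δ lam (u n).2 (toTorus (u n).1 x) |t| =
      torusCorr δ lam (u n).2 (toTorus (u n).1 x) t := by
    rcases abs_cases t with ⟨e, _⟩ | ⟨e, _⟩
    · rw [e]
    · rw [e] at h1 ⊢
      rw [← torusCorr_neg_time hδ (h.pos n) _ (t := -t) (by linarith) h1, neg_neg]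
  rwa [h4] at h3

lemma bubble_le_susceptibility (h : IsApproximation δ lam β μ u) (hδ : 0 < δ) (hlam : 0 ≤ lam) :
    bubble β μ ≤ susceptibility β μ := by
  refine ENNReal.tsum_le_tsum fun x => lintegral_mono fun t => ENNReal.ofReal_le_ofReal ?_
  nlinarith [h.nonneg hδ hlam x t, h.le_one hδ x t]

/-- The spatial sum of the two-point function. -/
def sliceSusceptibility (μ : Measure (Config d)) (t : ℝ) : ℝ≥0∞ :=
  ∑' x : Fin d → ℤ, ENNReal.ofReal (twoPoint μ x t)

lemma lintegral_sliceSusceptibility (h : IsApproximation δ lam β μ u) (hδ : 0 < δ) :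
    ∫⁻ t in timeWindow β, sliceSusceptibility μ t = susceptibility β μ :=
  lintegral_tsum fun x => (h.measurable hδ x).ennreal_ofReal.aemeasurable

lemma sliceSusceptibility_harnack (h : IsApproximation δ lam β μ u) (hδ : 0 < δ) (hlam : 0 ≤ lam)
    {t v T : ℝ} (ht0 : t ≠ 0) (ht : ENNReal.ofReal |t| < β) (hv : 0 < v)
    (hvβ : ENNReal.ofReal v < β) (hT : |v - (|t|)| ≤ T) :
    ENNReal.ofReal (Real.exp (-(2 * δ * T))) * sliceSusceptibility μ t ≤
      sliceSusceptibility μ v := by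
  unfold sliceSusceptibility
  rw [← ENNReal.tsum_mul_left]
  refine ENNReal.tsum_le_tsum fun x => ?_
  rw [← ENNReal.ofReal_mul (Real.exp_pos _).le]
  refine ENNReal.ofReal_le_ofReal (le_trans ?_ (h.harnack hδ hlam x ht0 ht hv hvβ))
  refine mul_le_mul_of_nonneg_right (Real.exp_le_exp.mpr ?_) (h.nonneg hδ hlam x t)
  have := mul_le_mul_of_nonneg_left hT (show 0 ≤ 2 * δ by positivity)
  linarith

/-- The scale of the bound of the spatial sums by the susceptibility. -/
def sliceRate (δ : ℝ) (β : ℝ≥0∞) : ℝ := δ + 4 * (β⁻¹).toReal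

lemma sliceRate_pos (hδ : 0 < δ) : 0 < sliceRate δ β := by
  unfold sliceRate; positivity

/-- The rate δ + 4/β makes the length at most β/4. The interval is taken to the right of |t| when
|t| ≤ β/4 and to the left otherwise, and so remains in the window. -/
lemma exists_interval (hδ : 0 < δ) (hβ : 0 < β) {t : ℝ} (htW : t ∈ timeWindow β) :
    ∃ a, 0 ≤ a ∧ (∀ v ∈ Set.Ioo a (a + 1 / sliceRate δ β),
      v ∈ timeWindow β ∧ ENNReal.ofReal v < β ∧ |v - (|t|)| ≤ 1 / sliceRate δ β) := by
  have hT := sliceRate_pos (β := β) hδ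
  set T := 1 / sliceRate δ β with hTdef
  have hT0 : 0 < T := by positivity
  by_cases he : β = ⊤
  · refine ⟨|t|, abs_nonneg t, fun v hv => ⟨by simp [timeWindow, he], by simp [he], ?_⟩⟩
    rw [abs_of_pos (by linarith [hv.1])]
    linarith [hv.2]
  · have hb : 0 < β.toReal := ENNReal.toReal_pos hβ.ne' he
    have hTb : T ≤ β.toReal / 4 := by
      rw [hTdef, div_le_iff₀ hT]
      unfold sliceRate
      rw [ENNReal.toReal_inv]
      have : β.toReal / 4 * (δ + 4 * β.toReal⁻¹) = β.toReal / 4 * δ + 1 := by field_simp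
      rw [this]
      nlinarith [mul_pos hb hδ]
    have htb : |t| ≤ β.toReal / 2 := by
      unfold timeWindow at htW
      rw [if_neg he] at htW
      exact abs_le.mpr htW
    have key : ∀ a, 0 ≤ a → a + T ≤ β.toReal / 2 → (∀ v ∈ Set.Ioo a (a + T), |v - (|t|)| ≤ T) →
        ∀ v ∈ Set.Ioo a (a + T), v ∈ timeWindow β ∧ ENNReal.ofReal v < β ∧ |v - (|t|)| ≤ T := by
      intro a ha haT h v hv
      have hv0 : 0 < v := ha.trans_lt hv.1
      refine ⟨?_, ?_, h v hv⟩
      · unfold timeWindow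
        rw [if_neg he]
        exact ⟨by linarith, by linarith [hv.2]⟩
      · rw [ENNReal.ofReal_lt_iff_lt_toReal hv0.le he]
        linarith [hv.2]
    rcases le_total |t| (β.toReal / 4) with h1 | h1
    · refine ⟨|t|, abs_nonneg t, key _ (abs_nonneg t) (by linarith) fun v hv => ?_⟩
      rw [abs_of_pos (by linarith [hv.1])]
      linarith [hv.2]
    · refine ⟨|t| - T, by linarith, key _ (by linarith) (by linarith) fun v hv => ?_⟩
      rw [abs_le]
      constructor <;> linarith [hv.1, hv.2]

/-- By Harnack's inequality the spatial sum stays above exp(-2) times its value at `t` on an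
interval of length 1/`sliceRate`, and its integral there is at most the susceptibility. -/
lemma sliceSusceptibility_le (h : IsApproximation δ lam β μ u) (hδ : 0 < δ) (hlam : 0 ≤ lam)
    (hβ : 0 < β) {t : ℝ} (ht0 : t ≠ 0) (ht : ENNReal.ofReal |t| < β) (htW : t ∈ timeWindow β) :
    sliceSusceptibility μ t ≤
      ENNReal.ofReal (Real.exp 2 * sliceRate δ β) * susceptibility β μ := by
  obtain ⟨a, ha, hI⟩ := exists_interval hδ hβ htW
  have hr := sliceRate_pos (β := β) hδ
  set T := 1 / sliceRate δ β with hTdef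
  have hT0 : 0 < T := by positivity
  have hδT : δ * T ≤ 1 := by
    rw [hTdef, mul_one_div, div_le_one hr]
    unfold sliceRate
    have : 0 ≤ (β⁻¹).toReal := ENNReal.toReal_nonneg
    linarith
  have h1 : ENNReal.ofReal T * (ENNReal.ofReal (Real.exp (-(2 * δ * T))) *
      sliceSusceptibility μ t) ≤ susceptibility β μ := by
    calc _ = ∫⁻ _ in Set.Ioo a (a + T), ENNReal.ofReal (Real.exp (-(2 * δ * T))) *
          sliceSusceptibility μ t := by
          rw [setLIntegral_const, Real.volume_Ioo, add_sub_cancel_left, mul_comm]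
      _ ≤ ∫⁻ v in Set.Ioo a (a + T), sliceSusceptibility μ v :=
          setLIntegral_mono' measurableSet_Ioo fun v hv =>
            sliceSusceptibility_harnack h hδ hlam ht0 ht (ha.trans_lt hv.1) (hI v hv).2.1
              (hI v hv).2.2
      _ ≤ ∫⁻ v in timeWindow β, sliceSusceptibility μ v :=
          lintegral_mono_set fun v hv => (hI v hv).1
      _ = _ := lintegral_sliceSusceptibility h hδ
  have h2 : ENNReal.ofReal (Real.exp 2 * sliceRate δ β) * (ENNReal.ofReal T *
      (ENNReal.ofReal (Real.exp (-(2 * δ * T))) * sliceSusceptibility μ t)) =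
      ENNReal.ofReal (Real.exp (2 - 2 * δ * T)) * sliceSusceptibility μ t := by
    rw [← mul_assoc, ← mul_assoc, ← ENNReal.ofReal_mul (by positivity),
      ← ENNReal.ofReal_mul (by positivity)]
    congr 2
    rw [sub_eq_add_neg, Real.exp_add, hTdef]
    field_simp
  refine le_trans ?_ (mul_le_mul_right h1 (ENNReal.ofReal (Real.exp 2 * sliceRate δ β)))
  rw [h2]
  refine le_mul_of_one_le_left (zero_le) ?_
  rw [← ENNReal.ofReal_one]
  refine ENNReal.ofReal_le_ofReal (Real.one_le_exp ?_)
  linarith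

/-- A translation of the lattice. -/
abbrev latticeShift (y : Fin d → ℕ) : Fin d → ℤ := fun i => (y i : ℤ)

/-- The distance of the two-point function to its translates. -/
def translationDefect (β : ℝ≥0∞) (μ : Measure (Config d)) (y : Fin d → ℕ) : ℝ≥0∞ :=
  ∑' x : Fin d → ℤ, ∫⁻ t in timeWindow β,
    ENNReal.ofReal ((twoPoint μ x t - twoPoint μ (x - latticeShift y) t) ^ 2)

/-- Only the limit of the finite-volume bounds enters, so a term with 1/b may disappear when the
period tends to infinity. -/
lemma translationDefect_le (h : IsApproximation δ lam β μ u) (hd : 1 ≤ d) (hδ : 0 < δ)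
    (hlam : 0 < lam) {y : Fin d → ℕ} {R : ℕ} (hy : ∀ i, y i ≤ R) {E : ℕ → ℝ} {E₀ : ℝ}
    (hE : ∀ n, 1 / ((u n).2 * lam ^ 2) * latticeSum d 4 R (u n).1 +
        √(δ / lam) / lam * latticeSum d 3 R (u n).1 ≤ E n)
    (hlim : Tendsto E atTop (𝓝 E₀)) :
    translationDefect β μ y ≤ ENNReal.ofReal (48 * d ^ 3 * 3 ^ d * E₀) := by
  have h1 := tsum_lintegral_le_liminf h
    (G := fun n z t => ENNReal.ofReal
      ((torusCorr δ lam (u n).2 z t - torusCorr δ lam (u n).2 (z - torusPoint (u n).1 y) t) ^ 2))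
    (g := fun x t => ENNReal.ofReal
      ((twoPoint μ x t - twoPoint μ (x - latticeShift y) t) ^ 2))
    (fun n z => (((measurable_torusCorr hδ (h.pos n) z).sub
      (measurable_torusCorr hδ (h.pos n) _)).pow_const 2).ennreal_ofReal)
    (fun x t => by
      refine ENNReal.tendsto_ofReal (((h.corr x t).sub ?_).pow 2)
      refine (h.corr (x - latticeShift y) t).congr fun n => ?_
      rw [toTorus_sub])
  refine h1.trans ?_
  have h2 : Tendsto (fun n => ENNReal.ofReal (48 * d ^ 3 * 3 ^ d * E n)) atTop
      (𝓝 (ENNReal.ofReal (48 * d ^ 3 * 3 ^ d * E₀))) :=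
    ENNReal.tendsto_ofReal (hlim.const_mul _)
  rw [← h2.liminf_eq]
  refine liminf_le_liminf (Eventually.of_forall fun n => ?_)
  have h3 : ∑ z : Torus d (u n).1, ∫⁻ t in symmWindow (u n).2, ENNReal.ofReal
      ((torusCorr δ lam (u n).2 z t - torusCorr δ lam (u n).2 (z - torusPoint (u n).1 y) t) ^ 2) =
      ENNReal.ofReal (∑ z : Torus d (u n).1, ∫ t in (0 : ℝ)..(u n).2,
        (torusCorr δ lam (u n).2 z t -
          torusCorr δ lam (u n).2 (z - torusPoint (u n).1 y) t) ^ 2) := by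
    rw [ENNReal.ofReal_sum_of_nonneg fun x _ =>
      intervalIntegral.integral_nonneg (h.pos n).le fun t _ => sq_nonneg _]
    refine Finset.sum_congr rfl fun z _ => ?_
    refine lintegral_symmWindow (h.pos n) (fun t => sq_nonneg _)
      (intervalIntegrable_torusCorr_mul hδ hlam.le (h.pos n) _ _) fun t => ?_
    simp only [torusCorr_add_period (h.pos n)]
  rw [h3]
  refine ENNReal.ofReal_le_ofReal ((sum_integral_sub_sq_le hd hδ hlam (h.pos n) hy).trans ?_)
  exact mul_le_mul_of_nonneg_left (hE n) (by positivity)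

/-- The bubble diagram is controlled by averages and by translation defects. -/
lemma bubble_le_of_translationDefect (h : IsApproximation δ lam β μ u) (hd : 1 ≤ d) (hδ : 0 < δ)
    (hlam : 0 ≤ lam) (hβ : 0 < β) (hχ : susceptibility β μ < ⊤) {R : ℕ} (hR : 1 ≤ R)
    (hRχ : Real.exp 2 * sliceRate δ β * (susceptibility β μ).toReal ^ 2 ≤ R) {D : ℝ≥0∞}
    (hD : ∀ y : Fin d → ℕ, (∀ i, y i ≤ R) → translationDefect β μ y ≤ D) :
    bubble β μ ≤ 2 + 2 * D := by
  classical
  set c := twoPoint μ with hc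
  let Y : Finset (Fin d → ℕ) := Fintype.piFinset fun _ => Finset.range R
  have hYcard : Y.card = R ^ d := by simp [Y]
  have hR0 : (0 : ℝ) < R := by exact_mod_cast hR
  set r : ℝ := ((R : ℝ) ^ d)⁻¹ with hr
  have hr0 : 0 < r := by positivity
  have hrY : r * Y.card = 1 := by
    rw [hYcard, hr]; push_cast; field_simp
  -- The average of the two-point function over its translates by a box of side `R`.
  let a : (Fin d → ℤ) → ℝ → ℝ := fun x t => r * ∑ y ∈ Y, c (x - latticeShift y) t
  have ha0 : ∀ x t, 0 ≤ a x t := fun x t =>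
    mul_nonneg hr0.le (Finset.sum_nonneg fun y _ => h.nonneg hδ hlam _ t)
  have ham : ∀ x, Measurable (a x) := fun x =>
    (Finset.measurable_sum _ fun y _ => h.measurable hδ _).const_mul _
  -- From c² ≤ 2a² + 2(c - a)², where c - a is itself an average of differences, to which
  -- Cauchy–Schwarz applies.
  have hpt : ∀ x t, c x t ^ 2 ≤ 2 * a x t ^ 2 +
      2 * (r * ∑ y ∈ Y, (c x t - c (x - latticeShift y) t) ^ 2) := by
    intro x t
    have h1 : c x t - a x t = r * ∑ y ∈ Y, (c x t - c (x - latticeShift y) t) := by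
      rw [Finset.sum_sub_distrib, mul_sub, Finset.sum_const, nsmul_eq_mul, ← mul_assoc, hrY,
        one_mul]
    have h2 : (c x t - a x t) ^ 2 ≤ r * ∑ y ∈ Y, (c x t - c (x - latticeShift y) t) ^ 2 := by
      rw [h1, mul_pow]
      have h3 := sq_sum_le_card_mul_sum_sq (s := Y)
        (f := fun y => c x t - c (x - latticeShift y) t)
      calc r ^ 2 * (∑ y ∈ Y, (c x t - c (x - latticeShift y) t)) ^ 2
          ≤ r ^ 2 * (Y.card * ∑ y ∈ Y, (c x t - c (x - latticeShift y) t) ^ 2) := by gcongr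
        _ = (r * Y.card) * (r * ∑ y ∈ Y, (c x t - c (x - latticeShift y) t) ^ 2) := by ring
        _ = _ := by rw [hrY, one_mul]
    nlinarith [sq_nonneg (c x t - 2 * a x t)]
  have hshift : ∀ (y : Fin d → ℕ) t, ∑' x, ENNReal.ofReal (c (x - latticeShift y) t) =
      sliceSusceptibility μ t := fun y t =>
    (Equiv.subRight (latticeShift y)).tsum_eq fun x => ENNReal.ofReal (c x t)
  have haS : ∀ x t, ENNReal.ofReal (a x t) ≤ ENNReal.ofReal r * sliceSusceptibility μ t := by
    intro x t
    simp only [a]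
    rw [ENNReal.ofReal_mul hr0.le, ENNReal.ofReal_sum_of_nonneg fun y _ => h.nonneg hδ hlam _ t]
    gcongr
    unfold sliceSusceptibility
    have hinj : Set.InjOn (fun y : Fin d → ℕ => x - latticeShift y) (Y : Set (Fin d → ℕ)) := by
      intro y _ z _ hyz
      funext i
      have := congrFun hyz i
      simp only [Pi.sub_apply, latticeShift] at this
      omega
    calc ∑ y ∈ Y, ENNReal.ofReal (c (x - latticeShift y) t)
        = ∑ z ∈ Y.image fun y => x - latticeShift y, ENNReal.ofReal (c z t) :=
          (Finset.sum_image (f := fun z => ENNReal.ofReal (c z t)) hinj).symm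
      _ ≤ _ := ENNReal.sum_le_tsum _
  have hasum : ∀ t, ∑' x, ENNReal.ofReal (a x t) = sliceSusceptibility μ t := by
    intro t
    simp only [a]
    have h1 : ∀ x, ENNReal.ofReal (r * ∑ y ∈ Y, c (x - latticeShift y) t) =
        ENNReal.ofReal r * ∑ y ∈ Y, ENNReal.ofReal (c (x - latticeShift y) t) := by
      intro x
      rw [ENNReal.ofReal_mul hr0.le, ENNReal.ofReal_sum_of_nonneg fun y _ => h.nonneg hδ hlam _ t]
    rw [tsum_congr h1, ENNReal.tsum_mul_left,
      Summable.tsum_finsetSum fun _ _ => ENNReal.summable]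
    simp only [hshift]
    rw [Finset.sum_const, nsmul_eq_mul, ← mul_assoc, ← ENNReal.ofReal_natCast,
      ← ENNReal.ofReal_mul hr0.le, hrY, ENNReal.ofReal_one, one_mul]
  -- At fixed time the sum of a² is at most sup a times the sum of a, hence R⁻ᵈ times the square of
  -- the spatial sum. One factor is bounded by `sliceSusceptibility_le`, the other integrates to the
  -- susceptibility, and `hRχ` makes the product at most R¹⁻ᵈ ≤ 1.
  have hA : ∑' x, ∫⁻ t in timeWindow β, ENNReal.ofReal (a x t ^ 2) ≤ 1 := by
    rw [← lintegral_tsum fun x => ((ham x).pow_const 2).ennreal_ofReal.aemeasurable]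
    have h1 : ∀ t, ∑' x, ENNReal.ofReal (a x t ^ 2) ≤
        ENNReal.ofReal r * sliceSusceptibility μ t * sliceSusceptibility μ t := by
      intro t
      rw [← hasum t, ← ENNReal.tsum_mul_left, hasum t]
      refine ENNReal.tsum_le_tsum fun x => ?_
      rw [sq, ENNReal.ofReal_mul (ha0 x t)]
      gcongr
      exact haS x t
    have hnull : ∀ᵐ t ∂(volume : Measure ℝ), t ∈ timeWindow β →
        t ≠ 0 ∧ ENNReal.ofReal |t| < β := by
      filter_upwards [(Set.countable_singleton (0 : ℝ)).ae_notMem volume] with t ht htW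
      refine ⟨ht, ?_⟩
      by_cases he : β = ⊤
      · simp [he]
      · have hb : 0 < β.toReal := ENNReal.toReal_pos hβ.ne' he
        unfold timeWindow at htW
        rw [if_neg he] at htW
        rw [ENNReal.ofReal_lt_iff_lt_toReal (abs_nonneg t) he]
        have := abs_le.mpr htW
        linarith
    calc ∫⁻ t in timeWindow β, ∑' x, ENNReal.ofReal (a x t ^ 2)
        ≤ ∫⁻ t in timeWindow β, ENNReal.ofReal r * (ENNReal.ofReal (Real.exp 2 * sliceRate δ β) *
            susceptibility β μ) * sliceSusceptibility μ t := by
          refine setLIntegral_mono_ae' (measurableSet_timeWindow β) ?_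
          filter_upwards [hnull] with t ht htW
          refine (h1 t).trans ?_
          gcongr
          exact sliceSusceptibility_le h hδ hlam hβ (ht htW).1 (ht htW).2 htW
      _ = ENNReal.ofReal r * (ENNReal.ofReal (Real.exp 2 * sliceRate δ β) *
            susceptibility β μ) * susceptibility β μ := by
          rw [lintegral_const_mul', lintegral_sliceSusceptibility h hδ]
          exact ENNReal.mul_ne_top ENNReal.ofReal_ne_top
            (ENNReal.mul_ne_top ENNReal.ofReal_ne_top hχ.ne)
      _ = ENNReal.ofReal (r * (Real.exp 2 * sliceRate δ β * (susceptibility β μ).toReal ^ 2)) := by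
          have hrate := sliceRate_pos (β := β) hδ
          rw [ENNReal.ofReal_mul hr0.le,
            ENNReal.ofReal_mul (p := Real.exp 2 * sliceRate δ β) (by positivity),
            ENNReal.ofReal_pow ENNReal.toReal_nonneg, ENNReal.ofReal_toReal hχ.ne]
          ring
      _ ≤ ENNReal.ofReal 1 := by
          refine ENNReal.ofReal_le_ofReal ?_
          calc r * (Real.exp 2 * sliceRate δ β * (susceptibility β μ).toReal ^ 2) ≤ r * R := by
                gcongr
            _ ≤ r * (R : ℝ) ^ d := by
                gcongr
                exact le_self_pow₀ (by exact_mod_cast hR) (by omega)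
            _ = 1 := by rw [hr]; field_simp
      _ = 1 := ENNReal.ofReal_one
  have hB : ∑' x, ∫⁻ t in timeWindow β, ENNReal.ofReal
      (r * ∑ y ∈ Y, (c x t - c (x - latticeShift y) t) ^ 2) ≤ D := by
    have hm : ∀ (x : Fin d → ℤ) (y : Fin d → ℕ), Measurable fun t =>
        ENNReal.ofReal ((c x t - c (x - latticeShift y) t) ^ 2) := fun x y =>
      (((h.measurable hδ x).sub (h.measurable hδ _)).pow_const 2).ennreal_ofReal
    have h1 : ∀ x, ∫⁻ t in timeWindow β, ENNReal.ofReal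
        (r * ∑ y ∈ Y, (c x t - c (x - latticeShift y) t) ^ 2) =
        ENNReal.ofReal r * ∑ y ∈ Y, ∫⁻ t in timeWindow β,
          ENNReal.ofReal ((c x t - c (x - latticeShift y) t) ^ 2) := by
      intro x
      rw [← lintegral_finsetSum _ fun y _ => hm x y, ← lintegral_const_mul _
        (Finset.measurable_sum _ fun y _ => hm x y)]
      refine lintegral_congr fun t => ?_
      rw [ENNReal.ofReal_mul hr0.le, ENNReal.ofReal_sum_of_nonneg fun y _ => sq_nonneg _]
    rw [tsum_congr h1, ENNReal.tsum_mul_left,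
      Summable.tsum_finsetSum fun _ _ => ENNReal.summable]
    calc ENNReal.ofReal r * ∑ y ∈ Y, translationDefect β μ y
        ≤ ENNReal.ofReal r * ∑ _y ∈ Y, D := by
          gcongr with y hy
          refine hD y fun i => ?_
          have := Fintype.mem_piFinset.mp hy i
          exact (Finset.mem_range.mp this).le
      _ = D := by
          rw [Finset.sum_const, nsmul_eq_mul, ← mul_assoc, ← ENNReal.ofReal_natCast,
            ← ENNReal.ofReal_mul hr0.le, hrY, ENNReal.ofReal_one, one_mul]
  calc bubble β μ ≤ ∑' x, (2 * (∫⁻ t in timeWindow β, ENNReal.ofReal (a x t ^ 2)) +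
        2 * ∫⁻ t in timeWindow β, ENNReal.ofReal
          (r * ∑ y ∈ Y, (c x t - c (x - latticeShift y) t) ^ 2)) := by
        refine ENNReal.tsum_le_tsum fun x => ?_
        have hm1 : Measurable fun t => ENNReal.ofReal (a x t ^ 2) :=
          ((ham x).pow_const 2).ennreal_ofReal
        have hm2 : Measurable fun t => ENNReal.ofReal
            (r * ∑ y ∈ Y, (c x t - c (x - latticeShift y) t) ^ 2) :=
          ((Finset.measurable_sum _ fun y _ => ((h.measurable hδ x).sub
            (h.measurable hδ _)).pow_const 2).const_mul _).ennreal_ofReal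
        rw [← lintegral_const_mul _ hm1, ← lintegral_const_mul _ hm2,
          ← lintegral_add_left (hm1.const_mul _)]
        refine lintegral_mono fun t => ?_
        refine (ENNReal.ofReal_le_ofReal (hpt x t)).trans_eq ?_
        have hnn : 0 ≤ r * ∑ y ∈ Y, (c x t - c (x - latticeShift y) t) ^ 2 :=
          mul_nonneg hr0.le (Finset.sum_nonneg fun y _ => sq_nonneg _)
        rw [ENNReal.ofReal_add (by positivity) (by positivity), ENNReal.ofReal_mul zero_le_two,
          ENNReal.ofReal_mul zero_le_two, ENNReal.ofReal_ofNat]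
    _ = 2 * (∑' x, ∫⁻ t in timeWindow β, ENNReal.ofReal (a x t ^ 2)) +
        2 * ∑' x, ∫⁻ t in timeWindow β, ENNReal.ofReal
          (r * ∑ y ∈ Y, (c x t - c (x - latticeShift y) t) ^ 2) := by
        rw [ENNReal.tsum_add, ENNReal.tsum_mul_left, ENNReal.tsum_mul_left]
    _ ≤ 2 * 1 + 2 * D := by gcongr
    _ = _ := by rw [mul_one]

end InfiniteVolume

/-! ### Bounds on the bubble diagram -/

section Bubble

variable {d : ℕ} {δ lam ε : ℝ} {β : ℝ≥0∞} {μ : Measure (Config d)} {u : ℕ → ℕ+ × ℝ}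

/-- The smoothing scale at which averages of the two-point function are negligible. -/
def smoothingScale (δ : ℝ) (β : ℝ≥0∞) (μ : Measure (Config d)) : ℕ :=
  ⌈Real.exp 2 * sliceRate δ β * (susceptibility β μ).toReal ^ 2⌉₊ + 1

lemma bubble_le_ofReal (h : IsApproximation δ lam β μ u) (hd : 1 ≤ d) (hδ : 0 < δ)
    (hlam : 0 < lam) (hβ : 0 < β) (hχ : susceptibility β μ < ⊤) {E : ℕ → ℝ} {E₀ E₁ : ℝ}
    (hE : ∀ n, 1 / ((u n).2 * lam ^ 2) * latticeSum d 4 (smoothingScale δ β μ) (u n).1 +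
        √(δ / lam) / lam * latticeSum d 3 (smoothingScale δ β μ) (u n).1 ≤ E n)
    (hlim : Tendsto E atTop (𝓝 E₀)) (hE₁ : E₀ ≤ E₁) (hE₁0 : 0 ≤ E₁) :
    bubble β μ ≤ ENNReal.ofReal (2 + 96 * d ^ 3 * 3 ^ d * E₁) := by
  have h1 := bubble_le_of_translationDefect h hd hδ hlam.le hβ hχ
    (R := smoothingScale δ β μ) (Nat.le_add_left 1 _)
    ((Nat.le_ceil _).trans (by unfold smoothingScale; push_cast; linarith))
    (D := ENNReal.ofReal (48 * d ^ 3 * 3 ^ d * E₁)) fun y hy =>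
      (translationDefect_le h hd hδ hlam hy hE hlim).trans
        (ENNReal.ofReal_le_ofReal (mul_le_mul_of_nonneg_left hE₁ (by positivity)))
  refine h1.trans_eq ?_
  rw [ENNReal.ofReal_add zero_le_two (by positivity), ENNReal.ofReal_ofNat,
    show 96 * (d : ℝ) ^ 3 * 3 ^ d * E₁ = 2 * (48 * d ^ 3 * 3 ^ d * E₁) by ring,
    ENNReal.ofReal_mul zero_le_two, ENNReal.ofReal_ofNat]

/-- Here δ/λ ≤ 4d ≤ (2d)². -/
lemma sqrt_div_div_le (hd : 1 ≤ d) (hlam : 0 < lam) (h : δ ≤ 4 * d * lam) :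
    √(δ / lam) / lam ≤ 2 * d / lam := by
  refine div_le_div_of_nonneg_right ?_ hlam.le
  rw [Real.sqrt_le_iff]
  refine ⟨by positivity, ?_⟩
  rw [div_le_iff₀ hlam]
  have hd' : (1 : ℝ) ≤ d := by exact_mod_cast hd
  refine h.trans (mul_le_mul_of_nonneg_right ?_ hlam.le)
  nlinarith

lemma bubble_le_of_field (h : IsApproximation δ lam β μ u) (hε : 0 < ε) (hδ : ε ≤ δ)
    (hlam : 0 ≤ lam) (hd : 4 * d * lam ≤ δ) : bubble β μ ≤ ENNReal.ofReal (2 / ε) := by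
  have hδ0 := hε.trans_le hδ
  refine (bubble_le_susceptibility h hδ0 hlam).trans
    ((susceptibility_le_of_field hδ0 hlam h hd).trans (ENNReal.ofReal_le_ofReal ?_))
  gcongr

/-- Above the upper critical dimension the bubble diagram is bounded. -/
lemma bubble_le_of_lt_dim (h : IsApproximation δ lam β μ u) (hε : 0 < ε) (hβ : 0 < β)
    (hδ : ε ≤ δ) (hlam : ε ≤ lam) (hχ : susceptibility β μ < ⊤)
    (hd : (β < ⊤ ∧ 4 < d) ∨ (β = ⊤ ∧ 3 < d)) :
    bubble β μ ≤ ENNReal.ofReal (2 / ε +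
      (2 + 96 * d ^ 3 * 3 ^ d * (1 / (β.toReal * ε ^ 2) + 2 * d / ε))) := by
  have hδ0 := hε.trans_le hδ
  have hlam0 := hε.trans_le hlam
  have hd1 : 1 ≤ d := by omega
  have hb0 : 0 ≤ β.toReal := ENNReal.toReal_nonneg
  -- A dominating field gives 2/ε at once; otherwise δ ≤ 4dλ makes the coefficient of the q⁻³ term
  -- bounded uniformly.
  rcases le_total (4 * d * lam) δ with hc | hc
  · refine (bubble_le_of_field h hε hδ hlam0.le hc).trans (ENNReal.ofReal_le_ofReal ?_)
    have : 0 ≤ 2 + 96 * (d : ℝ) ^ 3 * 3 ^ d * (1 / (β.toReal * ε ^ 2) + 2 * d / ε) := by positivity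
    linarith
  have hsq := sqrt_div_div_le hd1 hlam0 hc
  have hsq' : 2 * (d : ℝ) / lam ≤ 2 * d / ε := by gcongr
  -- For β = ∞ one has `β.toReal = 0`, so this term is 0 and a single formula serves both cases.
  have hb1 : 0 ≤ 1 / (β.toReal * ε ^ 2) := by positivity
  set R := smoothingScale δ β μ
  have hls3 : ∀ n, √(δ / lam) / lam * latticeSum d 3 R (u n).1 ≤ 2 * d / ε := by
    intro n
    have h3 := latticeSum_le_one (d := d) (p := 3) (by omega) R (u n).1.pos
    have h30 := latticeSum_nonneg d 3 R (u n).1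
    calc _ ≤ 2 * d / ε * 1 := mul_le_mul (hsq.trans hsq') h3 h30 (by positivity)
      _ = _ := mul_one _
  suffices hmain : bubble β μ ≤ ENNReal.ofReal
      (2 + 96 * d ^ 3 * 3 ^ d * (1 / (β.toReal * ε ^ 2) + 2 * d / ε)) by
    refine hmain.trans (ENNReal.ofReal_le_ofReal ?_)
    have : 0 ≤ 2 / ε := by positivity
    linarith
  rcases hd with ⟨hfin, hd4⟩ | ⟨htop, hd3⟩
  · refine bubble_le_ofReal h hd1 hδ0 hlam0 hβ hχ
      (E := fun _ => 1 / (β.toReal * ε ^ 2) + 2 * d / ε) (fun n => ?_)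
      tendsto_const_nhds le_rfl (by positivity)
    refine add_le_add ?_ (hls3 n)
    have hbn := h.pos n
    have h4 := latticeSum_le_one (d := d) (p := 4) (by omega) R (u n).1.pos
    have h40 := latticeSum_nonneg d 4 R (u n).1
    calc _ ≤ 1 / ((u n).2 * ε ^ 2) * 1 := by gcongr
      _ = _ := by rw [h.period_eq hfin.ne n, mul_one]
  -- At infinite β the q⁻⁴ sum need not be bounded in `R`, but `R` is fixed while the period tends
  -- to infinity, which kills this term.
  · refine bubble_le_ofReal h hd1 hδ0 hlam0 hβ hχ
      (E := fun n => (R : ℝ) ^ 2 / lam ^ 2 / (u n).2 + 2 * d / ε) (fun n => ?_)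
      ((tendsto_const_nhds.div_atTop (h.period_tendsto htop)).add tendsto_const_nhds)
      (by linarith) (by positivity)
    refine add_le_add ?_ (hls3 n)
    have hbn := h.pos n
    have h4 := latticeSum_four_le (d := d) (by omega) R (u n).1.pos
    calc _ ≤ 1 / ((u n).2 * lam ^ 2) * (R : ℝ) ^ 2 := by gcongr
      _ = _ := by field_simp

lemma log_one_add_le (X : ℝ) (hX : 0 ≤ X) : Real.log (1 + X) ≤ 1 + max (Real.log X) 0 := by
  rcases le_total X 1 with h | h
  · have h1 : Real.log (1 + X) ≤ X := by
      have := Real.log_le_sub_one_of_pos (show 0 < 1 + X by linarith)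
      linarith
    have := le_max_right (Real.log X) 0
    linarith
  · have h1 : Real.log (1 + X) ≤ Real.log (2 * X) := Real.log_le_log (by linarith) (by linarith)
    rw [Real.log_mul two_ne_zero (by linarith)] at h1
    have h2 : Real.log 2 ≤ 1 := by
      have := Real.log_le_sub_one_of_pos (show (0 : ℝ) < 2 by norm_num)
      linarith
    have := le_max_left (Real.log X) 0
    linarith

/-- The coefficient of the logarithmic bound. -/
def logCoefficient (d : ℕ) (ε : ℝ) (β : ℝ≥0∞) : ℝ :=
  4 / ε + Real.exp 2 * (4 * d + 4 * (β⁻¹).toReal / ε)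

lemma logCoefficient_nonneg (hε : 0 < ε) : 0 ≤ logCoefficient d ε β := by
  unfold logCoefficient; positivity

/-- The scale is of order Kχ² with K proportional to `sliceRate`, which grows with δ. Dividing by λ
makes the estimate uniform, since δ/λ ≤ 4d and log(1 + K) ≤ K. -/
lemma log_smoothingScale_div_le (hε : 0 < ε) (hδ : 0 < δ) (hlam : ε ≤ lam)
    (h : δ ≤ 4 * d * lam) :
    Real.log (1 + smoothingScale δ β μ) / lam ≤ logCoefficient d ε β *
      (1 + max (Real.log (susceptibility β μ).toReal) 0) := by
  have hlam0 := hε.trans_le hlam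
  set X := (susceptibility β μ).toReal
  have hX : 0 ≤ X := ENNReal.toReal_nonneg
  set κ := (β⁻¹).toReal with hκ
  have hκ0 : 0 ≤ κ := ENNReal.toReal_nonneg
  set K := Real.exp 2 * sliceRate δ β with hK
  have hr := sliceRate_pos (β := β) hδ
  have hK0 : 0 < K := by positivity
  set ℓ := max (Real.log X) 0
  have hℓ : 0 ≤ ℓ := le_max_right _ _
  have h1 : (1 + smoothingScale δ β μ : ℝ) ≤ 3 * ((1 + K) * (1 + X) ^ 2) := by
    unfold smoothingScale
    have := (Nat.ceil_lt_add_one (show 0 ≤ K * X ^ 2 by positivity)).le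
    push_cast
    nlinarith [mul_nonneg hK0.le hX, mul_nonneg hK0.le (sq_nonneg X)]
  have h2 : Real.log (1 + smoothingScale δ β μ) ≤ 4 + K + 2 * ℓ := by
    refine (Real.log_le_log (by positivity) h1).trans ?_
    rw [Real.log_mul (by norm_num) (by positivity), Real.log_mul (by positivity) (by positivity),
      Real.log_pow]
    have e1 : Real.log 3 ≤ 2 := by
      have := Real.log_le_sub_one_of_pos (show (0 : ℝ) < 3 by norm_num)
      linarith
    have e2 : Real.log (1 + K) ≤ K := by
      have := Real.log_le_sub_one_of_pos (show 0 < 1 + K by linarith)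
      linarith
    have e3 := log_one_add_le X hX
    push_cast
    linarith
  have h3 : K / lam ≤ Real.exp 2 * (4 * d + 4 * κ / ε) := by
    rw [hK, mul_div_assoc]
    refine mul_le_mul_of_nonneg_left ?_ (Real.exp_pos 2).le
    unfold sliceRate
    rw [← hκ, add_div]
    refine add_le_add ?_ (by gcongr)
    rw [div_le_iff₀ hlam0]
    exact h
  have h4 : 4 / lam ≤ 4 / ε := by gcongr
  have h5 : 2 * ℓ / lam ≤ 4 / ε * ℓ := by
    rw [div_le_iff₀ hlam0]
    have : 1 ≤ lam / ε := by rw [one_le_div hε]; exact hlam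
    calc 2 * ℓ ≤ 4 * ℓ * 1 := by linarith
      _ ≤ 4 * ℓ * (lam / ε) := by gcongr
      _ = _ := by ring
  calc Real.log (1 + smoothingScale δ β μ) / lam ≤ (4 + K + 2 * ℓ) / lam := by gcongr
    _ = 4 / lam + K / lam + 2 * ℓ / lam := by ring
    _ ≤ 4 / ε + Real.exp 2 * (4 * d + 4 * κ / ε) + 4 / ε * ℓ := by gcongr
    _ ≤ logCoefficient d ε β * (1 + ℓ) := by
      unfold logCoefficient
      have : 0 ≤ Real.exp 2 * (4 * d + 4 * κ / ε) * ℓ := by positivity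
      rw [← hκ]
      linarith

/-- At the upper critical dimension the bubble diagram diverges at most logarithmically. -/
lemma bubble_le_of_eq_dim (h : IsApproximation δ lam β μ u) (hε : 0 < ε) (hβ : 0 < β)
    (hδ : ε ≤ δ) (hlam : ε ≤ lam) (hχ : susceptibility β μ < ⊤)
    (hd : (β < ⊤ ∧ d = 4) ∨ (β = ⊤ ∧ d = 3)) :
    bubble β μ ≤ ENNReal.ofReal ((2 / ε + (2 + 96 * d ^ 3 * 3 ^ d *
      (4 * d * logCoefficient d ε β + 2 * logCoefficient d ε β / (β.toReal * ε) + 2 * d / ε))) *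
        (1 + max (Real.log (susceptibility β μ).toReal) 0)) := by
  have hδ0 := hε.trans_le hδ
  have hlam0 := hε.trans_le hlam
  have hd1 : 1 ≤ d := by omega
  have hb0 : 0 ≤ β.toReal := ENNReal.toReal_nonneg
  have hQ := logCoefficient_nonneg (d := d) (β := β) hε
  set Q := logCoefficient d ε β with hQdef
  set ℓ := max (Real.log (susceptibility β μ).toReal) 0 with hℓdef
  have hℓ : 0 ≤ ℓ := le_max_right _ _
  set P := 4 * d * Q + 2 * Q / (β.toReal * ε) + 2 * d / ε with hP
  have hP0 : 0 ≤ P := by positivity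
  have hε2 : 0 ≤ 2 / ε := by positivity
  rcases le_total (4 * d * lam) δ with hc | hc
  · refine (bubble_le_of_field h hε hδ hlam0.le hc).trans (ENNReal.ofReal_le_ofReal ?_)
    have h1 : 0 ≤ 2 + 96 * (d : ℝ) ^ 3 * 3 ^ d * P := by positivity
    nlinarith [mul_nonneg hε2 hℓ, mul_nonneg h1 hℓ]
  have hsq := sqrt_div_div_le hd1 hlam0 hc
  have hsq' : 2 * (d : ℝ) / lam ≤ 2 * d / ε := by gcongr
  have hlog := log_smoothingScale_div_le (d := d) (β := β) (μ := μ) hε hδ0 hlam hc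
  rw [← hQdef, ← hℓdef] at hlog
  set R := smoothingScale δ β μ
  have hL : 0 ≤ Real.log (1 + R) := Real.log_nonneg (by linarith [Nat.cast_nonneg (α := ℝ) R])
  suffices hmain : bubble β μ ≤ ENNReal.ofReal (2 + 96 * d ^ 3 * 3 ^ d * (P * (1 + ℓ))) by
    refine hmain.trans (ENNReal.ofReal_le_ofReal ?_)
    nlinarith [mul_nonneg hε2 hℓ]
  have hterm1 : 0 ≤ 4 * d * Q * (1 + ℓ) := by positivity
  have hterm2 : 0 ≤ 2 * Q / (β.toReal * ε) * (1 + ℓ) := by positivity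
  have hterm3 : 0 ≤ 2 * d / ε * (1 + ℓ) := by positivity
  have hPexp : P * (1 + ℓ) = 4 * d * Q * (1 + ℓ) + 2 * Q / (β.toReal * ε) * (1 + ℓ) +
      2 * d / ε * (1 + ℓ) := by rw [hP]; ring
  rcases hd with ⟨hfin, hd4⟩ | ⟨htop, hd3⟩
  -- Here d = 4: the q⁻⁴ sum is logarithmic in `R` and the q⁻³ sum is bounded.
  · have hb : 0 < β.toReal := ENNReal.toReal_pos hβ.ne' hfin.ne
    refine bubble_le_ofReal h hd1 hδ0 hlam0 hβ hχ
      (E := fun _ => 2 * Q / (β.toReal * ε) * (1 + ℓ) + 2 * d / ε * (1 + ℓ)) (fun n => ?_)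
      tendsto_const_nhds (by rw [hPexp]; linarith) (by positivity)
    have h4 : latticeSum d 4 R (u n).1 ≤ 2 * Real.log (1 + R) := by
      have := latticeSum_self_le (d := d) hd1 R (u n).1.pos
      rwa [hd4] at this ⊢
    have h3 := latticeSum_le_one (d := d) (p := 3) (by omega) R (u n).1.pos
    have h30 := latticeSum_nonneg d 3 R (u n).1
    refine add_le_add ?_ ?_
    · rw [h.period_eq hfin.ne n]
      calc 1 / (β.toReal * lam ^ 2) * latticeSum d 4 R (u n).1
          ≤ 1 / (β.toReal * lam ^ 2) * (2 * Real.log (1 + R)) := by gcongr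
        _ = 2 / (β.toReal * lam) * (Real.log (1 + R) / lam) := by field_simp
        _ ≤ 2 / (β.toReal * ε) * (Q * (1 + ℓ)) := by gcongr
        _ = _ := by ring
    · exact mul_le_mul (hsq.trans hsq') (h3.trans (by linarith)) h30 (by positivity)
  -- Here d = 3: the q⁻⁴ term vanishes as the period grows, and the logarithm comes from the q⁻³
  -- sum.
  · refine bubble_le_ofReal h hd1 hδ0 hlam0 hβ hχ
      (E := fun n => (R : ℝ) ^ 2 / lam ^ 2 / (u n).2 + 4 * d * Q * (1 + ℓ)) (fun n => ?_)
      ((tendsto_const_nhds.div_atTop (h.period_tendsto htop)).add tendsto_const_nhds)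
      (by rw [hPexp]; linarith) (by positivity)
    have hbn := h.pos n
    have h4 := latticeSum_four_le (d := d) (by omega) R (u n).1.pos
    have h3 : latticeSum d 3 R (u n).1 ≤ 2 * Real.log (1 + R) := by
      have := latticeSum_self_le (d := d) hd1 R (u n).1.pos
      rwa [hd3] at this ⊢
    have h30 := latticeSum_nonneg d 3 R (u n).1
    refine add_le_add ?_ ?_
    · calc _ ≤ 1 / ((u n).2 * lam ^ 2) * (R : ℝ) ^ 2 := by gcongr
        _ = _ := by field_simp
    · calc √(δ / lam) / lam * latticeSum d 3 R (u n).1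
          ≤ 2 * d / lam * (2 * Real.log (1 + R)) := mul_le_mul hsq h3 h30 (by positivity)
        _ = 4 * d * (Real.log (1 + R) / lam) := by ring
        _ ≤ 4 * d * (Q * (1 + ℓ)) := by gcongr
        _ = _ := by ring

end Bubble

end

end SpaceTimeIsing

/-! ### The bounds on the bubble diagram -/

theorem lemma3p2 (d : ℕ) (β : ℝ≥0∞) (hβ : 0 < β) (ε₀ : ℝ) (hε₀ : 0 < ε₀) :
    ((β < ⊤ ∧ 4 < d) ∨ (β = ⊤ ∧ 3 < d) →
      ∃ C₁ : ℝ, ∀ δ lam : ℝ, ε₀ ≤ δ → ε₀ ≤ lam →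
        ENNReal.ofReal lam < SpaceTimeIsing.criticalValue d δ β →
        ∀ μ : Measure (SpaceTimeIsing.Config d),
          SpaceTimeIsing.IsInfiniteVolumeLimit d δ lam β μ →
          SpaceTimeIsing.bubble β μ ≤ ENNReal.ofReal C₁) ∧
    ((β < ⊤ ∧ d = 4) ∨ (β = ⊤ ∧ d = 3) →
      ∃ C₂ : ℝ, ∀ δ lam : ℝ, ε₀ ≤ δ → ε₀ ≤ lam →
        ENNReal.ofReal lam < SpaceTimeIsing.criticalValue d δ β →
        ∀ μ : Measure (SpaceTimeIsing.Config d),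
          SpaceTimeIsing.IsInfiniteVolumeLimit d δ lam β μ →
          SpaceTimeIsing.susceptibility β μ < ⊤ ∧
          SpaceTimeIsing.bubble β μ ≤
            ENNReal.ofReal
              (C₂ * (1 + max (Real.log (SpaceTimeIsing.susceptibility β μ).toReal) 0))) := by
  refine ⟨fun hd => ⟨2 / ε₀ + (2 + 96 * d ^ 3 * 3 ^ d *
    (1 / (β.toReal * ε₀ ^ 2) + 2 * d / ε₀)), fun δ lam hδ hlam hc μ hμ => ?_⟩,
    fun hd => ⟨2 / ε₀ + (2 + 96 * d ^ 3 * 3 ^ d * (4 * d * SpaceTimeIsing.logCoefficient d ε₀ β +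
      2 * SpaceTimeIsing.logCoefficient d ε₀ β / (β.toReal * ε₀) + 2 * d / ε₀)),
      fun δ lam hδ hlam hc μ hμ => ?_⟩⟩
  · obtain ⟨K, u, hu, h⟩ := SpaceTimeIsing.exists_isApproximation hβ hμ
    exact SpaceTimeIsing.bubble_le_of_lt_dim h hε₀ hβ hδ hlam
      (SpaceTimeIsing.susceptibility_lt_top (hε₀.trans_le hδ) (hε₀.trans_le hlam).le hu h hc) hd
  · obtain ⟨K, u, hu, h⟩ := SpaceTimeIsing.exists_isApproximation hβ hμ
    have hχ := SpaceTimeIsing.susceptibility_lt_top (hε₀.trans_le hδ) (hε₀.trans_le hlam).le hu h hc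
    exact ⟨hχ, SpaceTimeIsing.bubble_le_of_eq_dim h hε₀ hβ hδ hlam hχ hd⟩
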